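/- Setting. A pseudo link diagram is a non-empty regular link diagram some of whose double points are precrossings, i.e. crossings without over/under information. Diagrams are oriented unless stated otherwise. Regular isotopy of annular pseudo link diagrams is generated by isotopies of the annulus $\mathcal A$ and the moves R2, R3, PR2 (a precrossing and an adjacent classical crossing of the same two strands change places) and PR3 (a strand passes over or under a precrossing). An $\mathrm O$-mixed pseudo link diagram $\mathrm O\cup K$ is a planar diagram consisting of a fixed simple closed curve $\mathrm O$ and a non-empty oriented moving part $K$; precrossings involve only strands of $K$, and the (mixed) crossings of $K$ with $\mathrm O$ are classical. Regular isotopy of $\mathrm O$-mixed diagrams is generated by planar isotopies, R2, R3, PR2, PR3 for the moving part, and the mixed moves MR2, MR3, MPR3 (the moves R2, R3, PR3 in which one strand belongs to $\mathrm O$). An annular diagram $D$ gives an $\mathrm O$-mixed diagram $\iota(D)$: include $\mathcal A$ in the plane, cut $\mathcal A$ along a ray and let $\mathrm O$ encircle the strands that cross the ray, passing over them on one side of the ray and under them on the other. An $\mathrm O$-mixed diagram $M$ and an annular diagram $D$ correspond if $M$ is regularly isotopic to $\iota(D')$ for some $D'$ regularly isotopic to $D$. Let $d=-A^2-A^{-2}$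 and let $R=\mathbb Z[A^{\pm1},V,H,s_1,s_2,\dots]$ (universal case) or $R=\mathbb Z[A^{\pm1},V,H,s]$ with $s_k:=s^k$ (4-variable case). The annular pseudo bracket $\langle D\rangle_{\mathcal A}\in R$ is the sum over all states, obtained by smoothing every crossing and precrossing: a classical crossing contributes $A$ or $A^{-1}$ by Kauffman's rule, a precrossing contributes $V$ for its oriented and $H$ for its non-oriented smoothing, and a state with $k$ essential and $j$ null-homotopic curves contributes $d^{\,j}s_k$ if $k\ge1$ and $d^{\,j-1}$ if $k=0$. The $\mathrm O$-mixed pseudo bracket is defined on $\mathrm O$-mixed diagrams and on the diagrams obtained from them by partial smoothing (unoriented diagrams in which each precrossing remembers which of its smoothings is the oriented one), with values in $R$, by the following rules: (1) a classical crossing of the moving part is smoothed with coefficients $A,A^{-1}$ by Kauffman's rule; (2) a precrossing is smoothed with coefficient $V$ for its oriented and $H$ for its non-oriented smoothing; (3) $\langle L\sqcup\bigcirc\rangle=d\,\langle L\rangle$ for a circle disjoint from an $\mathrm O$-mixed diagram $L$ with non-empty moving part; (4) $k\ge1$ parallel unknots, each linked once with $\mathrm O$, have the value $s_k$; (5) one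 unknot not linked with $\mathrm O$ has the value $1$; (6) diagrams without precrossings, in particular states, are evaluated up to regular isotopy in the complement of $\mathrm O$ (i.e. in the Kauffman bracket skein module of the solid torus). Mixed crossings are never smoothed. **Theorem 3.5.** In the universal case and in the 4-variable case alike: (a) there is exactly one $R$-valued function satisfying rules (1)–(6), the (universal) $\mathrm O$-mixed pseudo bracket; (b) it is invariant under regular isotopy of oriented $\mathrm O$-mixed pseudo link diagrams, including the moves MR2, MR3 and MPR3; (c) it is equivalent to the (universal) annular pseudo bracket: if $M$ and $D$ correspond, then $\langle M\rangle=\langle D\rangle_{\mathcal A}$; and every oriented $\mathrm O$-mixed diagram $M$ corresponds to some annular diagram $D$. -/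

import Mathlib

/-! # Diagrams as words of elementary slices

A planar diagram in general position with respect to a height function is a word of elementary
slices, read from bottom to top.  A slice consists of one elementary piece (a minimum, a maximum, a
classical crossing or a precrossing) with vertical strands to its left and to its right.
An annular diagram in general position with respect to the angle is such a word whose bottom and top
ends are glued along a ray of the annulus. -/

/-- A strand belongs to the moving part or to the fixed curve `O`. -/
inductive Colour
  | moving
  | fixed
  deriving DecidableEq

/-- Oriented strands: a moving strand is directed upwards or downwards, the fixed curve `O` carries
no direction. -/
inductive OStrand
  | up
  | down
  | fixed
  deriving DecidableEq

/-- The data that the labels of strands must carry.  `rev` is the label seen on the other side of an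
extremum. `markOK x y m` says whether a precrossing with bottom labels `x`, `y` may carry the mark
`m`, where `m = true` means that the *oriented* smoothing of the precrossing is the vertical one. -/
class StrandLabel (S : Type) where
  colour : S → Colour
  rev : S → S
  fixedStrand : S
  colour_fixedStrand : colour fixedStrand = Colour.fixed
  rev_fixedStrand : rev fixedStrand = fixedStrand
  markOK : S → S → Bool → Prop

/-- Unoriented labels; here a precrossing just remembers by its mark which smoothing was the
oriented one. -/
instance instStrandLabelColour : StrandLabel Colour where
  colour := fun c => c
  rev := fun c => c
  fixedStrand := Colour.fixed
  colour_fixedStrand := rfl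
  rev_fixedStrand := rfl
  markOK := fun _ _ _ => True

/-- The colour of an oriented strand. -/
def OStrand.colour : OStrand → Colour
  | .up => .moving
  | .down => .moving
  | .fixed => .fixed

/-- The reversed direction. -/
def OStrand.rev : OStrand → OStrand
  | .up => .down
  | .down => .up
  | .fixed => .fixed

/-- Oriented labels: the oriented smoothing of a precrossing is the vertical one exactly when the
two strands are parallel (both upwards or both downwards). -/
instance instStrandLabelOStrand : StrandLabel OStrand where
  colour := OStrand.colour
  rev := OStrand.rev
  fixedStrand := OStrand.fixed
  colour_fixedStrand := rfl
  rev_fixedStrand := rfl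
  markOK := fun x y m => m = decide (x = y)

/-- Elementary pieces.
* `cup x`: a minimum whose left end is labelled `x`;
* `cap x`: a maximum whose left end is labelled `x`;
* `cross x y o`: a classical crossing of the strand `x` entering at the bottom left and the strand
  `y` entering at the bottom right; `x` is the over-strand if `o = true`, and `y` if `o = false`.
  The crossing is mixed if one of the two strands is fixed;
* `pre x y m`: a precrossing, with the mark `m`. -/
inductive Gen (S : Type)
  | cup (x : S)
  | cap (x : S)
  | cross (x y : S) (o : Bool)
  | pre (x y : S) (m : Bool)

namespace Gen

variable {S : Type} [StrandLabel S]

/-- Labels at the bottom of a piece, from left to right. -/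
def dom : Gen S → List S
  | cup _ => []
  | cap x => [x, StrandLabel.rev x]
  | cross x y _ => [x, y]
  | pre x y _ => [x, y]

/-- Labels at the top of a piece, from left to right. -/
def cod : Gen S → List S
  | cup x => [x, StrandLabel.rev x]
  | cap _ => []
  | cross x y _ => [y, x]
  | pre x y _ => [y, x]

/-- The fixed curve has no self-crossings and is not involved in precrossings. -/
def Valid : Gen S → Prop
  | cup _ => True
  | cap _ => True
  | cross x y _ =>
      StrandLabel.colour x = Colour.moving ∨ StrandLabel.colour y = Colour.moving
  | pre x y m =>
      StrandLabel.colour x = Colour.moving ∧ StrandLabel.colour y = Colour.moving ∧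
        StrandLabel.markOK x y m

/-- Is this piece a minimum of the fixed curve? -/
def isFixedCup : Gen S → Bool
  | cup x => decide (StrandLabel.colour x = Colour.fixed)
  | _ => false

/-- Is this piece a precrossing? -/
def isPre : Gen S → Bool
  | pre _ _ _ => true
  | _ => false

/-- Change of labels. -/
def map {S T : Type} (f : S → T) : Gen S → Gen T
  | cup x => cup (f x)
  | cap x => cap (f x)
  | cross x y o => cross (f x) (f y) o
  | pre x y m => pre (f x) (f y) m

end Gen

/-- An elementary slice: one piece between vertical strands. -/
structure Slice (S : Type) where
  left : List S
  gen : Gen S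
  right : List S

namespace Slice

variable {S : Type} [StrandLabel S]

/-- The labels at the bottom of a slice. -/
def dom (s : Slice S) : List S := s.left ++ s.gen.dom ++ s.right

/-- The labels at the top of a slice. -/
def cod (s : Slice S) : List S := s.left ++ s.gen.cod ++ s.right

/-- Change of labels. -/
def map {S T : Type} (f : S → T) (s : Slice S) : Slice T :=
  ⟨s.left.map f, s.gen.map f, s.right.map f⟩

/-- Add vertical strands `r` on the right. -/
def addRight (r : List S) (s : Slice S) : Slice S := ⟨s.left, s.gen, s.right ++ r⟩

end Slice

/-- `IsTangle a w b`: the slices of the word `w` fit together to a tangle diagram with bottom ends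
`a` and top ends `b`. -/
def IsTangle {S : Type} [StrandLabel S] : List S → List (Slice S) → List S → Prop
  | a, [], b => a = b
  | a, s :: w, b => a = s.dom ∧ s.gen.Valid ∧ IsTangle s.cod w b

/-! ## `O`-mixed diagrams and annular diagrams -/

/-- An `O`-mixed pseudo link diagram.  It is a closed planar diagram; the fixed part has no
self-crossings and exactly one minimum, so it is one simple closed curve `O` in standard (round)
position; precrossings involve only moving strands; the moving part is not empty.

For `S = OStrand` these are the oriented `O`-mixed pseudo link diagrams.  For `S = Colour` they are
the diagrams that occur when an oriented diagram is smoothed step by step: arcs have lost their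
orientation, and each remaining precrossing remembers which of its smoothings is the oriented one. -/
structure OMixedDiagram (S : Type) [StrandLabel S] where
  word : List (Slice S)
  closed : IsTangle [] word []
  one_circle : word.countP (fun s => s.gen.isFixedCup) = 1
  moving_nonempty : ∃ s ∈ word, ∃ x ∈ s.cod, StrandLabel.colour x = Colour.moving

/-- An annular pseudo link diagram: the closure, around the annulus, of a word of slices all of whose
strands are moving.  `base` lists the points of the diagram on the ray along which the annulus is
cut, ordered from the outer boundary to the inner boundary. The diagram is not empty. -/
structure AnnularDiagram (S : Type) [StrandLabel S] where
  base : List S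
  word : List (Slice S)
  closed : IsTangle base word base
  base_moving : ∀ x ∈ base, StrandLabel.colour x = Colour.moving
  word_moving : ∀ s ∈ word, ∀ x ∈ s.cod, StrandLabel.colour x = Colour.moving
  nonempty : base ≠ [] ∨ word ≠ []

/-- Forget the orientation of a word; marks of precrossings are kept. -/
def forgetWord (w : List (Slice OStrand)) : List (Slice Colour) :=
  w.map (Slice.map OStrand.colour)

theorem Gen.dom_map_colour (g : Gen OStrand) :
    (g.map OStrand.colour).dom = g.dom.map OStrand.colour := by
  rcases g with x | x | ⟨x, y, o⟩ | ⟨x, y, m⟩ <;> try rfl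
  cases x <;> rfl

theorem Gen.cod_map_colour (g : Gen OStrand) :
    (g.map OStrand.colour).cod = g.cod.map OStrand.colour := by
  rcases g with x | x | ⟨x, y, o⟩ | ⟨x, y, m⟩ <;> try rfl
  cases x <;> rfl

theorem Gen.valid_map_colour (g : Gen OStrand) (h : g.Valid) :
    (g.map OStrand.colour).Valid := by
  rcases g with x | x | ⟨x, y, o⟩ | ⟨x, y, m⟩
  · trivial
  · trivial
  · exact h
  · exact ⟨h.1, h.2.1, trivial⟩

theorem Slice.dom_map_colour (s : Slice OStrand) :
    (s.map OStrand.colour).dom = s.dom.map OStrand.colour := by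
  simp [Slice.dom, Slice.map, Gen.dom_map_colour]

theorem Slice.cod_map_colour (s : Slice OStrand) :
    (s.map OStrand.colour).cod = s.cod.map OStrand.colour := by
  simp [Slice.cod, Slice.map, Gen.cod_map_colour]

theorem IsTangle.forget {w : List (Slice OStrand)} {a b : List OStrand} (h : IsTangle a w b) :
    IsTangle (a.map OStrand.colour) (forgetWord w) (b.map OStrand.colour) := by
  induction w generalizing a with
  | nil => exact congrArg _ h
  | cons s w ih =>
    obtain ⟨h1, h2, h3⟩ := h
    refine ⟨?_, Gen.valid_map_colour _ h2, ?_⟩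
    · rw [Slice.dom_map_colour, h1]
    · have := ih h3
      rw [← Slice.cod_map_colour] at this
      exact this

/-- The unoriented marked diagram underlying an oriented `O`-mixed pseudo link diagram. -/
def OMixedDiagram.forget (M : OMixedDiagram OStrand) : OMixedDiagram Colour where
  word := forgetWord M.word
  closed := M.closed.forget
  one_circle := by
    rw [forgetWord, List.countP_map, ← M.one_circle]
    congr 1
    funext s
    rcases s with ⟨l, g, r⟩
    cases g <;> rfl
  moving_nonempty := by
    obtain ⟨s, hs, x, hx, hm⟩ := M.moving_nonempty
    refine ⟨s.map OStrand.colour, List.mem_map_of_mem hs, OStrand.colour x, ?_, hm⟩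
    rw [Slice.cod_map_colour]
    exact List.mem_map_of_mem hx

/-! ## Regular isotopy -/

/-- The local moves, on unoriented marked words, with vertical strands `l` and `r` on both sides.
Strand labels `a`, `b`, `c`, `x`, `z` may be moving or fixed, so that each move comes in a version
for the moving part and in a mixed version. -/
inductive BasicMove : List (Slice Colour) → List (Slice Colour) → Prop
  /-- R0: cancellation of a maximum and a minimum. -/
  | zigzagLeft (l r : List Colour) (c : Colour) :
      BasicMove [⟨l ++ [c], .cup c, r⟩, ⟨l, .cap c, c :: r⟩] []
  /-- R0: cancellation of a maximum and a minimum. -/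
  | zigzagRight (l r : List Colour) (c : Colour) :
      BasicMove [⟨l, .cup c, c :: r⟩, ⟨l ++ [c], .cap c, r⟩] []
  /-- R0: pieces that lie side by side may exchange their heights. -/
  | interchange (l m r : List Colour) (g h : Gen Colour) :
      BasicMove [⟨l, g, m ++ h.dom ++ r⟩, ⟨l ++ g.cod ++ m, h, r⟩]
        [⟨l ++ g.dom ++ m, h, r⟩, ⟨l, g, m ++ h.cod ++ r⟩]
  /-- R0: a crossing slides through a maximum of one of its strands. -/
  | slideCap (l r : List Colour) (c x : Colour) (o : Bool) :
      BasicMove [⟨l, .cross c x o, c :: r⟩, ⟨l ++ [x], .cap c, r⟩]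
        [⟨l ++ [c], .cross x c (!o), r⟩, ⟨l, .cap c, x :: r⟩]
  /-- R0: a crossing slides through a minimum of one of its strands. -/
  | slideCup (l r : List Colour) (c x : Colour) (o : Bool) :
      BasicMove [⟨l ++ [x], .cup c, r⟩, ⟨l, .cross x c o, c :: r⟩]
        [⟨l, .cup c, x :: r⟩, ⟨l ++ [c], .cross c x (!o), r⟩]
  /-- R0: a precrossing slides through a maximum of one of its strands; its vertical and its
  horizontal smoothing change places. -/
  | slidePreCap (l r : List Colour) (m : Bool) :
      BasicMove [⟨l, .pre .moving .moving m, .moving :: r⟩, ⟨l ++ [.moving], .cap .moving, r⟩]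
        [⟨l ++ [.moving], .pre .moving .moving (!m), r⟩, ⟨l, .cap .moving, .moving :: r⟩]
  /-- R0: a precrossing slides through a minimum of one of its strands. -/
  | slidePreCup (l r : List Colour) (m : Bool) :
      BasicMove [⟨l ++ [.moving], .cup .moving, r⟩, ⟨l, .pre .moving .moving m, .moving :: r⟩]
        [⟨l, .cup .moving, .moving :: r⟩, ⟨l ++ [.moving], .pre .moving .moving (!m), r⟩]
  /-- R2 if both strands are moving, MR2 if one of them is fixed. -/
  | r2 (l r : List Colour) (a b : Colour) (o : Bool) :
      BasicMove [⟨l, .cross a b o, r⟩, ⟨l, .cross b a (!o), r⟩] []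
  /-- R3 if all strands are moving, MR3 if one of them is fixed. The over/under information is
  arbitrary except that the three strands must lie in three layers. -/
  | r3 (l r : List Colour) (a b c : Colour) (o₁ o₂ o₃ : Bool) (h : ¬ (o₁ = o₃ ∧ o₂ ≠ o₁)) :
      BasicMove
        [⟨l, .cross a b o₁, c :: r⟩, ⟨l ++ [b], .cross a c o₂, r⟩, ⟨l, .cross b c o₃, a :: r⟩]
        [⟨l ++ [a], .cross b c o₃, r⟩, ⟨l, .cross a c o₂, b :: r⟩, ⟨l ++ [c], .cross a b o₁, r⟩]
  /-- PR2. -/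
  | pr2 (l r : List Colour) (m o : Bool) :
      BasicMove [⟨l, .pre .moving .moving m, r⟩, ⟨l, .cross .moving .moving o, r⟩]
        [⟨l, .cross .moving .moving o, r⟩, ⟨l, .pre .moving .moving m, r⟩]
  /-- PR3 (MPR3 if the strand `z` is fixed): `z` passes over or under a precrossing, from the
  right end at the bottom to the left end at the top. -/
  | pr3Right (l r : List Colour) (z : Colour) (m o : Bool) :
      BasicMove
        [⟨l, .pre .moving .moving m, z :: r⟩, ⟨l ++ [.moving], .cross .moving z o, r⟩,
          ⟨l, .cross .moving z o, .moving :: r⟩]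
        [⟨l ++ [.moving], .cross .moving z o, r⟩, ⟨l, .cross .moving z o, .moving :: r⟩,
          ⟨l ++ [z], .pre .moving .moving m, r⟩]
  /-- PR3 or MPR3, with `z` running from the left to the right. -/
  | pr3Left (l r : List Colour) (z : Colour) (m o : Bool) :
      BasicMove
        [⟨l ++ [z], .pre .moving .moving m, r⟩, ⟨l, .cross z .moving o, .moving :: r⟩,
          ⟨l ++ [.moving], .cross z .moving o, r⟩]
        [⟨l, .cross z .moving o, .moving :: r⟩, ⟨l ++ [.moving], .cross z .moving o, r⟩,
          ⟨l, .pre .moving .moving m, z :: r⟩]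
  /-- PR3 or MPR3, with `z` between the strands of the precrossing. -/
  | pr3Mid (l r : List Colour) (z : Colour) (m o : Bool) :
      BasicMove
        [⟨l, .cross .moving z o, .moving :: r⟩, ⟨l ++ [z], .pre .moving .moving m, r⟩,
          ⟨l, .cross z .moving (!o), .moving :: r⟩]
        [⟨l ++ [.moving], .cross z .moving (!o), r⟩, ⟨l, .pre .moving .moving m, z :: r⟩,
          ⟨l ++ [.moving], .cross .moving z o, r⟩]

/-- Two oriented words differ by one local move.  Since the surrounding word is the same, the
orientations of the ends of the two local pictures agree, so this covers all oriented versions of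
the moves. -/
def LocalMove (w w' : List (Slice OStrand)) : Prop :=
  ∃ u v x y : List (Slice OStrand), w = u ++ x ++ v ∧ w' = u ++ y ++ v ∧
    BasicMove (forgetWord x) (forgetWord y)

/-- Regular isotopy of oriented `O`-mixed pseudo link diagrams: the equivalence relation generated by
R0, R2, R3, PR2, PR3, MR2, MR3 and MPR3. -/
def OMixedRegularIsotopy : OMixedDiagram OStrand → OMixedDiagram OStrand → Prop :=
  Relation.EqvGen fun M M' => LocalMove M.word M'.word

/-- One step of a regular isotopy of oriented annular pseudo link diagrams: a local move away from
the ray, or a rotation of the annulus that carries a part of the diagram through the ray. -/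
inductive AnnularStep : AnnularDiagram OStrand → AnnularDiagram OStrand → Prop
  | move (D D' : AnnularDiagram OStrand) (hb : D.base = D'.base)
      (h : LocalMove D.word D'.word) : AnnularStep D D'
  | rotate (D D' : AnnularDiagram OStrand) (w₁ w₂ : List (Slice OStrand))
      (h : D.word = w₁ ++ w₂) (h' : D'.word = w₂ ++ w₁) (ht : IsTangle D.base w₁ D'.base) :
      AnnularStep D D'

/-- Regular isotopy of oriented annular pseudo link diagrams: the equivalence relation generated by
surface isotopy, R2, R3, PR2 and PR3. -/
def AnnularRegularIsotopy : AnnularDiagram OStrand → AnnularDiagram OStrand → Prop :=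
  Relation.EqvGen AnnularStep

/-! ## From annular diagrams to `O`-mixed diagrams -/

section Inclusion

variable {S : Type} [StrandLabel S]

/-- Nested minima whose left ends are labelled by the given list, between strands `l` and `r`. -/
def nestedCups : List S → List S → List S → List (Slice S)
  | _, _, [] => []
  | l, r, x :: xs => ⟨l, .cup x, r⟩ :: nestedCups (l ++ [x]) (StrandLabel.rev x :: r) xs

/-- Nested maxima whose left ends are labelled by the given list, between strands `l` and `r`. -/
def nestedCaps : List S → List S → List S → List (Slice S)
  | _, _, [] => []
  | l, r, x :: xs => nestedCaps (l ++ [x]) (StrandLabel.rev x :: r) xs ++ [⟨l, .cap x, r⟩]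

/-- One arc of `O` crosses the given strands from the left to the right, passing over all of them. -/
def arcOver : List S → List S → List S → List (Slice S)
  | _, _, [] => []
  | l, r, x :: xs =>
      ⟨l, .cross StrandLabel.fixedStrand x true, xs ++ r⟩ :: arcOver (l ++ [x]) r xs

/-- One arc of `O` crosses the given strands back from the right to the left, passing under all of
them. -/
def arcUnder : List S → List S → List S → List (Slice S)
  | _, _, [] => []
  | l, r, x :: xs =>
      arcUnder (l ++ [x]) r xs ++ [⟨l, .cross x StrandLabel.fixedStrand true, xs ++ r⟩]

/-- The curve `O` encircling the strands `a`, to the left of the strands `r`: its lower arc passes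
over the strands `a` and its upper arc passes under them. -/
def ring (a r : List S) : List (Slice S) :=
  [⟨[], .cup StrandLabel.fixedStrand, a ++ r⟩] ++ arcOver [StrandLabel.fixedStrand] r a ++
    arcUnder [StrandLabel.fixedStrand] r a ++ [⟨[], .cap StrandLabel.fixedStrand, a ++ r⟩]

/-- The right ends of the nested minima whose left ends are labelled by `a`. -/
def bar (a : List S) : List S := (a.map StrandLabel.rev).reverse

/-- The planar closure of an annular word, with `O` encircling the strands that cross the ray. -/
def mixedWord (a : List S) (w : List (Slice S)) : List (Slice S) :=
  nestedCups [] [] a ++ ring a (bar a) ++ w.map (Slice.addRight (bar a)) ++ nestedCaps [] [] a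

theorem IsTangle.append {a b c : List S} {u v : List (Slice S)} (hu : IsTangle a u b)
    (hv : IsTangle b v c) : IsTangle a (u ++ v) c := by
  induction u generalizing a with
  | nil => cases hu; exact hv
  | cons s u ih => exact ⟨hu.1, hu.2.1, ih hu.2.2⟩

theorem IsTangle.addRight {a b : List S} {w : List (Slice S)} (h : IsTangle a w b) (r : List S) :
    IsTangle (a ++ r) (w.map (Slice.addRight r)) (b ++ r) := by
  induction w generalizing a with
  | nil => exact congrArg (· ++ r) h
  | cons s w ih =>
    obtain ⟨h1, h2, h3⟩ := h
    refine ⟨?_, h2, ?_⟩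
    · simp [h1, Slice.dom, Slice.addRight]
    · have := ih h3
      simpa [Slice.cod, Slice.addRight] using this

theorem isTangle_nestedCups (l r a : List S) :
    IsTangle (l ++ r) (nestedCups l r a) (l ++ a ++ bar a ++ r) := by
  induction a generalizing l r with
  | nil => simp [nestedCups, bar, IsTangle]
  | cons x xs ih =>
    refine ⟨by simp [Slice.dom, Gen.dom], trivial, ?_⟩
    have := ih (l ++ [x]) (StrandLabel.rev x :: r)
    simpa [Slice.cod, Gen.cod, bar] using this

theorem isTangle_nestedCaps (l r a : List S) :
    IsTangle (l ++ a ++ bar a ++ r) (nestedCaps l r a) (l ++ r) := by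
  induction a generalizing l r with
  | nil => simp [nestedCaps, bar, IsTangle]
  | cons x xs ih =>
    have := ih (l ++ [x]) (StrandLabel.rev x :: r)
    refine IsTangle.append (b := l ++ [x] ++ StrandLabel.rev x :: r) ?_ ?_
    · simpa [bar] using this
    · exact ⟨by simp [Slice.dom, Gen.dom], trivial, by simp [Slice.cod, Gen.cod, IsTangle]⟩

theorem isTangle_arcOver (l r a : List S)
    (ha : ∀ x ∈ a, StrandLabel.colour x = Colour.moving) :
    IsTangle (l ++ StrandLabel.fixedStrand :: a ++ r) (arcOver l r a)
      (l ++ a ++ StrandLabel.fixedStrand :: r) := by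
  induction a generalizing l with
  | nil => simp [arcOver, IsTangle]
  | cons x xs ih =>
    refine ⟨by simp [Slice.dom, Gen.dom], Or.inr (ha x (by simp)), ?_⟩
    have := ih (l ++ [x]) (fun y hy => ha y (by simp [hy]))
    simpa [Slice.cod, Gen.cod] using this

theorem isTangle_arcUnder (l r a : List S)
    (ha : ∀ x ∈ a, StrandLabel.colour x = Colour.moving) :
    IsTangle (l ++ a ++ StrandLabel.fixedStrand :: r) (arcUnder l r a)
      (l ++ StrandLabel.fixedStrand :: a ++ r) := by
  induction a generalizing l with
  | nil => simp [arcUnder, IsTangle]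
  | cons x xs ih =>
    have := ih (l ++ [x]) (fun y hy => ha y (by simp [hy]))
    refine IsTangle.append (b := l ++ [x] ++ StrandLabel.fixedStrand :: xs ++ r) ?_ ?_
    · simpa using this
    · exact ⟨by simp [Slice.dom, Gen.dom], Or.inl (ha x (by simp)),
        by simp [Slice.cod, Gen.cod, IsTangle]⟩

theorem isTangle_ring (a r : List S) (ha : ∀ x ∈ a, StrandLabel.colour x = Colour.moving) :
    IsTangle (a ++ r) (ring a r) (a ++ r) := by
  have h1 := isTangle_arcOver [StrandLabel.fixedStrand] r a ha
  have h2 := isTangle_arcUnder [StrandLabel.fixedStrand] r a ha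
  refine IsTangle.append (IsTangle.append (IsTangle.append ?_ h1) h2) ?_
  · exact ⟨by simp [Slice.dom, Gen.dom], trivial,
      by simp [Slice.cod, Gen.cod, IsTangle, StrandLabel.rev_fixedStrand]⟩
  · exact ⟨by simp [Slice.dom, Gen.dom, StrandLabel.rev_fixedStrand], trivial,
      by simp [Slice.cod, Gen.cod, IsTangle]⟩

theorem isTangle_mixedWord {a : List S} {w : List (Slice S)} (hw : IsTangle a w a)
    (ha : ∀ x ∈ a, StrandLabel.colour x = Colour.moving) : IsTangle [] (mixedWord a w) [] := by
  have h1 := isTangle_nestedCups [] [] a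
  have h2 := isTangle_ring a (bar a) ha
  have h3 := hw.addRight (bar a)
  have h4 := isTangle_nestedCaps [] [] a
  simp only [List.append_nil, List.nil_append] at h1 h4
  exact ((h1.append h2).append h3).append h4

theorem countP_nestedCups (l r a : List S)
    (ha : ∀ x ∈ a, StrandLabel.colour x = Colour.moving) :
    (nestedCups l r a).countP (fun s => s.gen.isFixedCup) = 0 := by
  induction a generalizing l r with
  | nil => rfl
  | cons x xs ih =>
    rw [nestedCups, List.countP_cons, ih _ _ (fun y hy => ha y (by simp [hy]))]
    simp [Gen.isFixedCup, ha x (by simp)]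

theorem countP_nestedCaps (l r a : List S) :
    (nestedCaps l r a).countP (fun s => s.gen.isFixedCup) = 0 := by
  induction a generalizing l r with
  | nil => rfl
  | cons x xs ih =>
    rw [nestedCaps, List.countP_append, ih]
    simp [Gen.isFixedCup]

theorem countP_arcOver (l r a : List S) :
    (arcOver l r a).countP (fun s => s.gen.isFixedCup) = 0 := by
  induction a generalizing l with
  | nil => rfl
  | cons x xs ih =>
    rw [arcOver, List.countP_cons, ih]
    simp [Gen.isFixedCup]

theorem countP_arcUnder (l r a : List S) :
    (arcUnder l r a).countP (fun s => s.gen.isFixedCup) = 0 := by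
  induction a generalizing l with
  | nil => rfl
  | cons x xs ih =>
    rw [arcUnder, List.countP_append, ih]
    simp [Gen.isFixedCup]

theorem countP_moving (r : List S) (w : List (Slice S))
    (hw : ∀ s ∈ w, ∀ x ∈ s.cod, StrandLabel.colour x = Colour.moving) :
    (w.map (Slice.addRight r)).countP (fun s => s.gen.isFixedCup) = 0 := by
  rw [List.countP_eq_zero]
  intro s hs
  obtain ⟨t, ht, rfl⟩ := List.mem_map.1 hs
  have h := hw t ht
  rcases t with ⟨l, g, r'⟩
  cases g with
  | cup x =>
    have := h x (by simp [Slice.cod, Gen.cod])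
    simp [Slice.addRight, Gen.isFixedCup, this]
  | _ => simp [Slice.addRight, Gen.isFixedCup]

/-- The `O`-mixed diagram of an annular diagram. -/
def AnnularDiagram.toMixed (D : AnnularDiagram S) : OMixedDiagram S where
  word := mixedWord D.base D.word
  closed := isTangle_mixedWord D.closed D.base_moving
  one_circle := by
    simp only [mixedWord, ring, List.countP_append, countP_nestedCups _ _ _ D.base_moving,
      countP_nestedCaps, countP_arcOver, countP_arcUnder, countP_moving _ _ D.word_moving]
    simp [Gen.isFixedCup, StrandLabel.colour_fixedStrand]
  moving_nonempty := by
    obtain ⟨a, w, hc, hb, hw, hn⟩ := D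
    cases a with
    | cons x xs =>
      exact ⟨⟨[], .cup x, []⟩, by simp [mixedWord, nestedCups], x, by simp [Slice.cod, Gen.cod],
        hb x (by simp)⟩
    | nil =>
      cases w with
      | nil => simp at hn
      | cons s w =>
        obtain ⟨h1, -, -⟩ := hc
        rcases s with ⟨l, g, r⟩
        cases g with
        | cup x =>
          refine ⟨Slice.addRight (bar []) ⟨l, .cup x, r⟩, by simp [mixedWord], x, ?_, ?_⟩
          · simp [Slice.addRight, Slice.cod, Gen.cod]
          · exact hw ⟨l, .cup x, r⟩ (by simp) x (by simp [Slice.cod, Gen.cod])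
        | _ => simp [Slice.dom, Gen.dom] at h1

end Inclusion

/-- The oriented `O`-mixed diagram `M` and the oriented annular diagram `D` represent corresponding
pseudo links (up to regular isotopy). -/
def Corresponds (M : OMixedDiagram OStrand) (D : AnnularDiagram OStrand) : Prop :=
  ∃ D' : AnnularDiagram OStrand, AnnularRegularIsotopy D D' ∧ OMixedRegularIsotopy M D'.toMixed

/-! ## The variables of the brackets -/

/-- Values for the variables `A`, `V`, `H` and for `k` essential curves, `k ≥ 1`. -/
structure BracketData (R : Type) [CommRing R] where
  A : Rˣ
  V : R
  H : R
  s : ℕ → R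

/-- The loop value `d = -A² - A⁻²`. -/
def BracketData.d {R : Type} [CommRing R] (p : BracketData R) : R :=
  -((p.A ^ 2 : Rˣ) : R) - ((p.A⁻¹ ^ 2 : Rˣ) : R)

/-- The variables of the universal bracket other than `A`. -/
inductive UnivVar
  | V
  | H
  | s (k : ℕ)

/-- The variables of the 4-variable bracket other than `A`. -/
inductive FourVar
  | V
  | H
  | s

noncomputable section Rings

open MvPolynomial

/-- The ring `ℤ[A^{±1}, V, H, s₁, s₂, …]`. -/
abbrev UnivRing : Type := MvPolynomial UnivVar (LaurentPolynomial ℤ)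

/-- The ring `ℤ[A^{±1}, V, H, s]`. -/
abbrev FourRing : Type := MvPolynomial FourVar (LaurentPolynomial ℤ)

/-- The unit `A` of `ℤ[A^{±1}]`. -/
def laurentA : (LaurentPolynomial ℤ)ˣ where
  val := LaurentPolynomial.T 1
  inv := LaurentPolynomial.T (-1)
  val_inv := by rw [← LaurentPolynomial.T_add]; rfl
  inv_val := by rw [← LaurentPolynomial.T_add]; rfl

/-- The universal bracket: `k` essential curves have the value `s_k`. -/
def univData : BracketData UnivRing where
  A := Units.map (C : LaurentPolynomial ℤ →+* UnivRing).toMonoidHom laurentA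
  V := X UnivVar.V
  H := X UnivVar.H
  s := fun k => X (UnivVar.s k)

/-- The 4-variable bracket: `k` essential curves have the value `s ^ k`. -/
def fourData : BracketData FourRing where
  A := Units.map (C : LaurentPolynomial ℤ →+* FourRing).toMonoidHom laurentA
  V := X FourVar.V
  H := X FourVar.H
  s := fun k => X FourVar.s ^ k

end Rings

/-! ## The annular pseudo bracket -/

/-- The horizontal smoothing of two moving strands, between the strands `l` and `r`. -/
def horizontal (l r : List Colour) : List (Slice Colour) :=
  [⟨l, .cap .moving, r⟩, ⟨l, .cup .moving, r⟩]

section Annular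

variable {R : Type} [CommRing R]

/-- The two smoothings of a classical crossing of moving strands, resp. of a precrossing, with their
coefficients; the vertical smoothing is the empty word.  All other slices are kept. -/
def smoothSlice (p : BracketData R) : Slice Colour → List (R × List (Slice Colour))
  | ⟨l, .cross .moving .moving true, r⟩ => [((p.A : R), []), ((p.A⁻¹ : Rˣ), horizontal l r)]
  | ⟨l, .cross .moving .moving false, r⟩ => [((p.A⁻¹ : Rˣ), []), ((p.A : R), horizontal l r)]
  | ⟨l, .pre _ _ true, r⟩ => [(p.V, []), (p.H, horizontal l r)]
  | ⟨l, .pre _ _ false, r⟩ => [(p.H, []), (p.V, horizontal l r)]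
  | s => [(1, [s])]

/-- The states of a word with their coefficients. -/
def states (p : BracketData R) : List (Slice Colour) → List (R × List (Slice Colour))
  | [] => [(1, [])]
  | s :: w => (smoothSlice p s).flatMap fun y =>
      (states p w).map fun z => (y.1 * z.1, y.2 ++ z.2)

end Annular

/-- The number of strands at level `t` of a word that starts with `n` strands. -/
def width (n : ℕ) (w : List (Slice Colour)) : ℕ → ℕ
  | 0 => n
  | t + 1 => (w[t]?.map fun s => s.cod.length).getD 0

/-- The points `(t, i)` of the closure of a word: the strand number `i` at level `t`. -/
def ClosurePoint (n : ℕ) (w : List (Slice Colour)) : Type :=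
  {q : ℕ × ℕ // q.1 ≤ w.length ∧ q.2 < width n w q.1}

/-- The arcs of the annular closure of a word without crossings. -/
inductive ClosureArc (w : List (Slice Colour)) : ℕ × ℕ → ℕ × ℕ → Prop
  | left (t i : ℕ) (s : Slice Colour) (hs : w[t]? = some s) (hi : i < s.left.length) :
      ClosureArc w (t, i) (t + 1, i)
  | right (t i : ℕ) (s : Slice Colour) (hs : w[t]? = some s) (hi : i < s.right.length) :
      ClosureArc w (t, s.left.length + s.gen.dom.length + i)
        (t + 1, s.left.length + s.gen.cod.length + i)
  | cup (t : ℕ) (l r : List Colour) (c : Colour) (hs : w[t]? = some ⟨l, .cup c, r⟩) :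
      ClosureArc w (t + 1, l.length) (t + 1, l.length + 1)
  | cap (t : ℕ) (l r : List Colour) (c : Colour) (hs : w[t]? = some ⟨l, .cap c, r⟩) :
      ClosureArc w (t, l.length) (t, l.length + 1)
  | close (i : ℕ) : ClosureArc w (w.length, i) (0, i)

/-- The simple closed curves of the annular closure of a word without crossings. -/
def ClosureCurve (n : ℕ) (w : List (Slice Colour)) : Type :=
  Quot fun x y : ClosurePoint n w => ClosureArc w x.1 y.1

/-- A simple closed curve in the annulus is essential if and only if it meets the ray (level `0`)
in an odd number of points. -/
def ClosureCurve.Essential {n : ℕ} {w : List (Slice Colour)} (c : ClosureCurve n w) : Prop :=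
  Odd (Nat.card {x : ClosurePoint n w // x.1.1 = 0 ∧ (Quot.mk _ x : ClosureCurve n w) = c})

/-- The value of an annular state: `k ≥ 1` essential and `j` null-homotopic curves have the value
`d ^ j * s_k`, and `j ≥ 1` null-homotopic curves alone have the value `d ^ (j - 1)`. -/
noncomputable def stateValue {R : Type} [CommRing R] (p : BracketData R) (n : ℕ)
    (w : List (Slice Colour)) : R :=
  let k := Nat.card {c : ClosureCurve n w // c.Essential}
  let j := Nat.card {c : ClosureCurve n w // ¬ c.Essential}
  if k = 0 then p.d ^ (j - 1) else p.d ^ j * p.s k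

/-- The annular pseudo bracket of an oriented annular pseudo link diagram. -/
noncomputable def annularBracket {R : Type} [CommRing R] (p : BracketData R)
    (D : AnnularDiagram OStrand) : R :=
  ((states p (forgetWord D.word)).map fun y => y.1 * stateValue p D.base.length y.2).sum

/-! ## The `O`-mixed pseudo bracket -/

/-- `k` parallel essential unknots, each linked once with `O`. -/
def hopfWord (k : ℕ) : List (Slice Colour) := mixedWord (List.replicate k Colour.moving) []

/-- The curve `O` and one unlinked circle. -/
def unknotWord : List (Slice Colour) :=
  [⟨[], .cup .fixed, []⟩, ⟨[], .cap .fixed, []⟩, ⟨[], .cup .moving, []⟩, ⟨[], .cap .moving, []⟩]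

/-- The rules that define the `O`-mixed pseudo bracket.  They involve crossings and precrossings of
the moving part only; no rule smooths a mixed crossing. -/
structure IsOMixedBracket {R : Type} [CommRing R] (p : BracketData R)
    (B : OMixedDiagram Colour → R) : Prop where
  /-- Smoothing of a classical crossing of the moving part, first type. -/
  crossing_true : ∀ (D D₀ D₁ : OMixedDiagram Colour) (u v : List (Slice Colour))
    (l r : List Colour), D.word = u ++ [⟨l, .cross .moving .moving true, r⟩] ++ v →
    D₀.word = u ++ v → D₁.word = u ++ horizontal l r ++ v →
    B D = (p.A : R) * B D₀ + ((p.A⁻¹ : Rˣ) : R) * B D₁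
  /-- Smoothing of a classical crossing of the moving part, second type. -/
  crossing_false : ∀ (D D₀ D₁ : OMixedDiagram Colour) (u v : List (Slice Colour))
    (l r : List Colour), D.word = u ++ [⟨l, .cross .moving .moving false, r⟩] ++ v →
    D₀.word = u ++ v → D₁.word = u ++ horizontal l r ++ v →
    B D = ((p.A⁻¹ : Rˣ) : R) * B D₀ + (p.A : R) * B D₁
  /-- Smoothing of a precrossing whose oriented smoothing is the vertical one. -/
  precrossing_true : ∀ (D D₀ D₁ : OMixedDiagram Colour) (u v : List (Slice Colour))
    (l r : List Colour), D.word = u ++ [⟨l, .pre .moving .moving true, r⟩] ++ v →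
    D₀.word = u ++ v → D₁.word = u ++ horizontal l r ++ v →
    B D = p.V * B D₀ + p.H * B D₁
  /-- Smoothing of a precrossing whose oriented smoothing is the horizontal one. -/
  precrossing_false : ∀ (D D₀ D₁ : OMixedDiagram Colour) (u v : List (Slice Colour))
    (l r : List Colour), D.word = u ++ [⟨l, .pre .moving .moving false, r⟩] ++ v →
    D₀.word = u ++ v → D₁.word = u ++ horizontal l r ++ v →
    B D = p.H * B D₀ + p.V * B D₁
  /-- A circle disjoint from the rest `D₀` of the diagram contributes the factor `d`. -/
  loop : ∀ (D D₀ : OMixedDiagram Colour) (u v : List (Slice Colour)) (l r : List Colour),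
    D.word = u ++ [⟨l, .cup .moving, r⟩, ⟨l, .cap .moving, r⟩] ++ v → D₀.word = u ++ v →
    B D = p.d * B D₀
  /-- The value of `k ≥ 1` essential unknots. -/
  essential : ∀ (D : OMixedDiagram Colour) (k : ℕ), 1 ≤ k → D.word = hopfWord k → B D = p.s k
  /-- The value of one unknot that is not linked with `O`. -/
  unknot : ∀ D : OMixedDiagram Colour, D.word = unknotWord → B D = 1
  /-- Diagrams without precrossings, in particular states, are evaluated in the Kauffman bracket
  skein module of the solid torus, that is, up to regular isotopy in the complement of `O`. -/
  skein_module : ∀ M M' : OMixedDiagram OStrand, (∀ s ∈ M.word, s.gen.isPre = false) →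
    (∀ s ∈ M'.word, s.gen.isPre = false) → OMixedRegularIsotopy M M' → B M.forget = B M'.forget

/-! Everything rests on one observation: the rules force each `O`-mixed diagram `M` to be a definite
`R`-linear combination of basic diagrams, namely `k ≥ 1` parallel essential unknots or one unlinked
unknot. `IsBracket` states the rules with values in any module and with arbitrary values `v k` of
the basic diagrams (`v 0` for the unlinked unknot). `IsExpansion p M c` says that the coefficients
`c : ℕ →₀ R` compute `B M` for all such `B` at once. An expansion always exists
(`exists_isExpansion`), and uniqueness of the bracket follows immediately.

To expand `M`, smooth the crossings and precrossings of the moving part. Mixed crossings may not be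
smoothed, so `O` has to be brought into standard position by isotopy (`exists_encircle`): one side
of `O` is straightened, the other is pulled to the left over everything, each place where `O` runs
under a strand becomes a clasp, and all clasps are merged into a single loop by stretching a finger
of the clasped strand along the rest of the diagram. `TEq.encircle_mixedWord` then unrolls the
diagram around the annulus. The same argument, without any smoothing, shows that every oriented
diagram corresponds to an annular one. The annular diagram is expanded into states, and
`IsBracket.eq_curveValue` evaluates a state by removing circles and zigzags and by carrying maxima
through the ring `O`. Rule (6) speaks of oriented diagrams whereas states have lost their
orientation; but moving strands that never cross each other can be oriented alternately at each
level, and then every planar isotopy lifts to an oriented one.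

Numbers of curves are compared by counting colourings rather than by tracing curves. With three
colours of weights `1, 1, -1` on the ray, a null-homotopic curve contributes `3` and an essential
one `1`; with all weights equal to `1` every curve contributes `3`. Both sums are traces of transfer
matrices (`colourSum`), so local moves and rotations act on them by linear algebra.

For existence of the bracket the expansion must be independent of all choices. This needs enough
brackets to separate combinations of basic diagrams. For each `n`, colour `O` by the irreducible
representation of quantum `sl₂` of dimension `n + 1` and the moving part by the one of dimension
`2`. The resulting state sum `EvalData.eval`, with values in the fraction field, satisfies all rules
and all moves (`EvalData.isBracket_eval`). A circle around a strand of `O` acts as the scalar `-(A ^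
(2n+2) + A ^ (-2n-2))`, so `k` essential unknots have the value of `O` times the `k`-th power of
this scalar. Since `A` is not a root of unity, these scalars are pairwise distinct and the values of
`O` do not vanish. A combination that vanishes for all `n` is therefore a polynomial with infinitely
many roots (`eq_zero_of_basicValue`). Hence expansions are unique and isotopy invariant, and
substituting `1` and `s_k` for the basic diagrams yields `mixedBracket`.

On annular closures the rules produce precisely the annular state sum. Invariance of the annular
bracket under local moves is inherited from the mixed bracket, and its invariance under rotation
comes from the cyclicity of the colouring count. -/

/-! # Calculus of words of slices -/

/-- Reversal of labels is an involution that preserves colours, and `fixedStrand` is the only fixed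
label. -/
class LawfulLabel (S : Type) [StrandLabel S] : Prop where
  colour_rev : ∀ x : S, StrandLabel.colour (StrandLabel.rev x) = StrandLabel.colour x
  rev_rev : ∀ x : S, StrandLabel.rev (StrandLabel.rev x) = x
  eq_fixed : ∀ x : S, StrandLabel.colour x = Colour.fixed → x = StrandLabel.fixedStrand

instance : LawfulLabel Colour where
  colour_rev _ := rfl
  rev_rev _ := rfl
  eq_fixed _ h := h

instance : LawfulLabel OStrand where
  colour_rev x := by cases x <;> rfl
  rev_rev x := by cases x <;> rfl
  eq_fixed x h := by cases x <;> first | rfl | exact absurd h (by decide)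

/-- Add vertical strands on both sides of a slice. -/
def Slice.pad {S : Type} (l r : List S) (s : Slice S) : Slice S := ⟨l ++ s.left, s.gen, s.right ++ r⟩

/-- Add vertical strands on both sides of a word. -/
def wpad {S : Type} (l : List S) (w : List (Slice S)) (r : List S) : List (Slice S) :=
  w.map (Slice.pad l r)

section Pad

variable {S : Type}

@[simp] theorem wpad_nil (l r : List S) : wpad l [] r = [] := rfl

@[simp] theorem wpad_cons (l r : List S) (s : Slice S) (w : List (Slice S)) :
    wpad l (s :: w) r = ⟨l ++ s.left, s.gen, s.right ++ r⟩ :: wpad l w r := rfl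

@[simp] theorem wpad_append (l r : List S) (u w : List (Slice S)) :
    wpad l (u ++ w) r = wpad l u r ++ wpad l w r := by simp [wpad]

@[simp] theorem wpad_wpad (l r l' r' : List S) (w : List (Slice S)) :
    wpad l (wpad l' w r') r = wpad (l ++ l') w (r' ++ r) := by
  simp [wpad, Slice.pad, Function.comp_def]

@[simp] theorem wpad_empty (w : List (Slice S)) : wpad [] w [] = w := by
  induction w with
  | nil => rfl
  | cons s w ih => simp [ih]

theorem map_addRight_eq_wpad (r : List S) (w : List (Slice S)) :
    w.map (Slice.addRight r) = wpad [] w r := rfl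

end Pad

section Calculus

variable {S : Type} [StrandLabel S]

/-- Change all labels of a word to their colours. -/
def colourWord (w : List (Slice S)) : List (Slice Colour) := w.map (Slice.map StrandLabel.colour)

@[simp] theorem colourWord_nil : colourWord ([] : List (Slice S)) = [] := rfl

@[simp] theorem colourWord_cons (s : Slice S) (w : List (Slice S)) :
    colourWord (s :: w) = ⟨s.left.map StrandLabel.colour, s.gen.map StrandLabel.colour,
      s.right.map StrandLabel.colour⟩ :: colourWord w := rfl

@[simp] theorem colourWord_append (u w : List (Slice S)) :
    colourWord (u ++ w) = colourWord u ++ colourWord w := by simp [colourWord]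

theorem colourWord_wpad (l r : List S) (w : List (Slice S)) :
    colourWord (wpad l w r) =
      wpad (l.map StrandLabel.colour) (colourWord w) (r.map StrandLabel.colour) := by
  simp [colourWord, wpad, Slice.pad, Slice.map, Function.comp_def]

/-- Tangle words all of whose pieces satisfy `P`. -/
def Tg (P : Gen S → Prop) : List S → List (Slice S) → List S → Prop
  | a, [], b => a = b
  | a, s :: w, b => a = s.dom ∧ (s.gen.Valid ∧ P s.gen) ∧ Tg P s.cod w b

/-- The number of minima of the fixed curve. -/
def fixedCups (w : List (Slice S)) : ℕ := w.countP fun s => s.gen.isFixedCup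

@[simp] theorem fixedCups_nil : fixedCups ([] : List (Slice S)) = 0 := rfl

@[simp] theorem fixedCups_append (u w : List (Slice S)) :
    fixedCups (u ++ w) = fixedCups u + fixedCups w := by simp [fixedCups]

@[simp] theorem fixedCups_cons (s : Slice S) (w : List (Slice S)) :
    fixedCups (s :: w) = fixedCups w + if s.gen.isFixedCup then 1 else 0 := by
  simp [fixedCups, List.countP_cons]

@[simp] theorem fixedCups_wpad (l r : List S) (w : List (Slice S)) :
    fixedCups (wpad l w r) = fixedCups w := by
  induction w with
  | nil => rfl
  | cons s w ih => simp [ih]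

variable {P : Gen S → Prop}

theorem Tg.isTangle {a b : List S} {w : List (Slice S)} (h : Tg P a w b) : IsTangle a w b := by
  induction w generalizing a with
  | nil => exact h
  | cons s w ih => exact ⟨h.1, h.2.1.1, ih h.2.2⟩

theorem Tg.prop {a b : List S} {w : List (Slice S)} (h : Tg P a w b) : ∀ s ∈ w, P s.gen := by
  induction w generalizing a with
  | nil => simp
  | cons s w ih =>
    intro t ht
    rcases List.mem_cons.1 ht with rfl | ht
    · exact h.2.1.2
    · exact ih h.2.2 t ht

theorem Tg.of_isTangle {a b : List S} {w : List (Slice S)} (h : IsTangle a w b)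
    (hP : ∀ s ∈ w, P s.gen) : Tg P a w b := by
  induction w generalizing a with
  | nil => exact h
  | cons s w ih =>
    exact ⟨h.1, ⟨h.2.1, hP s (by simp)⟩, ih h.2.2 fun t ht => hP t (by simp [ht])⟩

theorem Tg.append {a b c : List S} {u v : List (Slice S)} (hu : Tg P a u b) (hv : Tg P b v c) :
    Tg P a (u ++ v) c := by
  induction u generalizing a with
  | nil => cases hu; exact hv
  | cons s u ih => exact ⟨hu.1, hu.2.1, ih hu.2.2⟩

theorem Tg.split {a c : List S} {u v : List (Slice S)} (h : Tg P a (u ++ v) c) :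
    ∃ b, Tg P a u b ∧ Tg P b v c := by
  induction u generalizing a with
  | nil => exact ⟨a, rfl, h⟩
  | cons s u ih =>
    obtain ⟨b, h1, h2⟩ := ih h.2.2
    exact ⟨b, ⟨h.1, h.2.1, h1⟩, h2⟩

theorem Tg.pad {a b : List S} {w : List (Slice S)} (h : Tg P a w b) (l r : List S) :
    Tg P (l ++ a ++ r) (wpad l w r) (l ++ b ++ r) := by
  induction w generalizing a with
  | nil => cases h; rfl
  | cons s w ih =>
    refine ⟨?_, h.2.1, ?_⟩
    · simp [h.1, Slice.dom, Slice.pad]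
    · have := ih h.2.2
      simpa [Slice.cod, Slice.pad, wpad] using this

theorem Tg.padL {a b : List S} {w : List (Slice S)} (h : Tg P a w b) (l : List S) :
    Tg P (l ++ a) (wpad l w []) (l ++ b) := by simpa using h.pad l []

theorem Tg.padR {a b : List S} {w : List (Slice S)} (h : Tg P a w b) (r : List S) :
    Tg P (a ++ r) (wpad [] w r) (b ++ r) := by simpa using h.pad [] r

theorem Tg.cod_eq {a b b' : List S} {w : List (Slice S)} (h : Tg P a w b) (h' : Tg P a w b') :
    b = b' := by
  induction w generalizing a with
  | nil => exact h.symm.trans h'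
  | cons s w ih => exact ih h.2.2 h'.2.2

/-- Only for the empty word are the ends not encoded in the word. This allows `TEq.sub` to replace a
subword without being told its ends. -/
theorem Tg.unique {a b a' b' : List S} {w : List (Slice S)} (hw : w ≠ []) (h : Tg P a w b)
    (h' : Tg P a' w b') : a = a' ∧ b = b' := by
  cases w with
  | nil => exact absurd rfl hw
  | cons s w => exact ⟨h.1.trans h'.1.symm, h.2.2.cod_eq h'.2.2⟩

/-- One typed local move. -/
def TStep (P : Gen S → Prop) (a b : List S) (w w' : List (Slice S)) : Prop :=
  Tg P a w b ∧ Tg P a w' b ∧ fixedCups w = fixedCups w' ∧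
    ∃ u v x y : List (Slice S), w = u ++ x ++ v ∧ w' = u ++ y ++ v ∧
      BasicMove (colourWord x) (colourWord y)

/-- Regular isotopy of tangle words with given ends. -/
def TEq (P : Gen S → Prop) (a b : List S) (w w' : List (Slice S)) : Prop :=
  Tg P a w b ∧ Tg P a w' b ∧ Relation.EqvGen (TStep P a b) w w'

namespace TEq

theorem refl {a b : List S} {w : List (Slice S)} (h : Tg P a w b) : TEq P a b w w :=
  ⟨h, h, .refl _⟩

theorem symm {a b : List S} {w w' : List (Slice S)} (h : TEq P a b w w') : TEq P a b w' w :=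
  ⟨h.2.1, h.1, .symm _ _ h.2.2⟩

theorem trans {a b : List S} {w w' w'' : List (Slice S)} (h : TEq P a b w w')
    (h' : TEq P a b w' w'') : TEq P a b w w'' :=
  ⟨h.1, h'.2.1, .trans _ _ _ h.2.2 h'.2.2⟩

theorem of_move {a b : List S} {w w' : List (Slice S)}
    (hm : BasicMove (colourWord w) (colourWord w')) (h : Tg P a w b) (h' : Tg P a w' b)
    (hc : fixedCups w = fixedCups w') : TEq P a b w w' :=
  ⟨h, h', .rel _ _ ⟨h, h', hc, [], [], w, w', by simp, by simp, hm⟩⟩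

theorem ctx {a b a' b' : List S} {u x y v : List (Slice S)} (hu : Tg P a u a')
    (h : TEq P a' b' x y) (hv : Tg P b' v b) : TEq P a b (u ++ x ++ v) (u ++ y ++ v) := by
  refine ⟨(hu.append h.1).append hv, (hu.append h.2.1).append hv, ?_⟩
  obtain ⟨-, -, h⟩ := h
  induction h with
  | rel x y h =>
    obtain ⟨h1, h2, hc, u', v', x', y', rfl, rfl, hm⟩ := h
    refine .rel _ _ ⟨(hu.append h1).append hv, (hu.append h2).append hv, ?_,
      u ++ u', v' ++ v, x', y', by simp, by simp, hm⟩
    simp only [fixedCups_append] at hc ⊢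
    omega
  | refl x => exact .refl _
  | symm x y _ ih => exact .symm _ _ ih
  | trans x y z _ _ ih1 ih2 => exact .trans _ _ _ ih1 ih2

/-- Replace a non-empty subword of a well-typed word. -/
theorem sub {a b a' b' : List S} {x y : List (Slice S)} (u v : List (Slice S))
    (h : TEq P a' b' x y) (hw : Tg P a (u ++ x ++ v) b) (hx : x ≠ []) :
    TEq P a b (u ++ x ++ v) (u ++ y ++ v) := by
  obtain ⟨c, h1, hv⟩ := hw.split
  obtain ⟨c', hu, h2⟩ := h1.split
  obtain ⟨rfl, rfl⟩ := h2.unique hx h.1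
  exact ctx hu h hv

theorem comp {a b c : List S} {u u' v v' : List (Slice S)} (h : TEq P a b u u')
    (h' : TEq P b c v v') : TEq P a c (u ++ v) (u' ++ v') := by
  have h1 := ctx (u := []) (a := a) rfl h h'.1
  have h2 := ctx (v := []) (b := c) h.2.1 h' rfl
  simp only [List.nil_append, List.append_nil] at h1 h2
  exact h1.trans h2

theorem compL {a b c : List S} {u v v' : List (Slice S)} (h : Tg P a u b)
    (h' : TEq P b c v v') : TEq P a c (u ++ v) (u ++ v') := comp (refl h) h'

theorem compR {a b c : List S} {u u' v : List (Slice S)} (h : TEq P a b u u')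
    (h' : Tg P b v c) : TEq P a c (u ++ v) (u' ++ v) := comp h (refl h')

end TEq

theorem BasicMove.pad {x y : List (Slice Colour)} (h : BasicMove x y) (l r : List Colour) :
    BasicMove (wpad l x r) (wpad l y r) := by
  cases h with
  | zigzagLeft l' r' c => simpa using BasicMove.zigzagLeft (l ++ l') (r' ++ r) c
  | zigzagRight l' r' c => simpa using BasicMove.zigzagRight (l ++ l') (r' ++ r) c
  | interchange l' m r' g h => simpa using BasicMove.interchange (l ++ l') m (r' ++ r) g h
  | slideCap l' r' c x o => simpa using BasicMove.slideCap (l ++ l') (r' ++ r) c x o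
  | slideCup l' r' c x o => simpa using BasicMove.slideCup (l ++ l') (r' ++ r) c x o
  | slidePreCap l' r' m => simpa using BasicMove.slidePreCap (l ++ l') (r' ++ r) m
  | slidePreCup l' r' m => simpa using BasicMove.slidePreCup (l ++ l') (r' ++ r) m
  | r2 l' r' a b o => simpa using BasicMove.r2 (l ++ l') (r' ++ r) a b o
  | r3 l' r' a b c o₁ o₂ o₃ h => simpa using BasicMove.r3 (l ++ l') (r' ++ r) a b c o₁ o₂ o₃ h
  | pr2 l' r' m o => simpa using BasicMove.pr2 (l ++ l') (r' ++ r) m o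
  | pr3Right l' r' z m o => simpa using BasicMove.pr3Right (l ++ l') (r' ++ r) z m o
  | pr3Left l' r' z m o => simpa using BasicMove.pr3Left (l ++ l') (r' ++ r) z m o
  | pr3Mid l' r' z m o => simpa using BasicMove.pr3Mid (l ++ l') (r' ++ r) z m o

theorem TEq.pad {a b : List S} {w w' : List (Slice S)} (h : TEq P a b w w') (l r : List S) :
    TEq P (l ++ a ++ r) (l ++ b ++ r) (wpad l w r) (wpad l w' r) := by
  refine ⟨h.1.pad l r, h.2.1.pad l r, ?_⟩
  obtain ⟨-, -, h⟩ := h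
  induction h with
  | rel x y h =>
    obtain ⟨h1, h2, hc, u, v, x, y, rfl, rfl, hm⟩ := h
    refine .rel _ _ ⟨h1.pad l r, h2.pad l r, by simpa using hc,
      wpad l u r, wpad l v r, wpad l x r, wpad l y r, by simp, by simp, ?_⟩
    rw [colourWord_wpad, colourWord_wpad]
    exact hm.pad _ _
  | refl x => exact .refl _
  | symm x y _ ih => exact .symm _ _ ih
  | trans x y z _ _ ih1 ih2 => exact .trans _ _ _ ih1 ih2

theorem TEq.padL {a b : List S} {w w' : List (Slice S)} (h : TEq P a b w w') (l : List S) :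
    TEq P (l ++ a) (l ++ b) (wpad l w []) (wpad l w' []) := by simpa using h.pad l []

theorem TEq.padR {a b : List S} {w w' : List (Slice S)} (h : TEq P a b w w') (r : List S) :
    TEq P (a ++ r) (b ++ r) (wpad [] w r) (wpad [] w' r) := by simpa using h.pad [] r

variable [LawfulLabel S]

open StrandLabel

@[simp] theorem rev_colour (c : Colour) : rev c = c := rfl

@[simp] theorem colour_colour (c : Colour) : colour c = c := rfl

theorem map_dom_colour (g : Gen S) : (g.map colour).dom = g.dom.map colour := by
  cases g <;> simp [Gen.map, Gen.dom, LawfulLabel.colour_rev]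

theorem map_cod_colour (g : Gen S) : (g.map colour).cod = g.cod.map colour := by
  cases g <;> simp [Gen.map, Gen.cod, LawfulLabel.colour_rev]

/-- Two slices side by side exchange their heights. -/
theorem TEq.slices (s t : Slice S) (hs : s.gen.Valid ∧ P s.gen) (ht : t.gen.Valid ∧ P t.gen) :
    TEq P (s.dom ++ t.dom) (s.cod ++ t.cod)
      [⟨s.left, s.gen, s.right ++ t.dom⟩, ⟨s.cod ++ t.left, t.gen, t.right⟩]
      [⟨s.dom ++ t.left, t.gen, t.right⟩, ⟨s.left, s.gen, s.right ++ t.cod⟩] := by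
  refine TEq.of_move ?_ ⟨?_, hs, ?_, ht, ?_⟩ ⟨?_, ht, ?_, hs, ?_⟩ ?_
  · have := BasicMove.interchange (s.left.map colour) (s.right.map colour ++ t.left.map colour)
      (t.right.map colour) (s.gen.map colour) (t.gen.map colour)
    simpa [Slice.dom, Slice.cod, map_dom_colour, map_cod_colour] using this
  all_goals simp [Slice.dom, Slice.cod, Tg]
  omega

/-- Words side by side exchange their heights. -/
theorem TEq.interchange {a b c d : List S} {u v : List (Slice S)} (hu : Tg P a u b)
    (hv : Tg P c v d) :
    TEq P (a ++ c) (b ++ d) (wpad [] u c ++ wpad b v []) (wpad a v [] ++ wpad [] u d) := by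
  -- A single slice is first moved past the whole word `v`; the slices of `u` are then moved one
  -- after the other.
  have one : ∀ (s : Slice S) (_ : s.gen.Valid ∧ P s.gen) (c d : List S) (v : List (Slice S)),
      Tg P c v d → TEq P (s.dom ++ c) (s.cod ++ d)
        (⟨s.left, s.gen, s.right ++ c⟩ :: wpad s.cod v [])
        (wpad s.dom v [] ++ [⟨s.left, s.gen, s.right ++ d⟩]) := by
    intro s hs c d v hv
    have hs1 : ∀ e : List S, Tg P (s.dom ++ e) [⟨s.left, s.gen, s.right ++ e⟩] (s.cod ++ e) :=
      fun e => ⟨by simp [Slice.dom], hs, by simp [Slice.cod, Tg]⟩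
    induction v generalizing c with
    | nil => cases hv; exact .refl (hs1 _)
    | cons t v ih =>
      obtain ⟨rfl, ht, hv⟩ := hv
      have h1 := (TEq.slices s t hs ht).compR (hv.padL s.cod)
      have ht1 : Tg P (s.dom ++ t.dom) [⟨s.dom ++ t.left, t.gen, t.right⟩] (s.dom ++ t.cod) :=
        ⟨by simp [Slice.dom], ht, by simp [Slice.cod, Tg]⟩
      have h2 := TEq.compL ht1 (ih _ hv)
      simpa using h1.trans h2
  induction u generalizing a with
  | nil => cases hu; simpa using TEq.refl (hv.padL _)
  | cons s u ih =>
    obtain ⟨rfl, hs, hu⟩ := hu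
    have hs1 : ∀ e : List S, Tg P (s.dom ++ e) [⟨s.left, s.gen, s.right ++ e⟩] (s.cod ++ e) :=
      fun e => ⟨by simp [Slice.dom], hs, by simp [Slice.cod, Tg]⟩
    have h1 := TEq.compL (hs1 c) (ih hu)
    have h2 := (one s hs c d v hv).compR (hu.padR d)
    simpa using h1.trans (by simpa using h2)

end Calculus


/-! ### A strand passing over or under other strands and words -/

section Passing

variable {S : Type} [StrandLabel S] {P : Gen S → Prop}

open StrandLabel

/-- All labels of a list belong to the moving part. -/
def Mv (a : List S) : Prop := ∀ x ∈ a, colour x = Colour.moving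

/-- All labels of a word belong to the moving part. -/
def MvW (w : List (Slice S)) : Prop := ∀ s ∈ w, Mv s.dom ∧ Mv s.cod

@[simp] theorem Mv_nil : Mv ([] : List S) := by simp [Mv]

@[simp] theorem Mv_cons {x : S} {a : List S} : Mv (x :: a) ↔ colour x = Colour.moving ∧ Mv a := by
  simp [Mv]

@[simp] theorem Mv_append {a b : List S} : Mv (a ++ b) ↔ Mv a ∧ Mv b := by
  simp only [Mv, List.mem_append]
  exact ⟨fun h => ⟨fun x hx => h x (.inl hx), fun x hx => h x (.inr hx)⟩,
    fun h x hx => hx.elim (h.1 x) (h.2 x)⟩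

@[simp] theorem MvW_nil : MvW ([] : List (Slice S)) := by simp [MvW]

@[simp] theorem MvW_cons {s : Slice S} {w : List (Slice S)} :
    MvW (s :: w) ↔ (Mv s.dom ∧ Mv s.cod) ∧ MvW w := by
  simp [MvW]

@[simp] theorem MvW_append {u w : List (Slice S)} : MvW (u ++ w) ↔ MvW u ∧ MvW w := by
  simp only [MvW, List.mem_append]
  exact ⟨fun h => ⟨fun x hx => h x (.inl hx), fun x hx => h x (.inr hx)⟩,
    fun h x hx => hx.elim (h.1 x) (h.2 x)⟩

theorem MvW.pad {w : List (Slice S)} {l r : List S} (hl : Mv l) (hr : Mv r) (hw : MvW w) :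
    MvW (wpad l w r) := by
  induction w with
  | nil => simp
  | cons s w ih =>
    simp only [MvW_cons, wpad_cons, Slice.dom, Slice.cod, Mv_append] at hw ⊢
    tauto

theorem Tg.mv_cod {a b : List S} {w : List (Slice S)} (h : Tg P a w b) (ha : Mv a) (hw : MvW w) :
    Mv b := by
  induction w generalizing a with
  | nil => cases h; exact ha
  | cons s w ih => exact ih h.2.2 (MvW_cons.1 hw).1.2 (MvW_cons.1 hw).2

/-- The strand `z` passes all strands `a` from the left to the right, over them if `o = true`. -/
def passRight (z : S) (o : Bool) : List S → List (Slice S)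
  | [] => []
  | x :: xs => ⟨[], .cross z x o, xs⟩ :: wpad [x] (passRight z o xs) []

/-- The inverse of `passRight`. -/
def passLeft (z : S) (o : Bool) : List S → List (Slice S)
  | [] => []
  | x :: xs => wpad [x] (passLeft z o xs) [] ++ [⟨[], .cross x z (!o), xs⟩]

/-- The class `P` contains all crossings of the strand `z`. -/
def Crosses (P : Gen S → Prop) (z : S) : Prop := ∀ x o, P (.cross z x o) ∧ P (.cross x z o)

/-- The strand `z` may cross the strands `a`. -/
def MayCross (z : S) (a : List S) : Prop :=
  ∀ x ∈ a, colour z = Colour.moving ∨ colour x = Colour.moving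

theorem MayCross.of_moving {z : S} (h : colour z = Colour.moving) (a : List S) : MayCross z a :=
  fun _ _ => .inl h

theorem Mv.mayCross {a : List S} (h : Mv a) (z : S) : MayCross z a := fun x hx => .inr (h x hx)

theorem passRight_append (z : S) (o : Bool) (a b : List S) :
    passRight z o (a ++ b) = wpad [] (passRight z o a) b ++ wpad a (passRight z o b) [] := by
  induction a with
  | nil => simp [passRight]
  | cons x a ih => simp [passRight, ih]

theorem passLeft_append (z : S) (o : Bool) (a b : List S) :
    passLeft z o (a ++ b) = wpad a (passLeft z o b) [] ++ wpad [] (passLeft z o a) b := by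
  induction a with
  | nil => simp [passLeft]
  | cons x a ih => simp [passLeft, ih]

theorem MvW_passRight {z : S} {o : Bool} {a : List S} (hz : colour z = Colour.moving) (ha : Mv a) :
    MvW (passRight z o a) := by
  induction a with
  | nil => simp [passRight]
  | cons x a ih =>
    simp only [Mv_cons] at ha
    simp only [passRight, MvW_cons, Slice.dom, Slice.cod, Gen.dom, Gen.cod]
    exact ⟨by simp [hz, ha], (ih ha.2).pad (by simp [ha]) (by simp)⟩

theorem MvW_passLeft {z : S} {o : Bool} {a : List S} (hz : colour z = Colour.moving) (ha : Mv a) :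
    MvW (passLeft z o a) := by
  induction a with
  | nil => simp [passLeft]
  | cons x a ih =>
    simp only [Mv_cons] at ha
    simp only [passLeft, MvW_append, MvW_cons, Slice.dom, Slice.cod, Gen.dom, Gen.cod]
    exact ⟨(ih ha.2).pad (by simp [ha]) (by simp), by simp [hz, ha]⟩

theorem Tg_passRight {z : S} {a : List S} (hP : Crosses P z) (h : MayCross z a) (o : Bool) :
    Tg P (z :: a) (passRight z o a) (a ++ [z]) := by
  induction a with
  | nil => rfl
  | cons x a ih =>
    refine ⟨by simp [Slice.dom, Gen.dom], ⟨h x (by simp), (hP x o).1⟩, ?_⟩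
    simpa [Slice.cod, Gen.cod] using (ih fun y hy => h y (by simp [hy])).padL [x]

theorem Tg_passLeft {z : S} {a : List S} (hP : Crosses P z) (h : MayCross z a) (o : Bool) :
    Tg P (a ++ [z]) (passLeft z o a) (z :: a) := by
  induction a with
  | nil => rfl
  | cons x a ih =>
    refine Tg.append (b := x :: z :: a)
      (by simpa using (ih fun y hy => h y (by simp [hy])).padL [x]) ?_
    exact ⟨by simp [Slice.dom, Gen.dom], ⟨(h x (by simp)).symm, (hP x _).2⟩,
      by simp [Slice.cod, Gen.cod, Tg]⟩

theorem TEq.r2 {x y : S} (o : Bool) (h : colour x = Colour.moving ∨ colour y = Colour.moving)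
    (h1 : P (.cross x y o)) (h2 : P (.cross y x (!o))) :
    TEq P [x, y] [x, y] [⟨[], .cross x y o, []⟩, ⟨[], .cross y x (!o), []⟩] [] := by
  refine TEq.of_move ?_ ?_ rfl ?_
  · simpa [Gen.map] using BasicMove.r2 [] [] (colour x) (colour y) o
  · simp [Tg, Slice.dom, Slice.cod, Gen.dom, Gen.cod, Gen.Valid, h, h.symm, h1, h2]
  · simp [Gen.isFixedCup]

theorem TEq.passRight_passLeft {z : S} {a : List S} (hP : Crosses P z) (h : MayCross z a) (o : Bool) :
    TEq P (z :: a) (z :: a) (passRight z o a ++ passLeft z o a) [] := by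
  induction a with
  | nil => exact .refl rfl
  | cons x a ih =>
    have h' : MayCross z a := fun y hy => h y (by simp [hy])
    have h1 := (ih h').padL [x]
    have h2 := (TEq.r2 (P := P) (x := z) (y := x) o (h x (by simp)) (hP x o).1 (hP x _).2).padR a
    have hT := (Tg_passRight hP h o).append (Tg_passLeft hP h o)
    -- `TEq.sub` needs a non-empty word; without further strands only the R2 pair `h2` is left.
    by_cases ha : a = []
    · subst ha; simpa [passRight, passLeft] using h2
    · have h3 := h1.sub (a := z :: x :: a) (b := z :: x :: a) [⟨[], .cross z x o, a⟩]
        [⟨[], .cross x z (!o), a⟩] (by simpa [passRight, passLeft] using hT)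
        (by cases a <;> simp_all [passRight])
      simpa [passRight, passLeft] using h3.trans (by simpa using h2)

theorem TEq.passLeft_passRight {z : S} {a : List S} (hP : Crosses P z) (h : MayCross z a) (o : Bool) :
    TEq P (a ++ [z]) (a ++ [z]) (passLeft z o a ++ passRight z o a) [] := by
  induction a with
  | nil => exact .refl rfl
  | cons x a ih =>
    have h' : MayCross z a := fun y hy => h y (by simp [hy])
    have h1 := (ih h').padL [x]
    have h2 := (TEq.r2 (P := P) (x := x) (y := z) (!o) (h x (by simp)).symm (hP x _).2
      (by simpa using (hP x o).1)).padR a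
    have hT := (Tg_passLeft hP h o).append (Tg_passRight hP h o)
    have h3 := h2.sub (wpad [x] (passLeft z o a) []) (wpad [x] (passRight z o a) [])
      (by simpa [passRight, passLeft] using hT) (by simp)
    simpa [passRight, passLeft] using h3.trans (by simpa using h1)

variable [LawfulLabel S]

theorem TEq.zigzagLeft {x : S} (hx : colour x = Colour.moving)
    (h1 : P (.cup (rev x))) (h2 : P (.cap x)) :
    TEq P [x] [x] [⟨[x], .cup (rev x), []⟩, ⟨[], .cap x, [x]⟩] [] := by
  refine TEq.of_move ?_ ?_ rfl ?_
  · simpa [Gen.map, LawfulLabel.colour_rev] using BasicMove.zigzagLeft [] [] (colour x)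
  · simp [Tg, Slice.dom, Slice.cod, Gen.dom, Gen.cod, Gen.Valid, LawfulLabel.rev_rev, h1, h2]
  · simp [Gen.isFixedCup, LawfulLabel.colour_rev, hx]

theorem TEq.zigzagRight {x : S} (hx : colour x = Colour.moving)
    (h1 : P (.cup x)) (h2 : P (.cap (rev x))) :
    TEq P [x] [x] [⟨[], .cup x, [x]⟩, ⟨[x], .cap (rev x), []⟩] [] := by
  refine TEq.of_move ?_ ?_ rfl ?_
  · simpa [Gen.map, LawfulLabel.colour_rev] using BasicMove.zigzagRight [] [] (colour x)
  · simp [Tg, Slice.dom, Slice.cod, Gen.dom, Gen.cod, Gen.Valid, LawfulLabel.rev_rev, h1, h2]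
  · simp [Gen.isFixedCup, hx]

theorem TEq.slideCap {z c : S} (o : Bool)
    (h : colour c = Colour.moving ∨ colour z = Colour.moving)
    (hc : P (.cap c)) (h1 : P (.cross c z o)) (h2 : P (.cross z (rev c) (!o))) :
    TEq P [c, z, rev c] [z] [⟨[], .cross c z o, [rev c]⟩, ⟨[z], .cap c, []⟩]
      [⟨[c], .cross z (rev c) (!o), []⟩, ⟨[], .cap c, [z]⟩] := by
  refine TEq.of_move ?_ ?_ ?_ ?_
  · simpa [Gen.map, LawfulLabel.colour_rev] using BasicMove.slideCap [] [] (colour c) (colour z) o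
  · simp [Tg, Slice.dom, Slice.cod, Gen.dom, Gen.cod, Gen.Valid, h1, hc, h]
  · simp [Tg, Slice.dom, Slice.cod, Gen.dom, Gen.cod, Gen.Valid, h2, hc, h.symm,
      LawfulLabel.colour_rev]
  · simp [Gen.isFixedCup]

theorem TEq.slideCup {z c : S} (o : Bool)
    (h : colour c = Colour.moving ∨ colour z = Colour.moving)
    (hc : P (.cup c)) (h1 : P (.cross z c o)) (h2 : P (.cross (rev c) z (!o))) :
    TEq P [z] [c, z, rev c] [⟨[z], .cup c, []⟩, ⟨[], .cross z c o, [rev c]⟩]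
      [⟨[], .cup c, [z]⟩, ⟨[c], .cross (rev c) z (!o), []⟩] := by
  refine TEq.of_move ?_ ?_ ?_ ?_
  · simpa [Gen.map, LawfulLabel.colour_rev] using BasicMove.slideCup [] [] (colour c) (colour z) o
  · simp [Tg, Slice.dom, Slice.cod, Gen.dom, Gen.cod, Gen.Valid, h1, hc, h.symm]
  · simp [Tg, Slice.dom, Slice.cod, Gen.dom, Gen.cod, Gen.Valid, h2, hc, h,
      LawfulLabel.colour_rev]
  · simp [Gen.isFixedCup]

/-- A strand passes over or under a single piece. -/
theorem TEq.passRight_gen {z : S} (hP : Crosses P z) (o : Bool) (g : Gen S) (hg : g.Valid ∧ P g)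
    (h : colour z = Colour.moving ∨ (Mv g.dom ∧ Mv g.cod)) :
    TEq P (z :: g.dom) (g.cod ++ [z]) (⟨[z], g, []⟩ :: passRight z o g.cod)
      (passRight z o g.dom ++ [⟨[], g, [z]⟩]) := by
  rcases g with c | c | ⟨x, y, o'⟩ | ⟨x, y, m⟩
  · have hzc : colour c = Colour.moving ∨ colour z = Colour.moving := by
      simp [Gen.cod] at h; tauto
    have hzc' : colour (rev c) = Colour.moving ∨ colour z = Colour.moving := by
      simpa [LawfulLabel.colour_rev] using hzc
    -- The crossing with the left leg of the minimum slides around to the right leg, where it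
    -- cancels by R2 against the second crossing of `z`.
    have h1 := TEq.slideCup (P := P) (z := z) (c := c) o hzc hg.2 (hP c o).1 (hP _ _).2
    have h2 := (TEq.r2 (P := P) (x := rev c) (y := z) (!o) hzc' (hP _ _).2
      (by simpa using (hP (rev c) o).1)).padL [c]
    have hT : Tg P [c, z, rev c] [⟨[c], .cross z (rev c) o, []⟩] [c, rev c, z] :=
      ⟨rfl, ⟨hzc'.symm, (hP _ _).1⟩, rfl⟩
    have h3 := h1.compR hT
    have hU : Tg P [z] [⟨[], .cup c, [z]⟩] [c, rev c, z] := ⟨rfl, hg, rfl⟩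
    have h4 := TEq.compL hU h2
    simpa [passRight, Gen.dom, Gen.cod] using h3.trans (by simpa using h4)
  · have hzc : colour c = Colour.moving ∨ colour z = Colour.moving := by
      simp [Gen.dom] at h; tauto
    have hzc' : colour (rev c) = Colour.moving ∨ colour z = Colour.moving := by
      simpa [LawfulLabel.colour_rev] using hzc
    have h1 := TEq.slideCap (P := P) (z := z) (c := c) (!o) hzc hg.2 (hP c _).2 (hP _ _).1
    have h2 := (TEq.r2 (P := P) (x := z) (y := c) o hzc.symm (hP _ _).1 (hP _ _).2).padR [rev c]
    have hT : Tg P [z, c, rev c] [⟨[], .cross z c o, [rev c]⟩] [c, z, rev c] :=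
      ⟨rfl, ⟨hzc.symm, (hP _ _).1⟩, rfl⟩
    have h3 := TEq.compL hT h1.symm
    have hU : Tg P [z, c, rev c] [⟨[z], .cap c, []⟩] [z] := ⟨rfl, hg, rfl⟩
    have h4 := TEq.compR h2 hU
    simpa [passRight, Gen.dom, Gen.cod] using (h3.trans (by simpa using h4)).symm
  · have hzx : colour z = Colour.moving ∨ colour x = Colour.moving := by
      simp [Gen.dom] at h; tauto
    have hzy : colour z = Colour.moving ∨ colour y = Colour.moving := by
      simp [Gen.dom] at h; tauto
    refine TEq.symm (TEq.of_move ?_ ?_ ?_ ?_)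
    -- Since `z` is over both strands or under both, the three strands lie in layers whatever the
    -- value of `o'`.
    · simpa [Gen.map, Gen.dom, Gen.cod, passRight] using
        BasicMove.r3 [] [] (colour z) (colour x) (colour y) o o o' (by cases o <;> cases o' <;> decide)
    · simp [Tg, passRight, Slice.dom, Slice.cod, Gen.dom, Gen.cod, hzx, hzy, hg, hP x o, hP y o]
      simp [Gen.Valid, hzx, hzy]
    · simp [Tg, passRight, Slice.dom, Slice.cod, Gen.dom, Gen.cod, hzx, hzy, hg, hP x o, hP y o]
      simp [Gen.Valid, hzx, hzy]
    · simp [Gen.isFixedCup, passRight, Gen.dom, Gen.cod]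
  · obtain ⟨hx, hy, hm⟩ := hg.1
    refine TEq.of_move ?_ ?_ ?_ ?_
    · simpa [Gen.map, Gen.dom, Gen.cod, passRight, hx, hy] using
        BasicMove.pr3Left [] [] (colour z) m o
    · simp [Tg, passRight, Slice.dom, Slice.cod, Gen.dom, Gen.cod, hg, hP x o, hP y o]
      simp [Gen.Valid, hx, hy]
    · simp [Tg, passRight, Slice.dom, Slice.cod, Gen.dom, Gen.cod, hg, hP x o, hP y o]
      simp [Gen.Valid, hx, hy]
    · simp [Gen.isFixedCup, passRight, Gen.dom, Gen.cod]

/-- A strand passes over or under a word. -/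
theorem TEq.passRight_word {z : S} (hP : Crosses P z) (o : Bool) {a b : List S} {w : List (Slice S)}
    (hw : Tg P a w b) (h : colour z = Colour.moving ∨ (Mv a ∧ MvW w)) :
    TEq P (z :: a) (b ++ [z]) (wpad [z] w [] ++ passRight z o b) (passRight z o a ++ wpad [] w [z]) := by
  have hM : ∀ {c : List S}, colour z = Colour.moving ∨ Mv c → MayCross z c :=
    fun h => h.elim (MayCross.of_moving · _) (Mv.mayCross · _)
  induction w generalizing a with
  | nil =>
    cases hw
    simpa using TEq.refl (Tg_passRight hP (hM (h.imp_right And.left)) o)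
  | cons s w ih =>
    obtain ⟨rfl, hs, hw⟩ := hw
    obtain ⟨l, g, r⟩ := s
    have hl : MayCross z l := hM (h.imp_right fun h => by have := h.1; simp [Slice.dom] at this; tauto)
    have hr : MayCross z r := hM (h.imp_right fun h => by have := h.1; simp [Slice.dom] at this; tauto)
    have hg : colour z = Colour.moving ∨ (Mv g.dom ∧ Mv g.cod) :=
      h.imp_right fun h => by have := h.2; simp [Slice.dom, Slice.cod] at this; tauto
    have hcd : MayCross z g.dom := hM (hg.imp_right And.left)
    have hcc : MayCross z g.cod := hM (hg.imp_right And.right)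
    have ih' := ih hw (h.imp_right fun h => by have := h.2; simp at this; tauto)
    have hG : Tg P g.dom [⟨[], g, []⟩] g.cod := ⟨by simp [Slice.dom], hs, by simp [Slice.cod, Tg]⟩
    -- The path of `z` splits into its parts across `l`, across the piece and across `r`. These are
    -- moved below the piece one after the other: the outer two by a change of heights, the middle
    -- one by `TEq.passRight_gen`.
    have e1 := (TEq.interchange (Tg_passRight hP hl o) hG).symm.padR r
    have e2 := (TEq.passRight_gen hP o g hs hg).pad l r
    have e3 := (TEq.interchange hG (Tg_passRight hP hr o)).padL l
    have t1 := (Tg_passRight hP hl o).padR (g.dom ++ r)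
    have t2 := (Tg_passRight hP hcc o).pad l r
    have t3 := (Tg_passRight hP hr o).padL (l ++ g.cod)
    have t2' := (Tg_passRight hP hcd o).pad l r
    have key : TEq P (z :: (l ++ g.dom ++ r)) (l ++ g.cod ++ r ++ [z])
        (⟨z :: l, g, r⟩ :: passRight z o (l ++ g.cod ++ r))
        (passRight z o (l ++ g.dom ++ r) ++ [⟨l, g, r ++ [z]⟩]) := by
      have f1 := TEq.compR e1 ((t2.append (by simpa using t3)) |> fun t => by simpa using t)
      have f2 := TEq.compL t1 ((TEq.compR e2 (by simpa using t3)) |> fun t => by simpa using t)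
      have f3 := TEq.compL t1 (TEq.compL (by simpa using t2') (by simpa using e3))
      simp only [passRight_append]
      simp only [wpad_append, wpad_cons, wpad_wpad, List.append_assoc, List.nil_append,
        List.append_nil, List.cons_append, wpad_nil, List.singleton_append] at f1 f2 f3 ⊢
      exact f1.trans (f2.trans f3)
    have tw := hw.padR [z]
    have g1 : TEq P (z :: (l ++ g.dom ++ r)) (b ++ [z]) _ _ :=
      TEq.compL (u := [⟨z :: l, g, r⟩]) (b := z :: (l ++ g.cod ++ r))
        ⟨by simp [Slice.dom], hs, by simp [Slice.cod, Tg]⟩ ih'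
    have g2 := TEq.compR key tw
    simpa [Slice.cod, Slice.dom] using g1.trans (by simpa [Slice.cod] using g2)

/-- A strand passes back over or under a word. -/
theorem TEq.passLeft_word {z : S} (hP : Crosses P z) (o : Bool) {a b : List S} {w : List (Slice S)}
    (hw : Tg P a w b) (h : colour z = Colour.moving ∨ (Mv a ∧ MvW w)) :
    TEq P (a ++ [z]) (z :: b) (wpad [] w [z] ++ passLeft z o b) (passLeft z o a ++ wpad [z] w []) := by
  have ha : MayCross z a := h.elim (MayCross.of_moving · _) (Mv.mayCross ·.1 _)
  have hb : MayCross z b := h.elim (MayCross.of_moving · _)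
    fun h => (hw.mv_cod h.1 h.2).mayCross _
  -- Passing left is inverse to passing right, so the claim is `TEq.passRight_word` multiplied by
  -- the inverse on both sides.
  have e1 := TEq.compR (TEq.passLeft_passRight hP ha o) ((hw.padR [z]).append (Tg_passLeft hP hb o))
  have e2 := TEq.compL (Tg_passLeft hP ha o) (TEq.compR (TEq.passRight_word hP o hw h) (Tg_passLeft hP hb o))
  have e3 := TEq.compL (Tg_passLeft hP ha o) (TEq.compL (hw.padL [z]) (TEq.passRight_passLeft hP hb o))
  simp only [List.append_assoc, List.nil_append, List.append_nil] at e1 e2 e3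
  exact e1.symm.trans (e2.symm.trans e3)

end Passing


/-! ### Bundles of strands passing each other, and clasps -/

section Blocks

variable {S : Type} [StrandLabel S] {P : Gen S → Prop}

open StrandLabel

/-- The strands `b` pass the strands `a` from the left to the right, over them if `o = true`. -/
def blockRight (o : Bool) : List S → List S → List (Slice S)
  | [], _ => []
  | y :: b, a => wpad [y] (blockRight o b a) [] ++ wpad [] (passRight y o a) b

/-- The inverse of `blockRight`. -/
def blockLeft (o : Bool) : List S → List S → List (Slice S)
  | [], _ => []
  | y :: b, a => wpad [] (passLeft y o a) b ++ wpad [y] (blockLeft o b a) []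

theorem blockRight_empty (o : Bool) (b : List S) : blockRight o b [] = [] := by
  induction b with
  | nil => rfl
  | cons y b ih => simp [blockRight, ih, passRight]

/-- The same crossings seen from `z`: strands running to the right under `z` are strands over which
`z` runs to the left. This identifies the pulled strand of `O` with a passage of moving strands. -/
theorem blockRight_singleton (b : List S) (z : S) : blockRight false b [z] = passLeft z true b := by
  induction b with
  | nil => rfl
  | cons y b ih => simp [blockRight, ih, passRight, passLeft]

theorem blockLeft_singleton (b : List S) (z : S) : blockLeft false b [z] = passRight z true b := by
  induction b with
  | nil => rfl
  | cons y b ih => simp [blockLeft, ih, passRight, passLeft]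

/-- The class `P` contains all pieces except possibly precrossings. -/
def Full (P : Gen S → Prop) : Prop := ∀ g : Gen S, g.isPre = false → P g

theorem Full.crosses (hP : Full P) (z : S) : Crosses P z := fun _ _ => ⟨hP _ rfl, hP _ rfl⟩

theorem MvW_blockRight {o : Bool} {a b : List S} (ha : Mv a) (hb : Mv b) :
    MvW (blockRight o b a) := by
  induction b with
  | nil => simp [blockRight]
  | cons y b ih =>
    simp only [Mv_cons] at hb
    simp only [blockRight, MvW_append]
    exact ⟨(ih hb.2).pad (by simp [hb]) (by simp), (MvW_passRight hb.1 ha).pad (by simp) hb.2⟩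

theorem MvW_blockLeft {o : Bool} {a b : List S} (ha : Mv a) (hb : Mv b) :
    MvW (blockLeft o b a) := by
  induction b with
  | nil => simp [blockLeft]
  | cons y b ih =>
    simp only [Mv_cons] at hb
    simp only [blockLeft, MvW_append]
    exact ⟨(MvW_passLeft hb.1 ha).pad (by simp) hb.2, (ih hb.2).pad (by simp [hb]) (by simp)⟩

theorem Tg_blockRight (hP : Full P) (o : Bool) {b : List S} (hb : Mv b) (a : List S) :
    Tg P (b ++ a) (blockRight o b a) (a ++ b) := by
  induction b with
  | nil => simp [blockRight, Tg]
  | cons y b ih =>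
    simp only [Mv_cons] at hb
    have h1 := (ih hb.2).padL [y]
    have h2 := (Tg_passRight (hP.crosses y) (.of_moving hb.1 a) o).padR b
    exact h1.append (by simpa using h2)

theorem Tg_blockLeft (hP : Full P) (o : Bool) {b : List S} (hb : Mv b) (a : List S) :
    Tg P (a ++ b) (blockLeft o b a) (b ++ a) := by
  induction b with
  | nil => simp [blockLeft, Tg]
  | cons y b ih =>
    simp only [Mv_cons] at hb
    have h1 := (ih hb.2).padL [y]
    have h2 := (Tg_passLeft (hP.crosses y) (.of_moving hb.1 a) o).padR b
    exact Tg.append (by simpa using h2) h1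

theorem TEq.blockRight_blockLeft (hP : Full P) (o : Bool) {b : List S} (hb : Mv b) (a : List S) :
    TEq P (b ++ a) (b ++ a) (blockRight o b a ++ blockLeft o b a) [] := by
  induction b with
  | nil => exact .refl rfl
  | cons y b ih =>
    simp only [Mv_cons] at hb
    have h1 := (ih hb.2).padL [y]
    have h2 := (TEq.passRight_passLeft (hP.crosses y) (.of_moving hb.1 a) o).padR b
    have t1 := (Tg_blockRight hP o hb.2 a).padL [y]
    have t2 := (Tg_blockLeft hP o hb.2 a).padL [y]
    have h3 := TEq.compL t1 (TEq.compR (by simpa using h2) t2)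
    simp at h1 h3
    simpa [blockRight, blockLeft] using h3.trans h1

theorem TEq.blockLeft_blockRight (hP : Full P) (o : Bool) {b : List S} (hb : Mv b) (a : List S) :
    TEq P (a ++ b) (a ++ b) (blockLeft o b a ++ blockRight o b a) [] := by
  induction b with
  | nil => exact .refl rfl
  | cons y b ih =>
    simp only [Mv_cons] at hb
    have h1 := (ih hb.2).padL [y]
    have h2 := (TEq.passLeft_passRight (hP.crosses y) (.of_moving hb.1 a) o).padR b
    have t1 := (Tg_passLeft (hP.crosses y) (.of_moving hb.1 a) o).padR b
    have t2 := (Tg_passRight (hP.crosses y) (.of_moving hb.1 a) o).padR b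
    have h3 := TEq.compL t1 (TEq.compR (by simpa using h1) t2)
    simp at h2 h3
    simpa [blockRight, blockLeft] using h3.trans h2

variable [LawfulLabel S]

/-- Both words have the same crossings but list them in a different order, strand by strand of `b`
or first all those with `a`; crossings without a common strand may exchange their heights. -/
theorem TEq.blockRight_append (hP : Full P) (o : Bool) {b : List S} (hb : Mv b) (a c : List S) :
    TEq P (b ++ (a ++ c)) (a ++ c ++ b) (blockRight o b (a ++ c))
      (wpad [] (blockRight o b a) c ++ wpad a (blockRight o b c) []) := by
  induction b with
  | nil => simpa [blockRight] using TEq.refl (P := P) (a := a ++ c) (w := []) rfl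
  | cons y b ih =>
    simp only [Mv_cons] at hb
    have h1 := (ih hb.2).padL [y]
    have ty := Tg_passRight (P := P) (hP.crosses y) (.of_moving hb.1 (a ++ c)) o
    have ta := Tg_passRight (P := P) (hP.crosses y) (.of_moving hb.1 a) o
    have tc := Tg_passRight (P := P) (hP.crosses y) (.of_moving hb.1 c) o
    have h2 := TEq.compR h1 (by simpa using ty.padR b)
    have h3 := (TEq.interchange ta (Tg_blockRight hP o hb.2 c)).symm
    have tb := ((Tg_blockRight hP o hb.2 a).pad [y] c)
    have h4 := TEq.compL tb (TEq.compR (by simpa using h3) (by simpa using tc.pad a b))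
    simp [passRight_append] at h2 h4
    simpa [blockRight, passRight_append] using h2.trans h4

/-- Naturality of the passage, by iterating `TEq.passRight_word`. Because the passing strands are
moving, `w` may contain strands of `O`; this is what transports clasps and rings sideways. -/
theorem TEq.blockRight_word (hP : Full P) (o : Bool) {b : List S} (hb : Mv b) {a a' : List S}
    {w : List (Slice S)} (hw : Tg P a w a') :
    TEq P (b ++ a) (a' ++ b) (wpad b w [] ++ blockRight o b a')
      (blockRight o b a ++ wpad [] w b) := by
  induction b with
  | nil => simpa [blockRight] using TEq.refl hw
  | cons y b ih =>
    simp only [Mv_cons] at hb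
    have h1 := (ih hb.2).padL [y]
    have h2 := (TEq.passRight_word (hP.crosses y) o hw (.inl hb.1)).padR b
    have t1 := (Tg_passRight (P := P) (hP.crosses y) (.of_moving hb.1 a') o).padR b
    have t2 := (Tg_blockRight hP o hb.2 a).padL [y]
    have h3 := TEq.compR h1 (by simpa using t1)
    have h4 := TEq.compL t2 (by simpa using h2)
    simp at h3 h4
    simpa [blockRight] using h3.trans h4

/-- The strand `O` passes over the strands `a` and comes back under them. -/
def loopAround (a : List S) : List (Slice S) :=
  passRight fixedStrand true a ++ passLeft fixedStrand false a

theorem Tg_loopAround (hP : Full P) {a : List S} (ha : Mv a) :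
    Tg P (fixedStrand :: a) (loopAround a) (fixedStrand :: a) :=
  (Tg_passRight (hP.crosses _) (ha.mayCross _) _).append
    (Tg_passLeft (hP.crosses _) (ha.mayCross _) _)

/-- Conjugation of a clasp by the passage of `O` over the strands `a`. -/
theorem TEq.clasp_conj (hP : Full P) {x : S} (hx : colour x = Colour.moving) {a : List S}
    (ha : Mv a) :
    TEq P (fixedStrand :: x :: rev x :: a) (a ++ [fixedStrand, x, rev x])
      (wpad [] (loopAround [x]) (rev x :: a) ++
        (wpad [fixedStrand] (blockLeft false a [x, rev x]) [] ++
          wpad [] (passRight fixedStrand true a) [x, rev x]))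
      (wpad [fixedStrand] (blockLeft false a [x, rev x]) [] ++
        wpad [] (passRight fixedStrand true a) [x, rev x] ++
          wpad a (loopAround [x]) [rev x]) := by
  have tA : Tg P [fixedStrand, x, rev x] (wpad [] (loopAround [x]) [rev x])
      [fixedStrand, x, rev x] := (Tg_loopAround hP (a := [x]) (by simpa using hx)).padR [rev x]
  have nat := TEq.blockRight_word hP false ha tA
  have tQ := Tg_blockRight hP false ha [x, rev x]
  have tQi := Tg_blockLeft hP false ha [x, rev x]
  have tF := Tg_blockRight hP false ha [fixedStrand]
  have tFi := Tg_blockLeft hP false ha [fixedStrand]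
  have app : TEq P (a ++ [fixedStrand, x, rev x]) ([fixedStrand, x, rev x] ++ a)
      (blockRight false a [fixedStrand, x, rev x])
      (wpad [] (blockRight false a [fixedStrand]) [x, rev x] ++
        wpad [fixedStrand] (blockRight false a [x, rev x]) []) :=
    TEq.blockRight_append hP false ha [fixedStrand] [x, rev x]
  -- `T` carries `a` to the right under all three strands and `I` is its inverse, arranged as in the
  -- statement. Naturality says that `T` commutes with the clasp, so multiplying by `I` on both
  -- sides gives the claim.
  set T := blockRight false a [fixedStrand, x, rev x] with hT
  set I := wpad [fixedStrand] (blockLeft false a [x, rev x]) [] ++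
    wpad [] (blockLeft false a [fixedStrand]) [x, rev x] with hI
  have tI : Tg P ([fixedStrand, x, rev x] ++ a) I (a ++ [fixedStrand, x, rev x]) := by
    refine Tg.append (tQi.padL [fixedStrand]) ?_
    simpa using tFi.padR [x, rev x]
  have TI : TEq P (a ++ [fixedStrand, x, rev x]) (a ++ [fixedStrand, x, rev x]) (T ++ I) [] := by
    have h1 := TEq.compR app tI
    have h2 := TEq.ctx (tF.padR [x, rev x])
      (by simpa using (TEq.blockRight_blockLeft hP false ha [x, rev x]).padL [fixedStrand])
      (by simpa using (tFi.padR [x, rev x]))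
    have h3 := (TEq.blockRight_blockLeft hP false ha [fixedStrand]).padR [x, rev x]
    simp [hI] at h1 h2 h3 ⊢
    exact h1.trans (h2.trans h3)
  have IT : TEq P ([fixedStrand, x, rev x] ++ a) ([fixedStrand, x, rev x] ++ a) (I ++ T) [] := by
    have h1 := TEq.compL tI app
    have h2 := TEq.ctx (tQi.padL [fixedStrand])
      (by simpa using (TEq.blockLeft_blockRight hP false ha [fixedStrand]).padR [x, rev x])
      (by simpa using (tQ.padL [fixedStrand]))
    have h3 := (TEq.blockLeft_blockRight hP false ha [x, rev x]).padL [fixedStrand]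
    simp [hI] at h1 h2 h3 ⊢
    exact h1.trans (h2.trans h3)
  have tAa := tA.padR a
  have g1 := TEq.compR IT (tAa.append tI)
  have g2 := TEq.ctx tI nat tI
  have g3 := TEq.compL (tI.append (tA.padL a)) TI
  rw [blockLeft_singleton] at hI
  simp only [wpad_wpad, List.nil_append, List.append_nil, List.append_assoc, List.singleton_append,
    List.cons_append] at g1 g2 g3 ⊢
  rw [← List.append_assoc _ _ (wpad a _ _), ← hI]
  simpa using (g2.trans g1).symm.trans g3

/-- Two successive loops of `O`, around `x` and then around `a`, merge into one loop around `a` and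
`x`: the strands `a` are led under the arc formed by `x` and its maximum, which lets the maximum
rise above the second loop, and `TEq.clasp_conj` lifts the clasp into that loop. -/
theorem TEq.cap_loopAround (hP : Full P) {x : S} (hx : colour x = Colour.moving) {a : List S}
    (ha : Mv a) :
    TEq P (fixedStrand :: x :: rev x :: a) (fixedStrand :: a)
      (wpad [] (loopAround [x]) (rev x :: a) ++ ⟨[fixedStrand], .cap x, a⟩ :: loopAround a)
      (wpad [fixedStrand] (blockLeft false a [x, rev x]) [] ++
        wpad [] (loopAround (a ++ [x])) [rev x] ++ [⟨fixedStrand :: a, .cap x, []⟩]) := by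
  have tC : Tg P [x, rev x] [⟨[], .cap x, []⟩] [] := ⟨rfl, ⟨trivial, hP _ rfl⟩, rfl⟩
  have tQi := Tg_blockLeft hP false ha [x, rev x]
  have tA := (Tg_loopAround hP (a := [x]) (by simpa using hx))
  have tL := Tg_loopAround hP ha
  have c1 : TEq P ([x, rev x] ++ a) a [⟨[], .cap x, a⟩]
      (blockLeft false a [x, rev x] ++ [⟨a, .cap x, []⟩]) := by
    have h1 := TEq.blockRight_word hP false ha tC
    rw [blockRight_empty] at h1
    have h2 := TEq.compL tQi h1
    have h3 := TEq.compR (TEq.blockLeft_blockRight hP false ha [x, rev x]) (tC.padR a)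
    simp at h2 h3
    simpa using (h2.trans h3).symm
  have c2 := (TEq.interchange tL tC).symm
  have c3 := TEq.clasp_conj hP hx ha
  have e1 := TEq.ctx (tA.padR (rev x :: a)) (c1.padL [fixedStrand]) tL
  have e2 := TEq.compL ((tA.padR (rev x :: a)).append (tQi.padL [fixedStrand])) c2
  have t4 := (Tg_passLeft (P := P) (hP.crosses fixedStrand) (ha.mayCross _) false).padR [x, rev x]
  have t5 := t4.append (tC.padL (fixedStrand :: a))
  have e3 := TEq.compR c3 (by simpa using t5)
  simp at e1 e2 e3
  have e4 := e1.trans e2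
  simp [loopAround, passRight_append, passLeft_append] at e3 e4 ⊢
  exact e4.trans e3

end Blocks


/-! ### Normal form for a tangle with a single strand of `O` -/

section OneStrand

variable {S : Type} [StrandLabel S] {P : Gen S → Prop}

open StrandLabel

/-- A word with one strand of `O`, at the left end, is isotopic to one in which `O` encircles some
strands once. -/
def RingForm (P : Gen S → Prop) (c q : List S) (w : List (Slice S)) : Prop :=
  ∃ (a r : List S) (u v : List (Slice S)), Mv a ∧ Mv r ∧ Tg P c u (a ++ r) ∧ MvW u ∧
    Tg P (a ++ r) v q ∧ MvW v ∧
    TEq P (fixedStrand :: c) (fixedStrand :: q) w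
      (wpad [fixedStrand] u [] ++ wpad [] (loopAround a) r ++ wpad [fixedStrand] v [])

theorem RingForm.tg {c q : List S} {w : List (Slice S)} (h : RingForm P c q w) :
    Tg P (fixedStrand :: c) w (fixedStrand :: q) :=
  let ⟨_, _, _, _, _, _, _, _, _, _, e⟩ := h
  e.1

theorem RingForm.nil {c : List S} (hc : Mv c) : RingForm P c c [] :=
  ⟨[], c, [], [], by simp, hc, rfl, by simp, rfl, by simp,
    by simpa [loopAround, passRight, passLeft] using TEq.refl (P := P) (w := []) rfl⟩

theorem RingForm.cons {c c' q : List S} {w x : List (Slice S)} (h : RingForm P c' q w)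
    (hx : Tg P c x c') (hx' : MvW x) : RingForm P c q (wpad [fixedStrand] x [] ++ w) := by
  obtain ⟨a, r, u, v, ha, hr, hu, hu', hv, hv', h⟩ := h
  refine ⟨a, r, x ++ u, v, ha, hr, hx.append hu, by simp [hx', hu'], hv, hv', ?_⟩
  simpa using TEq.compL (hx.padL [fixedStrand]) h

variable [LawfulLabel S]

/-- The clasped strand is stretched to a finger reaching up to the level where `O` already encircles
`a`; there the two loops are merged by `TEq.cap_loopAround`. -/
theorem RingForm.clasp (hP : Full P) {x : S} {b q : List S} {w : List (Slice S)}
    (hx : colour x = Colour.moving) (hb : Mv b) (h : RingForm P (x :: b) q w) :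
    RingForm P (x :: b) q (wpad [] (loopAround [x]) b ++ w) := by
  obtain ⟨a, r, u, v, ha, hr, hu, hu', hv, hv', h⟩ := h
  have hx' : colour (rev x) = Colour.moving := by rw [LawfulLabel.colour_rev, hx]
  have tA := Tg_loopAround hP (P := P) (a := [x]) (by simpa using hx)
  have tL := Tg_loopAround hP (P := P) ha
  have tcup : Tg P b [⟨[], .cup (rev x), b⟩] (rev x :: x :: b) :=
    ⟨rfl, ⟨trivial, hP _ rfl⟩, by simp [Tg, Slice.cod, Gen.cod, LawfulLabel.rev_rev]⟩
  have tcap : Tg P [x, rev x] [⟨[], .cap x, []⟩] [] := ⟨rfl, ⟨trivial, hP _ rfl⟩, rfl⟩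
  have tQi := Tg_blockLeft hP false ha [x, rev x]
  -- The finger is created as a zigzag of `x` above the clasp.
  have z := (TEq.zigzagLeft (P := P) hx (hP _ rfl) (hP _ rfl)).pad [fixedStrand] b
  have tF : ∀ r : List S, Tg P (fixedStrand :: (a ++ r)) (wpad [] (loopAround a) r)
      (fixedStrand :: (a ++ r)) := fun r => by simpa using tL.padR r
  have e1 := TEq.compR ((TEq.interchange tA tcup).symm)
    (by simpa using tcap.pad [fixedStrand] (x :: b))
  have e2 := TEq.compL (tA.padR b) z
  have e3 := (TEq.interchange tcap hu).padL [fixedStrand]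
  have e4 := TEq.interchange tA (hu.padL [rev x])
  have e5 := (TEq.cap_loopAround hP hx ha).padR r
  simp at e1 e2 e3 e4 e5
  have f1 := TEq.compR (e1.trans e2).symm h.2.1
  have f0 := TEq.compL (tA.padR b) h
  have tv := hv.padL [fixedStrand]
  have tend := Tg.append (tF r) tv
  have tcupA : Tg P (fixedStrand :: x :: b)
      (⟨[fixedStrand, x], .cup (rev x), b⟩ :: wpad [] (loopAround [x]) (rev x :: x :: b))
      (fixedStrand :: x :: rev x :: x :: b) := by
    have := (tcup.padL [fixedStrand, x]).append (tA.padR (rev x :: x :: b))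
    simpa using this
  have tcup' : Tg P (fixedStrand :: x :: b) [⟨[fixedStrand, x], .cup (rev x), b⟩]
      (fixedStrand :: x :: rev x :: x :: b) := by simpa using tcup.padL [fixedStrand, x]
  have f2 := TEq.compL tcupA (TEq.compR e3 tend)
  have tcapr : Tg P (fixedStrand :: x :: rev x :: (a ++ r)) [⟨[fixedStrand], .cap x, a ++ r⟩]
      (fixedStrand :: (a ++ r)) := by simpa using tcap.pad [fixedStrand] (a ++ r)
  have f3 := TEq.compL tcup' (TEq.compR e4 (tcapr.append tend))
  have tu : Tg P (fixedStrand :: x :: rev x :: x :: b) (wpad [fixedStrand, x, rev x] u [])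
      (fixedStrand :: x :: rev x :: (a ++ r)) := by simpa using hu.padL [fixedStrand, x, rev x]
  have f4 := TEq.compL (tcup'.append tu) (TEq.compR e5 tv)
  -- The rising leg of the finger joins the encircled strands, the descending leg joins the
  -- remaining ones. Below the new ring lie the minimum of the finger, `u` beside it, and the
  -- passage of `a` under it; above lies the tip of the finger.
  refine ⟨a ++ [x], rev x :: r,
    [⟨[x], .cup (rev x), b⟩] ++ wpad [x, rev x] u [] ++ wpad [] (blockLeft false a [x, rev x]) r,
    [⟨a, .cap x, r⟩] ++ v, by simp [ha, hx], by simp [hr, hx'], ?_, ?_, ?_, ?_, ?_⟩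
  · refine Tg.append (Tg.append (b := x :: rev x :: x :: b) (by simpa using tcup.padL [x])
      (by simpa using hu.padL [x, rev x])) (by simpa using tQi.padR r)
  · simp only [MvW_append]
    refine ⟨⟨?_, hu'.pad (by simp [hx, hx']) (by simp)⟩,
      (MvW_blockLeft (by simp [hx, hx']) ha).pad (by simp) hr⟩
    simp [Slice.dom, Slice.cod, Gen.dom, Gen.cod, hx, LawfulLabel.colour_rev, hb]
  · exact Tg.append (by simpa using tcap.pad a r) hv
  · simp [Slice.dom, Slice.cod, Gen.dom, Gen.cod, hx, LawfulLabel.colour_rev, ha, hr, hv']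
  · simp at f0 f1 f2 f3 f4 ⊢
    exact f0.trans ((by simpa using f1.symm.symm.trans (f2.trans (f3.trans f4))))

/-- The strand of `O` is first pulled to the left end. -/
def OneForm (P : Gen S → Prop) (m n q : List S) (w : List (Slice S)) : Prop :=
  ∃ w', TEq P (m ++ fixedStrand :: n) (fixedStrand :: q) w
    (wpad [] (passLeft fixedStrand true m) n ++ w') ∧ RingForm P (m ++ n) q w'

theorem OneForm.congr {m n q : List S} {w w' : List (Slice S)} (h : OneForm P m n q w')
    (e : TEq P (m ++ fixedStrand :: n) (fixedStrand :: q) w w') : OneForm P m n q w := by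
  obtain ⟨x, h1, h2⟩ := h
  exact ⟨x, e.trans h1, h2⟩

theorem OneForm.nil {n : List S} (hn : Mv n) : OneForm P [] n n [] :=
  ⟨[], by simpa [passLeft] using TEq.refl (P := P) (w := []) rfl, .nil hn⟩

theorem OneForm.right (hP : Full P) {m n n' q : List S} {w x : List (Slice S)} (hm : Mv m)
    (h : OneForm P m n' q w) (hx : Tg P n x n') (hx' : MvW x) :
    OneForm P m n q (wpad (m ++ [fixedStrand]) x [] ++ w) := by
  obtain ⟨w', h1, h2⟩ := h
  refine ⟨wpad (fixedStrand :: m) x [] ++ w', ?_, ?_⟩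
  · have e1 := TEq.compL (hx.padL (m ++ [fixedStrand])) (by simpa using h1)
    have e2 := (TEq.interchange (Tg_passLeft (P := P) (hP.crosses fixedStrand) (hm.mayCross _) true)
      hx).symm
    have t : Tg P (fixedStrand :: (m ++ n')) w' (fixedStrand :: q) := h2.tg
    have e3 := TEq.compR e2 (by simpa using t)
    simp at e1 e3
    simpa using e1.trans e3
  · simpa using h2.cons (hx.padL m) (hx'.pad hm (by simp))

/-- The strand of `O` is pulled over everything on its left, so a moving word there slides through
beneath it. -/
theorem OneForm.left (hP : Full P) {m m' n q : List S} {w x : List (Slice S)} (hm : Mv m)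
    (hn : Mv n) (h : OneForm P m' n q w) (hx : Tg P m x m') (hx' : MvW x) :
    OneForm P m n q (wpad [] x (fixedStrand :: n) ++ w) := by
  obtain ⟨w', h1, h2⟩ := h
  refine ⟨wpad [fixedStrand] x n ++ w', ?_, ?_⟩
  · have e1 := TEq.compL (hx.padR (fixedStrand :: n)) h1
    have e2 := (TEq.passLeft_word (P := P) (hP.crosses fixedStrand) true hx (.inr ⟨hm, hx'⟩)).padR n
    have t : Tg P (fixedStrand :: (m' ++ n)) w' (fixedStrand :: q) := h2.tg
    have e3 := TEq.compR e2 (by simpa using t)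
    simp at e1 e3
    simpa using e1.trans e3
  · simpa using h2.cons (hx.padR n) (hx'.pad (by simp) hn)

/-- Such a crossing is simply the first crossing of the pull over a longer list of strands. -/
theorem OneForm.crossLeft_over (hP : Full P) {m n q : List S} {x : S} {w : List (Slice S)}
    (hx : colour x = Colour.moving)
    (h : OneForm P m (x :: n) q w) :
    OneForm P (m ++ [x]) n q (⟨m, .cross x fixedStrand false, n⟩ :: w) := by
  obtain ⟨w', h1, h2⟩ := h
  refine ⟨w', ?_, by simpa using h2⟩
  have t : Tg P (m ++ [x] ++ fixedStrand :: n) [⟨m, .cross x fixedStrand false, n⟩]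
      (m ++ fixedStrand :: x :: n) :=
    ⟨by simp [Slice.dom, Gen.dom], ⟨.inl hx, hP _ rfl⟩, by simp [Slice.cod, Gen.cod, Tg]⟩
  simpa [passLeft_append, passLeft] using TEq.compL t h1

/-- The pull starts by returning over `x`, and the two crossings cancel by R2. -/
theorem OneForm.crossRight_over (hP : Full P) {m n q : List S} {x : S} {w : List (Slice S)}
    (hx : colour x = Colour.moving) (hm : Mv m)
    (h : OneForm P (m ++ [x]) n q w) :
    OneForm P m (x :: n) q (⟨m, .cross fixedStrand x true, n⟩ :: w) := by
  obtain ⟨w', h1, h2⟩ := h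
  refine ⟨w', ?_, by simpa using h2⟩
  have t : Tg P (m ++ fixedStrand :: x :: n) [⟨m, .cross fixedStrand x true, n⟩]
      (m ++ [x] ++ fixedStrand :: n) :=
    ⟨by simp [Slice.dom, Gen.dom], ⟨.inr hx, hP _ rfl⟩, by simp [Slice.cod, Gen.cod, Tg]⟩
  have e1 := TEq.compL t h1
  have ht := ((Tg_passLeft (P := P) (hP.crosses fixedStrand) (hm.mayCross _) true).padR
    (x :: n)).append (by simpa using h2.tg)
  have r := ((TEq.r2 (P := P) (x := fixedStrand) (y := x) true (.inr hx) (hP _ rfl)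
    (hP _ rfl)).pad m n)
  simp [passLeft_append, passLeft] at e1 r
  exact e1.trans (by simpa using TEq.compR r (by simpa using ht))

/-- Crossing under `x` is the same as crossing over `x` and then clasping it. The clasp is
transported to the left end and absorbed by `RingForm.clasp`. -/
theorem OneForm.crossLeft_under (hP : Full P) {m n q : List S} {x : S} {w : List (Slice S)}
    (hx : colour x = Colour.moving) (hm : Mv m) (hn : Mv n)
    (h : OneForm P m (x :: n) q w) :
    OneForm P (m ++ [x]) n q (⟨m, .cross x fixedStrand true, n⟩ :: w) := by
  obtain ⟨w', h1, h2⟩ := h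
  have t : Tg P (m ++ [x] ++ fixedStrand :: n) [⟨m, .cross x fixedStrand true, n⟩]
      (m ++ fixedStrand :: x :: n) :=
    ⟨by simp [Slice.dom, Gen.dom], ⟨.inl hx, hP _ rfl⟩, by simp [Slice.cod, Gen.cod, Tg]⟩
  have tw' : Tg P (fixedStrand :: (m ++ x :: n)) w' (fixedStrand :: q) := h2.tg
  have tA := Tg_loopAround hP (P := P) (a := [x]) (by simpa using hx)
  -- R2 read backwards inserts the overcrossing and its inverse; the inverse together with the given
  -- undercrossing is `loopAround [x]`.
  have r := ((TEq.r2 (P := P) (x := x) (y := fixedStrand) false (.inl hx) (hP _ rfl)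
    (hP _ rfl)).pad m n)
  have tJ := Tg_blockRight (P := P) hP false hm [x]
  have tJi := Tg_blockLeft (P := P) hP false hm [x]
  have tF := Tg_blockRight (P := P) hP false hm [fixedStrand]
  have e1 := TEq.compL t h1
  have te := e1.2.1
  simp at te
  have e2 := TEq.compR r.symm (by simpa using te)
  -- Leading `m` to the right under both `O` and `x` carries the clasp to the left end. The part of
  -- this passage under `x` remains as a conjugating word of moving strands.
  have hJ := TEq.blockRight_append (P := P) hP false hm [fixedStrand] [x]
  have nat := TEq.blockRight_word (P := P) hP false hm tA
  have g1 := TEq.compR hJ (tJi.padL [fixedStrand])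
  have g2 := TEq.compL (tF.padR [x])
    (by simpa using (TEq.blockRight_blockLeft hP false hm [x]).padL [fixedStrand])
  have g1' := TEq.compR nat (tJi.padL [fixedStrand])
  have g3 := TEq.compR hJ ((tA.padR m).append (tJi.padL [fixedStrand]))
  have g4 := TEq.compL (tA.padL m) (g1.trans (by simpa using g2))
  simp at g1' g3 g4
  have g5 := ((g4.symm.trans (g1'.trans g3))).padR n
  have tc : Tg P (m ++ x :: fixedStrand :: n) [⟨m, .cross x fixedStrand false, n⟩]
      (m ++ fixedStrand :: x :: n) :=
    ⟨by simp [Slice.dom, Gen.dom], ⟨.inl hx, hP _ rfl⟩, by simp [Slice.cod, Gen.cod, Tg]⟩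
  simp at g5
  have g6 := TEq.compL tc (TEq.compR g5 tw')
  refine ⟨wpad [fixedStrand] (blockRight false m [x]) n ++ (wpad [] (loopAround [x]) (m ++ n) ++
    (wpad [fixedStrand] (blockLeft false m [x]) n ++ w')), ?_, ?_⟩
  · simp [blockRight_singleton, loopAround, passRight, passLeft, passLeft_append] at e1 e2 g6 ⊢
    exact e1.trans (e2.trans g6)
  · have k1 := h2.cons (by simpa using tJi.padR n)
      ((MvW_blockLeft (o := false) (a := [x]) (b := m) (by simpa using hx) hm).pad (l := [])
        (r := n) (by simp) hn)
    have k2 := k1.clasp hP hx (by simp [hm, hn])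
    have k3 := k2.cons (by simpa using tJ.padR n)
      ((MvW_blockRight (o := false) (a := [x]) (b := m) (by simpa using hx) hm).pad (l := [])
        (r := n) (by simp) hn)
    simpa using k3

/-- A crossing of `O` is obtained by bending the other strand. -/
theorem TEq.cross_bend (hP : Full P) {x : S} (hx : colour x = Colour.moving) (o : Bool) :
    TEq P [fixedStrand, x] [x, fixedStrand] [⟨[], .cross fixedStrand x (!o), []⟩]
      [⟨[], .cup x, [fixedStrand, x]⟩, ⟨[x], .cross (rev x) fixedStrand o, [x]⟩,
        ⟨[x, fixedStrand], .cap (rev x), []⟩] := by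
  have hx' : colour (rev x) = Colour.moving := by rw [LawfulLabel.colour_rev, hx]
  have tcup0 : Tg P [] [⟨[], .cup x, []⟩] [x, rev x] := ⟨rfl, ⟨trivial, hP _ rfl⟩, rfl⟩
  have tcr : Tg P [fixedStrand, x] [⟨[], .cross fixedStrand x (!o), []⟩] [x, fixedStrand] :=
    ⟨rfl, ⟨.inr hx, hP _ rfl⟩, rfl⟩
  have s1 := (TEq.slideCap (P := P) (z := fixedStrand) (c := rev x) o (.inl hx') (hP _ rfl)
    (hP _ rfl) (hP _ rfl)).padL [x]
  have s2 := TEq.interchange tcup0 tcr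
  have z := (TEq.zigzagRight (P := P) hx (hP _ rfl) (hP _ rfl)).padR [fixedStrand]
  have tcup1 := tcup0.padR [fixedStrand, x]
  simp [LawfulLabel.rev_rev] at s1 s2 z tcup1
  have tcapF : Tg P [x, rev x, x, fixedStrand] [⟨[x], .cap (rev x), [fixedStrand]⟩]
      [x, fixedStrand] :=
    ⟨by simp [Slice.dom, Gen.dom, LawfulLabel.rev_rev], ⟨trivial, hP _ rfl⟩, rfl⟩
  have k1 := TEq.compL tcup1 s1
  have k2 := TEq.compR s2 tcapF
  have k3 := TEq.compL tcr z
  simp at k1 k2 k3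
  exact (k1.trans (k2.trans k3)).symm

/-- After bending `x`, the crossing becomes one in which `O` runs to the left under `rev x`. The
additional minimum and maximum lie beside `O` and are absorbed by the previous lemmas. -/
theorem OneForm.crossRight_under (hP : Full P) {m n q : List S} {x : S} {w : List (Slice S)}
    (hx : colour x = Colour.moving) (hm : Mv m) (hn : Mv n)
    (h : OneForm P (m ++ [x]) n q w) :
    OneForm P m (x :: n) q (⟨m, .cross fixedStrand x false, n⟩ :: w) := by
  have hx' : colour (rev x) = Colour.moving := by rw [LawfulLabel.colour_rev, hx]
  have tcap : Tg P (rev x :: x :: n) [⟨[], .cap (rev x), n⟩] n :=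
    ⟨by simp [Slice.dom, Gen.dom, LawfulLabel.rev_rev], ⟨trivial, hP _ rfl⟩, rfl⟩
  have tcup : Tg P m [⟨m, .cup x, []⟩] (m ++ [x, rev x]) :=
    ⟨by simp [Slice.dom, Gen.dom], ⟨trivial, hP _ rfl⟩, by simp [Tg, Slice.cod, Gen.cod]⟩
  have h1 := OneForm.right hP (by simp [hm, hx]) h tcap
    (by simp [Slice.dom, Slice.cod, Gen.dom, Gen.cod, LawfulLabel.colour_rev, hx, hn])
  have h2 := OneForm.crossLeft_under hP hx' (by simp [hm, hx]) (by simp [hx, hn]) h1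
  have h3 := OneForm.left hP hm (n := x :: n) (by simp [hx, hn]) (m' := m ++ [x, rev x]) (by simpa using h2) tcup
    (by simp [Slice.dom, Slice.cod, Gen.dom, Gen.cod, LawfulLabel.colour_rev, hx, hm])
  refine h3.congr ?_
  have tw : Tg P (m ++ x :: fixedStrand :: n) w (fixedStrand :: q) := by
    obtain ⟨w', h, -⟩ := h; simpa using h.1
  have k := (TEq.cross_bend hP hx true).pad m n
  have kk := TEq.compR k (by simpa using tw)
  simpa using kk

end OneStrand


/-! ### Bringing `O` into the position of a ring -/

section RingNormalForm

variable {S : Type} [StrandLabel S] {P : Gen S → Prop} [LawfulLabel S]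

open StrandLabel

theorem Gen.mv_cod {g : Gen S} (hd : Mv g.dom) (hg : g.isFixedCup = false) : Mv g.cod := by
  cases g with
  | cup x =>
    simp only [Gen.isFixedCup, decide_eq_false_iff_not] at hg
    have : colour x = Colour.moving := by cases h : colour x <;> simp_all
    simp [Gen.cod, this, LawfulLabel.colour_rev]
  | cap x => simp [Gen.cod]
  | cross x y o => simp [Gen.dom, Gen.cod] at *; tauto
  | pre x y m => simp [Gen.dom, Gen.cod] at *; tauto

theorem colour_fixed_iff {x : S} : colour x = Colour.fixed ↔ x = fixedStrand :=
  ⟨LawfulLabel.eq_fixed x, fun h => h ▸ colour_fixedStrand⟩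

/-- The position of a slice with respect to the leftmost strand of `O`. -/
theorem Slice.cases_fixed {l rest : List S} {s : Slice S} (hv : s.gen.Valid)
    (h : l ++ fixedStrand :: rest = s.dom) (hl : Mv l) :
    (∃ r', s.right = r' ++ fixedStrand :: rest ∧ l = s.left ++ s.gen.dom ++ r') ∨
    (∃ l', s.left = l ++ fixedStrand :: l' ∧ rest = l' ++ s.gen.dom ++ s.right) ∨
    (∃ x o, s = ⟨l, .cross fixedStrand x o, s.right⟩ ∧ rest = x :: s.right ∧
      colour x = Colour.moving) ∨
    (∃ x o, s = ⟨s.left, .cross x fixedStrand o, rest⟩ ∧ l = s.left ++ [x] ∧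
      colour x = Colour.moving) ∨
    (s = ⟨l, .cap fixedStrand, s.right⟩ ∧ rest = fixedStrand :: s.right) := by
  obtain ⟨left, g, right⟩ := s
  simp only [Slice.dom, List.append_assoc] at h
  -- Treats the cases in which the leftmost strand of `O` is not among the strands left of the
  -- piece; `c'` lists the strands between those strands and `O`. What remains afterwards is `O`
  -- lying strictly left of the piece.
  have key : ∀ c', l = left ++ c' → g.dom ++ right = c' ++ fixedStrand :: rest →
    (∃ r', right = r' ++ fixedStrand :: rest ∧ l = left ++ g.dom ++ r') ∨
    (∃ x o, g = .cross fixedStrand x o ∧ left = l ∧ rest = x :: right ∧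
      colour x = Colour.moving) ∨
    (∃ x o, g = .cross x fixedStrand o ∧ right = rest ∧ l = left ++ [x] ∧
      colour x = Colour.moving) ∨
    (g = .cap fixedStrand ∧ left = l ∧ rest = fixedStrand :: right) := by
    rintro c' rfl h'
    have two : ∀ p q, g.dom = [p, q] →
        (∃ r', right = r' ++ fixedStrand :: rest ∧ left ++ c' = left ++ g.dom ++ r') ∨
        (c' = [] ∧ p = fixedStrand ∧ rest = q :: right) ∨
        (c' = [p] ∧ q = fixedStrand ∧ right = rest) := by
      intro p q hd
      rw [hd] at h'
      match c', h' with
      | [], h' => simp at h'; exact .inr (.inl ⟨rfl, h'.1, h'.2.symm⟩)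
      | [y], h' => simp at h'; exact .inr (.inr ⟨by rw [h'.1], h'.2.1, h'.2.2⟩)
      | y :: z :: c'', h' =>
        simp at h'
        exact .inl ⟨c'', h'.2.2, by simp [hd, h'.1, h'.2.1]⟩
    have mvF : ¬ colour (fixedStrand : S) = Colour.moving := by simp [colour_fixedStrand]
    cases g with
    | cup x => exact .inl ⟨c', by simpa [Gen.dom] using h', by simp [Gen.dom]⟩
    | cap x =>
      rcases two _ _ rfl with h | ⟨rfl, rfl, h⟩ | ⟨rfl, hx, -⟩
      · exact .inl h
      · exact .inr (.inr (.inr ⟨rfl, by simp, by rw [h, rev_fixedStrand]⟩))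
      · exfalso
        have : colour x = Colour.moving := by simp at hl; exact hl.2
        rw [← LawfulLabel.colour_rev, hx] at this
        exact mvF this
    | cross x y o =>
      rcases two _ _ rfl with h | ⟨rfl, rfl, h3⟩ | ⟨rfl, rfl, h3⟩
      · exact .inl h
      · exact .inr (.inl ⟨y, o, rfl, by simp, h3, hv.resolve_left mvF⟩)
      · exact .inr (.inr (.inl ⟨x, o, rfl, h3, rfl, hv.resolve_right mvF⟩))
    | pre x y m =>
      rcases two _ _ rfl with h | ⟨rfl, rfl, h⟩ | ⟨rfl, rfl, h⟩
      · exact .inl h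
      · exact absurd hv.1 mvF
      · exact absurd hv.2.1 mvF
  rcases List.append_eq_append_iff.1 h with ⟨c', h1, h2⟩ | ⟨c', h1, h2⟩
  · cases c' with
    | nil =>
      rcases key [] (by simpa using h1.symm) (by simpa using h2.symm) with h | h | h | h
      · exact .inl h
      · obtain ⟨x, o, rfl, rfl, h3⟩ := h; exact .inr (.inr (.inl ⟨x, o, rfl, h3⟩))
      · obtain ⟨x, o, rfl, rfl, h3⟩ := h; exact .inr (.inr (.inr (.inl ⟨x, o, rfl, h3⟩)))
      · obtain ⟨rfl, rfl, h3⟩ := h; exact .inr (.inr (.inr (.inr ⟨rfl, h3⟩)))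
    | cons y c' =>
      simp at h2
      exact .inr (.inl ⟨c', by simp [h1, h2.1], by simp [h2.2]⟩)
  · rcases key c' h1 h2 with h | h | h | h
    · exact .inl h
    · obtain ⟨x, o, rfl, rfl, h3⟩ := h; exact .inr (.inr (.inl ⟨x, o, rfl, h3⟩))
    · obtain ⟨x, o, rfl, rfl, h3⟩ := h; exact .inr (.inr (.inr (.inl ⟨x, o, rfl, h3⟩)))
    · obtain ⟨rfl, rfl, h3⟩ := h; exact .inr (.inr (.inr (.inr ⟨rfl, h3⟩)))

theorem fixedCups_cons_eq_zero {s : Slice S} {w : List (Slice S)} :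
    fixedCups (s :: w) = 0 ↔ s.gen.isFixedCup = false ∧ fixedCups w = 0 := by
  cases h : s.gen.isFixedCup <;> simp [h]

/-- Induction from the top slice downwards: each slice is absorbed by one of the preceding lemmas.
Without minima of `O`, and with all other bottom strands moving, no second strand of `O` can occur.
-/
theorem OneForm.of_tangle (hP : Full P) {m n q : List S} {w : List (Slice S)} (hm : Mv m)
    (hn : Mv n) (hw : Tg P (m ++ fixedStrand :: n) w (fixedStrand :: q)) (hc : fixedCups w = 0) :
    OneForm P m n q w := by
  induction w generalizing m n with
  | nil =>
    cases m with
    | nil => have : n = q := by simpa [Tg] using hw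
             subst this; exact .nil hn
    | cons x m =>
      have : x = fixedStrand := by simp [Tg] at hw; exact hw.1
      simp [this, colour_fixedStrand] at hm
  | cons s w ih =>
    obtain ⟨hd, hs, hw⟩ := hw
    rw [fixedCups_cons_eq_zero] at hc
    obtain ⟨hsc, hc⟩ := hc
    rcases s.cases_fixed hs.1 hd hm with ⟨r', h1, rfl⟩ | ⟨l', h1, rfl⟩ | ⟨x, o, h1, rfl, hx⟩ |
      ⟨x, o, h1, rfl, hx⟩ | ⟨h1, rfl⟩
    · obtain ⟨l, g, r⟩ := s
      simp only at h1 hm hsc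
      subst h1
      have hg : Mv g.cod := Gen.mv_cod (by simp at hm; tauto) hsc
      have tx : Tg P (l ++ g.dom ++ r') [⟨l, g, r'⟩] (l ++ g.cod ++ r') := ⟨rfl, hs, rfl⟩
      have := OneForm.left hP hm hn (ih (m := l ++ g.cod ++ r') (by simp at hm ⊢; tauto) hn
        (by simpa [Slice.cod] using hw) hc) tx (by simp [Slice.dom, Slice.cod, hg] at hm ⊢; tauto)
      simpa using this
    · obtain ⟨l, g, r⟩ := s
      simp only at h1 hn hsc
      subst h1
      have hg : Mv g.cod := Gen.mv_cod (by simp at hn; tauto) hsc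
      have tx : Tg P (l' ++ g.dom ++ r) [⟨l', g, r⟩] (l' ++ g.cod ++ r) := ⟨rfl, hs, rfl⟩
      have := OneForm.right hP hm (ih (n := l' ++ g.cod ++ r) hm (by simp at hn ⊢; tauto)
        (by simpa [Slice.cod] using hw) hc) tx (by simp [Slice.dom, Slice.cod, hg] at hn ⊢; tauto)
      simpa using this
    · rw [h1]
      have ihw := ih (m := m ++ [x]) (n := s.right) (by simp [hm, hx]) (by simp at hn; tauto)
        (by rw [h1] at hw; simpa [Slice.cod, Gen.cod] using hw) hc
      cases o with
      | true => exact .crossRight_over hP hx hm ihw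
      | false => exact .crossRight_under hP hx hm (by simp at hn; tauto) ihw
    · rw [h1]
      have ihw := ih (m := s.left) (n := x :: n) (by simp at hm; tauto) (by simp [hn, hx])
        (by rw [h1] at hw; simpa [Slice.cod, Gen.cod] using hw) hc
      cases o with
      | true => exact .crossLeft_under hP hx (by simp at hm; tauto) hn ihw
      | false => exact .crossLeft_over hP hx ihw
    · simp [colour_fixedStrand] at hn

/-- The left strand of `O` is straightened. -/
def LeftForm (P : Gen S → Prop) (l rest : List S) (w : List (Slice S)) : Prop :=
  ∃ (p : List S) (u y : List (Slice S)), Mv p ∧ Mv l ∧ Tg P [] u (l ++ p) ∧ MvW u ∧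
    Tg P (fixedStrand :: p) y rest ∧ fixedCups y = 0 ∧
    TEq P [] (l ++ fixedStrand :: rest) w
      (u ++ ⟨l, .cup fixedStrand, p⟩ :: wpad (l ++ [fixedStrand]) y [])

theorem Tg_cup_fixed (hP : Full P) (l r : List S) :
    Tg P (l ++ r) [⟨l, .cup fixedStrand, r⟩] (l ++ fixedStrand :: fixedStrand :: r) :=
  ⟨by simp [Slice.dom, Gen.dom], ⟨trivial, hP _ rfl⟩,
    by simp [Slice.cod, Gen.cod, Tg, rev_fixedStrand]⟩

theorem Tg_cap_fixed (hP : Full P) (l r : List S) :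
    Tg P (l ++ fixedStrand :: fixedStrand :: r) [⟨l, .cap fixedStrand, r⟩] (l ++ r) :=
  ⟨by simp [Slice.dom, Gen.dom, rev_fixedStrand], ⟨trivial, hP _ rfl⟩,
    by simp [Slice.cod, Gen.cod, Tg]⟩

theorem LeftForm.congr {l rest : List S} {w w' : List (Slice S)} (h : LeftForm P l rest w)
    (e : TEq P [] (l ++ fixedStrand :: rest) w' w) : LeftForm P l rest w' := by
  obtain ⟨p, u, y, hp, hl, hu, hu', hy, hc, h⟩ := h
  exact ⟨p, u, y, hp, hl, hu, hu', hy, hc, e.trans h⟩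

/-- What lies left of the straight strand commutes with the minimum of `O` and with everything right
of that strand, so it can be moved into `u`. -/
theorem LeftForm.left (hP : Full P) {l l' rest : List S} {w x : List (Slice S)}
    (h : LeftForm P l rest w) (hx : Tg P l x l') (hx' : MvW x) :
    LeftForm P l' rest (w ++ wpad [] x (fixedStrand :: rest)) := by
  obtain ⟨p, u, y, hp, hl, hu, hu', hy, hc, h⟩ := h
  have tz : Tg P p (⟨[], .cup fixedStrand, p⟩ :: wpad [fixedStrand] y []) (fixedStrand :: rest) :=
    (Tg_cup_fixed hP [] p).append (hy.padL [fixedStrand])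
  refine ⟨p, u ++ wpad [] x p, y, hp, hx.mv_cod hl hx', hu.append (hx.padR p),
    by simp [hu', hx'.pad (l := []) (r := p) (by simp) hp], hy, hc, ?_⟩
  have e1 := TEq.compR h (by simpa using hx.padR (fixedStrand :: rest))
  have e2 := TEq.compL hu (TEq.interchange hx tz).symm
  simp at e1 e2
  simpa using e1.trans e2

theorem LeftForm.right {l rest rest' : List S} {w x : List (Slice S)}
    (h : LeftForm P l rest w) (hx : Tg P rest x rest') (hx' : fixedCups x = 0) :
    LeftForm P l rest' (w ++ wpad (l ++ [fixedStrand]) x []) := by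
  obtain ⟨p, u, y, hp, hl, hu, hu', hy, hc, h⟩ := h
  refine ⟨p, u, y ++ x, hp, hl, hu, hu', hy.append hx, by simp [hc, hx'], ?_⟩
  have t : Tg P (l ++ fixedStrand :: rest) (wpad (l ++ [fixedStrand]) x [])
      (l ++ fixedStrand :: rest') := by
    have t := hx.padL (l ++ [fixedStrand])
    rw [List.append_assoc, List.append_assoc] at t
    exact t
  simpa using TEq.compR h t

/-- The crossing is pushed down along the straight strand and around the minimum of `O`, after which
it is a crossing of the other strand of `O` at the bottom of `y`. -/
theorem LeftForm.crossRight (hP : Full P) {l rest : List S} {w : List (Slice S)} {x : S}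
    (h : LeftForm P (l ++ [x]) rest w) (hx : colour x = Colour.moving) (o : Bool) :
    LeftForm P l (x :: rest) (w ++ [⟨l, .cross x fixedStrand o, rest⟩]) := by
  obtain ⟨p, u, y, hp, hl, hu, hu', hy, hc, h⟩ := h
  have tcr : Tg P [x, fixedStrand] [⟨[], .cross x fixedStrand o, []⟩] [fixedStrand, x] :=
    ⟨rfl, ⟨.inl hx, hP _ rfl⟩, rfl⟩
  have tcr' : Tg P [fixedStrand, x] [⟨[], .cross fixedStrand x (!o), []⟩] [x, fixedStrand] :=
    ⟨rfl, ⟨.inr hx, hP _ rfl⟩, rfl⟩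
  have e0 := (TEq.interchange tcr hy).symm.padL l
  have e1 := TEq.compR h (by simpa using tcr.pad l rest)
  have t := hu.append (Tg_cup_fixed (P := P) hP (l ++ [x]) p)
  have e2 := TEq.compL t (by simpa using e0)
  have e3 := (TEq.slideCup (P := P) (z := x) (c := fixedStrand) o (.inr hx) (hP _ rfl)
    (hP _ rfl) (hP _ rfl)).pad l p
  have ty := hy.padL (l ++ [fixedStrand, x])
  simp [rev_fixedStrand] at e3
  have e4 := TEq.compL (by simpa using hu) (TEq.compR e3 (by simpa using ty))
  refine ⟨x :: p, u, ⟨[], .cross fixedStrand x (!o), p⟩ :: wpad [x] y [], by simp [hp, hx],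
    by simp at hl; tauto, by simpa using hu, hu', ?_, by simp [hc, Gen.isFixedCup], ?_⟩
  · exact Tg.append (by simpa using tcr'.padR p) (hy.padL [x])
  · simp at e1 e2 e4
    simpa using e1.trans (e2.trans e4)

/-- Bending `x` reduces this to `LeftForm.crossRight`: the bend puts its minimum to the left and its
maximum to the right of `O`. -/
theorem LeftForm.crossLeft (hP : Full P) {l rest : List S} {w : List (Slice S)} {x : S}
    (h : LeftForm P l (x :: rest) w) (hx : colour x = Colour.moving) (o : Bool) :
    LeftForm P (l ++ [x]) rest (w ++ [⟨l, .cross fixedStrand x o, rest⟩]) := by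
  have hx' : colour (rev x) = Colour.moving := by rw [LawfulLabel.colour_rev, hx]
  have hl : Mv l := by obtain ⟨p, u, y, hp, hl, -⟩ := h; exact hl
  have tw : Tg P [] w (l ++ fixedStrand :: x :: rest) := by
    obtain ⟨p, u, y, -, -, -, -, -, -, h⟩ := h; exact h.1
  have tcup : Tg P l [⟨l, .cup x, []⟩] (l ++ [x] ++ [rev x]) :=
    ⟨by simp [Slice.dom, Gen.dom], ⟨trivial, hP _ rfl⟩, by simp [Tg, Slice.cod, Gen.cod]⟩
  have tcap : Tg P (rev x :: x :: rest) [⟨[], .cap (rev x), rest⟩] rest :=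
    ⟨by simp [Slice.dom, Gen.dom, LawfulLabel.rev_rev], ⟨trivial, hP _ rfl⟩, rfl⟩
  have h1 := h.left hP tcup (by simp [Slice.dom, Slice.cod, Gen.dom, Gen.cod, hl, hx, hx'])
  have h2 := (h1.crossRight hP hx' (!o)).right tcap (by simp [Gen.isFixedCup])
  refine h2.congr ?_
  have k := TEq.compL tw (by simpa using (TEq.cross_bend (P := P) hP hx (!o)).pad l rest)
  simpa using k

theorem MvW.of_tangle {a b : List S} {w : List (Slice S)} (hw : Tg P a w b) (ha : Mv a)
    (hc : fixedCups w = 0) : MvW w := by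
  induction w generalizing a with
  | nil => simp
  | cons s w ih =>
    obtain ⟨rfl, hs, hw⟩ := hw
    rw [fixedCups_cons_eq_zero] at hc
    have h1 : Mv s.cod := by
      have := Gen.mv_cod (g := s.gen) (by simp [Slice.dom] at ha; tauto) hc.1
      simp [Slice.dom, Slice.cod, this] at ha ⊢; tauto
    simp only [MvW_cons]
    exact ⟨⟨ha, h1⟩, ih hw h1 hc.2⟩

/-- The number of strands of `O`. -/
def fixedCount (a : List S) : ℕ := a.countP fun x => decide (colour x = Colour.fixed)

@[simp] theorem fixedCount_append (a b : List S) :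
    fixedCount (a ++ b) = fixedCount a + fixedCount b := by simp [fixedCount]

theorem fixedCount_eq_zero {a : List S} : fixedCount a = 0 ↔ Mv a := by
  simp only [fixedCount, List.countP_eq_zero, Mv, decide_eq_true_eq]
  refine forall₂_congr fun x _ => ?_
  cases colour x <;> simp

theorem Gen.fixedCount_cod (g : Gen S) :
    fixedCount g.cod ≤ fixedCount g.dom + if g.isFixedCup then 2 else 0 := by
  cases g with
  | cup x => by_cases h : colour x = Colour.fixed <;>
      simp [fixedCount, Gen.cod, Gen.dom, Gen.isFixedCup, LawfulLabel.colour_rev, h]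
  | cap x => simp [fixedCount, Gen.cod]
  | cross x y o => simp [fixedCount, Gen.cod, Gen.dom, List.countP_cons]; omega
  | pre x y m => simp [fixedCount, Gen.cod, Gen.dom, List.countP_cons]; omega

theorem Tg.fixedCount_le {a b : List S} {w : List (Slice S)} (hw : Tg P a w b) :
    fixedCount b ≤ fixedCount a + 2 * fixedCups w := by
  induction w generalizing a with
  | nil => cases hw; simp
  | cons s w ih =>
    obtain ⟨rfl, hs, hw⟩ := hw
    have h1 := ih hw
    have h2 := s.gen.fixedCount_cod
    simp only [Slice.dom, Slice.cod, fixedCount_append, fixedCups_cons] at *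
    split_ifs at * <;> omega

/-- The left strand is followed upwards and straightened slice by slice until it ends in the maximum
of `O`. -/
theorem LeftForm.close (hP : Full P) {l rest : List S} {w w' : List (Slice S)}
    (h : LeftForm P l rest w) (hw' : Tg P (l ++ fixedStrand :: rest) w' []) (hc : fixedCups w' = 0) :
    ∃ (l n : List S) (w₀ v : List (Slice S)), LeftForm P l (fixedStrand :: n) w₀ ∧ Mv n ∧
      Tg P (l ++ n) v [] ∧ MvW v ∧ w ++ w' = w₀ ++ ⟨l, .cap fixedStrand, n⟩ :: v := by
  induction w' generalizing l rest w with
  | nil => simp [Tg] at hw'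
  | cons s w' ih =>
    obtain ⟨hd, hs, hw'⟩ := hw'
    rw [fixedCups_cons_eq_zero] at hc
    obtain ⟨hsc, hc⟩ := hc
    have hl : Mv l := by obtain ⟨p, u, y, hp, hl, -⟩ := h; exact hl
    rcases s.cases_fixed hs.1 hd hl with ⟨r', h1, rfl⟩ | ⟨l', h1, rfl⟩ | ⟨x, o, h1, rfl, hx⟩ |
      ⟨x, o, h1, rfl, hx⟩ | ⟨h1, rfl⟩
    · obtain ⟨l, g, r⟩ := s
      simp only at h1 hl hsc
      subst h1
      have hg : Mv g.cod := Gen.mv_cod (by simp at hl; tauto) hsc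
      have tx : Tg P (l ++ g.dom ++ r') [⟨l, g, r'⟩] (l ++ g.cod ++ r') := ⟨rfl, hs, rfl⟩
      have := ih (h.left hP tx (by simp [Slice.dom, Slice.cod, hg] at hl ⊢; tauto))
        (by simpa [Slice.cod] using hw') hc
      simpa using this
    · obtain ⟨l, g, r⟩ := s
      simp only at h1 hsc
      subst h1
      have tx : Tg P (l' ++ g.dom ++ r) [⟨l', g, r⟩] (l' ++ g.cod ++ r) := ⟨rfl, hs, rfl⟩
      have := ih (h.right tx (by simpa using hsc)) (by simpa [Slice.cod] using hw') hc
      simpa using this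
    · have := ih (h.crossLeft hP hx o) (by rw [h1] at hw'; simpa [Slice.cod, Gen.cod] using hw') hc
      rw [h1]; simpa using this
    · have := ih (h.crossRight hP hx o) (by rw [h1] at hw'; simpa [Slice.cod, Gen.cod] using hw') hc
      rw [h1]; simpa using this
    -- Counting: `y` starts with one strand of `O` and has no minimum of `O`, so the strand closed
    -- by this maximum is the only one left.
    · have hn : Mv s.right := by
        obtain ⟨p, u, y, hp, -, -, -, hy, hcy, -⟩ := h
        have := hy.fixedCount_le
        rw [← fixedCount_eq_zero] at hp ⊢
        rw [← List.singleton_append, fixedCount_append,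
          ← List.singleton_append (l := p), fixedCount_append] at this
        omega
      rw [h1] at hw'
      have hv : Tg P (l ++ s.right) w' [] := by simpa [Slice.cod, Gen.cod] using hw'
      exact ⟨l, s.right, w, w', h, hn, hv, .of_tangle hv (by simp [hl, hn]) hc, by rw [← h1]⟩

theorem exists_fixedCup {a : List S} {w : List (Slice S)} (hw : Tg P a w []) (ha : Mv a)
    (hc : fixedCups w = 1) : ∃ l r u v, w = u ++ ⟨l, .cup fixedStrand, r⟩ :: v ∧ MvW u ∧
      Tg P a u (l ++ r) ∧ Tg P (l ++ fixedStrand :: fixedStrand :: r) v [] ∧ fixedCups v = 0 := by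
  induction w generalizing a with
  | nil => simp at hc
  | cons s w ih =>
    obtain ⟨rfl, hs, hw⟩ := hw
    cases hsc : s.gen.isFixedCup with
    | true =>
      obtain ⟨l, g, r⟩ := s
      cases g with
      | cup x =>
        simp only [Gen.isFixedCup, decide_eq_true_eq, colour_fixed_iff] at hsc
        subst hsc
        refine ⟨l, r, [], w, rfl, by simp, by simp [Tg, Slice.dom, Gen.dom], ?_, ?_⟩
        · simpa [Slice.cod, Gen.cod, rev_fixedStrand] using hw
        · simpa [Gen.isFixedCup, colour_fixedStrand] using hc
      | _ => simp [Gen.isFixedCup] at hsc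
    | false =>
      have h1 : Mv s.cod := by
        have := Gen.mv_cod (g := s.gen) (by simp [Slice.dom] at ha; tauto) hsc
        simp [Slice.dom, Slice.cod, this] at ha ⊢; tauto
      obtain ⟨l, r, u, v, rfl, h2, h3, h4, h5⟩ := ih hw h1 (by simpa [hsc] using hc)
      exact ⟨l, r, s :: u, v, rfl, by simp [ha, h1, h2], ⟨rfl, hs, h3⟩, h4, h5⟩

/-- `O` encircles the strands `a` once. -/
def encircle (a : List S) : List (Slice S) :=
  ⟨[], .cup fixedStrand, a⟩ :: wpad [fixedStrand] (loopAround a) [] ++ [⟨[], .cap fixedStrand, a⟩]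

theorem Tg_encircle (hP : Full P) {a : List S} (ha : Mv a) : Tg P a (encircle a) a := by
  have h1 := (Tg_cup_fixed (P := P) hP [] a).append ((Tg_loopAround hP ha).padL [fixedStrand])
  simpa [encircle] using h1.append (Tg_cap_fixed (P := P) hP [] a)

/-- `O` is brought into the position of a ring at the left end of one level. -/
theorem exists_encircle (hP : Full P) {w : List (Slice S)} (hw : Tg P [] w [])
    (hc : fixedCups w = 1) : ∃ (a r : List S) (u v : List (Slice S)), Mv a ∧ Mv r ∧
      Tg P [] u (a ++ r) ∧ MvW u ∧ Tg P (a ++ r) v [] ∧ MvW v ∧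
      TEq P [] [] w (u ++ wpad [] (encircle a) r ++ v) := by
  obtain ⟨l, r, u, v, rfl, hu, hu', hv, hv'⟩ := exists_fixedCup hw (by simp) hc
  have hlr : Mv (l ++ r) := hu'.mv_cod (by simp) hu
  have hlr' : Mv l ∧ Mv r := by simpa using hlr
  have h0 : LeftForm P l (fixedStrand :: r) (u ++ [⟨l, .cup fixedStrand, r⟩]) :=
    ⟨r, u, [], hlr'.2, hlr'.1, hu', hu, rfl, rfl,
      by simpa using TEq.refl (hu'.append (Tg_cup_fixed hP l r))⟩
  obtain ⟨l, n, w₀, v, h1, hn, hv, hvm, e⟩ := h0.close hP hv hv'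
  rw [List.append_assoc, List.singleton_append] at e
  rw [e] at hw ⊢
  clear h0 hv' hlr hlr' hu hu' hc e
  obtain ⟨p, u, y, hp, hl, hu, hu', hy, hcy, h⟩ := h1
  -- To the right of the straight strand there is a single strand of `O`, already in the leftmost
  -- position there, so nothing has to be pulled.
  obtain ⟨w', h2, h3⟩ := OneForm.of_tangle hP (m := []) (by simp) hp hy hcy
  obtain ⟨a, r, u1, v1, ha, hr, hu1, hu1', hv1, hv1', h3⟩ := h3
  simp [passLeft] at h2
  have h4 := (h2.trans h3).padL (l ++ [fixedStrand])
  have tcup0 := Tg_cup_fixed (P := P) hP [] []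
  have tcap0 := Tg_cap_fixed (P := P) hP [] []
  have tcup := Tg_cup_fixed (P := P) hP l p
  have tcap := Tg_cap_fixed (P := P) hP l n
  simp at h4
  have e1 := TEq.compR h (tcap.append hv)
  have e2 := TEq.compL (hu.append tcup) (TEq.compR h4 (by simpa using tcap.append hv))
  -- The moving word below the loop is slid below the minimum of `O`, and the one above the loop is
  -- slid above the maximum.
  have e3 := (TEq.interchange tcup0 hu1).padL l
  have e4 := (TEq.interchange tcap0 hv1).symm.padL l
  have tL := (Tg_loopAround hP ha).pad (l ++ [fixedStrand]) r
  have tv1 := hv1.padL (l ++ [fixedStrand, fixedStrand])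
  have tu1 := hu1.padL l
  have tcupr := Tg_cup_fixed (P := P) hP l (a ++ r)
  simp at tL tv1 e3 e4 tcup tcap tu1 tcupr
  have e5 := TEq.compL hu (TEq.compR e3 (tL.append (tv1.append (tcap.append hv))))
  have e6 := TEq.compL (hu.append (tu1.append (tcupr.append tL))) (TEq.compR e4 hv)
  -- A closed annular word has its ring at the left end; the strands `l` are therefore led under the
  -- ring to its right side and back afterwards.
  have nat := TEq.blockRight_word hP false hl (Tg_encircle hP ha)
  have tQ := Tg_blockRight (P := P) hP false hl a
  have tQi := Tg_blockLeft (P := P) hP false hl a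
  have n1 := TEq.compR nat tQi
  have n2 := TEq.compL ((Tg_encircle hP ha).padL l) (TEq.blockRight_blockLeft hP false hl a)
  have n3 := ((by simpa using n2.symm : TEq P _ _ _ _).trans (by simpa using n1)).padR r
  have e7 := TEq.compL (hu.append tu1) (TEq.compR (by simpa using n3) ((hv1.padL l).append hv))
  refine ⟨a, l ++ r, u ++ (wpad l u1 [] ++ wpad [] (blockRight false l a) r),
    wpad [] (blockLeft false l a) r ++ (wpad l v1 [] ++ v), ha, by simp [hl, hr], ?_, ?_, ?_, ?_, ?_⟩
  · exact hu.append (tu1.append (by simpa using tQ.padR r))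
  · simp only [MvW_append]
    exact ⟨hu', hu1'.pad hl (by simp), (MvW_blockRight ha hl).pad (by simp) hr⟩
  · exact Tg.append (by simpa using tQi.padR r) ((hv1.padL l).append hv)
  · simp only [MvW_append]
    exact ⟨(MvW_blockLeft ha hl).pad (by simp) hr, hv1'.pad hl (by simp), hvm⟩
  · simp [encircle] at e1 e2 e5 e6 e7 ⊢
    exact e1.trans (e2.trans (e5.trans (e6.trans e7)))

end RingNormalForm


/-! ### Unrolling a diagram around the annulus -/

section Closing

variable {S : Type} [StrandLabel S] {P : Gen S → Prop}

open StrandLabel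

theorem nestedCups_eq_wpad (l r a : List S) :
    nestedCups l r a = wpad l (nestedCups [] [] a) r := by
  induction a generalizing l r with
  | nil => rfl
  | cons x a ih =>
    simp only [nestedCups, wpad_cons]
    rw [ih, ih ([] ++ [x])]
    simp

theorem nestedCaps_eq_wpad (l r a : List S) :
    nestedCaps l r a = wpad l (nestedCaps [] [] a) r := by
  induction a generalizing l r with
  | nil => rfl
  | cons x a ih =>
    simp only [nestedCaps, wpad_append, wpad_cons]
    rw [ih, ih ([] ++ [x])]
    simp

theorem arcOver_eq_wpad (l r a : List S) :
    arcOver l r a = wpad l (passRight fixedStrand true a) r := by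
  induction a generalizing l with
  | nil => rfl
  | cons x a ih => simp [arcOver, passRight, ih]

theorem arcUnder_eq_wpad (l r a : List S) :
    arcUnder l r a = wpad l (passLeft fixedStrand false a) r := by
  induction a generalizing l with
  | nil => rfl
  | cons x a ih => simp [arcUnder, passLeft, ih]

theorem ring_eq_wpad (a r : List S) : ring a r = wpad [] (encircle a) r := by
  simp [ring, encircle, loopAround, arcOver_eq_wpad, arcUnder_eq_wpad]

@[simp] theorem bar_nil : bar ([] : List S) = [] := rfl

@[simp] theorem bar_cons (x : S) (a : List S) : bar (x :: a) = bar a ++ [rev x] := by simp [bar]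

@[simp] theorem bar_append (a b : List S) : bar (a ++ b) = bar b ++ bar a := by simp [bar]

theorem nestedCups_append (l r a b : List S) :
    nestedCups l r (a ++ b) = nestedCups l r a ++ nestedCups (l ++ a) (bar a ++ r) b := by
  induction a generalizing l r with
  | nil => simp [nestedCups]
  | cons x a ih => simp [nestedCups, ih]

theorem nestedCaps_append (l r a b : List S) :
    nestedCaps l r (a ++ b) = nestedCaps (l ++ a) (bar a ++ r) b ++ nestedCaps l r a := by
  induction a generalizing l r with
  | nil => simp [nestedCaps]
  | cons x a ih => simp [nestedCaps, ih]

theorem isPre_nestedCups (l r a : List S) : ∀ s ∈ nestedCups l r a, ∃ x, s.gen = .cup x := by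
  induction a generalizing l r with
  | nil => simp [nestedCups]
  | cons x a ih =>
    intro s hs
    rcases List.mem_cons.1 hs with rfl | hs
    · exact ⟨x, rfl⟩
    · exact ih _ _ s hs

theorem isPre_nestedCaps (l r a : List S) : ∀ s ∈ nestedCaps l r a, ∃ x, s.gen = .cap x := by
  induction a generalizing l r with
  | nil => simp [nestedCaps]
  | cons x a ih =>
    intro s hs
    rcases List.mem_append.1 hs with hs | hs
    · exact ih _ _ s hs
    · simp at hs; exact ⟨x, by rw [hs]⟩

/-- The class `P` contains all minima and maxima. -/
def Bends (P : Gen S → Prop) : Prop := ∀ x, P (.cup x) ∧ P (.cap x)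

theorem Full.bends (hP : Full P) : Bends P := fun _ => ⟨hP _ rfl, hP _ rfl⟩

theorem Tg_nestedCups (hP : Bends P) (a : List S) :
    Tg P [] (nestedCups [] [] a) (a ++ bar a) := by
  refine .of_isTangle (by simpa using isTangle_nestedCups [] [] a) fun s hs => ?_
  obtain ⟨x, hx⟩ := isPre_nestedCups _ _ _ s hs
  exact hx ▸ (hP x).1

theorem Tg_nestedCaps (hP : Bends P) (a : List S) :
    Tg P (a ++ bar a) (nestedCaps [] [] a) [] := by
  refine .of_isTangle (by simpa using isTangle_nestedCaps [] [] a) fun s hs => ?_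
  obtain ⟨x, hx⟩ := isPre_nestedCaps _ _ _ s hs
  exact hx ▸ (hP x).2

/-- A diagram contains a point of the moving part. -/
def HasMoving (w : List (Slice S)) : Prop := ∃ s ∈ w, ∃ x ∈ s.cod, colour x = Colour.moving

variable [LawfulLabel S]

theorem bar_bar (a : List S) : bar (bar a) = a := by
  induction a with
  | nil => rfl
  | cons x a ih => simp [ih, LawfulLabel.rev_rev]

theorem Mv.bar {a : List S} (h : Mv a) : Mv (bar a) := by
  induction a with
  | nil => simp
  | cons x a ih => simp at h; simp [ih h.2, LawfulLabel.colour_rev, h.1]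

theorem MvW_nestedCups {l r a : List S} (hl : Mv l) (hr : Mv r) (ha : Mv a) :
    MvW (nestedCups l r a) := by
  induction a generalizing l r with
  | nil => simp [nestedCups]
  | cons x a ih =>
    simp at ha
    simp only [nestedCups, MvW_cons]
    exact ⟨by simp [Slice.dom, Slice.cod, Gen.dom, Gen.cod, LawfulLabel.colour_rev, *],
      ih (by simp [*]) (by simp [LawfulLabel.colour_rev, *]) ha.2⟩

theorem MvW_nestedCaps {l r a : List S} (hl : Mv l) (hr : Mv r) (ha : Mv a) :
    MvW (nestedCaps l r a) := by
  induction a generalizing l r with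
  | nil => simp [nestedCaps]
  | cons x a ih =>
    simp at ha
    simp only [nestedCaps, MvW_append]
    exact ⟨ih (by simp [*]) (by simp [LawfulLabel.colour_rev, *]) ha.2,
      by simp [Slice.dom, Slice.cod, Gen.dom, Gen.cod, LawfulLabel.colour_rev, *]⟩

/-- The inner strands are straightened by induction; the outermost zigzag is freed by sliding the
maximum of the outer strand below the inner arcs. -/
theorem TEq.zigzag_nested (hP : Bends P) {a : List S} (ha : Mv a) :
    TEq P a a (wpad [] (nestedCups [] [] a) a ++ wpad a (nestedCaps [] [] (bar a)) []) [] := by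
  induction a with
  | nil => exact .refl rfl
  | cons x a ih =>
    simp at ha
    have tK := Tg_nestedCaps hP (bar a)
    rw [bar_bar] at tK
    have tcap : Tg P (rev x :: x :: a) [⟨[], .cap (rev x), a⟩] a :=
      ⟨by simp [Slice.dom, Gen.dom, LawfulLabel.rev_rev], ⟨trivial, (hP _).2⟩, rfl⟩
    have tcup : Tg P (x :: a) [⟨[], .cup x, x :: a⟩] (x :: rev x :: x :: a) :=
      ⟨rfl, ⟨trivial, (hP _).1⟩, rfl⟩
    have i := (TEq.interchange (Tg_nestedCups hP a) tcap).padL [x]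
    have z := (TEq.zigzagRight (P := P) ha.1 (hP _).1 (hP _).2).padR a
    have e1 := TEq.compL tcup (TEq.compR i (by simpa using tK.padL (x :: a)))
    have e2 := TEq.compR z ((((Tg_nestedCups hP a).pad [x] a)).append
      (by simpa using tK.padL (x :: a)))
    have e3 := (ih ha.2).padL [x]
    simp at e1 e2 e3
    have e := e1.trans (e2.trans e3)
    simp only [nestedCups, bar_cons, nestedCaps_append, nestedCaps, bar_bar, List.nil_append,
      List.append_nil, wpad_append, wpad_cons, wpad_nil, List.cons_append]
    rw [nestedCups_eq_wpad [x]]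
    simpa using e

/-- A ring around some strands is in the position required for the closure of an annular word. -/
theorem TEq.encircle_mixedWord (hP : Full P) {a r : List S} {u v : List (Slice S)} (ha : Mv a)
    (hu : Tg P [] u (a ++ r)) (hv : Tg P (a ++ r) v []) :
    TEq P [] [] (mixedWord a (wpad a (nestedCups [] [] (bar a)) [] ++
      wpad [] (wpad (a ++ bar a) u [] ++ wpad a (nestedCaps [] [] (bar a)) r ++ v) a))
      (u ++ wpad [] (encircle a) r ++ v) := by
  have tK := Tg_nestedCaps hP.bends a
  have tC := Tg_nestedCups hP.bends a
  have tK' := Tg_nestedCaps hP.bends (bar a)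
  have tC' := Tg_nestedCups hP.bends (bar a)
  have tE := Tg_encircle hP ha
  have z := TEq.zigzag_nested hP.bends ha
  have z' := TEq.zigzag_nested hP.bends ha.bar
  rw [bar_bar] at tK' tC' z'
  -- The annular word cuts the diagram at the ring. The strands `a` leaving the ring enter `v`; the
  -- strands `a` arriving from `u` are bent down into `bar a` and back up, so that they leave at the
  -- top and reach the ring by way of the closure.
  set X := wpad (a ++ bar a) u [] ++ wpad a (nestedCaps [] [] (bar a)) r ++ v with hX
  have tX : Tg P (a ++ bar a) X [] := by
    have h1 := hu.padL (a ++ bar a)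
    have h2 := tK'.pad a r
    simp at h1 h2
    exact Tg.append (Tg.append (by simpa using h1) h2) hv
  have s1 := TEq.interchange tX tK
  have tCE := tC.append (tE.padR (bar a))
  -- The closing maxima are lowered beneath `X` and cancel the nested minima of the annular word.
  have e1 := TEq.compL tCE (TEq.compL (by simpa using tC'.pad a (bar a)) (by simpa using s1))
  have e2 := TEq.compL tCE (TEq.compR (z'.padL a) (by simpa using tX))
  have s3 := TEq.interchange tE (hu.padL (bar a))
  have tK2 := tK'.pad a r
  simp at tK2
  simp at s3
  -- Next `u` and the nested maxima are lowered beneath the ring, then `u` beneath the closing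
  -- minima. The remaining nested zigzag on `a` is straightened in `e6`.
  have e3 := TEq.compL tC (TEq.compR s3 (by simpa using tK2.append hv))
  have s4 := TEq.interchange tE (tK'.padR r)
  have s5 := TEq.interchange tC hu
  have tE2 := tE.padR r
  simp at s4 s5
  have e4 := TEq.compL tC (TEq.compL (b := a ++ bar a ++ a ++ r)
    (by simpa using hu.padL (a ++ bar a)) (TEq.compR (by simpa using s4) hv))
  have e5 := TEq.compR s5 (by simpa using tK2.append (tE2.append hv))
  have e6 := TEq.compL hu (TEq.compR (z.padR r) (tE2.append hv))
  have e0 : mixedWord a (wpad a (nestedCups [] [] (bar a)) [] ++ wpad [] X a) =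
      nestedCups [] [] a ++ wpad [] (encircle a) (bar a) ++
        (wpad a (nestedCups [] [] (bar a)) (bar a) ++ (wpad [] X (a ++ bar a) ++
        nestedCaps [] [] a)) := by
    simp [mixedWord, ring_eq_wpad, map_addRight_eq_wpad]
  rw [e0]
  simp at e1 e2 e3 e4 e5 e6
  have f1 := e1.trans e2
  rw [hX] at f1 ⊢
  simp at f1 e3 e4 e5 e6 ⊢
  exact f1.trans (e3.trans (e4.trans (e5.trans e6)))

end Closing

/-! ### From isotopy of words to isotopy of diagrams -/

section Diagrams

variable {S : Type} [StrandLabel S] {P : Gen S → Prop} [LawfulLabel S]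

open StrandLabel

/-- A move such as R2 may erase every slice recording a moving strand, but then the strand is
visible at the bottom of the local picture. The bottom ends are therefore included in the
comparison. -/
theorem BasicMove.moving_iff {Q : Gen Colour → Prop} {a b b' : List Colour}
    {x y : List (Slice Colour)} (h : BasicMove x y) (hx : Tg Q a x b) (hy : Tg Q a y b') :
    (Colour.moving ∈ a ∨ HasMoving x) ↔ (Colour.moving ∈ a ∨ HasMoving y) := by
  have key : ∀ w : List (Slice Colour), HasMoving w ↔ ∃ s ∈ w, Colour.moving ∈ s.cod := by
    intro w
    simp [HasMoving]
  simp only [key]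
  cases h with
  | interchange l m r g h =>
    obtain ⟨rfl, -⟩ := hx
    simp [Slice.dom, Slice.cod]
    tauto
  | r2 l r a b o =>
    obtain ⟨rfl, -⟩ := hx
    simp [Slice.dom, Slice.cod, Gen.dom, Gen.cod]
    tauto
  | zigzagLeft l r c =>
    obtain ⟨rfl, -⟩ := hx
    simp [Slice.dom, Slice.cod, Gen.dom, Gen.cod]
    tauto
  | zigzagRight l r c =>
    obtain ⟨rfl, -⟩ := hx
    simp [Slice.dom, Slice.cod, Gen.dom, Gen.cod]
    tauto
  | _ =>
    obtain ⟨rfl, -⟩ := hx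
    simp [Slice.dom, Slice.cod, Gen.dom, Gen.cod]
    try tauto

theorem Slice.cod_map (s : Slice S) : (s.map colour).cod = s.cod.map colour := by
  simp [Slice.cod, Slice.map, map_cod_colour]

theorem Slice.dom_map (s : Slice S) : (s.map colour).dom = s.dom.map colour := by
  simp [Slice.dom, Slice.map, map_dom_colour]

theorem Tg.colourWord {a b : List S} {w : List (Slice S)} (h : Tg P a w b) :
    Tg (fun _ => True) (a.map colour) (colourWord w) (b.map colour) := by
  induction w generalizing a with
  | nil => exact congrArg _ h
  | cons s w ih =>
    obtain ⟨rfl, hs, hw⟩ := h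
    refine ⟨s.dom_map.symm, ⟨?_, trivial⟩, ?_⟩
    · obtain ⟨l, g, r⟩ := s
      have h1 := hs.1
      cases g with
      | cup x => trivial
      | cap x => trivial
      | cross x y o => exact h1
      | pre x y m => exact ⟨h1.1, h1.2.1, trivial⟩
    · have h2 := ih hw
      rwa [← Slice.cod_map] at h2

theorem HasMoving_colourWord {w : List (Slice S)} : HasMoving (colourWord w) ↔ HasMoving w := by
  simp [HasMoving, colourWord, Slice.cod_map]

theorem Tg.hasMoving {a : List S} {w : List (Slice S)} (h : Tg P [] w a) {x : S} (hx : x ∈ a)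
    (hm : colour x = Colour.moving) : HasMoving w := by
  have : ∀ (w : List (Slice S)) (c : List S), Tg P c w a → x ∈ c ∨ HasMoving w := by
    intro w
    induction w with
    | nil => intro c h; cases h; exact .inl hx
    | cons s w ih =>
      intro c h
      rcases ih _ h.2.2 with h' | ⟨t, ht, h'⟩
      · exact .inr ⟨s, by simp, x, h', hm⟩
      · exact .inr ⟨t, by simp [ht], h'⟩
  exact (this w [] h).resolve_left (by simp)

theorem HasMoving_append {u v : List (Slice S)} :
    HasMoving (u ++ v) ↔ HasMoving u ∨ HasMoving v := by
  simp only [HasMoving, List.mem_append, or_and_right, exists_or]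

theorem TStep.hasMoving {b : List S} {w w' : List (Slice S)} (h : TStep P [] b w w') :
    HasMoving w ↔ HasMoving w' := by
  obtain ⟨h1, h2, -, u, v, x, y, rfl, rfl, hm⟩ := h
  rw [List.append_assoc] at h1 h2
  obtain ⟨a, hu, h1⟩ := h1.split
  obtain ⟨a', hu', h2⟩ := h2.split
  obtain rfl := hu.cod_eq hu'
  obtain ⟨c, hx, -⟩ := h1.split
  obtain ⟨d, hy, -⟩ := h2.split
  have key := hm.moving_iff hx.colourWord hy.colourWord
  rw [HasMoving_colourWord, HasMoving_colourWord] at key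
  have ha : Colour.moving ∈ a.map colour → HasMoving u := by
    rw [List.mem_map]
    rintro ⟨z, hz, hz'⟩
    exact hu.hasMoving hz hz'
  simp only [HasMoving_append]
  tauto

/-- Isotopic words represent equivalent diagrams. -/
theorem TEq.diagram_rel {E : OMixedDiagram S → OMixedDiagram S → Prop} (hE : Equivalence E)
    (hs : ∀ M M' : OMixedDiagram S, TStep P [] [] M.word M'.word → E M M')
    {M M' : OMixedDiagram S} (h : TEq P [] [] M.word M'.word) : E M M' := by
  obtain ⟨-, -, h⟩ := h
  -- Every word along the chain is a diagram, because a step keeps the number of minima of `O` and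
  -- the presence of a moving strand. Both directions are proved together since the symmetric case
  -- swaps them.
  have key : ∀ w w', Relation.EqvGen (TStep P [] []) w w' →
      (∀ M : OMixedDiagram S, M.word = w → ∃ M' : OMixedDiagram S, M'.word = w' ∧ E M M') ∧
      (∀ M' : OMixedDiagram S, M'.word = w' → ∃ M : OMixedDiagram S, M.word = w ∧ E M M') := by
    intro w w' h
    induction h with
    | rel w w' h =>
      constructor
      · rintro M rfl
        refine ⟨⟨w', h.2.1.isTangle, ?_, ?_⟩, rfl, hs _ _ h⟩
        · exact h.2.2.1.symm.trans M.one_circle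
        · exact h.hasMoving.1 M.moving_nonempty
      · rintro M rfl
        refine ⟨⟨w, h.1.isTangle, ?_, ?_⟩, rfl, hs _ _ h⟩
        · exact h.2.2.1.trans M.one_circle
        · exact h.hasMoving.2 M.moving_nonempty
    | refl w => exact ⟨fun M hM => ⟨M, hM, hE.refl M⟩, fun M hM => ⟨M, hM, hE.refl M⟩⟩
    | symm w w' _ ih =>
      refine ⟨fun M hM => ?_, fun M hM => ?_⟩
      · obtain ⟨M', h1, h2⟩ := ih.2 M hM; exact ⟨M', h1, hE.symm h2⟩
      · obtain ⟨M', h1, h2⟩ := ih.1 M hM; exact ⟨M', h1, hE.symm h2⟩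
    | trans w w' w'' _ _ ih1 ih2 =>
      refine ⟨fun M hM => ?_, fun M hM => ?_⟩
      · obtain ⟨M', h1, h2⟩ := ih1.1 M hM
        obtain ⟨M'', h3, h4⟩ := ih2.1 M' h1
        exact ⟨M'', h3, hE.trans h2 h4⟩
      · obtain ⟨M', h1, h2⟩ := ih2.2 M hM
        obtain ⟨M'', h3, h4⟩ := ih1.2 M' h1
        exact ⟨M'', h3, hE.trans h4 h2⟩
  obtain ⟨M'', h1, h2⟩ := (key _ _ h).1 M rfl
  obtain rfl : M'' = M' := by cases M''; cases M'; simp_all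
  exact h2

theorem TEq.hasMoving {b : List S} {w w' : List (Slice S)} (h : TEq P [] b w w') :
    HasMoving w ↔ HasMoving w' := by
  obtain ⟨-, -, h⟩ := h
  induction h with
  | rel _ _ h => exact h.hasMoving
  | refl _ => rfl
  | symm _ _ _ ih => exact ih.symm
  | trans _ _ _ _ _ ih1 ih2 => exact ih1.trans ih2

/-- Every diagram is isotopic to the closure of an annular diagram. -/
theorem exists_annular (hP : Full P) (M : OMixedDiagram S) (hM : ∀ s ∈ M.word, P s.gen) :
    ∃ D : AnnularDiagram S, TEq P [] [] M.word D.toMixed.word := by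
  obtain ⟨a, r, u, v, ha, hr, hu, hu', hv, hv', e⟩ :=
    exists_encircle hP (Tg.of_isTangle M.closed hM) M.one_circle
  have e2 := TEq.encircle_mixedWord hP ha hu hv
  have e3 := e.trans e2.symm
  set w := wpad a (nestedCups [] [] (bar a)) [] ++
      wpad [] (wpad (a ++ bar a) u [] ++ wpad a (nestedCaps [] [] (bar a)) r ++ v) a with hw
  have tw : Tg P a w a := by
    have h1 := (Tg_nestedCups hP.bends (bar a)).padL a
    have h2 := (hu.padL (a ++ bar a)).padR a
    have h3 := ((Tg_nestedCaps hP.bends (bar a)).pad a r).padR a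
    have h4 := hv.padR a
    rw [bar_bar] at h1 h3
    simp at h1 h2 h3 h4
    have := h1.append (h2.append (h3.append h4))
    simpa [hw] using this
  have mw : MvW w := by
    simp only [hw, MvW_append, wpad_append, wpad_wpad]
    exact ⟨(MvW_nestedCups (by simp) (by simp) ha.bar).pad ha (by simp),
      ⟨hu'.pad (by simp [ha, ha.bar]) (by simp [ha]),
        (MvW_nestedCaps (by simp) (by simp) ha.bar).pad (by simp [ha]) (by simp [ha, hr])⟩,
      hv'.pad (by simp) ha⟩
  refine ⟨⟨a, w, tw.isTangle, ha, fun s hs => (mw s hs).2, ?_⟩, e3⟩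
  -- With empty base and empty word the closure is `O` alone, which contradicts that isotopy
  -- preserves the presence of a moving strand.
  by_contra hne
  rw [not_or, not_not, not_not] at hne
  obtain ⟨rfl, hw0⟩ := hne
  rw [hw0] at e3
  obtain ⟨s, hs, x, hx, hm⟩ := e3.hasMoving.1 M.moving_nonempty
  simp [mixedWord, nestedCups, nestedCaps, ring, arcOver, arcUnder] at hs
  rcases hs with rfl | rfl
  · simp [Slice.cod, Gen.cod, rev_fixedStrand] at hx
    simp [hx, colour_fixedStrand] at hm
  · simp [Slice.cod, Gen.cod] at hx

theorem TEq.regularIsotopy {P : Gen OStrand → Prop} {M M' : OMixedDiagram OStrand}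
    (h : TEq P [] [] M.word M'.word) : OMixedRegularIsotopy M M' := by
  refine TEq.diagram_rel (E := OMixedRegularIsotopy) (Relation.EqvGen.is_equivalence _) ?_ h
  rintro M M' ⟨-, -, -, u, v, x, y, h1, h2, h3⟩
  exact .rel _ _ ⟨u, v, x, y, h1, h2, h3⟩

theorem exists_corresponds (M : OMixedDiagram OStrand) :
    ∃ D : AnnularDiagram OStrand, Corresponds M D := by
  obtain ⟨D, h⟩ := exists_annular (P := fun _ => True) (fun _ _ => trivial) M (fun _ _ => trivial)
  exact ⟨D, D, .refl D, h.regularIsotopy⟩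

end Diagrams


/-! # Evaluation of diagrams with `O` coloured by an irreducible representation -/

/-- The parameters of the evaluation: values of `A`, `V`, `H` in a field, and the colour `n` of `O`;
the strands of `O` have the states `0, …, n` and moving strands have the states `0`, `1`. -/
structure EvalData (K : Type*) [Field K] where
  A : K
  V : K
  H : K
  n : ℕ
  A_ne : A ≠ 0

namespace EvalData

variable {K : Type*} [Field K] (e : EvalData K)

/-- The weight of the state `i` of a strand of `O`. -/
def wt (i : ℕ) : K := e.A ^ e.n * (e.A ^ (2 * i))⁻¹

/-- The coefficient of the raising term of a mixed crossing. -/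
def raise (i : ℕ) : K :=
  -- With lowering coefficients `1`, this is the value for which a circle around a strand of `O`
  -- acts by the same scalar on all states.
  (e.A ^ 2)⁻¹ * (e.A ^ (2 * e.n + 2) + (e.A ^ (2 * e.n + 2))⁻¹ - e.wt i ^ 2 * (e.A ^ 2)⁻¹ -
    (e.wt i ^ 2)⁻¹ * e.A ^ 2)

/-- The coefficient of the lowering term of a mixed crossing. -/
def lower (_ : EvalData K) (i : ℕ) : K := if i = 0 then 0 else 1

@[simp] theorem lower_zero : e.lower 0 = 0 := rfl

@[simp] theorem lower_succ (i : ℕ) : e.lower (i + 1) = 1 := rfl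

/-- The matrix of a maximum of a moving strand. -/
def capCoeff : ℕ → ℕ → K
  | 0, 1 => -e.A ^ 2
  | 1, 0 => 1
  | _, _ => 0

/-- The horizontal smoothing with a coefficient. -/
def hook (x : K) (i j : ℕ) : List (K × List ℕ) :=
  [(x * e.capCoeff i j, [0, 1]), (-(x * e.capCoeff i j * (e.A ^ 2)⁻¹), [1, 0])]

/-- The rows of the matrix of an elementary piece. -/
def row : Gen Colour → List ℕ → List (K × List ℕ)
  | .cup .moving, _ => [(1, [0, 1]), (-(e.A ^ 2)⁻¹, [1, 0])]
  | .cup .fixed, _ => (List.range (e.n + 1)).map fun i => ((-e.A ^ 2) ^ (e.n - i), [i, e.n - i])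
  | .cap .moving, [i, j] => [(e.capCoeff i j, [])]
  | .cap .fixed, [i, j] => [(if i + j = e.n then ((-e.A ^ 2) ^ i)⁻¹ else 0, [])]
  | .cross .moving .moving true, [i, j] => (e.A, [i, j]) :: e.hook e.A⁻¹ i j
  | .cross .moving .moving false, [i, j] => (e.A⁻¹, [i, j]) :: e.hook e.A i j
  -- Mixed crossings are the `R`-matrix and its inverse: a diagonal weight, plus a term in which the
  -- two strands exchange one unit. Where `i - 1` is truncated at `i = 0`, its coefficient `lower 0`
  -- vanishes.
  | .cross .moving .fixed true, [0, i] => [(e.wt i, [i, 0])]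
  | .cross .moving .fixed true, [_, i] => [((e.wt i)⁻¹, [i, 1]), (e.raise i, [i + 1, 0])]
  | .cross .fixed .moving false, [i, 0] => [((e.wt i)⁻¹, [0, i])]
  | .cross .fixed .moving false, [i, _] => [(e.wt i, [1, i]), (-e.raise i * e.A ^ 2, [0, i + 1])]
  | .cross .fixed .moving true, [i, 0] => [(e.wt i, [0, i]), (e.lower i, [1, i - 1])]
  | .cross .fixed .moving true, [i, _] => [((e.wt i)⁻¹, [1, i])]
  | .cross .moving .fixed false, [0, i] => [((e.wt i)⁻¹, [i, 0]), (-e.lower i * e.A ^ 2, [i - 1, 1])]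
  | .cross .moving .fixed false, [_, i] => [(e.wt i, [i, 1])]
  | .pre _ _ true, [i, j] => (e.V, [i, j]) :: e.hook e.H i j
  | .pre _ _ false, [i, j] => (e.H, [i, j]) :: e.hook e.V i j
  | _, _ => []

/-- The pullback of a function of the states at the top of a slice. -/
def sliceOp (s : Slice Colour) (φ : List ℕ → K) (t : List ℕ) : K :=
  ((e.row s.gen ((t.drop s.left.length).take s.gen.dom.length)).map fun c =>
    c.1 * φ (t.take s.left.length ++ (c.2 ++ t.drop (s.left.length + s.gen.dom.length)))).sum

/-- The pullback of a function of the states at the top of a word. -/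
def wordOp : List (Slice Colour) → (List ℕ → K) → List ℕ → K
  | [], φ => φ
  | s :: w, φ => e.sliceOp s (wordOp w φ)

@[simp] theorem wordOp_nil (φ : List ℕ → K) : e.wordOp [] φ = φ := rfl

@[simp] theorem wordOp_cons (s : Slice Colour) (w : List (Slice Colour)) (φ : List ℕ → K) :
    e.wordOp (s :: w) φ = e.sliceOp s (e.wordOp w φ) := rfl

theorem wordOp_append (u v : List (Slice Colour)) (φ : List ℕ → K) :
    e.wordOp (u ++ v) φ = e.wordOp u (e.wordOp v φ) := by
  induction u with
  | nil => rfl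
  | cons s u ih => simp [ih]

theorem sliceOp_append {l : List Colour} {g : Gen Colour} (r : List Colour) (φ : List ℕ → K)
    {x y : List ℕ} (z : List ℕ) (hx : x.length = l.length) (hy : y.length = g.dom.length) :
    e.sliceOp ⟨l, g, r⟩ φ (x ++ (y ++ z)) =
      ((e.row g y).map fun c => c.1 * φ (x ++ (c.2 ++ z))).sum := by
  have h1 : (x ++ (y ++ z)).drop (l.length + g.dom.length) = z := by
    rw [← hx, ← hy, ← List.append_assoc, ← List.length_append, List.drop_left]
  simp only [sliceOp]
  rw [h1, ← hx, ← hy]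
  simp

theorem sliceOp_zero (r : List Colour) (g : Gen Colour) (φ : List ℕ → K) (t : List ℕ)
    (hg : g.dom = []) : e.sliceOp ⟨[], g, r⟩ φ t =
      ((e.row g []).map fun c => c.1 * φ (c.2 ++ t)).sum := by
  simp [sliceOp, hg]

theorem sliceOp_two (r : List Colour) (g : Gen Colour) (φ : List ℕ → K) (i j : ℕ) (t : List ℕ)
    (hg : g.dom.length = 2) : e.sliceOp ⟨[], g, r⟩ φ (i :: j :: t) =
      ((e.row g [i, j]).map fun c => c.1 * φ (c.2 ++ t)).sum := by
  simp [sliceOp, hg]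

@[simp] theorem sliceOp_cons (c : Colour) (l r : List Colour) (g : Gen Colour) (φ : List ℕ → K)
    (i : ℕ) (t : List ℕ) : e.sliceOp ⟨c :: l, g, r⟩ φ (i :: t) =
      e.sliceOp ⟨l, g, r⟩ (fun t => φ (i :: t)) t := by
  simp [sliceOp, Nat.add_right_comm]

@[simp] theorem sliceOp_cup (x : Colour) (r : List Colour) (φ : List ℕ → K) (t : List ℕ) :
    e.sliceOp ⟨[], .cup x, r⟩ φ t =
      ((e.row (.cup x) []).map fun c => c.1 * φ (c.2 ++ t)).sum := e.sliceOp_zero _ _ _ _ rfl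

@[simp] theorem sliceOp_cap (x : Colour) (r : List Colour) (φ : List ℕ → K) (i j : ℕ) (t : List ℕ) :
    e.sliceOp ⟨[], .cap x, r⟩ φ (i :: j :: t) =
      ((e.row (.cap x) [i, j]).map fun c => c.1 * φ (c.2 ++ t)).sum := e.sliceOp_two _ _ _ _ _ _ rfl

@[simp] theorem sliceOp_cross (x y : Colour) (o : Bool) (r : List Colour) (φ : List ℕ → K) (i j : ℕ)
    (t : List ℕ) : e.sliceOp ⟨[], .cross x y o, r⟩ φ (i :: j :: t) =
      ((e.row (.cross x y o) [i, j]).map fun c => c.1 * φ (c.2 ++ t)).sum :=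
  e.sliceOp_two _ _ _ _ _ _ rfl

@[simp] theorem sliceOp_pre (x y : Colour) (o : Bool) (r : List Colour) (φ : List ℕ → K) (i j : ℕ)
    (t : List ℕ) : e.sliceOp ⟨[], .pre x y o, r⟩ φ (i :: j :: t) =
      ((e.row (.pre x y o) [i, j]).map fun c => c.1 * φ (c.2 ++ t)).sum :=
  e.sliceOp_two _ _ _ _ _ _ rfl

/-- Strands on the left act as frozen parameters, and strands on the right are never inspected.
Hence local identities need only be verified without surrounding strands. -/
theorem wordOp_pad {l : List Colour} (r : List Colour) (w : List (Slice Colour)) (φ : List ℕ → K)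
    {x : List ℕ} (t : List ℕ) (hx : x.length = l.length) :
    e.wordOp (wpad l w r) φ (x ++ t) = e.wordOp w (fun t => φ (x ++ t)) t := by
  induction l generalizing x φ with
  | nil =>
    obtain rfl := List.length_eq_zero_iff.1 hx
    induction w generalizing t with
    | nil => rfl
    | cons s w ih =>
      simp only [wpad_cons, wordOp_cons, List.nil_append]
      simp only [List.nil_append] at ih
      simp only [sliceOp, ih]
  | cons c l ihl =>
    cases x with
    | nil => simp at hx
    | cons i x =>
      simp only [List.length_cons, Nat.add_right_cancel_iff] at hx
      have h1 := ihl (fun t => φ (i :: t)) hx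
      simp only [List.cons_append]
      rw [← h1]
      generalize x ++ t = t'
      clear h1 ihl hx
      induction w generalizing t' with
      | nil => rfl
      | cons s w ih => simp [ih]

/-! ### Admissible states -/

/-- The largest state of a strand. -/
def top : Colour → ℕ
  | .moving => 1
  | .fixed => e.n

/-- The admissible states of a list of strands. -/
def Adm : List Colour → List ℕ → Prop
  | [], [] => True
  | c :: a, i :: t => i ≤ e.top c ∧ Adm a t
  | _, _ => False

variable {e}

theorem Adm.length {a : List Colour} {t : List ℕ} (h : e.Adm a t) : t.length = a.length := by
  induction a generalizing t with
  | nil => cases t <;> simp_all [Adm]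
  | cons c a ih =>
    cases t with
    | nil => exact h.elim
    | cons i t => simp [ih h.2]

theorem adm_append {a b : List Colour} {t : List ℕ} :
    e.Adm (a ++ b) t ↔ ∃ x y, t = x ++ y ∧ e.Adm a x ∧ e.Adm b y := by
  induction a generalizing t with
  | nil =>
    constructor
    · intro h; exact ⟨[], t, rfl, trivial, h⟩
    · rintro ⟨x, y, rfl, hx, hy⟩
      cases x with
      | nil => exact hy
      | cons i x => exact hx.elim
  | cons c a ih =>
    cases t with
    | nil =>
      constructor
      · intro h; exact h.elim
      · rintro ⟨x, y, h, hx, -⟩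
        obtain ⟨rfl, rfl⟩ := List.append_eq_nil_iff.1 h.symm
        exact hx.elim
    | cons i t =>
      constructor
      · intro h
        obtain ⟨x, y, rfl, hx, hy⟩ := ih.1 h.2
        exact ⟨i :: x, y, rfl, ⟨h.1, hx⟩, hy⟩
      · rintro ⟨x, y, h, hx, hy⟩
        cases x with
        | nil => exact hx.elim
        | cons j x =>
          simp only [List.cons_append, List.cons.injEq] at h
          obtain ⟨rfl, rfl⟩ := h
          exact ⟨hx.1, ih.2 ⟨x, y, rfl, hx.2, hy⟩⟩

theorem Adm.append {a b : List Colour} {x y : List ℕ} (hx : e.Adm a x) (hy : e.Adm b y) :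
    e.Adm (a ++ b) (x ++ y) := adm_append.2 ⟨x, y, rfl, hx, hy⟩

theorem adm_two {a b : Colour} {x : List ℕ} (h : e.Adm [a, b] x) :
    ∃ i j, x = [i, j] ∧ i ≤ e.top a ∧ j ≤ e.top b := by
  match x, h with
  | [i, j], h => exact ⟨i, j, rfl, h.1, h.2.1⟩

theorem wt_ne (i : ℕ) : e.wt i ≠ 0 := by
  have := e.A_ne
  simp [wt, this]

theorem wt_succ (i : ℕ) : e.wt (i + 1) = e.wt i * (e.A ^ 2)⁻¹ := by
  have := e.A_ne
  simp only [wt, Nat.mul_add, pow_add]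
  field_simp

theorem wt_mul {i j : ℕ} (h : i + j = e.n) : e.wt i * e.wt j = 1 := by
  have := e.A_ne
  simp only [wt, ← h]
  field_simp
  ring

/-- The highest state cannot be raised, which keeps the `n + 1` states of `O` closed under all
pieces. -/
theorem raise_top : e.raise e.n = 0 := by
  have := e.A_ne
  simp only [raise, wt]
  field_simp
  ring

/-- Reflecting the states of `O` interchanges the two subtracted terms of `raise`. This is the
self-duality needed for crossings to slide around extrema of `O`. -/
theorem raise_symm {i j : ℕ} (h : i + j + 1 = e.n) : e.raise i = e.raise j := by
  have := e.A_ne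
  have h1 : e.wt i * e.wt (j + 1) = 1 := wt_mul (by omega)
  rw [wt_succ] at h1
  have h2 : e.wt i = e.A ^ 2 * (e.wt j)⁻¹ := by
    have := e.wt_ne j
    field_simp at h1 ⊢
    linear_combination h1
  simp only [raise, h2]
  have := e.wt_ne j
  field_simp
  ring

/-- The states in a row of an elementary piece are admissible. -/
theorem row_adm {g : Gen Colour} (hg : g.Valid) {x : List ℕ} (hx : e.Adm g.dom x) {c : K × List ℕ}
    (hc : c ∈ e.row g x) : c.1 = 0 ∨ e.Adm g.cod c.2 := by
  cases g with
  | cup x =>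
    cases x with
    | moving =>
      simp only [row, List.mem_cons, List.not_mem_nil, or_false] at hc
      rcases hc with rfl | rfl <;> simp [Gen.cod, Adm, top]
    | fixed =>
      simp only [row, List.mem_map, List.mem_range] at hc
      obtain ⟨i, hi, rfl⟩ := hc
      right
      simp [Gen.cod, Adm, top]
      omega
  | cap x =>
    obtain ⟨i, j, rfl, hi, hj⟩ := adm_two hx
    cases x <;> simp only [row, List.mem_cons, List.not_mem_nil, or_false] at hc <;> subst hc <;>
      simp [Gen.cod, Adm]
  | cross x y o =>
    obtain ⟨i, j, rfl, hi, hj⟩ := adm_two hx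
    cases x <;> cases y
    · simp only [top] at hi hj
      cases o <;> simp only [row, hook, List.mem_cons, List.not_mem_nil, or_false] at hc <;>
        rcases hc with rfl | rfl | rfl <;> simp [Gen.cod, Adm, top, hi, hj] <;> grind
    · simp only [top] at hi hj
      cases o <;> interval_cases i <;>
        simp only [row, List.mem_cons, List.not_mem_nil, or_false] at hc
      · rcases hc with rfl | rfl <;> simp [Gen.cod, Adm, top] <;> grind
      · rcases hc with rfl; simp [Gen.cod, Adm, top]; grind
      · rcases hc with rfl; simp [Gen.cod, Adm, top]; grind
      · rcases hc with rfl | rfl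
        · simp [Gen.cod, Adm, top]; grind
        -- Raising the top state would leave the admissible range; the coefficient is then zero.
        · rcases Nat.lt_or_eq_of_le hj with h | rfl
          · simp [Gen.cod, Adm, top]; grind
          · simp [raise_top]
    · simp only [top] at hi hj
      cases o <;> interval_cases j <;>
        simp only [row, List.mem_cons, List.not_mem_nil, or_false] at hc
      · rcases hc with rfl; simp [Gen.cod, Adm, top]; grind
      · rcases hc with rfl | rfl
        · simp [Gen.cod, Adm, top]; grind
        · rcases Nat.lt_or_eq_of_le hi with h | rfl
          · simp [Gen.cod, Adm, top]; grind
          · simp [raise_top]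
      · rcases hc with rfl | rfl <;> simp [Gen.cod, Adm, top] <;> grind
      · rcases hc with rfl; simp [Gen.cod, Adm, top]; grind
    · exact absurd hg (by simp [Gen.Valid])
  | pre x y o =>
    obtain ⟨i, j, rfl, hi, hj⟩ := adm_two hx
    obtain ⟨h1, h2, -⟩ := hg
    simp only [colour_colour] at h1 h2
    subst h1 h2
    simp only [top] at hi hj
    cases o <;> simp only [row, hook, List.mem_cons, List.not_mem_nil, or_false] at hc <;>
      rcases hc with rfl | rfl | rfl <;> simp [Gen.cod, Adm, top, hi, hj] <;> grind

/-- The identities hold only on admissible states; they may be used inside a word because a slice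
sends admissible states to admissible ones, up to terms with coefficient zero. -/
theorem sliceOp_congr {s : Slice Colour} (hs : s.gen.Valid) {φ ψ : List ℕ → K}
    (h : ∀ t, e.Adm s.cod t → φ t = ψ t) {t : List ℕ} (ht : e.Adm s.dom t) :
    e.sliceOp s φ t = e.sliceOp s ψ t := by
  obtain ⟨l, g, r⟩ := s
  simp only [Slice.dom, List.append_assoc] at ht
  obtain ⟨x, t, rfl, hx, ht⟩ := adm_append.1 ht
  obtain ⟨y, z, rfl, hy, hz⟩ := adm_append.1 ht
  rw [sliceOp_append _ _ _ _ hx.length hy.length, sliceOp_append _ _ _ _ hx.length hy.length]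
  congr 1
  refine List.map_congr_left fun c hc => ?_
  rcases row_adm hs hy hc with h0 | h1
  · simp [h0]
  · rw [h]
    simpa [Slice.cod] using hx.append (h1.append hz)

theorem wordOp_congr {P : Gen Colour → Prop} {a b : List Colour} {w : List (Slice Colour)}
    (hw : Tg P a w b) {φ ψ : List ℕ → K} (h : ∀ t, e.Adm b t → φ t = ψ t) {t : List ℕ}
    (ht : e.Adm a t) : e.wordOp w φ t = e.wordOp w ψ t := by
  induction w generalizing a t with
  | nil => cases hw; exact h t ht
  | cons s w ih =>
    obtain ⟨rfl, hs, hw⟩ := hw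
    exact sliceOp_congr hs.1 (fun t ht => ih hw ht) ht

end EvalData


/-! ### Matrix identities behind the local moves -/

namespace EvalData

variable {K : Type*} [Field K] {e : EvalData K}

/-- Equality of the operators of two words on the states of the strands `a` and further strands. -/
def OpEq (e : EvalData K) (a : List Colour) (x y : List (Slice Colour)) : Prop :=
  ∀ (φ : List ℕ → K) (s t : List ℕ), e.Adm a s → e.wordOp x φ (s ++ t) = e.wordOp y φ (s ++ t)

theorem OpEq.pad {a : List Colour} {x y : List (Slice Colour)} (h : e.OpEq a x y)
    (l r : List Colour) {φ : List ℕ → K} {c : List Colour} {t : List ℕ}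
    (ht : e.Adm (l ++ (a ++ c)) t) : e.wordOp (wpad l x r) φ t = e.wordOp (wpad l y r) φ t := by
  obtain ⟨i, t, rfl, hi, ht⟩ := adm_append.1 ht
  obtain ⟨s, t, rfl, hs, -⟩ := adm_append.1 ht
  rw [e.wordOp_pad _ _ _ _ hi.length, e.wordOp_pad _ _ _ _ hi.length]
  exact h _ _ _ hs

theorem adm_three {a b c : Colour} {x : List ℕ} (h : e.Adm [a, b, c] x) :
    ∃ i j k, x = [i, j, k] ∧ i ≤ e.top a ∧ j ≤ e.top b ∧ k ≤ e.top c := by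
  match x, h with
  | [i, j, k], h => exact ⟨i, j, k, rfl, h.1, h.2.1, h.2.2.1⟩

theorem adm_one {a : Colour} {x : List ℕ} (h : e.Adm [a] x) : ∃ i, x = [i] ∧ i ≤ e.top a := by
  match x, h with
  | [i], h => exact ⟨i, rfl, h.1⟩

theorem opEq_r2 {a b : Colour} (h : a = .moving ∨ b = .moving) (o : Bool) :
    e.OpEq [a, b] [⟨[], .cross a b o, []⟩, ⟨[], .cross b a (!o), []⟩] [] := by
  intro φ s t hs
  obtain ⟨i, j, rfl, hi, hj⟩ := adm_two hs
  have hA := e.A_ne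
  cases a <;> cases b
  · simp only [top] at hi hj
    interval_cases i <;> interval_cases j <;> cases o <;> simp [row, hook, capCoeff] <;>
      field_simp <;> ring
  · simp only [top] at hi
    have := e.wt_ne j
    cases o <;> interval_cases i
    · cases j with
      | zero => simp [row]; field_simp
      | succ j =>
        have := e.wt_ne j
        simp [row, wt_succ]; field_simp; ring
    · simp [row]; field_simp
    · simp [row]; field_simp
    · simp [row, wt_succ]; field_simp; ring
  · simp only [top] at hj
    have := e.wt_ne i
    cases o <;> interval_cases j
    · simp [row]; field_simp
    · simp [row, wt_succ]; field_simp; ring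
    · cases i with
      | zero => simp [row]; field_simp
      | succ j =>
        have := e.wt_ne j
        simp [row, wt_succ]; field_simp; ring
    · simp [row]; field_simp
  · simp at h

theorem wt_zero : e.wt 0 = e.A ^ e.n := by simp [wt]

theorem wt_one : e.wt 1 = e.A ^ e.n * (e.A ^ 2)⁻¹ := by rw [← wt_zero, ← wt_succ]

/-- The operators of the two sides of the third Reidemeister move agree. -/
def OpR3 (e : EvalData K) (a b c : Colour) (o₁ o₂ o₃ : Bool) : Prop :=
  e.OpEq [a, b, c]
    [⟨[], .cross a b o₁, [c]⟩, ⟨[b], .cross a c o₂, []⟩, ⟨[], .cross b c o₃, [a]⟩]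
    [⟨[a], .cross b c o₃, []⟩, ⟨[], .cross a c o₂, [b]⟩, ⟨[c], .cross a b o₁, []⟩]

theorem opR3_moving : e.OpR3 .moving .moving .moving true true true := by
  intro φ s t hs
  obtain ⟨i, j, k, rfl, hi, hj, hk⟩ := adm_three hs
  have hA := e.A_ne
  simp only [top] at hi hj hk
  interval_cases i <;> interval_cases j <;> interval_cases k <;> simp [row, hook, capCoeff] <;>
    field_simp <;> ring

set_option maxHeartbeats 1000000 in
theorem opR3_under : e.OpR3 .moving .moving .fixed true true true := by
  intro φ s t hs
  obtain ⟨i, j, k, rfl, hi, hj, hk⟩ := adm_three hs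
  have hA := e.A_ne
  simp only [top] at hi hj hk
  obtain _ | k := k
  · interval_cases i <;> interval_cases j <;>
      simp [row, hook, capCoeff, raise, wt_zero, wt_one, -mul_eq_mul_left_iff, -mul_eq_mul_right_iff, -mul_eq_zero] <;> field_simp <;> ring
  · have hw := e.wt_ne k
    interval_cases i <;> interval_cases j <;>
      simp [row, hook, capCoeff, raise, wt_succ, -mul_eq_mul_left_iff, -mul_eq_mul_right_iff, -mul_eq_zero] <;> field_simp <;> ring

set_option maxHeartbeats 1000000 in
theorem opR3_between : e.OpR3 .moving .moving .fixed true true false := by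
  intro φ s t hs
  obtain ⟨i, j, k, rfl, hi, hj, hk⟩ := adm_three hs
  have hA := e.A_ne
  simp only [top] at hi hj hk
  obtain _ | k := k
  · interval_cases i <;> interval_cases j <;>
      simp [row, hook, capCoeff, raise, wt_zero, wt_one, -mul_eq_mul_left_iff, -mul_eq_mul_right_iff, -mul_eq_zero] <;> field_simp <;> ring
  · have hw := e.wt_ne k
    interval_cases i <;> interval_cases j <;>
      simp [row, hook, capCoeff, raise, wt_succ, -mul_eq_mul_left_iff, -mul_eq_mul_right_iff, -mul_eq_zero] <;> field_simp <;> ring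

set_option maxHeartbeats 1000000 in
theorem opR3_over : e.OpR3 .moving .moving .fixed true false false := by
  intro φ s t hs
  obtain ⟨i, j, k, rfl, hi, hj, hk⟩ := adm_three hs
  have hA := e.A_ne
  simp only [top] at hi hj hk
  obtain _ | k := k
  · interval_cases i <;> interval_cases j <;>
      simp [row, hook, capCoeff, raise, wt_zero, wt_one, -mul_eq_mul_left_iff, -mul_eq_mul_right_iff, -mul_eq_zero] <;> field_simp <;> ring
  · have hw := e.wt_ne k
    interval_cases i <;> interval_cases j <;>
      simp [row, hook, capCoeff, raise, wt_succ, -mul_eq_mul_left_iff, -mul_eq_mul_right_iff, -mul_eq_zero] <;> field_simp <;> ring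


theorem wt_eq_inv {i j : ℕ} (h : i + j = e.n) : e.wt i = (e.wt j)⁻¹ :=
  eq_inv_of_mul_eq_one_left (wt_mul h)

/-- A maximum of `O` pairs states with sum `n`, for which the weights are inverse to each other; off
the diagonal the pairing is between states with sum `n - 1` before the shift, where `raise_symm`
applies. -/
theorem opEq_slideCap_fixed (o : Bool) :
    e.OpEq [.fixed, .moving, .fixed]
      [⟨[], .cross .fixed .moving o, [.fixed]⟩, ⟨[.moving], .cap .fixed, []⟩]
      [⟨[.fixed], .cross .moving .fixed (!o), []⟩, ⟨[], .cap .fixed, [.moving]⟩] := by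
  intro φ s t hs
  obtain ⟨i, j, k, rfl, hi, hj, hk⟩ := adm_three hs
  have hu : (-e.A ^ 2) ≠ 0 := by simpa using e.A_ne
  have hw : i + k = e.n → e.wt i = (e.wt k)⁻¹ := wt_eq_inv
  simp only [top] at hi hj hk
  cases o <;> interval_cases j
  · simp [row]
    split_ifs with h
    · simp [hw h]
    · simp
  · simp [row]
    congr 1
    · split_ifs with h
      · simp [hw h]
      · simp
    · by_cases h : i + k + 1 = e.n
      · rw [if_pos (by omega), if_pos (by omega), raise_symm h, pow_succ]
        field_simp
        ring
      · rw [if_neg (by omega), if_neg (by omega)]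
  · simp [row]
    congr 1
    · split_ifs with h
      · simp [hw h]
      · simp
    · obtain _ | i := i
      · obtain _ | k := k
        · simp
        · simp
          intro h; omega
      · obtain _ | k := k
        · simp
          intro h; omega
        · by_cases h : i + k + 1 = e.n
          · simp
            rw [if_pos (by omega), if_pos (by omega), pow_succ]
            field_simp
            ring
          · simp
            rw [if_neg (by omega), if_neg (by omega)]
  · simp [row]
    split_ifs with h
    · simp [hw h]
    · simp

theorem sum_map_range (n : ℕ) (f : ℕ → K) :
    ((List.range n).map f).sum = ∑ i ∈ Finset.range n, f i := rfl

theorem opEq_slideCup_fixed (o : Bool) :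
    e.OpEq [.moving] [⟨[.moving], .cup .fixed, []⟩, ⟨[], .cross .moving .fixed o, [.fixed]⟩]
      [⟨[], .cup .fixed, [.moving]⟩, ⟨[.fixed], .cross .fixed .moving (!o), []⟩] := by
  intro φ s t hs
  obtain ⟨i, rfl, hi⟩ := adm_one hs
  have hu : (-e.A ^ 2) ≠ 0 := by simpa using e.A_ne
  simp only [top] at hi
  have h1 : ∀ j ∈ Finset.range (e.n + 1), e.wt j = (e.wt (e.n - j))⁻¹ := fun j hj =>
    wt_eq_inv (by simp at hj; omega)
  cases o <;> interval_cases i <;>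
    simp [row, Function.comp_def, sum_map_range, mul_add, Finset.sum_add_distrib, -mul_eq_mul_left_iff, -mul_eq_mul_right_iff, -mul_eq_zero]
  · congr 1
    · refine Finset.sum_congr rfl fun j hj => ?_
      simp [h1 j hj]
    -- The term `j + 1` of one sum equals the term `j` of the other; the two unmatched end terms
    -- carry `lower 0 = 0`.
    · rw [Finset.sum_range_succ', Finset.sum_range_succ]
      simp
      rw [← Finset.sum_neg_distrib]
      refine Finset.sum_congr rfl fun j hj => ?_
      simp at hj
      rw [show e.n - j = e.n - (j + 1) + 1 by omega]
      simp [pow_succ]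
      ring
  · refine Finset.sum_congr rfl fun j hj => ?_
    simp [h1 j hj]
  · refine Finset.sum_congr rfl fun j hj => ?_
    simp [h1 j hj]
  · congr 1
    · refine Finset.sum_congr rfl fun j hj => ?_
      simp [h1 j hj]
    -- The same shift by one for the raising terms; the unmatched end terms now vanish by
    -- `raise_top`.
    · rw [Finset.sum_range_succ, Finset.sum_range_succ']
      simp [raise_top]
      rw [← Finset.sum_neg_distrib]
      refine Finset.sum_congr rfl fun j hj => ?_
      simp at hj
      rw [show e.n - j = e.n - (j + 1) + 1 by omega, raise_symm (i := e.n - (j + 1)) (j := j) (by omega)]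
      simp [pow_succ]
      ring

theorem opEq_slideCap {c x : Colour} (h : c = .moving ∨ x = .moving) (o : Bool) :
    e.OpEq [c, x, c] [⟨[], .cross c x o, [c]⟩, ⟨[x], .cap c, []⟩]
      [⟨[c], .cross x c (!o), []⟩, ⟨[], .cap c, [x]⟩] := by
  intro φ s t hs
  obtain ⟨i, j, k, rfl, hi, hj, hk⟩ := adm_three hs
  have hA := e.A_ne
  cases c <;> cases x
  · simp only [top] at hi hj hk
    interval_cases i <;> interval_cases j <;> interval_cases k <;> cases o <;>
      simp [row, hook, capCoeff, -mul_eq_mul_left_iff, -mul_eq_mul_right_iff, -mul_eq_zero] <;> field_simp <;> ring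
  · simp only [top] at hi hk
    have hw := e.wt_ne j
    interval_cases i <;> interval_cases k <;> cases o <;>
      simp [row, capCoeff, -mul_eq_mul_left_iff, -mul_eq_mul_right_iff, -mul_eq_zero] <;> field_simp <;> ring
  · exact opEq_slideCap_fixed o φ _ t hs
  · simp at h

theorem opEq_slideCup {c x : Colour} (h : c = .moving ∨ x = .moving) (o : Bool) :
    e.OpEq [x] [⟨[x], .cup c, []⟩, ⟨[], .cross x c o, [c]⟩]
      [⟨[], .cup c, [x]⟩, ⟨[c], .cross c x (!o), []⟩] := by
  intro φ s t hs
  obtain ⟨i, rfl, hi⟩ := adm_one hs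
  have hA := e.A_ne
  cases c <;> cases x
  · simp only [top] at hi
    interval_cases i <;> cases o <;> simp [row, hook, capCoeff, -mul_eq_mul_left_iff, -mul_eq_mul_right_iff, -mul_eq_zero] <;> field_simp <;> ring
  · have hw := e.wt_ne i
    cases o <;> simp [row, -mul_eq_mul_left_iff, -mul_eq_mul_right_iff, -mul_eq_zero] <;> field_simp <;> ring
  · exact opEq_slideCup_fixed o φ _ t hs
  · simp at h

theorem opEq_zigzagLeft (c : Colour) : e.OpEq [c] [⟨[c], .cup c, []⟩, ⟨[], .cap c, [c]⟩] [] := by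
  intro φ s t hs
  obtain ⟨i, rfl, hi⟩ := adm_one hs
  have hA := e.A_ne
  cases c
  · simp only [top] at hi
    interval_cases i <;> simp [row, capCoeff]
    field_simp
  · simp only [top] at hi
    have : (-e.A ^ 2) ≠ 0 := by simpa using hA
    simp [row, Function.comp_def, sum_map_range]
    rw [Finset.sum_eq_single (e.n - i)]
    · rw [show e.n - (e.n - i) = i by omega, if_pos (by omega)]
      field_simp
    · intro j hj hji
      simp at hj
      rw [if_neg (by omega)]
    · simp

theorem opEq_zigzagRight (c : Colour) : e.OpEq [c] [⟨[], .cup c, [c]⟩, ⟨[c], .cap c, []⟩] [] := by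
  intro φ s t hs
  obtain ⟨i, rfl, hi⟩ := adm_one hs
  have hA := e.A_ne
  cases c
  · simp only [top] at hi
    interval_cases i <;> simp [row, capCoeff]
    field_simp
  · simp only [top] at hi
    have : (-e.A ^ 2) ≠ 0 := by simpa using hA
    simp [row, Function.comp_def, sum_map_range]
    rw [Finset.sum_eq_single i]
    · rw [if_pos (by omega)]
      field_simp
    · intro j hj hji
      simp at hj
      rw [if_neg (by omega)]
    · simp; omega

theorem opEq_slidePreCap (m : Bool) :
    e.OpEq [.moving, .moving, .moving]
      [⟨[], .pre .moving .moving m, [.moving]⟩, ⟨[.moving], .cap .moving, []⟩]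
      [⟨[.moving], .pre .moving .moving (!m), []⟩, ⟨[], .cap .moving, [.moving]⟩] := by
  intro φ s t hs
  obtain ⟨i, j, k, rfl, hi, hj, hk⟩ := adm_three hs
  have hA := e.A_ne
  simp only [top] at hi hj hk
  interval_cases i <;> interval_cases j <;> interval_cases k <;> cases m <;>
      simp [row, hook, capCoeff, -mul_eq_mul_left_iff, -mul_eq_mul_right_iff, -mul_eq_zero] <;> field_simp <;> ring

theorem opEq_slidePreCup (m : Bool) :
    e.OpEq [.moving] [⟨[.moving], .cup .moving, []⟩, ⟨[], .pre .moving .moving m, [.moving]⟩]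
      [⟨[], .cup .moving, [.moving]⟩, ⟨[.moving], .pre .moving .moving (!m), []⟩] := by
  intro φ s t hs
  obtain ⟨i, rfl, hi⟩ := adm_one hs
  have hA := e.A_ne
  simp only [top] at hi
  interval_cases i <;> cases m <;> simp [row, hook, capCoeff, -mul_eq_mul_left_iff, -mul_eq_mul_right_iff, -mul_eq_zero] <;> field_simp <;> ring

end EvalData


/-! ### All versions of the third Reidemeister move -/

namespace EvalData

variable {K : Type*} [Field K] {e : EvalData K}

/-- Equality of the operators of two words with the same ends. -/
def OEq (e : EvalData K) (a b : List Colour) (x y : List (Slice Colour)) : Prop :=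
  Tg (fun _ => True) a x b ∧ Tg (fun _ => True) a y b ∧
    ∀ (φ : List ℕ → K) (t : List ℕ), e.Adm a t → e.wordOp x φ t = e.wordOp y φ t

namespace OEq

theorem symm {a b : List Colour} {x y : List (Slice Colour)} (h : e.OEq a b x y) :
    e.OEq a b y x := ⟨h.2.1, h.1, fun φ t ht => (h.2.2 φ t ht).symm⟩

theorem trans {a b : List Colour} {x y z : List (Slice Colour)} (h : e.OEq a b x y)
    (h' : e.OEq a b y z) : e.OEq a b x z :=
  ⟨h.1, h'.2.1, fun φ t ht => (h.2.2 φ t ht).trans (h'.2.2 φ t ht)⟩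

theorem ctx {a b a' b' : List Colour} {u x y v : List (Slice Colour)}
    (hu : Tg (fun _ => True) a u a') (h : e.OEq a' b' x y) (hv : Tg (fun _ => True) b' v b) :
    e.OEq a b (u ++ x ++ v) (u ++ y ++ v) := by
  refine ⟨(hu.append h.1).append hv, (hu.append h.2.1).append hv, fun φ t ht => ?_⟩
  rw [wordOp_append, wordOp_append, wordOp_append, wordOp_append]
  exact wordOp_congr hu (fun t ht => h.2.2 _ t ht) ht

theorem of_opEq {a b : List Colour} {x y : List (Slice Colour)} (h : e.OpEq a x y)
    (hx : Tg (fun _ => True) a x b) (hy : Tg (fun _ => True) a y b) (l r : List Colour) :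
    e.OEq (l ++ a ++ r) (l ++ b ++ r) (wpad l x r) (wpad l y r) :=
  ⟨hx.pad l r, hy.pad l r, fun φ t ht => h.pad l r (c := r) (by simpa using ht)⟩

/-- The states to the right of all ends of a word are inert, so testing on functions of the ends
themselves suffices. -/
theorem opEq {a b : List Colour} {x y : List (Slice Colour)} (h : e.OEq a b x y) :
    e.OpEq a x y := by
  intro φ s t hs
  have key : ∀ w : List (Slice Colour), Tg (fun _ => True) a w b →
      ∀ (φ : List ℕ → K) (s : List ℕ), e.Adm a s →
      e.wordOp w φ (s ++ t) = e.wordOp w (fun s => φ (s ++ t)) s := by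
    intro w
    clear hs h s φ
    induction w generalizing a with
    | nil => intro _ φ s _; rfl
    | cons g w ih =>
      rintro ⟨rfl, hg, hw⟩ φ s hs
      obtain ⟨l, g, r⟩ := g
      simp only [Slice.dom, List.append_assoc] at hs
      obtain ⟨i, s, rfl, hi, hs⟩ := adm_append.1 hs
      obtain ⟨j, k, rfl, hj, hk⟩ := adm_append.1 hs
      simp only [wordOp_cons, List.append_assoc]
      rw [sliceOp_append _ _ _ _ hi.length hj.length, sliceOp_append _ _ _ _ hi.length hj.length]
      congr 1
      refine List.map_congr_left fun c hc => ?_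
      rcases row_adm hg.1 hj hc with h0 | h1
      · simp [h0]
      · rw [← ih hw]
        · simp
        · simpa [Slice.cod] using hi.append (h1.append hk)
  rw [key x h.1 _ _ hs, key y h.2.1 _ _ hs]
  exact h.2.2 _ _ hs

end OEq

theorem tg_cross {a b : Colour} (h : a = .moving ∨ b = .moving) (o : Bool) (l r : List Colour) :
    Tg (fun _ => True) (l ++ a :: b :: r) [⟨l, .cross a b o, r⟩] (l ++ b :: a :: r) :=
  ⟨by simp [Slice.dom, Gen.dom], ⟨h, trivial⟩, by simp [Slice.cod, Gen.cod, Tg]⟩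

theorem oEq_r2 {a b : Colour} (h : a = .moving ∨ b = .moving) (o : Bool) (l r : List Colour) :
    e.OEq (l ++ a :: b :: r) (l ++ a :: b :: r)
      [⟨l, .cross a b o, r⟩, ⟨l, .cross b a (!o), r⟩] [] := by
  have h1 : Tg (fun _ => True) [a, b]
      [⟨[], .cross a b o, []⟩, ⟨[], .cross b a (!o), []⟩] [a, b] :=
    (tg_cross h o [] []).append (tg_cross h.symm (!o) [] [])
  simpa using OEq.of_opEq (opEq_r2 h o) h1 rfl l r

/-- The two sides of the third Reidemeister move have the same operators. -/
def R3 (e : EvalData K) (a b c : Colour) (o₁ o₂ o₃ : Bool) : Prop :=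
  e.OEq [a, b, c] [c, b, a]
    [⟨[], .cross a b o₁, [c]⟩, ⟨[b], .cross a c o₂, []⟩, ⟨[], .cross b c o₃, [a]⟩]
    [⟨[a], .cross b c o₃, []⟩, ⟨[], .cross a c o₂, [b]⟩, ⟨[c], .cross a b o₁, []⟩]

theorem OpR3.r3 {a b c : Colour} {o₁ o₂ o₃ : Bool} (h : e.OpR3 a b c o₁ o₂ o₃)
    (h1 : a = .moving ∨ b = .moving) (h2 : a = .moving ∨ c = .moving)
    (h3 : b = .moving ∨ c = .moving) : e.R3 a b c o₁ o₂ o₃ := by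
  have t1 : Tg (fun _ => True) [a, b, c]
      [⟨[], .cross a b o₁, [c]⟩, ⟨[b], .cross a c o₂, []⟩, ⟨[], .cross b c o₃, [a]⟩] [c, b, a] :=
    (tg_cross h1 o₁ [] [c]).append ((tg_cross h2 o₂ [b] []).append (tg_cross h3 o₃ [] [a]))
  have t2 : Tg (fun _ => True) [a, b, c]
      [⟨[a], .cross b c o₃, []⟩, ⟨[], .cross a c o₂, [b]⟩, ⟨[c], .cross a b o₁, []⟩] [c, b, a] :=
    (tg_cross h3 o₃ [a] []).append ((tg_cross h2 o₂ [] [b]).append (tg_cross h1 o₁ [c] []))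
  exact ⟨t1, t2, fun φ t ht => by simpa using h φ t [] ht⟩

theorem R3.valid {a b c : Colour} {o₁ o₂ o₃ : Bool} (h : e.R3 a b c o₁ o₂ o₃) :
    (a = .moving ∨ b = .moving) ∧ (a = .moving ∨ c = .moving) ∧ (b = .moving ∨ c = .moving) :=
  ⟨h.1.2.1.1, h.1.2.2.2.1.1, h.1.2.2.2.2.2.1.1⟩

/-- Composing both sides with the inverse of the crossing of `a` and `b`, below on one side and
above on the other, and cancelling by R2 turns one version of the move into another. Thus few
versions require a computation. -/
theorem R3.flipLeft {a b c : Colour} {o₁ o₂ o₃ : Bool} (h : e.R3 a b c o₁ o₂ o₃) :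
    e.R3 b a c (!o₁) o₃ o₂ := by
  obtain ⟨h1, h2, h3⟩ := h.valid
  have r := OEq.ctx (tg_cross h1.symm (!o₁) [] [c]) h (tg_cross h1.symm (!o₁) [c] [])
  have e1 := OEq.ctx (u := []) rfl (oEq_r2 (e := e) h1.symm (!o₁) [] [c])
    ((tg_cross h2 o₂ [b] []).append ((tg_cross h3 o₃ [] [a]).append
      (tg_cross h1.symm (!o₁) [c] [])))
  have e2 := OEq.ctx (v := []) ((tg_cross h1.symm (!o₁) [] [c]).append
    ((tg_cross h3 o₃ [a] []).append (tg_cross h2 o₂ [] [b]))) (oEq_r2 (e := e) h1 o₁ [c] []) rfl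
  simp only [Bool.not_not, List.nil_append, List.cons_append, List.append_nil] at r e1 e2
  exact e2.symm.trans (r.symm.trans e1)

theorem R3.flipRight {a b c : Colour} {o₁ o₂ o₃ : Bool} (h : e.R3 a b c o₁ o₂ o₃) :
    e.R3 a c b o₂ o₁ (!o₃) := by
  obtain ⟨h1, h2, h3⟩ := h.valid
  have r := OEq.ctx (tg_cross h3.symm (!o₃) [a] []) h (tg_cross h3.symm (!o₃) [] [a])
  have e1 := OEq.ctx (v := []) ((tg_cross h3.symm (!o₃) [a] []).append
    ((tg_cross h1 o₁ [] [c]).append (tg_cross h2 o₂ [b] []))) (oEq_r2 (e := e) h3 o₃ [] [a]) rfl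
  have e2 := OEq.ctx (u := []) rfl (oEq_r2 (e := e) h3.symm (!o₃) [a] [])
    ((tg_cross h2 o₂ [] [b]).append ((tg_cross h1 o₁ [c] []).append
      (tg_cross h3.symm (!o₃) [] [a])))
  simp only [Bool.not_not, List.nil_append, List.cons_append, List.append_nil] at r e1 e2
  exact e2.symm.trans (r.symm.trans e1)

/-- One computed version for three moving strands, and three for `O` entering on the right (under,
between, over), generate all admissible layerings by the two flips. -/
theorem r3_of_valid {a b c : Colour} {o₁ o₂ o₃ : Bool} (h1 : a = .moving ∨ b = .moving)
    (h2 : a = .moving ∨ c = .moving) (h3 : b = .moving ∨ c = .moving)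
    (h : ¬ (o₁ = o₃ ∧ o₂ ≠ o₁)) : e.R3 a b c o₁ o₂ o₃ := by
  have v : Colour.moving = .moving ∨ Colour.moving = .moving := Or.inl rfl
  have w : Colour.moving = .moving ∨ Colour.fixed = .moving := Or.inl rfl
  have mmm : e.R3 .moving .moving .moving true true true := opR3_moving.r3 v v v
  have mmF : ∀ o₁ o₂ o₃ : Bool, ¬ (o₁ = o₃ ∧ o₂ ≠ o₁) → e.R3 .moving .moving .fixed o₁ o₂ o₃ := by
    have h1 : e.R3 .moving .moving .fixed true true true := opR3_under.r3 v w w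
    have h2 : e.R3 .moving .moving .fixed true true false := opR3_between.r3 v w w
    have h3 : e.R3 .moving .moving .fixed true false false := opR3_over.r3 v w w
    rintro (_ | _) (_ | _) (_ | _) h
    · exact h3.flipLeft
    · exact h2.flipLeft
    · exact absurd h (by decide)
    · exact h1.flipLeft
    · exact h3
    · exact absurd h (by decide)
    · exact h2
    · exact h1
  have mFm : ∀ o₁ o₂ o₃ : Bool, ¬ (o₁ = o₃ ∧ o₂ ≠ o₁) →
      e.R3 .moving .fixed .moving o₁ o₂ o₃ := by
    intro o₁ o₂ o₃ h
    simpa using (mmF o₂ o₁ (!o₃) (by revert h; cases o₁ <;> cases o₂ <;> cases o₃ <;> decide)).flipRight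
  cases a <;> cases b <;> cases c
  · revert h
    cases o₁ <;> cases o₂ <;> cases o₃ <;> intro h
    · exact mmm.flipLeft.flipRight.flipLeft
    · exact mmm.flipRight.flipLeft
    · exact absurd h (by decide)
    · exact mmm.flipLeft
    · exact mmm.flipLeft.flipRight
    · exact absurd h (by decide)
    · exact mmm.flipRight
    · exact mmm
  · exact mmF _ _ _ h
  · exact mFm _ _ _ h
  · simp at h3
  · simpa using (mFm (!o₁) o₃ o₂
      (by revert h; cases o₁ <;> cases o₂ <;> cases o₃ <;> decide)).flipLeft
  · simp at h2
  · simp at h1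
  · simp at h1

/-! ### Linearity and precrossings -/

theorem sliceOp_linear (s : Slice Colour) (x y : K) (φ ψ : List ℕ → K) (t : List ℕ) :
    e.sliceOp s (fun t => x * φ t + y * ψ t) t = x * e.sliceOp s φ t + y * e.sliceOp s ψ t := by
  simp only [sliceOp, ← List.sum_map_mul_left, ← List.sum_map_add]
  congr 1
  refine List.map_congr_left fun c _ => ?_
  ring

theorem wordOp_linear (w : List (Slice Colour)) (x y : K) (φ ψ : List ℕ → K) (t : List ℕ) :
    e.wordOp w (fun t => x * φ t + y * ψ t) t = x * e.wordOp w φ t + y * e.wordOp w ψ t := by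
  induction w generalizing t with
  | nil => rfl
  | cons s w ih =>
    have : e.wordOp w (fun t => x * φ t + y * ψ t) =
        fun t => x * e.wordOp w φ t + y * e.wordOp w ψ t := funext ih
    rw [wordOp_cons, this, sliceOp_linear]
    rfl

theorem wordOp_expand {u v w₀ w₁ w : List (Slice Colour)} {a b : List Colour} {x y : K}
    (hu : Tg (fun _ => True) a u b)
    (h : ∀ (φ : List ℕ → K) (t : List ℕ), e.Adm b t →
      e.wordOp w φ t = x * e.wordOp w₀ φ t + y * e.wordOp w₁ φ t)
    (φ : List ℕ → K) {t : List ℕ} (ht : e.Adm a t) :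
    e.wordOp (u ++ w ++ v) φ t = x * e.wordOp (u ++ w₀ ++ v) φ t + y * e.wordOp (u ++ w₁ ++ v) φ t := by
  simp only [wordOp_append]
  rw [← wordOp_linear]
  exact wordOp_congr hu (fun t ht => h _ t ht) ht

end EvalData


/-! ### Invariance of the evaluation under all moves -/

theorem sum_map_comm {ι κ N : Type*} [AddCommMonoid N] (L : List ι) (M : List κ) (F : ι → κ → N) :
    (L.map fun c => (M.map (F c)).sum).sum = (M.map fun d => (L.map fun c => F c d).sum).sum := by
  induction L with
  | nil => simp
  | cons c L ih => simp [ih, List.sum_map_add]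

namespace EvalData

variable {K : Type*} [Field K] {e : EvalData K}

/-- The operator of a word is a combination of the operators of two other words. -/
def Expands (e : EvalData K) (a : List Colour) (w : List (Slice Colour)) (x y : K)
    (w₀ w₁ : List (Slice Colour)) : Prop :=
  ∀ (φ : List ℕ → K) (t : List ℕ), e.Adm a t →
    e.wordOp w φ t = x * e.wordOp w₀ φ t + y * e.wordOp w₁ φ t

theorem expands_horizontal (l r : List Colour) (x y : K) (g : Gen Colour)
    (hg : g.dom = [.moving, .moving])
    (h : ∀ i j, e.row g [i, j] = (x, [i, j]) :: e.hook y i j) :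
    e.Expands (l ++ .moving :: .moving :: r) [⟨l, g, r⟩] x y [] (horizontal l r) := by
  intro φ t ht
  obtain ⟨s, t, rfl, hs, ht⟩ := adm_append.1 ht
  obtain ⟨q, t, rfl, hq, -⟩ := adm_append (a := [.moving, .moving]).1 ht
  obtain ⟨i, j, rfl, -⟩ := adm_two hq
  have h1 := e.wordOp_pad [] [⟨[], g, r⟩] φ ([i, j] ++ t) hs.length
  have h2 := e.wordOp_pad [] (horizontal [] r) φ ([i, j] ++ t) hs.length
  simp [horizontal] at h1 h2
  simp only [horizontal, List.cons_append, List.nil_append, wordOp_cons, wordOp_nil]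
  rw [h1, h2, sliceOp_two _ _ _ _ _ _ _ (by simp [hg]), h]
  simp [hook, row]
  ring

theorem expands_cross_true (l r : List Colour) : e.Expands (l ++ .moving :: .moving :: r)
    [⟨l, .cross .moving .moving true, r⟩] e.A e.A⁻¹ [] (horizontal l r) :=
  expands_horizontal l r _ _ _ rfl fun _ _ => rfl

theorem expands_cross_false (l r : List Colour) : e.Expands (l ++ .moving :: .moving :: r)
    [⟨l, .cross .moving .moving false, r⟩] e.A⁻¹ e.A [] (horizontal l r) :=
  expands_horizontal l r _ _ _ rfl fun _ _ => rfl

theorem expands_pre_true (l r : List Colour) : e.Expands (l ++ .moving :: .moving :: r)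
    [⟨l, .pre .moving .moving true, r⟩] e.V e.H [] (horizontal l r) :=
  expands_horizontal l r _ _ _ rfl fun _ _ => rfl

theorem expands_pre_false (l r : List Colour) : e.Expands (l ++ .moving :: .moving :: r)
    [⟨l, .pre .moving .moving false, r⟩] e.H e.V [] (horizontal l r) :=
  expands_horizontal l r _ _ _ rfl fun _ _ => rfl

/-- A precrossing is a combination of the vertical smoothing and a crossing. -/
theorem expands_pre (m : Bool) : ∃ x y : K, ∀ l r : List Colour,
    e.Expands (l ++ .moving :: .moving :: r) [⟨l, .pre .moving .moving m, r⟩] x y []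
      [⟨l, .cross .moving .moving true, r⟩] := by
  have key : ∀ (g : Gen Colour) (x y : K), (∀ l r : List Colour,
      e.Expands (l ++ .moving :: .moving :: r) [⟨l, g, r⟩] x y [] (horizontal l r)) →
      ∃ x y : K, ∀ l r : List Colour, e.Expands (l ++ .moving :: .moving :: r) [⟨l, g, r⟩] x y []
        [⟨l, .cross .moving .moving true, r⟩] := by
    intro g x y h
    -- Solving the Kauffman relation for the horizontal smoothing gives `A` times the crossing minus
    -- `A ^ 2` times the vertical smoothing.
    refine ⟨x - y * e.A ^ 2, y * e.A, fun l r φ t ht => ?_⟩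
    have := e.A_ne
    rw [h l r φ t ht, expands_cross_true l r φ t ht]
    field_simp
    ring
  cases m
  · exact key _ _ _ expands_pre_false
  · exact key _ _ _ expands_pre_true

theorem Expands.ctx {a b : List Colour} {u w w₀ w₁ : List (Slice Colour)} {x y : K}
    (h : e.Expands b w x y w₀ w₁) (hu : Tg (fun _ => True) a u b) (v : List (Slice Colour)) :
    e.Expands a (u ++ w ++ v) x y (u ++ w₀ ++ v) (u ++ w₁ ++ v) :=
  fun φ _ ht => wordOp_expand hu h φ ht

/-- Reduces the moves PR2 and PR3 to R2 and R3: both sides expand with the same coefficients, and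
the resulting words are compared separately. -/
theorem Expands.oEq {a b : List Colour} {w w₀ w₁ w' w₀' w₁' : List (Slice Colour)} {x y : K}
    (h : e.Expands a w x y w₀ w₁) (h' : e.Expands a w' x y w₀' w₁')
    (h₀ : e.OEq a b w₀ w₀') (h₁ : e.OEq a b w₁ w₁') {φ : List ℕ → K} {t : List ℕ}
    (ht : e.Adm a t) : e.wordOp w φ t = e.wordOp w' φ t := by
  rw [h φ t ht, h' φ t ht, h₀.2.2 φ t ht, h₁.2.2 φ t ht]

/-- Disjoint pieces read and write disjoint blocks of states, so both orders give the same double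
sum. -/
theorem wordOp_interchange (l m r : List Colour) (g h : Gen Colour) (hg : g.Valid) (hh : h.Valid)
    (φ : List ℕ → K) {t : List ℕ} (ht : e.Adm (l ++ g.dom ++ (m ++ h.dom ++ r)) t) :
    e.wordOp [⟨l, g, m ++ h.dom ++ r⟩, ⟨l ++ g.cod ++ m, h, r⟩] φ t =
      e.wordOp [⟨l ++ g.dom ++ m, h, r⟩, ⟨l, g, m ++ h.cod ++ r⟩] φ t := by
  simp only [List.append_assoc] at ht
  obtain ⟨x₁, t, rfl, h₁, ht⟩ := adm_append.1 ht
  obtain ⟨x₂, t, rfl, h₂, ht⟩ := adm_append.1 ht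
  obtain ⟨x₃, t, rfl, h₃, ht⟩ := adm_append.1 ht
  obtain ⟨x₄, t, rfl, h₄, -⟩ := adm_append.1 ht
  simp only [wordOp_cons, wordOp_nil]
  rw [sliceOp_append _ _ _ _ h₁.length h₂.length]
  have e1 : x₁ ++ (x₂ ++ (x₃ ++ (x₄ ++ t))) = (x₁ ++ x₂ ++ x₃) ++ (x₄ ++ t) := by simp
  have e2 : (x₁ ++ x₂ ++ x₃).length = (l ++ g.dom ++ m).length := by
    simp [h₁.length, h₂.length, h₃.length]
  rw [e1, sliceOp_append _ _ _ _ e2 h₄.length]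
  have e3 : ∀ c ∈ e.row g x₂, c.1 * e.sliceOp ⟨l ++ g.cod ++ m, h, r⟩ φ
      (x₁ ++ (c.2 ++ (x₃ ++ (x₄ ++ t)))) =
      ((e.row h x₄).map fun d => c.1 * (d.1 * φ (x₁ ++ (c.2 ++ (x₃ ++ (d.2 ++ t)))))).sum := by
    intro c hc
    rcases row_adm hg h₂ hc with h0 | h0
    · simp [h0]
    · have e4 : x₁ ++ (c.2 ++ (x₃ ++ (x₄ ++ t))) = (x₁ ++ c.2 ++ x₃) ++ (x₄ ++ t) := by simp
      have e5 : (x₁ ++ c.2 ++ x₃).length = (l ++ g.cod ++ m).length := by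
        simp [h₁.length, h0.length, h₃.length]
      rw [e4, sliceOp_append _ _ _ _ e5 h₄.length, List.sum_map_mul_left]
      simp
  have e6 : ∀ d ∈ e.row h x₄, d.1 * e.sliceOp ⟨l, g, m ++ h.cod ++ r⟩ φ
      (x₁ ++ x₂ ++ x₃ ++ (d.2 ++ t)) =
      ((e.row g x₂).map fun c => c.1 * (d.1 * φ (x₁ ++ (c.2 ++ (x₃ ++ (d.2 ++ t)))))).sum := by
    intro d _
    have e7 : x₁ ++ x₂ ++ x₃ ++ (d.2 ++ t) = x₁ ++ (x₂ ++ (x₃ ++ (d.2 ++ t))) := by simp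
    rw [e7, sliceOp_append _ _ _ _ h₁.length h₂.length, ← List.sum_map_mul_left]
    congr 1
    refine List.map_congr_left fun c _ => ?_
    ring
  rw [List.map_congr_left e3, List.map_congr_left e6, sum_map_comm]

theorem OpEq.wordOp_eq {a : List Colour} {x y : List (Slice Colour)} (h : e.OpEq a x y)
    (l r : List Colour) {φ : List ℕ → K} {c : List Colour} {t : List ℕ}
    (ht : e.Adm c t) (hc : ∃ d, c = l ++ (a ++ d)) :
    e.wordOp (wpad l x r) φ t = e.wordOp (wpad l y r) φ t := by
  obtain ⟨d, rfl⟩ := hc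
  exact h.pad l r ht

theorem tg_cross_right {x a b : Colour} (h : a = .moving ∨ b = .moving) (o : Bool)
    (l r : List Colour) :
    Tg (fun _ => True) (l ++ x :: a :: b :: r) [⟨l ++ [x], .cross a b o, r⟩]
      (l ++ x :: b :: a :: r) :=
  ⟨by simp [Slice.dom, Gen.dom], ⟨h, trivial⟩, by simp [Slice.cod, Gen.cod, Tg]⟩

/-- The evaluation is invariant under the local moves. -/
theorem wordOp_move {a b b' : List Colour} {x y : List (Slice Colour)} (h : BasicMove x y)
    (hx : Tg (fun _ => True) a x b) (hy : Tg (fun _ => True) a y b') (φ : List ℕ → K) {t : List ℕ}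
    (ht : e.Adm a t) : e.wordOp x φ t = e.wordOp y φ t := by
  have v : Colour.moving = .moving ∨ Colour.moving = .moving := Or.inl rfl
  cases h with
  | zigzagLeft l r c =>
    simpa using (opEq_zigzagLeft c).wordOp_eq l r ht ⟨r, by simp [hx.1, Slice.dom, Gen.dom]⟩
  | zigzagRight l r c =>
    simpa using (opEq_zigzagRight c).wordOp_eq l r ht ⟨r, by simp [hx.1, Slice.dom, Gen.dom]⟩
  | interchange l m r g h =>
    exact wordOp_interchange l m r g h hx.2.1.1 hy.2.1.1 φ (by simpa [hx.1, Slice.dom] using ht)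
  | slideCap l r c x o =>
    simpa using (opEq_slideCap hx.2.1.1 o).wordOp_eq l r ht
      ⟨r, by simp [hx.1, Slice.dom, Gen.dom]⟩
  | slideCup l r c x o =>
    simpa using (opEq_slideCup hx.2.2.2.1.1.symm o).wordOp_eq l r ht
      ⟨r, by simp [hx.1, Slice.dom, Gen.dom]⟩
  | slidePreCap l r m =>
    simpa using (opEq_slidePreCap m).wordOp_eq l r ht ⟨r, by simp [hx.1, Slice.dom, Gen.dom]⟩
  | slidePreCup l r m =>
    simpa using (opEq_slidePreCup m).wordOp_eq l r ht ⟨r, by simp [hx.1, Slice.dom, Gen.dom]⟩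
  | r2 l r a b o =>
    simpa using (opEq_r2 hx.2.1.1 o).wordOp_eq l r ht ⟨r, by simp [hx.1, Slice.dom, Gen.dom]⟩
  | r3 l r a b c o₁ o₂ o₃ h =>
    simpa using (r3_of_valid hx.2.1.1 hx.2.2.2.1.1 hx.2.2.2.2.2.1.1 h).opEq.wordOp_eq l r ht
      ⟨r, by simp [hx.1, Slice.dom, Gen.dom]⟩
  | pr2 l r m o =>
    obtain ⟨x, y, h⟩ := expands_pre (e := e) m
    obtain ⟨rfl, -⟩ := hx
    have h1 := (h l r).ctx (u := []) rfl [⟨l, .cross .moving .moving o, r⟩]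
    have h2 := (h l r).ctx (tg_cross v o l r) []
    simp only [List.nil_append, List.append_nil, List.cons_append] at h1 h2
    refine h1.oEq h2 ⟨tg_cross v o l r, tg_cross v o l r, fun _ _ _ => rfl⟩ ?_
      (by simpa [Slice.dom, Gen.dom] using ht)
    -- The substitute for the precrossing is a crossing with `o = true`. It commutes with the given
    -- crossing: the two are mutually inverse or equal.
    cases o
    · exact (oEq_r2 v true l r).trans (oEq_r2 v false l r).symm
    · have := (tg_cross v true l r).append (tg_cross v true l r)
      exact ⟨this, this, fun _ _ _ => rfl⟩
  | pr3Right l r z m o =>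
    obtain ⟨x, y, h⟩ := expands_pre (e := e) m
    obtain ⟨rfl, -⟩ := hx
    have vz : Colour.moving = .moving ∨ z = .moving := Or.inl rfl
    have t := (tg_cross vz o (l ++ [.moving]) r).append
      (by simpa using tg_cross vz o l (.moving :: r))
    have h1 := (h l (z :: r)).ctx (u := []) rfl [⟨l ++ [.moving], .cross .moving z o, r⟩,
          ⟨l, .cross .moving z o, .moving :: r⟩]
    have h2 := (h (l ++ [z]) r).ctx (a := l ++ .moving :: .moving :: z :: r)
      (u := [⟨l ++ [.moving], .cross .moving z o, r⟩, ⟨l, .cross .moving z o, .moving :: r⟩])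
      (by simpa using t) []
    simp only [List.nil_append, List.append_nil, List.cons_append] at h1 h2
    refine h1.oEq h2 (b := l ++ z :: .moving :: .moving :: r)
      ⟨by simpa using t, by simpa using t, fun _ _ _ => rfl⟩ ?_
      (by simpa [Slice.dom, Gen.dom] using ht)
    -- As `z` passes both strands on the same side, the layer condition holds for the substituted
    -- crossing.
    have := (r3_of_valid (e := e) v vz vz (o₁ := true) (o₂ := o) (o₃ := o) (by cases o <;> decide))
    simpa using OEq.of_opEq this.opEq this.1 this.2.1 l r
  | pr3Left l r z m o =>
    obtain ⟨x, y, h⟩ := expands_pre (e := e) m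
    obtain ⟨rfl, -⟩ := hx
    have vz : z = .moving ∨ Colour.moving = .moving := Or.inr rfl
    have t := (tg_cross vz o l (.moving :: r)).append
      (tg_cross_right vz o l r)
    have h1 := (h (l ++ [z]) r).ctx (u := []) rfl [⟨l, .cross z .moving o, .moving :: r⟩,
          ⟨l ++ [.moving], .cross z .moving o, r⟩]
    have h2 := (h l (z :: r)).ctx (a := l ++ z :: .moving :: .moving :: r)
      (u := [⟨l, .cross z .moving o, .moving :: r⟩, ⟨l ++ [.moving], .cross z .moving o, r⟩])
      (by simpa using t) []
    simp only [List.nil_append, List.append_nil, List.cons_append, List.append_assoc] at h1 h2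
    refine h1.oEq h2 (b := l ++ .moving :: .moving :: z :: r)
      ⟨by simpa using t, by simpa using t, fun _ _ _ => rfl⟩ ?_
      (by simpa [Slice.dom, Gen.dom] using ht)
    have := (r3_of_valid (e := e) vz vz v (o₁ := o) (o₂ := o) (o₃ := true)
      (by cases o <;> decide)).symm
    simpa using OEq.of_opEq this.opEq this.1 this.2.1 l r
  | pr3Mid l r z m o =>
    obtain ⟨x, y, h⟩ := expands_pre (e := e) m
    obtain ⟨rfl, -⟩ := hx
    have vz : Colour.moving = .moving ∨ z = .moving := Or.inl rfl
    have h1 := (h (l ++ [z]) r).ctx (a := l ++ .moving :: z :: .moving :: r)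
      (u := [⟨l, .cross .moving z o, .moving :: r⟩])
      (by simpa using tg_cross vz o l (.moving :: r))
      [⟨l, .cross z .moving (!o), .moving :: r⟩]
    have h2 := (h l (z :: r)).ctx (a := l ++ .moving :: z :: .moving :: r)
      (u := [⟨l ++ [.moving], .cross z .moving (!o), r⟩])
      (tg_cross_right vz.symm (!o) l r) [⟨l ++ [.moving], .cross .moving z o, r⟩]
    simp only [List.nil_append, List.append_nil, List.cons_append, List.append_assoc] at h1 h2
    refine h1.oEq h2 (b := l ++ .moving :: z :: .moving :: r) ?_ ?_
      (by simpa [Slice.dom, Gen.dom] using ht)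
    · have e1 := oEq_r2 (e := e) vz o l (.moving :: r)
      have e2 := oEq_r2 (e := e) vz.symm (!o) (l ++ [.moving]) r
      simp only [Bool.not_not, List.append_assoc, List.cons_append, List.nil_append] at e1 e2
      exact e1.trans e2.symm
    · have := (r3_of_valid (e := e) vz v vz.symm (o₁ := o) (o₂ := true) (o₃ := !o)
        (by cases o <;> decide))
      simpa using OEq.of_opEq this.opEq this.1 this.2.1 l r

end EvalData


/-! ### Brackets in modules, and the evaluations as examples -/

/-- The rules of the `O`-mixed pseudo bracket with values in a module; `v k` is the value of `k ≥ 1`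
essential unknots, and `v 0` the value of one unknot that is not linked with `O`. -/
structure IsBracket {R : Type} [CommRing R] (p : BracketData R) {N : Type*} [AddCommGroup N]
    [Module R N] (v : ℕ → N) (B : OMixedDiagram Colour → N) : Prop where
  crossing_true : ∀ (D D₀ D₁ : OMixedDiagram Colour) (u v : List (Slice Colour))
    (l r : List Colour), D.word = u ++ [⟨l, .cross .moving .moving true, r⟩] ++ v →
    D₀.word = u ++ v → D₁.word = u ++ horizontal l r ++ v →
    B D = (p.A : R) • B D₀ + ((p.A⁻¹ : Rˣ) : R) • B D₁
  crossing_false : ∀ (D D₀ D₁ : OMixedDiagram Colour) (u v : List (Slice Colour))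
    (l r : List Colour), D.word = u ++ [⟨l, .cross .moving .moving false, r⟩] ++ v →
    D₀.word = u ++ v → D₁.word = u ++ horizontal l r ++ v →
    B D = ((p.A⁻¹ : Rˣ) : R) • B D₀ + (p.A : R) • B D₁
  precrossing_true : ∀ (D D₀ D₁ : OMixedDiagram Colour) (u v : List (Slice Colour))
    (l r : List Colour), D.word = u ++ [⟨l, .pre .moving .moving true, r⟩] ++ v →
    D₀.word = u ++ v → D₁.word = u ++ horizontal l r ++ v →
    B D = p.V • B D₀ + p.H • B D₁
  precrossing_false : ∀ (D D₀ D₁ : OMixedDiagram Colour) (u v : List (Slice Colour))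
    (l r : List Colour), D.word = u ++ [⟨l, .pre .moving .moving false, r⟩] ++ v →
    D₀.word = u ++ v → D₁.word = u ++ horizontal l r ++ v →
    B D = p.H • B D₀ + p.V • B D₁
  loop : ∀ (D D₀ : OMixedDiagram Colour) (u v : List (Slice Colour)) (l r : List Colour),
    D.word = u ++ [⟨l, .cup .moving, r⟩, ⟨l, .cap .moving, r⟩] ++ v → D₀.word = u ++ v →
    B D = p.d • B D₀
  essential : ∀ (D : OMixedDiagram Colour) (k : ℕ), 1 ≤ k → D.word = hopfWord k → B D = v k
  unknot : ∀ D : OMixedDiagram Colour, D.word = unknotWord → B D = v 0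
  skein_module : ∀ M M' : OMixedDiagram OStrand, (∀ s ∈ M.word, s.gen.isPre = false) →
    (∀ s ∈ M'.word, s.gen.isPre = false) → OMixedRegularIsotopy M M' → B M.forget = B M'.forget

theorem colourWord_self (w : List (Slice Colour)) : colourWord w = w := by
  have h : (StrandLabel.colour : Colour → Colour) = id := rfl
  induction w with
  | nil => rfl
  | cons s w ih =>
    obtain ⟨l, g, r⟩ := s
    cases g <;> simp [ih, Gen.map, h]

namespace EvalData

variable {K : Type*} [Field K] {e : EvalData K}

theorem oEq_of_tStep {P : Gen Colour → Prop} {a b : List Colour} {w w' : List (Slice Colour)}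
    (h : TStep P a b w w') : e.OEq a b w w' := by
  have tr : ∀ {a b : List Colour} {w : List (Slice Colour)}, Tg P a w b →
      Tg (fun _ => True) a w b := fun h => .of_isTangle h.isTangle fun _ _ => trivial
  obtain ⟨h1, h2, -, u, v, x, y, rfl, rfl, hm⟩ := h
  replace h1 := tr h1
  replace h2 := tr h2
  refine ⟨h1, h2, fun φ t ht => ?_⟩
  rw [List.append_assoc] at h1 h2
  obtain ⟨c, hu, h1⟩ := h1.split
  obtain ⟨c', hu', h2⟩ := h2.split
  obtain rfl := hu.cod_eq hu'
  obtain ⟨f, hx, -⟩ := h1.split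
  obtain ⟨f', hy, -⟩ := h2.split
  simp only [wordOp_append]
  rw [colourWord_self, colourWord_self] at hm
  exact wordOp_congr hu (fun t ht => wordOp_move hm hx hy _ ht) ht

theorem oEq_of_tEq {P : Gen Colour → Prop} {a b : List Colour} {w w' : List (Slice Colour)}
    (h : TEq P a b w w') : e.OEq a b w w' := by
  obtain ⟨h1, h2, h⟩ := h
  -- The reflexive case of the generated relation carries no typing, so equality of words is kept as
  -- a separate alternative.
  have key : ∀ {w w' : List (Slice Colour)}, Relation.EqvGen (TStep P a b) w w' →
      w = w' ∨ e.OEq a b w w' := by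
    intro w w' h
    induction h with
    | rel _ _ h => exact .inr (oEq_of_tStep h)
    | refl _ => exact .inl rfl
    | symm _ _ _ ih => exact ih.imp Eq.symm OEq.symm
    | trans _ _ _ _ _ ih1 ih2 =>
      rcases ih1 with rfl | h1
      · exact ih2
      · rcases ih2 with rfl | h2
        · exact .inr h1
        · exact .inr (h1.trans h2)
  rcases key h with rfl | h
  · have := Tg.of_isTangle (P := fun _ => True) h1.isTangle fun _ _ => trivial
    exact ⟨this, this, fun _ _ _ => rfl⟩
  · exact h

variable (e)

/-- The evaluation of a closed diagram. -/
def eval (M : OMixedDiagram Colour) : K := e.wordOp M.word (fun _ => 1) []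

variable {e}

theorem eval_eq_of_move {M M' : OMixedDiagram Colour} {u v x y : List (Slice Colour)}
    (h : M.word = u ++ x ++ v) (h' : M'.word = u ++ y ++ v) (hm : BasicMove x y) :
    e.eval M = e.eval M' := by
  have h1 := Tg.of_isTangle (P := fun _ => True) M.closed fun _ _ => trivial
  have h2 := Tg.of_isTangle (P := fun _ => True) M'.closed fun _ _ => trivial
  rw [h, List.append_assoc] at h1
  rw [h', List.append_assoc] at h2
  obtain ⟨c, hu, h1⟩ := h1.split
  obtain ⟨c', hu', h2⟩ := h2.split
  obtain rfl := hu.cod_eq hu'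
  obtain ⟨f, hx, -⟩ := h1.split
  obtain ⟨f', hy, -⟩ := h2.split
  simp only [eval, h, h', wordOp_append]
  exact wordOp_congr hu (fun t ht => wordOp_move hm hx hy _ ht) trivial

theorem eval_forget_eq {M M' : OMixedDiagram OStrand} (h : OMixedRegularIsotopy M M') :
    e.eval M.forget = e.eval M'.forget := by
  induction h with
  | rel M M' h =>
    obtain ⟨u, v, x, y, h1, h2, hm⟩ := h
    refine eval_eq_of_move (u := forgetWord u) (v := forgetWord v) ?_ ?_ hm
    · simp [OMixedDiagram.forget, h1, forgetWord]
    · simp [OMixedDiagram.forget, h2, forgetWord]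
  | refl _ => rfl
  | symm _ _ _ ih => exact ih.symm
  | trans _ _ _ _ _ ih1 ih2 => exact ih1.trans ih2

theorem eval_expand {M M₀ M₁ : OMixedDiagram Colour} {u v w₀ w₁ : List (Slice Colour)}
    {s : Slice Colour} {x y : K} (h : M.word = u ++ [s] ++ v) (h₀ : M₀.word = u ++ w₀ ++ v)
    (h₁ : M₁.word = u ++ w₁ ++ v) (hs : e.Expands s.dom [s] x y w₀ w₁) :
    e.eval M = x * e.eval M₀ + y * e.eval M₁ := by
  have h1 := Tg.of_isTangle (P := fun _ => True) M.closed fun _ _ => trivial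
  rw [h, List.append_assoc] at h1
  obtain ⟨c, hu, h1⟩ := h1.split
  obtain ⟨rfl, -⟩ := h1
  simp only [eval, h, h₀, h₁]
  exact (hs.ctx hu v) _ _ trivial

theorem wordOp_loop (l r : List Colour) (φ : List ℕ → K) {t : List ℕ} {c : List Colour}
    (ht : e.Adm (l ++ c) t) :
    e.wordOp [⟨l, .cup .moving, r⟩, ⟨l, .cap .moving, r⟩] φ t =
      (-e.A ^ 2 - (e.A ^ 2)⁻¹) * φ t := by
  obtain ⟨s, t, rfl, hs, -⟩ := adm_append.1 ht
  have h := e.wordOp_pad [] [⟨[], .cup .moving, r⟩, ⟨[], .cap .moving, r⟩] φ t hs.length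
  simp only [wpad_cons, wpad_nil, List.append_nil] at h
  rw [h]
  simp [row, capCoeff]
  ring

/-- Smoothing rules are built into the rows of the crossings, the loop rule is a computation, and
invariance is `eval_forget_eq`. The values on basic words are left unevaluated here and computed
below. -/
theorem isBracket_eval {R : Type} [CommRing R] [Algebra R K] (p : BracketData R)
    (hA : algebraMap R K p.A = e.A) (hV : algebraMap R K p.V = e.V)
    (hH : algebraMap R K p.H = e.H) :
    IsBracket p (fun k => e.wordOp (if k = 0 then unknotWord else hopfWord k) (fun _ => 1) [])
      e.eval := by
  have hA' : algebraMap R K ((p.A⁻¹ : Rˣ) : R) = e.A⁻¹ := by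
    refine eq_inv_of_mul_eq_one_left ?_
    rw [← hA, ← map_mul]
    simp
  have ex : ∀ {g : Gen Colour} {x y : K} (hg : g.dom = [.moving, .moving]) (l r : List Colour),
      e.Expands (l ++ .moving :: .moving :: r) [⟨l, g, r⟩] x y [] (horizontal l r) →
      e.Expands (Slice.dom ⟨l, g, r⟩) [⟨l, g, r⟩] x y [] (horizontal l r) := by
    intro g x y hg l r h
    simpa [Slice.dom, hg] using h
  constructor
  · intro D D₀ D₁ u v l r h h₀ h₁
    simp only [Algebra.smul_def, hA, hA']
    exact eval_expand h (by simpa using h₀) h₁ (ex rfl l r (expands_cross_true l r))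
  · intro D D₀ D₁ u v l r h h₀ h₁
    simp only [Algebra.smul_def, hA, hA']
    exact eval_expand h (by simpa using h₀) h₁ (ex rfl l r (expands_cross_false l r))
  · intro D D₀ D₁ u v l r h h₀ h₁
    simp only [Algebra.smul_def, hV, hH]
    exact eval_expand h (by simpa using h₀) h₁ (ex rfl l r (expands_pre_true l r))
  · intro D D₀ D₁ u v l r h h₀ h₁
    simp only [Algebra.smul_def, hV, hH]
    exact eval_expand h (by simpa using h₀) h₁ (ex rfl l r (expands_pre_false l r))
  · intro D D₀ u v l r h h₀
    have hd : algebraMap R K p.d = -e.A ^ 2 - (e.A ^ 2)⁻¹ := by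
      simp [BracketData.d, hA, hA']
    rw [Algebra.smul_def, hd]
    have h1 := Tg.of_isTangle (P := fun _ => True) D.closed fun _ _ => trivial
    rw [h, List.append_assoc] at h1
    obtain ⟨c, hu, h1⟩ := h1.split
    obtain ⟨rfl, -⟩ := h1
    have h2 := wordOp_linear (e := e) u (-e.A ^ 2 - (e.A ^ 2)⁻¹) 0 (e.wordOp v fun _ => 1)
      (fun _ => 0) []
    simp only [zero_mul, add_zero] at h2
    simp only [eval, h, h₀, wordOp_append]
    rw [← h2]
    exact wordOp_congr hu (fun t ht => wordOp_loop l r _ (c := r)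
      (by simpa [Slice.dom, Gen.dom] using ht)) trivial
  · intro D k hk h
    simp [eval, h, show k ≠ 0 by omega]
  · intro D h
    simp [eval, h]
  · intro M M' _ _ h
    exact eval_forget_eq h

/-! ### The values of the basic diagrams -/

/-- The value of `O`. -/
def ringValue (e : EvalData K) : K :=
  ∑ i ∈ Finset.range (e.n + 1), (-e.A ^ 2) ^ (e.n - i) * ((-e.A ^ 2) ^ i)⁻¹

/-- The factor contributed by a circle around a strand of `O`. -/
def circleValue (e : EvalData K) : K := -(e.A ^ (2 * e.n + 2) + (e.A ^ (2 * e.n + 2))⁻¹)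

theorem wordOp_unknotWord :
    e.wordOp unknotWord (fun _ => 1) [] = e.ringValue * (-e.A ^ 2 - (e.A ^ 2)⁻¹) := by
  have h2 : e.wordOp [⟨[], .cup .moving, []⟩, ⟨[], .cap .moving, []⟩] (fun _ => 1) =
      fun _ => (-e.A ^ 2 - (e.A ^ 2)⁻¹) := by
    funext t
    simp [row, capCoeff]
    ring
  have : unknotWord = [⟨[], .cup .fixed, []⟩, ⟨[], .cap .fixed, []⟩] ++
    [⟨[], .cup .moving, []⟩, ⟨[], .cap .moving, []⟩] := rfl
  rw [this, wordOp_append, h2]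
  simp only [wordOp_cons, wordOp_nil, sliceOp_cup, row, List.map_map, Function.comp_def,
    sum_map_range, ringValue, Finset.sum_mul]
  refine Finset.sum_congr rfl fun i hi => ?_
  simp at hi
  simp [row]
  rw [if_pos (by omega)]
  ring

/-- A moving circle around a strand of `O`. -/
def circleWord : List (Slice Colour) :=
  [⟨[.fixed], .cup .moving, []⟩, ⟨[], .cross .fixed .moving true, [.moving]⟩,
    ⟨[], .cross .moving .fixed true, [.moving]⟩, ⟨[.fixed], .cap .moving, []⟩]

/-- Schur's lemma in coordinates: the choice of `raise` makes the contribution of the exchanged unit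
compensate the change of weight, so the scalar does not depend on the state `i`. -/
theorem wordOp_circleWord (φ : List ℕ → K) (i : ℕ) (t : List ℕ) :
    e.wordOp circleWord φ (i :: t) = e.circleValue * φ (i :: t) := by
  have hA := e.A_ne
  simp only [circleWord]
  obtain _ | i := i
  · simp [row, capCoeff, wt_zero, raise, circleValue]
    field_simp
    ring
  · have := e.wt_ne i
    simp [row, capCoeff, wt_succ, raise, circleValue]
    field_simp
    ring

theorem expands_circleWord (a r : List Colour) :
    e.Expands (a ++ .fixed :: r) (wpad a circleWord r) e.circleValue 0 [] [] := by
  intro φ t ht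
  obtain ⟨s, t, rfl, hs, ht⟩ := adm_append.1 ht
  obtain ⟨q, t, rfl, hq, -⟩ := adm_append (a := [.fixed]).1 ht
  obtain ⟨i, rfl, -⟩ := adm_one hq
  have h := e.wordOp_pad r circleWord φ ([i] ++ t) hs.length
  rw [h]
  simp only [List.cons_append, List.nil_append]
  rw [wordOp_circleWord]
  simp

/-- Moving circles around a strand of `O` on the left. -/
def parallelCircles (a : List Colour) : List (Slice Colour) :=
  wpad [.fixed] (nestedCups [] [] a) [] ++ wpad [] (loopAround a) (bar a) ++
    wpad [.fixed] (nestedCaps [] [] a) []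

theorem full_true : Full fun _ : Gen Colour => True := fun _ _ => trivial

/-- The innermost circle is isolated: `O` passes over the outer strands, meets only this circle, and
returns under the outer strands. -/
theorem tEq_parallelCircles {a : List Colour} (ha : Mv a) :
    TEq (fun _ => True) [.fixed] [.fixed] (parallelCircles (a ++ [.moving]))
      (wpad [.fixed] (nestedCups [] [] a) [] ++
        (wpad [] (passRight Colour.fixed true a) (bar a) ++ wpad a circleWord (bar a) ++
          wpad [] (passLeft Colour.fixed false a) (bar a)) ++ wpad [.fixed] (nestedCaps [] [] a) []) := by
  have t1 := (Tg_nestedCups full_true.bends a).padL [.fixed]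
  have t2 := (Tg_nestedCaps full_true.bends a).padL [.fixed]
  have p1 := Tg_passRight (full_true.crosses Colour.fixed) (ha.mayCross _) true
  have p2 := Tg_passLeft (full_true.crosses Colour.fixed) (ha.mayCross _) false
  have c1 : Tg (fun _ => True) (bar a) [⟨[], .cup .moving, bar a⟩]
      (.moving :: .moving :: bar a) := by simp [Tg, Slice.dom, Slice.cod, Gen.dom, Gen.cod, Gen.Valid]
  have c2 : Tg (fun _ => True) (.moving :: .moving :: bar a) [⟨[], .cap .moving, bar a⟩]
      (bar a) := by simp [Tg, Slice.dom, Slice.cod, Gen.dom, Gen.cod, Gen.Valid]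
  have i1 := (TEq.interchange p1 c1).symm
  have i2 := TEq.interchange p2 c2
  have q : Tg (fun _ => True) (a ++ .fixed :: .moving :: .moving :: bar a)
      [⟨a, .cross .fixed .moving true, .moving :: bar a⟩,
        ⟨a, .cross .moving .fixed true, .moving :: bar a⟩]
      (a ++ .fixed :: .moving :: .moving :: bar a) := by
    simp [Tg, Slice.dom, Slice.cod, Gen.dom, Gen.cod, Gen.Valid]
  have e1 := TEq.comp i1 (TEq.compL (by simpa using q) i2)
  have e2 := TEq.ctx (by simpa using t1) e1 (by simpa using t2)
  simpa [parallelCircles, loopAround, passRight_append, passLeft_append, passRight, passLeft,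
    nestedCups_append, nestedCaps_append, nestedCups, nestedCaps, circleWord,
    StrandLabel.fixedStrand] using e2

/-- The innermost circle acts as a scalar and can be removed, which leaves one circle fewer. -/
theorem wordOp_parallelCircles (k : ℕ) (φ : List ℕ → K) {t : List ℕ} (ht : e.Adm [.fixed] t) :
    e.wordOp (parallelCircles (List.replicate k .moving)) φ t = e.circleValue ^ k * φ t := by
  induction k generalizing φ t with
  | zero =>
    simp [parallelCircles, nestedCups, nestedCaps, loopAround, passRight, passLeft]
  | succ k ih =>
    have ha : Mv (List.replicate k Colour.moving) := by
      intro x hx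
      rw [List.eq_of_mem_replicate hx]
      rfl
    have h1 := oEq_of_tEq (e := e) (tEq_parallelCircles ha)
    set a := List.replicate k Colour.moving with hka
    have t1 := (Tg_nestedCups full_true.bends a).padL [.fixed]
    have p1 := (Tg_passRight (full_true.crosses Colour.fixed) (ha.mayCross _) true).padR (bar a)
    have tu : Tg (fun _ => True) [.fixed] (wpad [.fixed] (nestedCups [] [] a) [] ++
        wpad [] (passRight Colour.fixed true a) (bar a)) (a ++ .fixed :: bar a) := by
      simpa using Tg.append (by simpa using t1) p1
    have h2 := (expands_circleWord (e := e) a (bar a)).ctx tu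
      (wpad [] (passLeft Colour.fixed false a) (bar a) ++ wpad [.fixed] (nestedCaps [] [] a) [])
    rw [List.replicate_succ', h1.2.2 _ _ ht, pow_succ, mul_comm _ e.circleValue, mul_assoc,
      ← ih φ ht]
    simpa [parallelCircles, loopAround, StrandLabel.fixedStrand] using h2 φ t ht

theorem tEq_hopfWord (k : ℕ) : TEq (fun _ => True) [] [] (hopfWord k)
    (⟨[], .cup .fixed, []⟩ :: wpad [.fixed] (parallelCircles (List.replicate k .moving)) [] ++
      [⟨[], .cap .fixed, []⟩]) := by
  have ha : Mv (List.replicate k Colour.moving) := by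
    intro x hx
    rw [List.eq_of_mem_replicate hx]
    rfl
  simp only [hopfWord]
  set a := List.replicate k Colour.moving with hka
  have t1 := Tg_nestedCups full_true.bends a
  have t2 := Tg_nestedCaps full_true.bends a
  have t3 := (Tg_loopAround full_true ha).pad [.fixed] (bar a)
  have c1 : Tg (fun _ => True) [] [⟨[], .cup .fixed, []⟩] [Colour.fixed, .fixed] := by
    simp [Tg, Slice.dom, Slice.cod, Gen.dom, Gen.cod, Gen.Valid]
  have c2 : Tg (fun _ => True) [Colour.fixed, .fixed] [⟨[], .cap .fixed, []⟩] [] := by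
    simp [Tg, Slice.dom, Slice.cod, Gen.dom, Gen.cod, Gen.Valid]
  have i1 := (TEq.interchange c1 t1).symm
  have i2 := (TEq.interchange c2 t2)
  have e1 := TEq.comp i1 (TEq.compL (by simpa [StrandLabel.fixedStrand] using t3) i2)
  simpa [mixedWord, ring_eq_wpad, encircle, parallelCircles, StrandLabel.fixedStrand] using e1

theorem wordOp_hopfWord (k : ℕ) :
    e.wordOp (hopfWord k) (fun _ => 1) [] = e.ringValue * e.circleValue ^ k := by
  rw [(oEq_of_tEq (e := e) (tEq_hopfWord k)).2.2 _ [] trivial]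
  simp only [List.cons_append, wordOp_cons, wordOp_append, wordOp_nil, sliceOp_cup, row,
    List.map_map, Function.comp_def, sum_map_range, ringValue, Finset.sum_mul]
  refine Finset.sum_congr rfl fun i hi => ?_
  simp only [Finset.mem_range] at hi
  have h := e.wordOp_pad (l := [.fixed]) [] (parallelCircles (List.replicate k .moving))
    (e.sliceOp ⟨[], .cap .fixed, []⟩ fun _ => 1) (x := [i]) [e.n - i] rfl
  have h' : e.Adm [.fixed] [e.n - i] := by simp [Adm, top]
  simp only [List.cons_append, List.nil_append, List.append_nil] at h ⊢
  rw [h, wordOp_parallelCircles k _ h']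
  simp [row]
  rw [if_pos (by omega)]
  ring

/-- Up to a unit, the value of `O` is a geometric sum in `A ^ 4` with `n + 1` terms. -/
theorem ringValue_ne (h : e.A ^ (4 * (e.n + 1)) ≠ 1) : e.ringValue ≠ 0 := by
  have hu : (-e.A ^ 2) ≠ 0 := by simpa using e.A_ne
  have h1 : e.ringValue * (e.A ^ 4 - 1) * (-e.A ^ 2) ^ e.n = e.A ^ (4 * (e.n + 1)) - 1 := by
    have h2 := geom_sum_mul (e.A ^ 4) (e.n + 1)
    rw [pow_mul, ← h2, ← Finset.sum_range_reflect]
    simp only [ringValue, Finset.sum_mul]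
    refine Finset.sum_congr rfl fun i hi => ?_
    simp only [Finset.mem_range] at hi
    obtain ⟨j, hj⟩ : ∃ j, e.n = i + j := ⟨e.n - i, by omega⟩
    rw [show e.n + 1 - 1 - i = j by omega, show e.n - i = j by omega, hj, pow_add,
      show e.A ^ 4 = (-e.A ^ 2) * (-e.A ^ 2) by ring, mul_pow]
    field_simp
  intro h0
  rw [h0] at h1
  exact h (by linear_combination -h1)

end EvalData


/-! # Rotation of a maximum of an annular diagram -/

/-- Pieces other than precrossings and crossings of the moving part. -/
def Planar : Gen Colour → Prop
  | .cross .moving .moving _ => False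
  | .pre _ _ _ => False
  | _ => True

theorem Planar.bends : Bends Planar := fun x => by cases x <;> exact ⟨trivial, trivial⟩

theorem Planar.crosses : Crosses Planar Colour.fixed := fun x _ => by
  cases x <;> exact ⟨trivial, trivial⟩

theorem tg_cup (l r : List Colour) (x : Colour) :
    Tg Planar (l ++ r) [⟨l, .cup x, r⟩] (l ++ x :: x :: r) :=
  ⟨by simp [Slice.dom, Gen.dom], ⟨trivial, (Planar.bends x).1⟩, by simp [Slice.cod, Gen.cod, Tg]⟩

theorem tg_cap (l r : List Colour) (x : Colour) :
    Tg Planar (l ++ x :: x :: r) [⟨l, .cap x, r⟩] (l ++ r) :=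
  ⟨by simp [Slice.dom, Gen.dom], ⟨trivial, (Planar.bends x).2⟩, by simp [Slice.cod, Gen.cod, Tg]⟩

theorem tg_encircle {a : List Colour} (ha : Mv a) : Tg Planar a (encircle a) a := by
  have h1 := (Tg_passRight Planar.crosses (ha.mayCross _) true).padL [.fixed]
  have h2 := (Tg_passLeft Planar.crosses (ha.mayCross _) false).padL [.fixed]
  have h3 := (tg_cup [] a .fixed).append (h1.append (h2.append (tg_cap [] a .fixed)))
  simpa [encircle, loopAround, StrandLabel.fixedStrand] using h3

/-- A moving tangle passes through a ring. -/
theorem TEq.encircle_word {a b : List Colour} {w : List (Slice Colour)} (ha : Mv a)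
    (hw : Tg Planar a w b) (hM : MvW w) :
    TEq Planar a b (encircle a ++ w) (w ++ encircle b) := by
  have hb : Mv b := hw.mv_cod ha hM
  have c1 : ∀ r, Tg Planar r [⟨[], .cup .fixed, r⟩] (.fixed :: .fixed :: r) :=
    fun r => tg_cup [] r .fixed
  have c2 : ∀ r, Tg Planar (.fixed :: .fixed :: r) [⟨[], .cap .fixed, r⟩] r :=
    fun r => tg_cap [] r .fixed
  have rA := (Tg_passRight Planar.crosses (ha.mayCross _) true).padL [.fixed]
  have lA := (Tg_passLeft Planar.crosses (ha.mayCross _) false).padL [.fixed]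
  have rB := (Tg_passRight Planar.crosses (hb.mayCross _) true).padL [.fixed]
  have lB := (Tg_passLeft Planar.crosses (hb.mayCross _) false).padL [.fixed]
  have i1 := TEq.interchange (c1 []) hw
  have i2 := TEq.interchange (c2 []) hw
  have p1 := (TEq.passRight_word Planar.crosses true hw (.inr ⟨ha, hM⟩)).symm.padL [.fixed]
  have p2 := (TEq.passLeft_word Planar.crosses false hw (.inr ⟨ha, hM⟩)).symm.padL [.fixed]
  have e1 := TEq.compL ((c1 a).append (rA.append lA)) i2
  have e2 := TEq.compL ((c1 a).append rA) (TEq.compR p2 (c2 b))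
  have e3 := TEq.compL (c1 a) (TEq.compR p1 (lB.append (c2 b)))
  have e4 := TEq.compR i1 (rB.append (lB.append (c2 b)))
  simp at e1 e2 e3 e4
  simpa [encircle, loopAround, StrandLabel.fixedStrand] using e1.trans (e2.trans (e3.trans e4))

theorem TEq.zigzag_moving (l r : List Colour) : TEq Planar (l ++ .moving :: r) (l ++ .moving :: r)
    [⟨l ++ [.moving], .cup .moving, r⟩, ⟨l, .cap .moving, .moving :: r⟩] [] := by
  simpa using (TEq.zigzagLeft (P := Planar) (x := Colour.moving) rfl trivial trivial).pad l r

/-- The maximum joins two of the nested minima into one arc, whose ends are their two right ends;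
the arc straightens to a single minimum on the returning strands. -/
theorem TEq.nestedCups_cap (l r : List Colour) :
    TEq Planar [] (l ++ r ++ bar (l ++ .moving :: .moving :: r))
      (nestedCups [] [] (l ++ .moving :: .moving :: r) ++
        [⟨l, .cap .moving, r ++ bar (l ++ .moving :: .moving :: r)⟩])
      (nestedCups [] [] (l ++ r) ++ [⟨l ++ r ++ bar r, .cup .moving, bar l⟩]) := by
  have tr := Tg_nestedCups Planar.bends r
  have c1 := tg_cap [] [] .moving
  have c2 := tg_cup [] [] .moving
  have i1 := (TEq.interchange c1 (tr.padR [.moving, .moving])).symm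
  have z := TEq.compL c2 (TEq.zigzag_moving [] [.moving])
  have i2 := (TEq.interchange tr c2).symm
  have e1 := TEq.compL (c2.append (tg_cup [.moving] [.moving] .moving)) i1
  have e2 := TEq.compR z (tr.padR [.moving, .moving])
  simp at e1 e2 i2
  have e4 := (e1.trans (e2.trans i2)).pad l (bar l)
  rw [List.append_nil] at e4
  have e3 := TEq.compL (by simpa using Tg_nestedCups Planar.bends l) e4
  have h1 : l ++ .moving :: .moving :: r = l ++ ([.moving, .moving] ++ r) := rfl
  rw [h1, nestedCups_append, nestedCups_append, nestedCups_append, nestedCups_eq_wpad ([] ++ l),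
    nestedCups_eq_wpad ([] ++ l ++ _), nestedCups_eq_wpad ([] ++ l)]
  simpa [bar_append, nestedCups] using e3

theorem TEq.cup_nestedCaps (l r : List Colour) :
    TEq Planar (l ++ .moving :: .moving :: r ++ bar (l ++ r)) []
      ([⟨l ++ .moving :: .moving :: r ++ bar r, .cup .moving, bar l⟩] ++
        nestedCaps [] [] (l ++ .moving :: .moving :: r))
      ([⟨l, .cap .moving, r ++ bar (l ++ r)⟩] ++ nestedCaps [] [] (l ++ r)) := by
  have tr := Tg_nestedCaps Planar.bends r
  have c1 := tg_cap [] [] .moving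
  have c2 := tg_cup [] [] .moving
  have i1 := (TEq.interchange tr c2).symm.padL [.moving, .moving]
  have z := TEq.compR (TEq.zigzag_moving [.moving] []) c1
  have i2 := (TEq.interchange c1 tr).symm
  have e1 := TEq.compR i1 ((tg_cap [.moving] [.moving] .moving).append c1)
  have e2 := TEq.compL (tr.padL [.moving, .moving]) z
  simp at e1 e2 i2
  have e4 := (e1.trans (e2.trans i2)).pad l (bar l)
  rw [List.append_nil] at e4
  have e3 := TEq.compR e4 (by simpa using Tg_nestedCaps Planar.bends l)
  have h1 : l ++ .moving :: .moving :: r = l ++ ([.moving, .moving] ++ r) := rfl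
  rw [h1, nestedCaps_append, nestedCaps_append, nestedCaps_append, nestedCaps_eq_wpad ([] ++ l),
    nestedCaps_eq_wpad ([] ++ l ++ _), nestedCaps_eq_wpad ([] ++ l)]
  simpa [bar_append, nestedCaps] using e3

/-- A maximum at the bottom of an annular word is rotated to the top. -/
theorem TEq.rotate_cap {l r : List Colour} {w : List (Slice Colour)} (hl : Mv l) (hr : Mv r)
    (hw : Tg Planar (l ++ r) w (l ++ .moving :: .moving :: r)) (hM : MvW w) :
    TEq Planar [] [] (mixedWord (l ++ .moving :: .moving :: r) (⟨l, .cap .moving, r⟩ :: w))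
      (mixedWord (l ++ r) (w ++ [⟨l, .cap .moving, r⟩])) := by
  set a := l ++ .moving :: .moving :: r with ha
  have mb : Mv (l ++ r) := by simp [hl, hr]
  have ma : Mv a := by simp [ha, hl, hr]
  have tc : Tg Planar a [⟨l, .cap .moving, r⟩] (l ++ r) := tg_cap l r .moving
  -- The maximum is pulled down through the ring, becomes a minimum on the returning strands (`b1`),
  -- slides up beside the ring and `w` (`i3`), and becomes a maximum again at the top (`b2`).
  have e1 := (TEq.encircle_word ma tc (by simp [MvW, Slice.dom, Slice.cod, Gen.dom, Gen.cod, hl, hr])).padR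
    (bar a)
  have tY := (tg_encircle mb).append hw
  have tσ : Tg Planar (bar (l ++ r)) [⟨bar r, .cup .moving, bar l⟩] (bar a) := by
    have := tg_cup (bar r) (bar l) .moving
    simpa [ha, bar_append] using this
  have i3 := (TEq.interchange tY tσ).symm
  have tA := Tg_nestedCaps Planar.bends a
  have b1 := TEq.nestedCups_cap l r
  have b2 := TEq.cup_nestedCaps l r
  rw [← ha] at b1 b2
  have f1 := TEq.compL (Tg_nestedCups Planar.bends a) (TEq.compR e1 ((hw.padR (bar a)).append tA))
  have f2 := TEq.compR b1 ((tY.padR (bar a)).append tA)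
  have f3 := TEq.compL (Tg_nestedCups Planar.bends (l ++ r)) (TEq.compR i3 tA)
  have f4 := TEq.compL (Tg_nestedCups Planar.bends (l ++ r)) (TEq.compL (tY.padR (bar (l ++ r))) b2)
  simp [bar_append] at f1 f2 f3 f4
  simpa [mixedWord, ring_eq_wpad, map_addRight_eq_wpad, bar_append, Slice.addRight] using
    f1.trans (f2.trans (f3.trans f4))


/-! # Alternating orientations -/

/-- The oriented strand of a given colour; moving strands are directed downwards if `b = true`. -/
def orient : Bool → Colour → OStrand
  | false, .moving => .up
  | true, .moving => .down
  | _, .fixed => .fixed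

/-- The parity of the number of moving strands, added to `b`. -/
def parity : Bool → List Colour → Bool
  | b, [] => b
  | b, .moving :: a => parity (!b) a
  | b, .fixed :: a => parity b a

/-- Moving strands are oriented alternately. -/
def alternate : Bool → List Colour → List OStrand
  | _, [] => []
  | b, c :: a => orient b c :: alternate (parity b [c]) a

theorem parity_append (b : Bool) (u v : List Colour) :
    parity b (u ++ v) = parity (parity b u) v := by
  induction u generalizing b with
  | nil => rfl
  | cons c u ih => cases c <;> simp [parity, ih]

theorem alternate_append (b : Bool) (u v : List Colour) :
    alternate b (u ++ v) = alternate b u ++ alternate (parity b u) v := by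
  induction u generalizing b with
  | nil => rfl
  | cons c u ih => cases c <;> simp [parity, alternate, ih]

theorem map_colour_alternate (b : Bool) (u : List Colour) :
    (alternate b u).map OStrand.colour = u := by
  induction u generalizing b with
  | nil => rfl
  | cons c u ih => cases c <;> cases b <;> simp [alternate, ih, orient, OStrand.colour]

/-- Alternating orientation of a piece. -/
def Gen.alternate (b : Bool) : Gen Colour → Gen OStrand
  | .cup x => .cup (orient b x)
  | .cap x => .cap (orient b x)
  | .cross x y o => .cross (orient b x) (orient (parity b [x]) y) o
  | .pre x y m => .pre (orient b x) (orient (parity b [x]) y) m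

/-- Alternating orientation of a slice. -/
def Slice.alternate (s : Slice Colour) : Slice OStrand :=
  ⟨_root_.alternate false s.left, s.gen.alternate (parity false s.left),
    _root_.alternate (parity false (s.left ++ s.gen.dom)) s.right⟩

theorem orient_colour (b : Bool) (c : Colour) : (orient b c).colour = c := by
  cases b <;> cases c <;> rfl

theorem Slice.map_colour_alternate (s : Slice Colour) : s.alternate.map OStrand.colour = s := by
  obtain ⟨l, g, r⟩ := s
  cases g <;> simp [Slice.alternate, Slice.map, Gen.alternate, Gen.map, orient_colour,
    _root_.map_colour_alternate]

theorem Gen.parity_dom (g : Gen Colour) (b : Bool) : parity b g.dom = parity b g.cod := by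
  rcases g with x | x | ⟨x, y, o⟩ | ⟨x, y, m⟩
  · cases x <;> simp [Gen.dom, Gen.cod, parity]
  · cases x <;> simp [Gen.dom, Gen.cod, parity]
  · cases x <;> cases y <;> simp [Gen.dom, Gen.cod, parity]
  · cases x <;> cases y <;> simp [Gen.dom, Gen.cod, parity]

theorem Gen.dom_alternate (g : Gen Colour) (b : Bool) :
    (g.alternate b).dom = _root_.alternate b g.dom := by
  rcases g with x | x | ⟨x, y, o⟩ | ⟨x, y, m⟩
  · rfl
  · cases x <;> cases b <;> rfl
  · rfl
  · rfl

/-- The ends of an extremum are neighbours with opposite directions, and a mixed crossing does not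
change the order of the moving strands. A crossing of two moving strands would destroy the
alternation; hence the restriction to `Planar`. -/
theorem Gen.cod_alternate {g : Gen Colour} (hg : Planar g) (b : Bool) :
    (g.alternate b).cod = _root_.alternate b g.cod := by
  rcases g with x | x | ⟨x, y, o⟩ | ⟨x, y, m⟩
  · cases x <;> cases b <;> rfl
  · rfl
  · cases x <;> cases y
    · exact hg.elim
    · cases b <;> rfl
    · cases b <;> rfl
    · cases b <;> rfl
  · exact hg.elim

theorem Slice.dom_alternate (s : Slice Colour) : s.alternate.dom = _root_.alternate false s.dom := by
  simp [Slice.alternate, Slice.dom, Gen.dom_alternate, alternate_append, parity_append]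

theorem Slice.cod_alternate {s : Slice Colour} (hs : Planar s.gen) :
    s.alternate.cod = _root_.alternate false s.cod := by
  simp [Slice.alternate, Slice.cod, Gen.cod_alternate hs, alternate_append, parity_append,
    Gen.parity_dom]

/-- Alternating orientation of a word. -/
def alternateWord (w : List (Slice Colour)) : List (Slice OStrand) := w.map Slice.alternate

theorem forgetWord_alternateWord (w : List (Slice Colour)) : forgetWord (alternateWord w) = w := by
  simp [forgetWord, alternateWord, Function.comp_def, Slice.map_colour_alternate]

theorem isTangle_alternateWord {a b : List Colour} {w : List (Slice Colour)}
    (h : Tg Planar a w b) : IsTangle (alternate false a) (alternateWord w) (alternate false b) := by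
  induction w generalizing a with
  | nil => exact congrArg _ h
  | cons s w ih =>
    obtain ⟨rfl, ⟨hv, hp⟩, hw⟩ := h
    refine ⟨s.dom_alternate.symm, ?_, ?_⟩
    · obtain ⟨l, g, r⟩ := s
      rcases g with x | x | ⟨x, y, o⟩ | ⟨x, y, m⟩
      · trivial
      · trivial
      · cases x <;> cases y
        · exact hp.elim
        · exact .inl (orient_colour _ _)
        · exact .inr (orient_colour _ _)
        · exact absurd hv (by simp [Gen.Valid])
      · exact hp.elim
    · rw [Slice.cod_alternate hp]
      exact ih hw

theorem isPre_alternate {s : Slice Colour} (h : Planar s.gen) : s.alternate.gen.isPre = false := by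
  obtain ⟨l, g, r⟩ := s
  cases g <;> first | rfl | exact h.elim

/-- A diagram without precrossings and crossings of its moving part, with the alternating
orientation. -/
def OMixedDiagram.alternate (M : OMixedDiagram Colour) (h : ∀ s ∈ M.word, Planar s.gen) :
    OMixedDiagram OStrand where
  word := alternateWord M.word
  closed := isTangle_alternateWord (.of_isTangle M.closed h)
  one_circle := by
    rw [alternateWord, List.countP_map, ← M.one_circle]
    congr 1
    funext s
    obtain ⟨l, g, r⟩ := s
    cases g <;> simp [Slice.alternate, Gen.alternate, Gen.isFixedCup, StrandLabel.colour,
      orient_colour]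
  moving_nonempty := by
    obtain ⟨s, hs, x, hx, hm⟩ := M.moving_nonempty
    refine ⟨s.alternate, List.mem_map_of_mem hs, ?_⟩
    rw [Slice.cod_alternate (h s hs)]
    rw [← map_colour_alternate false s.cod] at hx
    obtain ⟨y, hy, rfl⟩ := List.mem_map.1 hx
    exact ⟨y, hy, hm⟩

theorem OMixedDiagram.ext_word {S : Type} [StrandLabel S] {M M' : OMixedDiagram S}
    (h : M.word = M'.word) : M = M' := by
  cases M; cases M'; simp_all

theorem OMixedDiagram.forget_alternate (M : OMixedDiagram Colour)
    (h : ∀ s ∈ M.word, Planar s.gen) : (M.alternate h).forget = M :=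
  OMixedDiagram.ext_word (forgetWord_alternateWord _)

theorem OMixedDiagram.isPre_alternate (M : OMixedDiagram Colour)
    (h : ∀ s ∈ M.word, Planar s.gen) : ∀ s ∈ (M.alternate h).word, s.gen.isPre = false := by
  intro s hs
  obtain ⟨t, ht, rfl⟩ := List.mem_map.1 hs
  exact _root_.isPre_alternate (h t ht)

/-! ### Isotopy invariance of brackets on states -/

namespace IsBracket

variable {R : Type} [CommRing R] {p : BracketData R} {N : Type*} [AddCommGroup N] [Module R N]
  {v : ℕ → N} {B : OMixedDiagram Colour → N}

/-- Both words receive the alternating orientation, which makes the step an oriented isotopy to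
which rule (6) applies. -/
theorem eq_of_tStep (hB : IsBracket p v B) {M M' : OMixedDiagram Colour}
    (h : TStep Planar [] [] M.word M'.word) : B M = B M' := by
  obtain ⟨h1, h2, -, u, w, x, y, hx, hy, hm⟩ := h
  rw [colourWord_self, colourWord_self] at hm
  rw [← M.forget_alternate h1.prop, ← M'.forget_alternate h2.prop]
  refine hB.skein_module _ _ (M.isPre_alternate _) (M'.isPre_alternate _) (.rel _ _ ?_)
  refine ⟨alternateWord u, alternateWord w, alternateWord x, alternateWord y, ?_, ?_, ?_⟩
  · simp [OMixedDiagram.alternate, hx, alternateWord]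
  · simp [OMixedDiagram.alternate, hy, alternateWord]
  · rwa [forgetWord_alternateWord, forgetWord_alternateWord]

theorem eq_of_tEq (hB : IsBracket p v B) {M M' : OMixedDiagram Colour}
    (h : TEq Planar [] [] M.word M'.word) : B M = B M' :=
  TEq.diagram_rel (E := fun M M' => B M = B M') ⟨fun _ => rfl, Eq.symm, Eq.trans⟩
    (fun _ _ h => hB.eq_of_tStep h) h

/-- A state is the closure of an annular diagram without precrossings. -/
theorem exists_annular (M : OMixedDiagram Colour) (h : ∀ s ∈ M.word, Planar s.gen) :
    ∃ D : AnnularDiagram OStrand, ∀ {R : Type} [CommRing R] {p : BracketData R} {N : Type}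
      [AddCommGroup N] [Module R N] {v : ℕ → N} {B : OMixedDiagram Colour → N},
      IsBracket p v B → B M = B D.toMixed.forget := by
  -- Moving `O` into ring position may create crossings of the moving part, so only precrossings are
  -- excluded. The annular diagram is found before any bracket is chosen, which makes the resulting
  -- expansion universal.
  obtain ⟨D, hD⟩ := _root_.exists_annular (P := fun g => g.isPre = false) (fun _ hg => hg)
    (M.alternate h) (M.isPre_alternate h)
  refine ⟨D, fun hB => ?_⟩
  rw [← hB.skein_module _ _ (M.isPre_alternate h) hD.2.1.prop hD.regularIsotopy,
    M.forget_alternate]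

end IsBracket


/-! # Curves of annular states and their colourings -/

/-- Maxima and minima of moving strands. -/
def Flat (g : Gen Colour) : Prop := g = .cup .moving ∨ g = .cap .moving

namespace Curves

/-- Colours of points of a state. -/
abbrev X := Fin 3

/-- The arcs of a slice join points of the same colour. -/
structure Compat (s : Slice Colour) (a a' : List X) : Prop where
  length_dom : a.length = s.dom.length
  length_cod : a'.length = s.cod.length
  left : ∀ i < s.left.length, a[i]? = a'[i]?
  right : ∀ i < s.right.length, a[s.left.length + s.gen.dom.length + i]? =
    a'[s.left.length + s.gen.cod.length + i]?
  cup : ∀ c, s.gen = .cup c → a'[s.left.length]? = a'[s.left.length + 1]?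
  cap : ∀ c, s.gen = .cap c → a[s.left.length]? = a[s.left.length + 1]?

/-- Summation over the colourings of the top of a slice with a given colouring of its bottom. -/
def step (s : Slice Colour) (φ : List X → ℤ) (a : List X) : ℤ :=
  match s.gen with
  | .cup _ => ∑ x : X, φ (a.take s.left.length ++ x :: x :: a.drop s.left.length)
  | .cap _ => if a[s.left.length]? = a[s.left.length + 1]? then
      φ (a.take s.left.length ++ a.drop (s.left.length + 2)) else 0
  | _ => 0

/-- Summation over the colourings of a word with a given colouring of its bottom. -/
def transfer : List (Slice Colour) → (List X → ℤ) → List X → ℤ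
  | [], φ => φ
  | s :: w, φ => step s (transfer w φ)

/-- Colourings of a word with given colours at the ends. -/
structure IsColouring (w : List (Slice Colour)) (a b : List X) (c : ℕ → List X) : Prop where
  bot : c 0 = a
  top : c w.length = b
  out : ∀ t, w.length < t → c t = []
  compat : ∀ t s, w[t]? = some s → Compat s (c t) (c (t + 1))

theorem step_cup {l r : List Colour} {x : Colour} (φ : List X → ℤ) {a b : List X}
    (h : a.length = l.length) :
    step ⟨l, .cup x, r⟩ φ (a ++ b) = ∑ x : X, φ (a ++ x :: x :: b) := by
  simp [step, ← h]

theorem step_cap {l r : List Colour} {x : Colour} (φ : List X → ℤ) {a b : List X} (y z : X)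
    (h : a.length = l.length) :
    step ⟨l, .cap x, r⟩ φ (a ++ y :: z :: b) = if y = z then φ (a ++ b) else 0 := by
  simp [step, ← h]

theorem exists_split {a : List X} {m n : ℕ} (h : a.length = m + n) :
    ∃ u v, a = u ++ v ∧ u.length = m ∧ v.length = n :=
  ⟨a.take m, a.drop m, by simp, by simp [h], by simp [h]⟩

theorem compat_cup {l r : List Colour} {x : Colour} {u v a' : List X} (hu : u.length = l.length)
    (hv : v.length = r.length) :
    Compat ⟨l, .cup x, r⟩ (u ++ v) a' ↔ ∃ x : X, a' = u ++ x :: x :: v := by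
  constructor
  · intro h
    have h1 : a'.length = l.length + (r.length + 1 + 1) := by
      rw [h.length_cod]; simp [Slice.cod, Gen.cod]
    obtain ⟨u', v', rfl, h2, h3⟩ := exists_split h1
    match v', h3 with
    | x :: y :: v', h3 =>
      have h4 := h.cup _ rfl
      simp [← h2] at h4
      have h5 : u' = u := by
        refine List.ext_getElem? fun i => ?_
        by_cases hi : i < l.length
        · have := h.left i hi
          rw [List.getElem?_append_left (by omega), List.getElem?_append_left (by omega)] at this
          exact this.symm
        · rw [List.getElem?_eq_none (by omega), List.getElem?_eq_none (by omega)]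
      have h6 : v' = v := by
        refine List.ext_getElem? fun i => ?_
        by_cases hi : i < r.length
        · have := h.right i hi
          simp only [Gen.dom, Gen.cod, List.length_nil, List.length_cons] at this
          rw [List.getElem?_append_right (by omega), List.getElem?_append_right (by omega)] at this
          rw [show l.length + (0 + 1 + 1) + i - u'.length = i + 1 + 1 by omega,
            show l.length + 0 + i - u.length = i by omega] at this
          exact this.symm
        · simp at h3
          rw [List.getElem?_eq_none (by omega), List.getElem?_eq_none (by omega)]
      exact ⟨x, by rw [h5, h6, h4]⟩
  · rintro ⟨x, rfl⟩
    constructor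
    · simp [Slice.dom, Gen.dom, hu, hv]
    · simp [Slice.cod, Gen.cod, hu, hv]
    · intro i hi
      simp only at hi
      rw [List.getElem?_append_left (by omega), List.getElem?_append_left (by omega)]
    · intro i hi
      simp only [Gen.dom, Gen.cod, List.length_nil, List.length_cons]
      rw [List.getElem?_append_right (by omega), List.getElem?_append_right (by omega),
        show l.length + (0 + 1 + 1) + i - u.length = i + 1 + 1 by omega,
        show l.length + 0 + i - u.length = i by omega]
      rfl
    · intro c _
      simp [← hu]
    · intro c hc
      simp at hc

theorem compat_cap {l r : List Colour} {x : Colour} {u v a' : List X} {y z : X}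
    (hu : u.length = l.length) (hv : v.length = r.length) :
    Compat ⟨l, .cap x, r⟩ (u ++ y :: z :: v) a' ↔ y = z ∧ a' = u ++ v := by
  constructor
  · intro h
    have h1 : a'.length = l.length + r.length := by
      rw [h.length_cod]; simp [Slice.cod, Gen.cod]
    obtain ⟨u', v', rfl, h2, h3⟩ := exists_split h1
    have h4 := h.cap _ rfl
    simp [← hu] at h4
    refine ⟨h4, ?_⟩
    have h5 : u' = u := by
      refine List.ext_getElem? fun i => ?_
      by_cases hi : i < l.length
      · have := h.left i hi
        rw [List.getElem?_append_left (by omega), List.getElem?_append_left (by omega)] at this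
        exact this.symm
      · rw [List.getElem?_eq_none (by omega), List.getElem?_eq_none (by omega)]
    have h6 : v' = v := by
      refine List.ext_getElem? fun i => ?_
      by_cases hi : i < r.length
      · have := h.right i hi
        simp only [Gen.dom, Gen.cod, List.length_nil, List.length_cons] at this
        rw [List.getElem?_append_right (by omega), List.getElem?_append_right (by omega)] at this
        rw [show l.length + (0 + 1 + 1) + i - u.length = i + 1 + 1 by omega,
          show l.length + 0 + i - u'.length = i by omega] at this
        exact this.symm
      · rw [List.getElem?_eq_none (by omega), List.getElem?_eq_none (by omega)]
    rw [h5, h6]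
  · rintro ⟨rfl, rfl⟩
    constructor
    · simp [Slice.dom, Gen.dom, hu, hv]
    · simp [Slice.cod, Gen.cod, hu, hv]
    · intro i hi
      simp only at hi
      rw [List.getElem?_append_left (by omega), List.getElem?_append_left (by omega)]
    · intro i hi
      simp only [Gen.dom, Gen.cod, List.length_nil, List.length_cons]
      rw [List.getElem?_append_right (by omega), List.getElem?_append_right (by omega),
        show l.length + (0 + 1 + 1) + i - u.length = i + 1 + 1 by omega,
        show l.length + 0 + i - u.length = i by omega]
      rfl
    · intro c hc
      simp at hc
    · intro c _
      simp [← hu]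

/-- Connects the two descriptions of a slice: the relation `Compat` between colourings of its ends,
and the operator `step` that sums over the compatible tops. -/
theorem finite_compat {s : Slice Colour} (hs : Flat s.gen) {a : List X}
    (ha : a.length = s.dom.length) : Finite {a' // Compat s a a'} ∧
      ∀ (φ : List X → ℤ), (∑ᶠ a' : {a' // Compat s a a'}, φ a'.1) = step s φ a := by
  obtain ⟨l, g, r⟩ := s
  rcases hs with rfl | rfl
  · obtain ⟨u, v, rfl, hu, hv⟩ := exists_split (a := a) (m := l.length) (n := r.length)
      (by rw [ha]; simp [Slice.dom, Gen.dom])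
    let E : X ≃ {a' // Compat ⟨l, .cup .moving, r⟩ (u ++ v) a'} :=
      Equiv.ofBijective (fun x => ⟨u ++ x :: x :: v, (compat_cup hu hv).2 ⟨x, rfl⟩⟩) ⟨by
        intro x y h
        simpa using h, by
        rintro ⟨a', h⟩
        obtain ⟨x, rfl⟩ := (compat_cup hu hv).1 h
        exact ⟨x, rfl⟩⟩
    refine ⟨.of_equiv _ E, fun φ => ?_⟩
    rw [step_cup φ hu, ← finsum_comp_equiv E, finsum_eq_sum_of_fintype]
    rfl
  · obtain ⟨u, v, rfl, hu, hv⟩ := exists_split (a := a) (m := l.length) (n := r.length + 1 + 1)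
      (by rw [ha]; simp [Slice.dom, Gen.dom])
    match v, hv with
    | y :: z :: v, hv =>
      simp at hv
      by_cases hyz : y = z
      · let E : Unit ≃ {a' // Compat ⟨l, .cap .moving, r⟩ (u ++ y :: z :: v) a'} :=
          Equiv.ofBijective (fun _ => ⟨u ++ v, (compat_cap hu hv).2 ⟨hyz, rfl⟩⟩) ⟨by
            intro _ _ _; rfl, by
            rintro ⟨a', h⟩
            obtain ⟨-, rfl⟩ := (compat_cap hu hv).1 h
            exact ⟨(), rfl⟩⟩
        refine ⟨.of_equiv _ E, fun φ => ?_⟩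
        rw [step_cap φ y z hu, if_pos hyz, ← finsum_comp_equiv E, finsum_eq_sum_of_fintype,
          Fintype.sum_unique]
        rfl
      · have : IsEmpty {a' // Compat ⟨l, .cap .moving, r⟩ (u ++ y :: z :: v) a'} :=
          ⟨fun h => hyz ((compat_cap hu hv).1 h.2).1⟩
        refine ⟨inferInstance, fun φ => ?_⟩
        rw [step_cap φ y z hu, if_neg hyz, finsum_of_isEmpty]

/-- The colourings of a non-empty word. -/
def colouringCons (s : Slice Colour) (w : List (Slice Colour)) (a b : List X) :
    {c // IsColouring (s :: w) a b c} ≃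
      (Σ a' : {a' // Compat s a a'}, {c // IsColouring w a'.1 b c}) where
  toFun c := ⟨⟨c.1 1, by simpa [c.2.bot] using c.2.compat 0 s rfl⟩, fun t => c.1 (t + 1), rfl,
    by simpa using c.2.top, fun t ht => c.2.out _ (by simpa using ht),
    fun t s' h => c.2.compat (t + 1) s' (by simpa using h)⟩
  invFun c := ⟨fun t => Nat.casesOn t a c.2.1, rfl, by simpa using c.2.2.top, by
    rintro (_ | t) ht
    · simp at ht
    · exact c.2.2.out t (by simpa using ht), by
    rintro (_ | t) s' h
    · simp at h
      subst h
      simpa [c.2.2.bot] using c.1.2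
    · exact c.2.2.compat t s' (by simpa using h)⟩
  left_inv c := by
    refine Subtype.ext (funext fun t => ?_)
    cases t with
    | zero => exact c.2.bot.symm
    | succ t => rfl
  right_inv c := by
    obtain ⟨⟨a', ha'⟩, c, hc⟩ := c
    obtain rfl := hc.bot
    rfl

/-- Transfer matrix method: a colouring of a word is a choice of colours above its first slice
followed by a colouring of the rest. -/
theorem card_colourings {w : List (Slice Colour)} {x y : List Colour} (hw : Tg Flat x w y)
    {a b : List X} (ha : a.length = x.length) : Finite {c // IsColouring w a b c} ∧
      (Nat.card {c // IsColouring w a b c} : ℤ) = transfer w (fun z => if z = b then 1 else 0) a := by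
  induction w generalizing a x with
  | nil =>
    by_cases hab : a = b
    · let E : Unit ≃ {c // IsColouring [] a b c} :=
        Equiv.ofBijective (fun _ => ⟨fun t => if t = 0 then a else [], by simp, by simp [hab],
          fun t ht => if_neg (by simp at ht; omega), by simp⟩) ⟨fun _ _ _ => rfl, by
          rintro ⟨c, hc⟩
          refine ⟨(), Subtype.ext (funext fun t => ?_)⟩
          by_cases ht : t = 0
          · simp [ht, hc.bot]
          · simp only [ht, if_false]
            exact (hc.out t (by simp; omega)).symm⟩
      refine ⟨.of_equiv _ E, ?_⟩
      rw [← Nat.card_congr E]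
      simp [transfer, hab]
    · have : IsEmpty {c // IsColouring [] a b c} :=
        ⟨fun c => hab (c.2.bot.symm.trans c.2.top)⟩
      exact ⟨inferInstance, by simp [transfer, hab]⟩
  | cons s w ih =>
    obtain ⟨rfl, hs, hw⟩ := hw
    obtain ⟨h1, h2⟩ := finite_compat hs.2 ha
    have h3 : ∀ a' : {a' // Compat s a a'}, Finite {c // IsColouring w a'.1 b c} :=
      fun a' => (ih hw a'.2.length_cod).1
    refine ⟨.of_equiv _ (colouringCons s w a b).symm, ?_⟩
    rw [Nat.card_congr (colouringCons s w a b)]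
    have := Fintype.ofFinite {a' // Compat s a a'}
    rw [Nat.card_sigma, Nat.cast_sum]
    simp only [transfer]
    rw [← h2, finsum_eq_sum_of_fintype]
    exact Finset.sum_congr rfl fun a' _ => (ih hw a'.2.length_cod).2

end Curves


/-! ### Colourings of curves as closed colourings of words -/

namespace Curves

theorem width_cons (n : ℕ) (s : Slice Colour) (w : List (Slice Colour)) (t : ℕ) :
    width n (s :: w) (t + 1) = width s.cod.length w t := by
  cases t <;> simp [width]

theorem width_eq {P : Gen Colour → Prop} {x y : List Colour} {w : List (Slice Colour)}
    (hw : Tg P x w y) : width x.length w w.length = y.length ∧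
      ∀ t s, w[t]? = some s → width x.length w t = s.dom.length := by
  induction w generalizing x with
  | nil => cases hw; simp [width]
  | cons s w ih =>
    obtain ⟨rfl, -, hw⟩ := hw
    refine ⟨by rw [List.length_cons, width_cons]; exact (ih hw).1, ?_⟩
    rintro (_ | t) s' h
    · simp at h
      simp [h, width]
    · rw [width_cons]
      exact (ih hw).2 t s' (by simpa using h)

theorem width_succ {n t : ℕ} {w : List (Slice Colour)} {s : Slice Colour} (h : w[t]? = some s) :
    width n w (t + 1) = s.cod.length := by
  simp [width, h]

variable {n : ℕ} {w : List (Slice Colour)}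

instance : Finite (ClosurePoint n w) := by
  let f : ClosurePoint n w → Σ t : Fin (w.length + 1), Fin (width n w t) :=
    fun q => ⟨⟨q.1.1, by have := q.2.1; omega⟩, ⟨q.1.2, q.2.2⟩⟩
  refine .of_injective f fun p q h => ?_
  obtain ⟨⟨t, i⟩, hp⟩ := p
  obtain ⟨⟨t', i'⟩, hq⟩ := q
  simp only [f, Sigma.mk.injEq, Fin.mk.injEq] at h
  obtain ⟨rfl, h⟩ := h
  simp only [heq_eq_eq, Fin.mk.injEq] at h
  subst h
  rfl

instance : Finite (ClosureCurve n w) := inferInstanceAs (Finite (Quot _))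

/-- The colours of the points at a level. -/
noncomputable def colours (F : ClosureCurve n w → X) (t : ℕ) : List X :=
  if h : t ≤ w.length then List.ofFn fun i : Fin (width n w t) => F (Quot.mk _ ⟨(t, i), h, i.2⟩)
  else []

theorem getElem_colours (F : ClosureCurve n w → X) (q : ClosurePoint n w) :
    (colours F q.1.1)[q.1.2]? = some (F (Quot.mk _ q)) := by
  rw [colours, dif_pos q.2.1, List.getElem?_ofFn, dif_pos q.2.2]
  rfl

theorem length_colours (F : ClosureCurve n w → X) {t : ℕ} (h : t ≤ w.length) :
    (colours F t).length = width n w t := by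
  rw [colours, dif_pos h, List.length_ofFn]

theorem getElem_colours_eq (F : ClosureCurve n w → X) {t i t' i' : ℕ} (ht : t ≤ w.length)
    (hi : i < width n w t) (ht' : t' ≤ w.length) (hi' : i' < width n w t')
    (h : ClosureArc w (t, i) (t', i')) : (colours F t)[i]? = (colours F t')[i']? := by
  have h1 := getElem_colours F ⟨(t, i), ht, hi⟩
  have h2 := getElem_colours F ⟨(t', i'), ht', hi'⟩
  rw [h1, h2]
  exact congrArg (fun c => some (F c)) (Quot.sound h)

theorem isColouring_colours {P : Gen Colour → Prop} {x : List Colour} (hw : Tg P x w x)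
    (F : ClosureCurve x.length w → X) :
    IsColouring w (colours F 0) (colours F 0) (colours F) where
  bot := rfl
  top := by
    have h1 := (width_eq hw).1
    refine List.ext_getElem? fun i => ?_
    by_cases hi : i < x.length
    · exact getElem_colours_eq F le_rfl (by omega) (Nat.zero_le _) hi (.close i)
    · rw [List.getElem?_eq_none (by rw [length_colours F le_rfl]; omega),
        List.getElem?_eq_none (by rw [length_colours F (Nat.zero_le _)]; simp [width]; omega)]
  out t ht := by rw [colours, dif_neg (by omega)]
  compat t s hs := by
    have h1 := (width_eq hw).2 t s hs
    have h2 := width_succ (n := x.length) hs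
    have h3 : t < w.length := by
      by_contra h
      rw [List.getElem?_eq_none (by omega)] at hs
      cases hs
    have d : s.dom.length = s.left.length + s.gen.dom.length + s.right.length := by
      simp [Slice.dom]; omega
    have c : s.cod.length = s.left.length + s.gen.cod.length + s.right.length := by
      simp [Slice.cod]; omega
    constructor
    · rw [length_colours F (by omega), h1]
    · rw [length_colours F (by omega), h2]
    · intro i hi
      exact getElem_colours_eq F (by omega) (by omega) (by omega) (by omega) (.left t i s hs hi)
    · intro i hi
      exact getElem_colours_eq F (by omega) (by omega) (by omega) (by omega) (.right t i s hs hi)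
    · intro y hy
      obtain ⟨l, g, r⟩ := s
      obtain rfl : g = .cup y := hy
      change _ = l.length + 2 + r.length at c
      change (colours F _)[l.length]? = (colours F _)[l.length + 1]?
      exact getElem_colours_eq F (by omega) (by omega) (by omega) (by omega) (.cup t l r y hs)
    · intro y hy
      obtain ⟨l, g, r⟩ := s
      obtain rfl : g = .cap y := hy
      change _ = l.length + 2 + r.length at d
      change (colours F _)[l.length]? = (colours F _)[l.length + 1]?
      exact getElem_colours_eq F (by omega) (by omega) (by omega) (by omega) (.cap t l r y hs)

theorem IsColouring.length {P : Gen Colour → Prop} {x : List Colour} (hw : Tg P x w x) {a : List X}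
    (ha : a.length = x.length) {c : ℕ → List X} (hc : IsColouring w a a c) {t : ℕ}
    (ht : t ≤ w.length) : (c t).length = width x.length w t := by
  rcases ht.lt_or_eq with h | rfl
  · obtain ⟨s, hs⟩ : ∃ s, w[t]? = some s := ⟨w[t], List.getElem?_eq_getElem h⟩
    rw [(hc.compat t s hs).length_dom, (width_eq hw).2 t s hs]
  · rw [hc.top, ha, (width_eq hw).1]

/-- The colouring of the curves given by a colouring of the word. -/
def curveColour {a : List X} {c : ℕ → List X} (hc : IsColouring w a a c) :
    ClosureCurve n w → X :=
  Quot.lift (fun q => ((c q.1.1)[q.1.2]?).getD 0) (by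
    rintro ⟨⟨t, i⟩, hp⟩ ⟨⟨t', i'⟩, hq⟩ h
    simp only at h ⊢
    congr 1
    cases h with
    | left _ _ s hs hi => exact (hc.compat _ s hs).left i hi
    | right _ _ s hs hi => exact (hc.compat _ s hs).right _ hi
    | cup _ l r y hs => exact (hc.compat _ _ hs).cup y rfl
    | cap _ l r y hs => exact (hc.compat _ _ hs).cap y rfl
    | close => rw [hc.top, hc.bot])

theorem sigma_ext {p q : Σ a : List.Vector X n, {c // IsColouring w a.1 a.1 c}}
    (h : p.2.1 = q.2.1) : p = q := by
  obtain ⟨⟨a, ha⟩, c, hc⟩ := p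
  obtain ⟨⟨a', ha'⟩, c', hc'⟩ := q
  obtain rfl : c = c' := h
  obtain rfl : a = a' := hc.bot.symm.trans hc'.bot
  rfl

/-- Colourings of the curves are colourings of the word with equal colours at both ends. -/
noncomputable def curveColourings {P : Gen Colour → Prop} {x : List Colour} (hw : Tg P x w x) :
    (ClosureCurve x.length w → X) ≃
      (Σ a : List.Vector X x.length, {c // IsColouring w a.1 a.1 c}) where
  toFun F := ⟨⟨colours F 0, length_colours F (Nat.zero_le _)⟩, colours F, isColouring_colours hw F⟩
  invFun c := curveColour c.2.2
  left_inv F := by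
    refine funext fun q => ?_
    induction q using Quot.ind with
    | mk q =>
      simp only [curveColour]
      rw [getElem_colours]
      rfl
  right_inv c := by
    obtain ⟨⟨a, ha⟩, c, hc⟩ := c
    have key : colours (curveColour (n := x.length) hc) = c := by
      refine funext fun t => ?_
      by_cases ht : t ≤ w.length
      · have h1 := hc.length hw ha ht
        refine List.ext_getElem? fun i => ?_
        by_cases hi : i < width x.length w t
        · have := getElem_colours (curveColour (n := x.length) hc) ⟨(t, i), ht, hi⟩
          rw [this, curveColour]
          simp only
          rw [List.getElem?_eq_getElem (by omega)]
          rfl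
        · rw [List.getElem?_eq_none (by rw [length_colours _ ht]; omega),
            List.getElem?_eq_none (by omega)]
      · rw [colours, dif_neg ht, hc.out t (by omega)]
    exact sigma_ext key

/-- The sum over the colourings of the closure of a word, weighted by the colours on the ray. -/
def colourSum (ω : X → ℤ) (n : ℕ) (w : List (Slice Colour)) : ℤ :=
  ∑ a : List.Vector X n, (a.1.map ω).prod * transfer w (fun z => if z = a.1 then 1 else 0) a.1

/-- Colourings of the closed word are the maps from the set of curves to the colours. The weight is
a product over points of the ray, hence over curves, and the sum over all maps factorises. -/
theorem colourSum_eq {x : List Colour} (hw : Tg Flat x w x) (ω : X → ℤ) [Fintype (ClosureCurve x.length w)] :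
    colourSum ω x.length w = ∏ c : ClosureCurve x.length w, ∑ y : X,
      ω y ^ Nat.card {q : ClosurePoint x.length w //
        q.1.1 = 0 ∧ (Quot.mk _ q : ClosureCurve x.length w) = c} := by
  classical
  have fin : ∀ a : List.Vector X x.length, Finite {c // IsColouring w a.1 a.1 c} :=
    fun a => (card_colourings hw a.2).1
  have fin' := fun a => Fintype.ofFinite {c // IsColouring w (a : List.Vector X x.length).1 a.1 c}
  have h1 : colourSum ω x.length w = ∑ p : (Σ a : List.Vector X x.length,
      {c // IsColouring w a.1 a.1 c}), (p.1.1.map ω).prod := by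
    rw [Fintype.sum_sigma, colourSum]
    refine Finset.sum_congr rfl fun a _ => ?_
    rw [← (card_colourings hw a.2).2]
    simp [mul_comm]
  rw [h1, ← (curveColourings hw).sum_comp, Finset.prod_univ_sum, Fintype.piFinset_univ]
  refine Finset.sum_congr rfl fun F _ => ?_
  let e : Fin x.length → ClosurePoint x.length w := fun i => ⟨(0, i), Nat.zero_le _, i.2⟩
  have h2 : ((curveColourings hw F).1.1.map ω).prod =
      ∏ i : Fin x.length, ω (F (Quot.mk _ (e i))) := by
    change ((colours F 0).map ω).prod = _
    rw [colours, dif_pos (Nat.zero_le _), List.map_ofFn, List.prod_ofFn]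
    rfl
  -- The points on the ray are grouped by the curve to which they belong.
  let κ : Fin x.length → ClosureCurve x.length w := fun i => Quot.mk _ (e i)
  rw [h2, ← Finset.prod_fiberwise (g := κ)]
  refine Finset.prod_congr rfl fun c _ => ?_
  rw [Finset.prod_congr rfl (g := fun _ => ω (F c)) (fun i hi => by
    rw [← (Finset.mem_filter.1 hi).2]), Finset.prod_const]
  congr 1
  rw [← Fintype.card_subtype, ← Nat.card_eq_fintype_card]
  refine Nat.card_congr (Equiv.ofBijective (fun i => ⟨e i.1, rfl, i.2⟩) ⟨fun i i' h => ?_, ?_⟩)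
  · have := congrArg (fun q => q.1.1.2) h
    exact Subtype.ext (Fin.ext this)
  · rintro ⟨⟨⟨t, i⟩, ht, hi⟩, h0, hc⟩
    obtain rfl : t = 0 := h0
    exact ⟨⟨⟨i, hi⟩, hc⟩, rfl⟩

/-- The weights that detect the parity of the number of points on the ray. -/
def sign : X → ℤ := ![1, 1, -1]

theorem colourSum_one {x : List Colour} (hw : Tg Flat x w x) :
    colourSum (fun _ => 1) x.length w = 3 ^ (Nat.card {c : ClosureCurve x.length w // c.Essential} +
      Nat.card {c : ClosureCurve x.length w // ¬ c.Essential}) := by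
  classical
  have := Fintype.ofFinite (ClosureCurve x.length w)
  rw [colourSum_eq hw, ← Nat.card_sum, ← Nat.card_congr (Equiv.sumCompl _).symm]
  simp

/-- A curve meeting the ray in an odd number of points contributes `1 + 1 - 1 = 1`, any other curve
contributes `1 + 1 + 1 = 3`. -/
theorem colourSum_sign {x : List Colour} (hw : Tg Flat x w x) :
    colourSum sign x.length w = 3 ^ Nat.card {c : ClosureCurve x.length w // ¬ c.Essential} := by
  classical
  have := Fintype.ofFinite (ClosureCurve x.length w)
  rw [colourSum_eq hw, Nat.card_eq_fintype_card, Fintype.card_subtype, Finset.prod_congr rfl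
    (g := fun c => if ¬ c.Essential then 3 else 1), Finset.prod_ite, Finset.prod_const]
  · simp
  · intro c _
    simp only [sign, Fin.sum_univ_three, ClosureCurve.Essential]
    split_ifs with h
    · simp [h.neg_one_pow, h]
    · rw [Nat.not_odd_iff_even] at h
      simp [h.neg_one_pow, h]

end Curves


/-! ### Rotation and local moves of colouring counts -/

namespace Curves

theorem transfer_append (u w : List (Slice Colour)) (φ : List X → ℤ) :
    transfer (u ++ w) φ = transfer u (transfer w φ) := by
  induction u with
  | nil => rfl
  | cons s u ih => simp [transfer, ih]

theorem step_congr {s : Slice Colour} (hs : Flat s.gen) {φ ψ : List X → ℤ}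
    (h : ∀ z, z.length = s.cod.length → φ z = ψ z) {a : List X} (ha : a.length = s.dom.length) :
    step s φ a = step s ψ a := by
  obtain ⟨h1, h2⟩ := finite_compat hs ha
  rw [← h2, ← h2]
  exact finsum_congr fun a' => h _ a'.2.length_cod

theorem transfer_congr {x y : List Colour} {w : List (Slice Colour)} (hw : Tg Flat x w y)
    {φ ψ : List X → ℤ} (h : ∀ z, z.length = y.length → φ z = ψ z) {a : List X}
    (ha : a.length = x.length) : transfer w φ a = transfer w ψ a := by
  induction w generalizing a x with
  | nil => cases hw; exact h a ha
  | cons s w ih =>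
    obtain ⟨rfl, hs, hw⟩ := hw
    exact step_congr hs.2 (fun z hz => ih hw hz) ha

theorem step_sum {ι : Type*} (s : Slice Colour) (I : Finset ι) (c : ι → ℤ) (φ : ι → List X → ℤ)
    (a : List X) : step s (fun z => ∑ i ∈ I, c i * φ i z) a = ∑ i ∈ I, c i * step s (φ i) a := by
  obtain ⟨l, g, r⟩ := s
  cases g with
  | cup x => simp only [step, Finset.mul_sum]; exact Finset.sum_comm
  | cap x => simp only [step]; split_ifs <;> simp
  | cross x y o => simp [step]
  | pre x y o => simp [step]

theorem transfer_sum {ι : Type*} (w : List (Slice Colour)) (I : Finset ι) (c : ι → ℤ)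
    (φ : ι → List X → ℤ) (a : List X) :
    transfer w (fun z => ∑ i ∈ I, c i * φ i z) a = ∑ i ∈ I, c i * transfer w (φ i) a := by
  induction w generalizing a with
  | nil => rfl
  | cons s w ih =>
    simp only [transfer]
    rw [funext fun a => ih a, step_sum]

/-- The indicator function of a colouring. -/
abbrev indicator (b : List X) (z : List X) : ℤ := if z = b then 1 else 0

theorem eq_sum_indicator {n : ℕ} (φ : List X → ℤ) {z : List X} (hz : z.length = n) :
    φ z = ∑ b : List.Vector X n, φ b.1 * indicator b.1 z := by
  rw [Finset.sum_eq_single ⟨z, hz⟩]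
  · simp [indicator]
  · intro b _ hb
    have : z ≠ b.1 := fun h => hb (Subtype.ext h.symm)
    simp [indicator, this]
  · exact fun h => absurd (Finset.mem_univ _) h

theorem transfer_eq_sum {x y : List Colour} {w : List (Slice Colour)} (hw : Tg Flat x w y)
    (φ : List X → ℤ) {a : List X} (ha : a.length = x.length) :
    transfer w φ a = ∑ b : List.Vector X y.length, φ b.1 * transfer w (indicator b.1) a := by
  rw [← transfer_sum]
  exact transfer_congr hw (fun z hz => eq_sum_indicator φ hz) ha

theorem tg_singleton {s : Slice Colour} (hv : s.gen.Valid) (hs : Flat s.gen) :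
    Tg Flat s.dom [s] s.cod := ⟨rfl, ⟨hv, hs⟩, rfl⟩

/-- An extremum creates or removes two points of equal colour, whose weights multiply to `1`. The
total weight can therefore be read at any level, and the ray may be moved. -/
theorem step_indicator_ne {ω : X → ℤ} (hω : ∀ x, ω x * ω x = 1) {s : Slice Colour}
    (hs : Flat s.gen) {a b : List X} (ha : a.length = s.dom.length)
    (h : step s (indicator b) a ≠ 0) : (a.map ω).prod = (b.map ω).prod := by
  obtain ⟨h1, h2⟩ := finite_compat hs ha
  rw [← h2] at h
  obtain ⟨⟨a', ha'⟩, hc⟩  : ∃ a' : {a' // Compat s a a'}, indicator b a'.1 ≠ 0 := by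
    by_contra! hc
    exact h (finsum_eq_zero_of_forall_eq_zero hc)
  have hb : a' = b := by by_contra h'; simp [indicator, h'] at hc
  subst hb
  obtain ⟨l, g, r⟩ := s
  rcases hs with rfl | rfl
  · obtain ⟨u, v, rfl, hu, hv⟩ := exists_split (a := a) (m := l.length) (n := r.length)
      (by rw [ha]; simp [Slice.dom, Gen.dom])
    obtain ⟨x, rfl⟩ := (compat_cup hu hv).1 ha'
    simp [← mul_assoc (ω x), hω]
  · obtain ⟨u, v, rfl, hu, hv⟩ := exists_split (a := a) (m := l.length) (n := r.length + 1 + 1)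
      (by rw [ha]; simp [Slice.dom, Gen.dom])
    match v, hv with
    | y :: z :: v, hv =>
      obtain ⟨rfl, rfl⟩ := (compat_cap hu (by simpa using hv)).1 ha'
      simp [← mul_assoc (ω y), hω]

/-- The first slice of an annular word may be moved to its end. -/
theorem colourSum_rotate {ω : X → ℤ} (hω : ∀ x, ω x * ω x = 1) {s : Slice Colour}
    {w : List (Slice Colour)} (hs : Flat s.gen) (hw : Tg Flat s.cod w s.dom) :
    colourSum ω s.dom.length (s :: w) = colourSum ω s.cod.length (w ++ [s]) := by
  have h1 : ∀ a : List.Vector X s.dom.length, transfer (s :: w) (indicator a.1) a.1 =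
      ∑ b : List.Vector X s.cod.length,
        transfer w (indicator a.1) b.1 * step s (indicator b.1) a.1 := by
    intro a
    simp only [transfer]
    rw [← step_sum]
    exact step_congr hs (fun z hz => eq_sum_indicator _ hz) a.2
  have h2 : ∀ b : List.Vector X s.cod.length, transfer (w ++ [s]) (indicator b.1) b.1 =
      ∑ a : List.Vector X s.dom.length,
        step s (indicator b.1) a.1 * transfer w (indicator a.1) b.1 := by
    intro b
    rw [transfer_append, transfer_eq_sum hw _ b.2]
    rfl
  unfold colourSum
  rw [Finset.sum_congr rfl fun a _ => congrArg _ (h1 a),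
    Finset.sum_congr rfl fun b _ => congrArg _ (h2 b)]
  simp only [Finset.mul_sum]
  rw [Finset.sum_comm]
  refine Finset.sum_congr rfl fun b _ => Finset.sum_congr rfl fun a _ => ?_
  -- The two double sums differ only in the level at which the weight is read, and the weights agree
  -- on all nonzero terms.
  by_cases h : step s (indicator b.1) a.1 = 0
  · simp [h]
  · rw [step_indicator_ne hω hs a.2 h]
    ring

theorem colourSum_nil (ω : X → ℤ) (n : ℕ) : colourSum ω n [] = (∑ x, ω x) ^ n := by
  simp only [colourSum, transfer, if_true, mul_one]
  rw [← (Equiv.vectorEquivFin X n).symm.sum_comp]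
  calc _ = ∑ f : Fin n → X, ∏ i, ω (f i) := Finset.sum_congr rfl fun f _ => by
        change ((List.Vector.ofFn f).toList.map ω).prod = _
        rw [List.Vector.toList_ofFn, List.map_ofFn, List.prod_ofFn]; rfl
    _ = _ := by
      rw [← Fintype.piFinset_univ, ← Finset.prod_univ_sum]; simp

/-- Two words with the same transfer function up to the factor `c`. -/
def Proportional (c : ℤ) (x : List Colour) (p q : List (Slice Colour)) : Prop :=
  ∀ φ a, a.length = x.length → transfer p φ a = c * transfer q φ a

theorem colourSum_local {c : ℤ} {x y : List Colour} {u p q v : List (Slice Colour)}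
    (hu : Tg Flat x u y) (h : Proportional c y p q) (ω : X → ℤ) :
    colourSum ω x.length (u ++ p ++ v) = c * colourSum ω x.length (u ++ q ++ v) := by
  unfold colourSum
  rw [Finset.mul_sum]
  refine Finset.sum_congr rfl fun a _ => ?_
  have e1 : transfer (u ++ p ++ v) (indicator a.1) a.1 =
      -- The sum with one term allows the factor `c` to be extracted by `transfer_sum`.
      transfer u (fun z => ∑ _i ∈ {()}, c * transfer (q ++ v) (indicator a.1) z) a.1 := by
    rw [List.append_assoc, transfer_append]
    refine transfer_congr hu (fun z hz => ?_) a.2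
    rw [transfer_append, h _ _ hz, transfer_append]
    simp
  rw [transfer_sum] at e1
  rw [e1, List.append_assoc, transfer_append u]
  simp
  ring

theorem proportional_loop (l r : List Colour) :
    Proportional 3 (l ++ r) [⟨l, .cup .moving, r⟩, ⟨l, .cap .moving, r⟩] [] := by
  intro φ a ha
  obtain ⟨u, v, rfl, hu, hv⟩ := exists_split (a := a) (by simpa using ha)
  simp [transfer, step_cup _ hu, step_cap _ _ _ hu]

theorem proportional_zigzagLeft (l r : List Colour) :
    Proportional 1 (l ++ .moving :: r)
      [⟨l ++ [.moving], .cup .moving, r⟩, ⟨l, .cap .moving, .moving :: r⟩] [] := by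
  intro φ a ha
  obtain ⟨u, v, rfl, hu, hv⟩ := exists_split (a := a) (m := l.length) (n := r.length + 1)
    (by simpa using ha)
  match v, hv with
  | y :: v, hv =>
    have h : (u ++ [y]).length = (l ++ [Colour.moving]).length := by simp [hu]
    have := step_cup (r := r) (x := .moving) (step ⟨l, .cap .moving, .moving :: r⟩ φ) (b := v) h
    simp only [List.append_assoc, List.cons_append, List.nil_append] at this
    simp only [transfer, this, step_cap _ _ _ hu]
    simp

theorem proportional_zigzagRight (l r : List Colour) :
    Proportional 1 (l ++ .moving :: r)
      [⟨l, .cup .moving, .moving :: r⟩, ⟨l ++ [.moving], .cap .moving, r⟩] [] := by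
  intro φ a ha
  obtain ⟨u, v, rfl, hu, hv⟩ := exists_split (a := a) (m := l.length) (n := r.length + 1)
    (by simpa using ha)
  match v, hv with
  | y :: v, hv =>
    have h : ∀ x : X, (u ++ [x]).length = (l ++ [Colour.moving]).length := by simp [hu]
    have := fun x => step_cap (r := r) (x := .moving) φ (b := v) x y (h x)
    simp only [List.append_assoc, List.cons_append, List.nil_append] at this
    simp only [transfer, step_cup _ hu, this]
    simp

theorem proportional_cup_cap (l m r : List Colour) :
    Proportional 1 (l ++ m ++ .moving :: .moving :: r)
      [⟨l, .cup .moving, m ++ .moving :: .moving :: r⟩,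
        ⟨l ++ .moving :: .moving :: m, .cap .moving, r⟩]
      [⟨l ++ m, .cap .moving, r⟩, ⟨l, .cup .moving, m ++ r⟩] := by
  intro φ a ha
  obtain ⟨a', v, rfl, ha', hv⟩ := exists_split (a := a) (m := l.length + m.length)
    (n := r.length + 1 + 1) (by simpa [add_assoc] using ha)
  obtain ⟨t, u, rfl, ht, hu⟩ := exists_split ha'
  match v, hv with
  | y :: z :: v, hv =>
    have h : ∀ x : X, (t ++ x :: x :: u).length =
      (l ++ Colour.moving :: Colour.moving :: m).length := by simp [ht, hu]
    have h1 := fun x => step_cap (r := r) (x := .moving) φ (b := v) y z (h x)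
    have h2 := step_cap (r := r) (x := .moving) (step ⟨l, .cup .moving, m ++ r⟩ φ) (b := v) y z
      (show (t ++ u).length = (l ++ m).length by simp [ht, hu])
    have h3 := step_cup (r := m ++ .moving :: .moving :: r) (x := .moving)
      (step ⟨l ++ .moving :: .moving :: m, .cap .moving, r⟩ φ) (b := u ++ y :: z :: v) ht
    have h4 := step_cup (r := m ++ r) (x := .moving) φ (b := u ++ v) ht
    simp only [List.append_assoc, List.cons_append] at h1 h2 h3 h4 ⊢
    simp only [transfer, h1, h2, h3, h4]
    split_ifs <;> simp

theorem proportional_cap_cup (l m r : List Colour) :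
    Proportional 1 (l ++ .moving :: .moving :: m ++ r)
      [⟨l ++ .moving :: .moving :: m, .cup .moving, r⟩,
        ⟨l, .cap .moving, m ++ .moving :: .moving :: r⟩]
      [⟨l, .cap .moving, m ++ r⟩, ⟨l ++ m, .cup .moving, r⟩] := by
  intro φ a ha
  obtain ⟨t, v, rfl, ht, hv⟩ := exists_split (a := a) (m := l.length)
    (n := m.length + r.length + 1 + 1) (by rw [ha]; simp [← add_assoc])
  match v, hv with
  | y :: z :: v, hv =>
    obtain ⟨u, v, rfl, hu, hv⟩ := exists_split (a := v) (by simpa using hv)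
    have h1 := step_cup (r := r) (x := .moving)
      (step ⟨l, .cap .moving, m ++ .moving :: .moving :: r⟩ φ) (a := t ++ y :: z :: u) (b := v)
      (show _ = (l ++ Colour.moving :: Colour.moving :: m).length by simp [ht, hu])
    have h2 := fun b => step_cap (r := m ++ .moving :: .moving :: r) (x := .moving) φ (b := b) y z ht
    have h3 := fun φ b => step_cap (r := m ++ r) (x := .moving) φ (b := b) y z ht
    have h4 := step_cup (r := r) (x := .moving) φ (a := t ++ u) (b := v)
      (show _ = (l ++ m).length by simp [ht, hu])
    simp only [List.append_assoc, List.cons_append] at h1 h2 h3 h4 ⊢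
    simp only [transfer, h1, h2, h3, h4]
    split_ifs <;> simp

/-- The number of essential curves. -/
noncomputable def essentials (n : ℕ) (w : List (Slice Colour)) : ℕ :=
  Nat.card {c : ClosureCurve n w // c.Essential}

/-- The number of null-homotopic curves. -/
noncomputable def trivials (n : ℕ) (w : List (Slice Colour)) : ℕ :=
  Nat.card {c : ClosureCurve n w // ¬ c.Essential}

theorem sign_mul_self (x : X) : sign x * sign x = 1 := by
  fin_cases x <;> rfl

theorem pow_three_inj {m n : ℕ} (h : (3 : ℤ) ^ m = 3 ^ n) : m = n :=
  Nat.pow_right_injective (le_refl 3 |>.trans' (by norm_num)) (by exact_mod_cast h)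

/-- Constant weight counts all curves and `sign` counts the null-homotopic ones, both as exponents
of `3`; together they determine both numbers. -/
theorem curves_eq {x y : List Colour} {w w' : List (Slice Colour)} (hw : Tg Flat x w x)
    (hw' : Tg Flat y w' y)
    (h : ∀ ω : X → ℤ, (∀ x, ω x * ω x = 1) → colourSum ω x.length w = colourSum ω y.length w') :
    essentials x.length w = essentials y.length w' ∧ trivials x.length w = trivials y.length w' := by
  have h1 := h (fun _ => 1) (by simp)
  have h2 := h sign sign_mul_self
  rw [colourSum_one hw, colourSum_one hw'] at h1
  rw [colourSum_sign hw, colourSum_sign hw'] at h2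
  have h1 := pow_three_inj h1
  have h2 := pow_three_inj h2
  unfold essentials trivials
  omega

theorem curves_loop {x y : List Colour} {w w' : List (Slice Colour)} (hw : Tg Flat x w x)
    (hw' : Tg Flat y w' y)
    (h : ∀ ω : X → ℤ, colourSum ω x.length w = 3 * colourSum ω y.length w') :
    essentials x.length w = essentials y.length w' ∧
      trivials x.length w = trivials y.length w' + 1 := by
  have h1 := h (fun _ => 1)
  have h2 := h sign
  rw [colourSum_one hw, colourSum_one hw', ← pow_succ'] at h1
  rw [colourSum_sign hw, colourSum_sign hw', ← pow_succ'] at h2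
  have h1 := pow_three_inj h1
  have h2 := pow_three_inj h2
  unfold essentials trivials
  omega

theorem curves_nil (x : List Colour) : essentials x.length [] = x.length ∧ trivials x.length [] = 0 := by
  have hw : Tg Flat x [] x := rfl
  have h1 := colourSum_one hw
  have h2 := colourSum_sign hw
  rw [colourSum_nil] at h1 h2
  have e1 : ∑ _x : X, (1 : ℤ) = 3 := by simp
  have e2 : ∑ x : X, sign x = 3 ^ 0 := by simp [sign, Fin.sum_univ_three]
  rw [e1] at h1
  rw [e2, ← pow_mul] at h2
  have h1 := pow_three_inj h1
  have h2 := pow_three_inj h2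
  unfold essentials trivials
  omega

/-- Justifies the truncated exponent `trivials - 1` in `curveValue`: without essential curves there
is at least one null-homotopic curve. -/
theorem curves_pos {x : List Colour} {w : List (Slice Colour)} (hw : Tg Flat x w x)
    (h : x ≠ [] ∨ w ≠ []) : 0 < essentials x.length w + trivials x.length w := by
  classical
  have : Nonempty (ClosureCurve x.length w) := by
    rcases x with _ | ⟨c, x⟩
    · match w, hw, h with
      | s :: w, hw, _ =>
        refine ⟨Quot.mk _ ⟨(1, 0), by simp, ?_⟩⟩
        obtain ⟨h1, ⟨-, h2⟩, -⟩ := hw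
        obtain ⟨l, g, r⟩ := s
        rcases h2 with rfl | rfl
        · simp [width, Slice.cod, Gen.cod]
        · simp [Slice.dom, Gen.dom] at h1
    · exact ⟨Quot.mk _ ⟨(0, 0), Nat.zero_le _, by simp [width]⟩⟩
  rw [essentials, trivials, ← Nat.card_sum, ← Nat.card_congr (Equiv.sumCompl _).symm]
  exact Nat.card_pos

end Curves


/-! # Evaluation of annular states -/

open Curves

theorem Flat.planar {g : Gen Colour} (h : Flat g) : Planar g := by
  rcases h with rfl | rfl <;> trivial

theorem Tg.mono {S : Type} [StrandLabel S] {P Q : Gen S → Prop} (h : ∀ g, P g → Q g) {a b : List S}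
    {w : List (Slice S)} (hw : Tg P a w b) : Tg Q a w b :=
  .of_isTangle hw.isTangle fun s hs => h _ (hw.prop s hs)

theorem Tg.mvW_of_flat {a b : List Colour} {w : List (Slice Colour)} (hw : Tg Flat a w b)
    (ha : Mv a) : MvW w := by
  refine .of_tangle hw ha (List.countP_eq_zero.2 fun s hs => ?_)
  rcases hw.prop s hs with h | h <;> simp [h, Gen.isFixedCup, StrandLabel.colour]

theorem tEq_mixedWord {a : List Colour} {w w' : List (Slice Colour)} (ha : Mv a)
    (h : TEq Planar a a w w') : TEq Planar [] [] (mixedWord a w) (mixedWord a w') := by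
  have h1 := (Tg_nestedCups Planar.bends a).append ((tg_encircle ha).padR (bar a))
  have h2 := TEq.ctx h1 (h.padR (bar a)) (Tg_nestedCaps Planar.bends a)
  simpa [mixedWord, ring_eq_wpad, map_addRight_eq_wpad] using h2

/-- A diagram without crossings and precrossings. -/
abbrev AnnularDiagram.IsState (D : AnnularDiagram Colour) : Prop := ∀ s ∈ D.word, Flat s.gen

theorem AnnularDiagram.IsState.tg {D : AnnularDiagram Colour} (h : D.IsState) :
    Tg Flat D.base D.word D.base := .of_isTangle D.closed h

/-- The state with given base and word. -/
def AnnularDiagram.ofFlat {a : List Colour} {w : List (Slice Colour)} (h : Tg Flat a w a) (ha : Mv a)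
    (hn : a ≠ [] ∨ w ≠ []) : AnnularDiagram Colour :=
  ⟨a, w, h.isTangle, ha, fun s hs => (h.mvW_of_flat ha s hs).2, hn⟩

/-- The value of a state, given the values `v` of parallel essential curves. -/
noncomputable def curveValue {R : Type} [CommRing R] (p : BracketData R) {N : Type*}
    [AddCommGroup N] [Module R N] (v : ℕ → N) (n : ℕ) (w : List (Slice Colour)) : N :=
  if essentials n w = 0 then p.d ^ (trivials n w - 1) • v 0
  else p.d ^ trivials n w • v (essentials n w)

theorem mv_eq_replicate {a : List Colour} (ha : Mv a) : a = List.replicate a.length .moving :=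
  List.eq_replicate_iff.2 ⟨rfl, ha⟩

theorem split_cups (w : List (Slice Colour)) (h : ∀ s ∈ w, Flat s.gen) :
    (∀ s ∈ w, s.gen = .cup .moving) ∨ ∃ u l r w', (∀ s ∈ u, s.gen = .cup .moving) ∧
      w = u ++ (⟨l, .cap .moving, r⟩ : Slice Colour) :: w' := by
  induction w with
  | nil => simp
  | cons s w ih =>
    obtain ⟨l, g, r⟩ := s
    rcases h _ List.mem_cons_self with hg | hg
    · obtain rfl : g = .cup .moving := hg
      rcases ih (fun t ht => h t (by simp [ht])) with h1 | ⟨u, l', r', w', h1, rfl⟩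
      · exact .inl (by simpa using h1)
      · exact .inr ⟨⟨l, .cup .moving, r⟩ :: u, l', r', w', by simpa using h1, rfl⟩
    · obtain rfl : g = .cap .moving := hg
      exact .inr ⟨[], l, r, w, by simp, rfl⟩

theorem length_of_cups {a b : List Colour} {w : List (Slice Colour)} (hw : Tg Flat a w b)
    (h : ∀ s ∈ w, s.gen = .cup .moving) : b.length = a.length + 2 * w.length := by
  induction w generalizing a with
  | nil => cases hw; rfl
  | cons s w ih =>
    obtain ⟨rfl, hs, hw⟩ := hw
    rw [ih hw fun t ht => h t (by simp [ht])]
    obtain ⟨l, g, r⟩ := s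
    obtain rfl : g = .cup .moving := h _ List.mem_cons_self
    simp [Slice.dom, Slice.cod, Gen.dom, Gen.cod]
    ring

/-- Relative positions of two pairs of neighbours in a word of moving strands. -/
theorem pairs_cases {l l' r r' : List Colour}
    (h : l' ++ .moving :: .moving :: r' = l ++ .moving :: .moving :: r) :
    (l' = l ∧ r' = r) ∨ (l = l' ++ [.moving] ∧ r' = .moving :: r) ∨
      (l' = l ++ [.moving] ∧ r = .moving :: r') ∨
      (∃ m, l = l' ++ .moving :: .moving :: m ∧ r' = m ++ .moving :: .moving :: r) ∨
      ∃ m, l' = l ++ .moving :: .moving :: m ∧ r = m ++ .moving :: .moving :: r' := by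
  rcases List.append_eq_append_iff.1 h with ⟨k, rfl, hk⟩ | ⟨k, rfl, hk⟩
  · match k, hk with
    | [], hk => simp at hk; simp [hk]
    | [x], hk => simp at hk; simp [hk]
    | x :: y :: m, hk =>
      simp at hk
      obtain ⟨rfl, rfl, rfl⟩ := hk
      exact .inr (.inr (.inr (.inl ⟨m, by simp, by simp⟩)))
  · match k, hk with
    | [], hk => simp at hk; simp [hk]
    | [x], hk => simp at hk; simp [hk]
    | x :: y :: m, hk =>
      simp at hk
      obtain ⟨rfl, rfl, rfl⟩ := hk
      exact .inr (.inr (.inr (.inr ⟨m, by simp, by simp⟩)))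

namespace IsBracket

variable {R : Type} [CommRing R] {p : BracketData R} {N : Type*} [AddCommGroup N] [Module R N]
  {v : ℕ → N} {B : OMixedDiagram Colour → N}

theorem curveValue_of_tEq (hB : IsBracket p v B) {D D' : AnnularDiagram Colour} (h : D.IsState)
    (h' : D'.IsState) (e : TEq Planar [] [] D.toMixed.word D'.toMixed.word)
    (hs : ∀ ω : X → ℤ, (∀ x, ω x * ω x = 1) →
      colourSum ω D.base.length D.word = colourSum ω D'.base.length D'.word)
    (hD : B D'.toMixed = curveValue p v D'.base.length D'.word) :
    B D.toMixed = curveValue p v D.base.length D.word := by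
  rw [hB.eq_of_tEq e, hD]
  obtain ⟨h1, h2⟩ := curves_eq h.tg h'.tg hs
  rw [curveValue, curveValue, h1, h2]

/-- A local replacement must respect two invariants at once: the bracket, through planar isotopy,
and the numbers of curves, through equality of transfer operators. -/
theorem exists_replace (hB : IsBracket p v B) {D : AnnularDiagram Colour} (h : D.IsState)
    {u x y w : List (Slice Colour)} {b c : List Colour} (hD : D.word = u ++ x ++ w) (hx : x ≠ [])
    (e : TEq Planar b c x y) (hy : ∀ s ∈ y, Flat s.gen) (hxy : Proportional 1 b x y)
    (hn : b ≠ [] ∨ y ≠ []) :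
    ∃ D' : AnnularDiagram Colour, D'.base = D.base ∧ D'.word = u ++ y ++ w ∧ D'.IsState ∧
      (B D'.toMixed = curveValue p v D'.base.length D'.word →
        B D.toMixed = curveValue p v D.base.length D.word) := by
  have ht := h.tg
  rw [hD] at ht
  obtain ⟨c', h1, hw⟩ := ht.split
  obtain ⟨b', hu, h2⟩ := h1.split
  obtain ⟨rfl, rfl⟩ := (h2.mono fun _ => Flat.planar).unique hx e.1
  have ty : Tg Flat b' y c' := .of_isTangle e.2.1.isTangle hy
  have ht' := (hu.append ty).append hw
  have hne : D.base ≠ [] ∨ u ++ y ++ w ≠ [] := by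
    by_contra! hc
    obtain ⟨h3, h4⟩ := hc
    simp only [List.append_eq_nil_iff] at h4
    obtain ⟨⟨rfl, rfl⟩, rfl⟩ := h4
    rw [h3] at hu
    simp [← show [] = b' from hu] at hn
  refine ⟨.ofFlat ht' D.base_moving hne, rfl, rfl, ht'.prop, hB.curveValue_of_tEq h ht'.prop ?_ ?_⟩
  · change TEq Planar [] [] (mixedWord D.base D.word) (mixedWord D.base (u ++ y ++ w))
    rw [hD]
    exact tEq_mixedWord D.base_moving (TEq.ctx (hu.mono fun _ => Flat.planar) e
      (hw.mono fun _ => Flat.planar))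
  · intro ω _
    change _ = colourSum ω D.base.length (u ++ y ++ w)
    rw [hD, colourSum_local hu hxy, one_mul]

/-- The loop rule gives the factor `d`, and the colour count shows that exactly one null-homotopic
curve disappears. -/
theorem curveValue_loop (hB : IsBracket p v B) {D : AnnularDiagram Colour} (h : D.IsState)
    {u w : List (Slice Colour)} {l r : List Colour}
    (hD : D.word = u ++ [⟨l, .cup .moving, r⟩, ⟨l, .cap .moving, r⟩] ++ w)
    (ih : ∀ D' : AnnularDiagram Colour, D'.IsState → D'.word = u ++ w →
      B D'.toMixed = curveValue p v D'.base.length D'.word) :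
    B D.toMixed = curveValue p v D.base.length D.word := by
  have ht := h.tg
  rw [hD] at ht
  obtain ⟨c, h1, hw⟩ := ht.split
  obtain ⟨b, hu, h2⟩ := h1.split
  have h3 : b = l ++ r := by simpa [Slice.dom, Gen.dom] using h2.1
  have h4 : c = l ++ r := by simpa [Slice.cod, Gen.cod] using h2.2.2.2.2.symm
  subst h3 h4
  have ht' := hu.append hw
  have hs : ∀ ω : X → ℤ, colourSum ω D.base.length D.word =
      3 * colourSum ω D.base.length (u ++ w) := by
    intro ω
    rw [hD, colourSum_local hu (proportional_loop l r), List.append_nil]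
  obtain ⟨h5, h6⟩ := curves_loop h.tg ht' hs
  by_cases hn : D.base ≠ [] ∨ u ++ w ≠ []
  · set D' : AnnularDiagram Colour := .ofFlat ht' D.base_moving hn
    have h7 := ih D' ht'.prop rfl
    have h8 := curves_pos ht' hn
    have h9 : B D.toMixed = p.d • B D'.toMixed := by
      refine hB.loop _ _ (nestedCups [] [] D.base ++ ring D.base (bar D.base) ++ wpad [] u (bar D.base))
        (wpad [] w (bar D.base) ++ nestedCaps [] [] D.base) l (r ++ bar D.base) ?_ ?_
      · change mixedWord D.base D.word = _
        rw [hD]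
        simp [mixedWord, map_addRight_eq_wpad, Slice.addRight]
      · change mixedWord D.base (u ++ w) = _
        simp [mixedWord, map_addRight_eq_wpad]
    rw [h9, h7]
    change p.d • curveValue p v D.base.length (u ++ w) = _
    rw [curveValue, curveValue, h5, h6]
    split_ifs with h0
    · rw [smul_smul, ← pow_succ', show trivials D.base.length (u ++ w) + 1 - 1 =
        trivials D.base.length (u ++ w) - 1 + 1 by omega]
    · rw [smul_smul, ← pow_succ']
  -- The circle was the whole moving part. The loop rule cannot remove it, but the diagram is the
  -- unlinked unknot, with `d` to the power zero.
  · push Not at hn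
    obtain ⟨h7, h8⟩ := hn
    simp only [List.append_eq_nil_iff] at h8
    obtain ⟨rfl, rfl⟩ := h8
    rw [h7] at hu
    have h9 : l = [] ∧ r = [] := by simpa using (show [] = l ++ r from hu).symm
    obtain ⟨rfl, rfl⟩ := h9
    have h10 := curves_nil []
    rw [h7] at h5 h6 ⊢
    rw [hB.unknot D.toMixed]
    · simp only [List.append_nil, h10.1, h10.2] at h5 h6
      simp only [List.length_nil] at h5 h6 ⊢
      simp [curveValue, h5, h6]
    · change mixedWord D.base D.word = _
      rw [hD, h7]
      simp [mixedWord, unknotWord, nestedCups, nestedCaps, ring, arcOver, arcUnder,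
        StrandLabel.fixedStrand, Slice.addRight]

/-- The value of a state of an annular diagram. -/
theorem eq_curveValue (hB : IsBracket p v B) (D : AnnularDiagram Colour) (h : D.IsState) :
    B D.toMixed = curveValue p v D.base.length D.word := by
  generalize hL : D.word.length = L
  -- Lexicographic induction on the length of the word, the number of strands on the ray, and the
  -- height of the first maximum.
  induction L using Nat.strong_induction_on generalizing D with | _ L ihL => ?_
  generalize hn : D.base.length = n
  induction n using Nat.strong_induction_on generalizing D with | _ n ihn => ?_
  rw [← hn]
  rcases split_cups D.word h with hc | ⟨u, l, r, w, hu, hD⟩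
  -- Minima only widen the word, whereas its two ends have equal width; so there are no slices at
  -- all and the state consists of parallel essential curves.
  · have h1 := length_of_cups h.tg hc
    have h2 : D.word = [] := List.length_eq_zero_iff.1 (by omega)
    have h3 : D.base ≠ [] := by simpa [h2] using D.nonempty
    have h4 := curves_nil D.base
    have h5 : 1 ≤ D.base.length := List.length_pos_iff.2 h3
    rw [hB.essential D.toMixed D.base.length h5]
    · rw [h2, curveValue, h4.1, h4.2, if_neg (by omega), pow_zero, one_smul]
    · change mixedWord D.base D.word = _
      rw [hopfWord, ← mv_eq_replicate D.base_moving, h2]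
  · generalize hi : u.length = i
    induction i generalizing D u l r w with
    | zero =>
      -- A maximum at the very bottom is rotated to the top: the word keeps its length, and two
      -- strands on the ray disappear.
      obtain rfl := List.length_eq_zero_iff.1 hi
      have ht := h.tg
      rw [hD] at ht
      obtain ⟨h1, h2, hw⟩ := ht
      simp only [Slice.dom, Gen.dom, Slice.cod, Gen.cod] at h1 hw
      have h1 : D.base = l ++ .moving :: .moving :: r := by simpa using h1
      have hb := D.base_moving
      have hm : Mv l ∧ Mv r := by
        have : Mv D.base := hb
        simp [h1] at this
        exact this
      rw [h1] at hw
      simp only [List.append_nil] at hw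
      have ts : Tg Flat (l ++ .moving :: .moving :: r) [⟨l, .cap .moving, r⟩] (l ++ r) :=
        ⟨by simp [Slice.dom, Gen.dom], ⟨trivial, .inr rfl⟩, by simp [Slice.cod, Gen.cod, Tg]⟩
      have ht' := hw.append ts
      have hm' : Mv (l ++ r) := by simp [hm]
      have hM := hw.mvW_of_flat hm'
      refine hB.curveValue_of_tEq (D' := .ofFlat ht' hm' (by simp)) h ht'.prop ?_ ?_ ?_
      · change TEq Planar [] [] (mixedWord D.base D.word) (mixedWord (l ++ r) (w ++ _))
        rw [h1, hD]
        exact TEq.rotate_cap hm.1 hm.2 (hw.mono fun _ => Flat.planar) hM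
      · intro ω hω
        change _ = colourSum ω (l ++ r).length (w ++ _)
        have := colourSum_rotate hω (s := ⟨l, .cap .moving, r⟩) (w := w) (.inr rfl)
          (by simpa [Slice.dom, Slice.cod, Gen.dom, Gen.cod] using hw)
        rw [h1, hD]
        simpa [Slice.dom, Slice.cod, Gen.dom, Gen.cod] using this
      · refine ihn (l ++ r).length ?_ _ ht'.prop ?_ rfl
        · rw [← hn, h1]; simp
        · change (w ++ _).length = L
          rw [← hL, hD]; simp
    | succ i ihi =>
      obtain ⟨u, ⟨l', g, r'⟩, rfl⟩ : ∃ u' s, u = u' ++ [s] :=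
        ⟨_, _, (List.dropLast_append_getLast (l := u) (by rintro rfl; simp at hi)).symm⟩
      obtain rfl : g = .cup .moving := hu ⟨l', g, r'⟩ (by simp)
      have hu' : ∀ s ∈ u, s.gen = .cup .moving := fun s hs => hu s (by simp [hs])
      have hi' : u.length = i := by simpa using hi
      have hD' : D.word = u ++ [⟨l', .cup .moving, r'⟩, ⟨l, .cap .moving, r⟩] ++ w := by
        simp [hD]
      have ht := h.tg
      rw [hD'] at ht
      obtain ⟨c, h1, hw⟩ := ht.split
      obtain ⟨b, hu, h2⟩ := h1.split
      have h3 := h2.2.2.1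
      simp only [Slice.dom, Gen.dom, Slice.cod, Gen.cod, List.append_assoc, List.cons_append,
        List.nil_append, rev_colour] at h3
      have short : ∀ D' : AnnularDiagram Colour, D'.IsState → D'.word = u ++ w →
          B D'.toMixed = curveValue p v D'.base.length D'.word := fun D' h' h'' =>
        ihL (u ++ w).length (by rw [← hL, hD']; simp) D' h' (by rw [h''])
      -- The slice before the first maximum is a minimum. Sharing both strands, the two form a
      -- circle; sharing one, a zigzag, and the word becomes shorter in either case; sharing none,
      -- they exchange heights and the maximum descends by one.
      rcases pairs_cases h3 with ⟨rfl, rfl⟩ | ⟨rfl, rfl⟩ | ⟨rfl, rfl⟩ | ⟨m, rfl, rfl⟩ | ⟨m, rfl, rfl⟩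
      · exact hB.curveValue_loop h hD' short
      · have e : TEq Planar (l' ++ .moving :: r) (l' ++ .moving :: r)
            [⟨l', .cup .moving, .moving :: r⟩, ⟨l' ++ [.moving], .cap .moving, r⟩] [] := by
          simpa using (TEq.zigzagRight (P := Planar) (x := Colour.moving) rfl trivial trivial).pad l' r
        obtain ⟨D', -, h4, h5, h6⟩ := hB.exists_replace h hD' (by simp) e (by simp)
          (proportional_zigzagRight l' r) (.inl (by simp))
        exact h6 (short D' h5 (by simpa using h4))
      · obtain ⟨D', -, h4, h5, h6⟩ := hB.exists_replace h hD' (by simp) (TEq.zigzag_moving l r')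
          (by simp) (proportional_zigzagLeft l r') (.inl (by simp))
        exact h6 (short D' h5 (by simpa using h4))
      · have e : TEq Planar (l' ++ m ++ .moving :: .moving :: r) (l' ++ .moving :: .moving :: m ++ r)
            [⟨l', .cup .moving, m ++ .moving :: .moving :: r⟩,
              ⟨l' ++ .moving :: .moving :: m, .cap .moving, r⟩]
            [⟨l' ++ m, .cap .moving, r⟩, ⟨l', .cup .moving, m ++ r⟩] := by
          simpa using TEq.interchange (tg_cup l' m .moving) (tg_cap [] r .moving)
        obtain ⟨D', h0, h4, h5, h6⟩ := hB.exists_replace h hD' (by simp) e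
          (by simp [Flat]) (proportional_cup_cap l' m r) (.inl (by simp))
        refine h6 (ihi D' h5 ?_ ?_ u (l' ++ m) r (⟨l', .cup .moving, m ++ r⟩ :: w) hu' (by simp [h4]) hi')
        · rw [← hL, h4, hD']; simp
        · rw [h0, hn]
      · have e : TEq Planar (l ++ .moving :: .moving :: m ++ r') (l ++ m ++ .moving :: .moving :: r')
            [⟨l ++ .moving :: .moving :: m, .cup .moving, r'⟩,
              ⟨l, .cap .moving, m ++ .moving :: .moving :: r'⟩]
            [⟨l, .cap .moving, m ++ r'⟩, ⟨l ++ m, .cup .moving, r'⟩] := by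
          simpa using (TEq.interchange (tg_cap l m .moving) (tg_cup [] r' .moving)).symm
        obtain ⟨D', h0, h4, h5, h6⟩ := hB.exists_replace h hD' (by simp) e
          (by simp [Flat]) (proportional_cap_cup l m r') (.inl (by simp))
        refine h6 (ihi D' h5 ?_ ?_ u l (m ++ r') (⟨l ++ m, .cup .moving, r'⟩ :: w) hu' (by simp [h4]) hi')
        · rw [← hL, h4, hD']; simp
        · rw [h0, hn]

end IsBracket


/-! # Expansion of annular diagrams -/

/-- The value of a combination of states. -/
noncomputable def stateSum {R : Type} [CommRing R] (p : BracketData R) {N : Type*} [AddCommGroup N]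
    [Module R N] (v : ℕ → N) (n : ℕ) (u : List (Slice Colour)) (L : List (R × List (Slice Colour))) :
    N :=
  (L.map fun y => y.1 • curveValue p v n (u ++ y.2)).sum

section StateSum

variable {R : Type} [CommRing R] (p : BracketData R) {N : Type*} [AddCommGroup N] [Module R N]
  (v : ℕ → N)

theorem stateSum_smul (n : ℕ) (u x : List (Slice Colour)) (c : R)
    (L : List (R × List (Slice Colour))) :
    stateSum p v n u (L.map fun z => (c * z.1, x ++ z.2)) = c • stateSum p v n (u ++ x) L := by
  simp only [stateSum, List.smul_sum, List.map_map]
  congr 1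
  refine List.map_congr_left fun z _ => ?_
  simp [mul_smul]

theorem stateSum_keep (n : ℕ) (u w : List (Slice Colour)) {s : Slice Colour}
    (h : smoothSlice p s = [(1, [s])]) :
    stateSum p v n u (states p (s :: w)) = stateSum p v n (u ++ [s]) (states p w) := by
  rw [states, h, List.flatMap_singleton, stateSum_smul, one_smul]

theorem stateSum_smooth (n : ℕ) (u w : List (Slice Colour)) {s : Slice Colour} {x y : R}
    {z : List (Slice Colour)} (h : smoothSlice p s = [(x, []), (y, z)]) :
    stateSum p v n u (states p (s :: w)) =
      x • stateSum p v n u (states p w) + y • stateSum p v n (u ++ z) (states p w) := by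
  have h1 := stateSum_smul p v n u [] x (states p w)
  have h2 := stateSum_smul p v n u z y (states p w)
  rw [List.append_nil] at h1
  rw [← h1, ← h2, states, h]
  simp [stateSum]

end StateSum

theorem AnnularDiagram.mvW {S : Type} [StrandLabel S] [LawfulLabel S] (D : AnnularDiagram S) :
    MvW D.word := by
  refine .of_tangle (P := fun _ => True) (.of_isTangle D.closed fun _ _ => trivial) D.base_moving
    (List.countP_eq_zero.2 fun s hs => ?_)
  have h := D.word_moving s hs
  obtain ⟨l, g, r⟩ := s
  cases g with
  | cup x => simp [Gen.isFixedCup, h x (by simp [Slice.cod, Gen.cod])]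
  | _ => simp [Gen.isFixedCup]

/-- The two smoothings of a crossing or precrossing of an annular diagram. -/
theorem AnnularDiagram.exists_smoothings {D : AnnularDiagram Colour} {u w : List (Slice Colour)}
    {l r : List Colour} {g : Gen Colour} (hd : g.dom = [.moving, .moving])
    (hc : g.cod = [.moving, .moving]) (hD : D.word = u ++ ⟨l, g, r⟩ :: w) :
    ∃ D₀ D₁ : AnnularDiagram Colour, D₀.base = D.base ∧ D₁.base = D.base ∧ D₀.word = u ++ w ∧
      D₁.word = u ++ horizontal l r ++ w := by
  have ht : Tg (fun _ => True) D.base D.word D.base := .of_isTangle D.closed fun _ _ => trivial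
  have hM := D.mvW
  rw [hD] at ht hM
  obtain ⟨b, hu, h1, -, hw⟩ := ht.split
  simp only [Slice.dom, hd] at h1
  simp only [Slice.cod, hc] at hw
  subst h1
  have th : Tg (fun _ => True) (l ++ [.moving, .moving] ++ r) (horizontal l r)
      (l ++ [.moving, .moving] ++ r) :=
    ⟨by simp [Slice.dom, Gen.dom], ⟨trivial, trivial⟩, by simp [Slice.dom, Slice.cod, Gen.cod,
      Gen.dom], ⟨trivial, trivial⟩, by simp [Slice.cod, Gen.cod, Tg]⟩
  simp only [MvW_append, MvW_cons] at hM
  obtain ⟨hMu, ⟨h2, -⟩, hMw⟩ := hM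
  have h3 : Mv l ∧ Mv r := by
    simp [Slice.dom] at h2
    tauto
  have hMh : MvW (horizontal l r) := by
    simp [horizontal, Slice.dom, Slice.cod, Gen.dom, Gen.cod, h3]
  have hne : D.base ≠ [] ∨ u ++ w ≠ [] := by
    by_contra! hc
    obtain ⟨h4, h5⟩ := hc
    rw [List.append_eq_nil_iff] at h5
    obtain ⟨rfl, rfl⟩ := h5
    rw [h4] at hu
    have : [] = l ++ [Colour.moving, .moving] ++ r := hu
    simp at this
  exact ⟨⟨D.base, u ++ w, (hu.append hw).isTangle, D.base_moving,
      fun s hs => ((MvW_append.2 ⟨hMu, hMw⟩) s hs).2, hne⟩,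
    ⟨D.base, u ++ horizontal l r ++ w, ((hu.append th).append hw).isTangle, D.base_moving,
      fun s hs => ((MvW_append.2 ⟨MvW_append.2 ⟨hMu, hMh⟩, hMw⟩) s hs).2, .inr (by simp [horizontal])⟩,
    rfl, rfl, rfl, rfl⟩

theorem mixedWord_append {S : Type} [StrandLabel S] (a : List S) (u x w : List (Slice S)) :
    mixedWord a (u ++ x ++ w) = (nestedCups [] [] a ++ ring a (bar a) ++ wpad [] u (bar a)) ++
      wpad [] x (bar a) ++ (wpad [] w (bar a) ++ nestedCaps [] [] a) := by
  simp [mixedWord, map_addRight_eq_wpad, Slice.addRight]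

namespace IsBracket

variable {R : Type} [CommRing R] {p : BracketData R} {N : Type*} [AddCommGroup N] [Module R N]
  {v : ℕ → N} {B : OMixedDiagram Colour → N}

/-- The expansion of an annular diagram into states. -/
theorem eq_stateSum (hB : IsBracket p v B) (D : AnnularDiagram Colour) {u w : List (Slice Colour)}
    (hu : ∀ s ∈ u, Flat s.gen) (hD : D.word = u ++ w) :
    B D.toMixed = stateSum p v D.base.length u (states p w) := by
  induction w generalizing u D with
  | nil =>
    rw [List.append_nil] at hD
    subst hD
    rw [hB.eq_curveValue D hu]
    simp [stateSum, states]
  | cons s w ih =>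
    have hM := D.mvW s (by simp [hD])
    obtain ⟨l, g, r⟩ := s
    -- The flat prefix `u` consists of slices already processed; a kept slice or a smoothing is
    -- appended to it.
    have keep : Flat g → smoothSlice p ⟨l, g, r⟩ = [(1, [⟨l, g, r⟩])] →
        B D.toMixed = stateSum p v D.base.length u (states p (⟨l, g, r⟩ :: w)) := by
      intro hg hs
      rw [stateSum_keep p v _ _ _ hs]
      refine ih D ?_ (by simp [hD])
      intro t ht
      rcases List.mem_append.1 ht with ht | ht
      · exact hu t ht
      · obtain rfl := List.mem_singleton.1 ht
        exact hg
    have smooth : ∀ {x y : R}, g.dom = [.moving, .moving] → g.cod = [.moving, .moving] →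
        smoothSlice p ⟨l, g, r⟩ = [(x, []), (y, horizontal l r)] →
        (∀ (D D₀ D₁ : OMixedDiagram Colour) (u v : List (Slice Colour)) (l r : List Colour),
          D.word = u ++ [⟨l, g, r⟩] ++ v → D₀.word = u ++ v → D₁.word = u ++ horizontal l r ++ v →
          B D = x • B D₀ + y • B D₁) →
        B D.toMixed = stateSum p v D.base.length u (states p (⟨l, g, r⟩ :: w)) := by
      intro x y hd hc hs hr
      obtain ⟨D₀, D₁, h1, h2, h3, h4⟩ := D.exists_smoothings hd hc hD
      rw [stateSum_smooth p v _ _ _ hs]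
      have e0 := ih D₀ hu h3
      have e1 := ih D₁ (u := u ++ horizontal l r) (by
        intro t ht
        rcases List.mem_append.1 ht with ht | ht
        · exact hu t ht
        · simp [horizontal] at ht
          rcases ht with rfl | rfl
          · exact .inr rfl
          · exact .inl rfl) h4
      rw [h1] at e0
      rw [h2] at e1
      rw [← e0, ← e1]
      refine hr _ _ _ (nestedCups [] [] D.base ++ ring D.base (bar D.base) ++ wpad [] u (bar D.base))
        (wpad [] w (bar D.base) ++ nestedCaps [] [] D.base) l (r ++ bar D.base) ?_ ?_ ?_
      · change mixedWord D.base D.word = _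
        rw [hD, ← List.singleton_append, ← List.append_assoc, mixedWord_append]
        simp
      · change mixedWord D₀.base D₀.word = _
        rw [h1, h3, ← List.append_nil u, mixedWord_append]
        simp
      · change mixedWord D₁.base D₁.word = _
        rw [h2, h4, mixedWord_append]
        simp [horizontal]
    cases g with
    | cup x =>
      obtain rfl : x = .moving := by simpa [Slice.cod, Gen.cod] using (hM.2 x (by
        simp [Slice.cod, Gen.cod]))
      exact keep (.inl rfl) (by simp [smoothSlice])
    | cap x =>
      obtain rfl : x = .moving := by simpa [Slice.dom, Gen.dom] using (hM.1 x (by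
        simp [Slice.dom, Gen.dom]))
      exact keep (.inr rfl) (by simp [smoothSlice])
    | cross x y o =>
      obtain rfl : x = .moving := hM.1 x (by simp [Slice.dom, Gen.dom])
      obtain rfl : y = .moving := hM.1 y (by simp [Slice.dom, Gen.dom])
      cases o
      · exact smooth rfl rfl (by simp [smoothSlice]) hB.crossing_false
      · exact smooth rfl rfl (by simp [smoothSlice]) hB.crossing_true
    | pre x y m =>
      obtain rfl : x = .moving := hM.1 x (by simp [Slice.dom, Gen.dom])
      obtain rfl : y = .moving := hM.1 y (by simp [Slice.dom, Gen.dom])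
      cases m
      · exact smooth rfl rfl (by simp [smoothSlice]) hB.precrossing_false
      · exact smooth rfl rfl (by simp [smoothSlice]) hB.precrossing_true

end IsBracket

/-! ### Forgetting the orientation commutes with the inclusion into the plane -/

/-- The unoriented marked annular diagram underlying an oriented annular pseudo link diagram. -/
def AnnularDiagram.forget (D : AnnularDiagram OStrand) : AnnularDiagram Colour where
  base := D.base.map OStrand.colour
  word := forgetWord D.word
  closed := D.closed.forget
  base_moving := by
    intro x hx
    obtain ⟨y, hy, rfl⟩ := List.mem_map.1 hx
    exact D.base_moving y hy
  word_moving := by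
    intro s hs x hx
    obtain ⟨t, ht, rfl⟩ := List.mem_map.1 hs
    rw [Slice.cod_map_colour] at hx
    obtain ⟨y, hy, rfl⟩ := List.mem_map.1 hx
    exact D.word_moving t ht y hy
  nonempty := D.nonempty.imp (by simp) (by simp [forgetWord])

section Forget

open OStrand

theorem OStrand.colour_rev (x : OStrand) :
    OStrand.colour (StrandLabel.rev x) = StrandLabel.rev (OStrand.colour x) := by
  cases x <;> rfl

theorem OStrand.colour_fixedStrand :
    OStrand.colour StrandLabel.fixedStrand = StrandLabel.fixedStrand := rfl

theorem forgetWord_nil : forgetWord [] = [] := rfl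

theorem forgetWord_append (u w : List (Slice OStrand)) :
    forgetWord (u ++ w) = forgetWord u ++ forgetWord w := by simp [forgetWord]

theorem forgetWord_cons (s : Slice OStrand) (w : List (Slice OStrand)) :
    forgetWord (s :: w) = s.map OStrand.colour :: forgetWord w := rfl

theorem map_colour_bar (a : List OStrand) : (bar a).map colour = bar (a.map colour) := by
  simp [bar, Function.comp_def, OStrand.colour_rev]

theorem forgetWord_nestedCups (l r a : List OStrand) : forgetWord (nestedCups l r a) =
    nestedCups (l.map colour) (r.map colour) (a.map colour) := by
  induction a generalizing l r with
  | nil => rfl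
  | cons x a ih =>
    simp [nestedCups, forgetWord_cons, ih, Slice.map, Gen.map, OStrand.colour_rev]

theorem forgetWord_nestedCaps (l r a : List OStrand) : forgetWord (nestedCaps l r a) =
    nestedCaps (l.map colour) (r.map colour) (a.map colour) := by
  induction a generalizing l r with
  | nil => rfl
  | cons x a ih =>
    simp [nestedCaps, forgetWord_append, ih, Slice.map, Gen.map, OStrand.colour_rev]
    rfl

theorem forgetWord_arcOver (l r a : List OStrand) : forgetWord (arcOver l r a) =
    arcOver (l.map colour) (r.map colour) (a.map colour) := by
  induction a generalizing l with
  | nil => rfl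
  | cons x a ih =>
    simp [arcOver, forgetWord_cons, ih, Slice.map, Gen.map, OStrand.colour_fixedStrand]

theorem forgetWord_arcUnder (l r a : List OStrand) : forgetWord (arcUnder l r a) =
    arcUnder (l.map colour) (r.map colour) (a.map colour) := by
  induction a generalizing l with
  | nil => rfl
  | cons x a ih =>
    simp [arcUnder, forgetWord_append, ih, forgetWord_cons, Slice.map, Gen.map,
      OStrand.colour_fixedStrand, forgetWord_nil]

theorem forgetWord_mixedWord (a : List OStrand) (w : List (Slice OStrand)) :
    forgetWord (mixedWord a w) = mixedWord (a.map colour) (forgetWord w) := by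
  have h : forgetWord (w.map (Slice.addRight (bar a))) =
      (forgetWord w).map (Slice.addRight (bar (a.map colour))) := by
    simp [forgetWord, Slice.addRight, Slice.map, ← map_colour_bar]
  simp only [mixedWord, ring, forgetWord_append, forgetWord_nestedCups, forgetWord_nestedCaps,
    forgetWord_arcOver, forgetWord_arcUnder, h, map_colour_bar]
  simp [forgetWord_cons, Slice.map, Gen.map, map_colour_bar, OStrand.colour_fixedStrand,
    forgetWord_nil]

end Forget

theorem AnnularDiagram.forget_toMixed (D : AnnularDiagram OStrand) :
    D.forget.toMixed = D.toMixed.forget :=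
  OMixedDiagram.ext_word (forgetWord_mixedWord _ _).symm


/-! # The universal expansion of an `O`-mixed diagram -/

open Finsupp (linearCombination)

section Smoothing

/-- The two smoothings of a crossing or precrossing of the moving part. -/
theorem OMixedDiagram.exists_smoothings {M : OMixedDiagram Colour} {u w : List (Slice Colour)}
    {l r : List Colour} {g : Gen Colour} (hd : g.dom = [.moving, .moving])
    (hc : g.cod = [.moving, .moving]) (hM : M.word = u ++ ⟨l, g, r⟩ :: w) :
    ∃ M₀ M₁ : OMixedDiagram Colour, M₀.word = u ++ w ∧ M₁.word = u ++ horizontal l r ++ w := by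
  have ht : Tg (fun _ => True) [] M.word [] := .of_isTangle M.closed fun _ _ => trivial
  have hf : fixedCups M.word = 1 := M.one_circle
  rw [hM] at ht hf
  obtain ⟨b, hu, h1, -, hw⟩ := ht.split
  simp only [Slice.dom, hd] at h1
  simp only [Slice.cod, hc] at hw
  subst h1
  have hg : g.isFixedCup = false := by
    cases g <;> first | rfl | simp [Gen.dom] at hd
  have th : Tg (fun _ => True) (l ++ [.moving, .moving] ++ r) (horizontal l r)
      (l ++ [.moving, .moving] ++ r) :=
    ⟨by simp [Slice.dom, Gen.dom], ⟨trivial, trivial⟩, by simp [Slice.dom, Slice.cod, Gen.cod,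
      Gen.dom], ⟨trivial, trivial⟩, by simp [Slice.cod, Gen.cod, Tg]⟩
  have hf' : fixedCups u + fixedCups w = 1 := by simpa [hg] using hf
  -- Smoothing may delete the slice with the crossing, so a witness for the moving part is sought
  -- below it: the diagram starts from nothing, hence some earlier slice ends in the strands
  -- entering the crossing.
  have hm : ∃ s ∈ u, Colour.moving ∈ s.cod := by
    rcases List.eq_nil_or_concat u with rfl | ⟨u', s, rfl⟩
    · have : [] = l ++ [Colour.moving, .moving] ++ r := hu
      simp at this
    · rw [List.concat_eq_append] at hu
      obtain ⟨c, -, -, -, h2⟩ := hu.split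
      refine ⟨s, by simp, ?_⟩
      rw [show s.cod = _ from h2]
      simp
  refine ⟨⟨u ++ w, (hu.append hw).isTangle, ?_, ?_⟩,
    ⟨u ++ horizontal l r ++ w, ((hu.append th).append hw).isTangle, ?_, ?_⟩, rfl, rfl⟩
  · change fixedCups (u ++ w) = 1
    simpa using hf'
  · obtain ⟨s, hs, hx⟩ := hm
    exact ⟨s, by simp [hs], _, hx, rfl⟩
  · change fixedCups (u ++ horizontal l r ++ w) = 1
    simpa [horizontal, Gen.isFixedCup, StrandLabel.colour] using hf'
  · obtain ⟨s, hs, hx⟩ := hm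
    exact ⟨s, by simp [hs], _, hx, rfl⟩

end Smoothing

section Expansion

variable {R : Type} [CommRing R] {p : BracketData R}

/-- The combination `c` of parallel essential curves and the unlinked unknot evaluates a diagram. -/
def IsExpansion (p : BracketData R) (M : OMixedDiagram Colour) (c : ℕ →₀ R) : Prop :=
  ∀ ⦃N : Type⦄ [AddCommGroup N] [Module R N] (v : ℕ → N) (B : OMixedDiagram Colour → N),
    IsBracket p v B → B M = linearCombination R v c

theorem map_stateSum {N N' : Type*} [AddCommGroup N] [Module R N] [AddCommGroup N'] [Module R N']
    (f : N →ₗ[R] N') (v : ℕ → N) (n : ℕ) (u : List (Slice Colour))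
    (L : List (R × List (Slice Colour))) :
    f (stateSum p v n u L) = stateSum p (fun k => f (v k)) n u L := by
  rw [stateSum, map_list_sum, List.map_map]
  congr 1
  refine List.map_congr_left fun y _ => ?_
  simp only [Function.comp_apply, map_smul, curveValue]
  split_ifs <;> simp

/-- The state sum is taken with the basis vectors of `ℕ →₀ R` as values; any other choice of values
is a linear image of this one. -/
theorem isExpansion_annular (D : AnnularDiagram Colour) : IsExpansion p D.toMixed
    (stateSum p (fun k => Finsupp.single k 1) D.base.length [] (states p D.word)) := by
  intro N _ _ v B hB
  rw [map_stateSum, hB.eq_stateSum D (u := []) (by simp) rfl]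
  simp

theorem IsExpansion.smooth {M M₀ M₁ : OMixedDiagram Colour} {c₀ c₁ : ℕ →₀ R} {x y : R}
    (h₀ : IsExpansion p M₀ c₀) (h₁ : IsExpansion p M₁ c₁)
    (h : ∀ ⦃N : Type⦄ [AddCommGroup N] [Module R N] (v : ℕ → N) (B : OMixedDiagram Colour → N),
      IsBracket p v B → B M = x • B M₀ + y • B M₁) : IsExpansion p M (x • c₀ + y • c₁) := by
  intro N _ _ v B hB
  rw [h v B hB, h₀ v B hB, h₁ v B hB, map_add, map_smul, map_smul]

instance decidablePlanar : DecidablePred Planar := fun g => by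
  unfold Planar
  split <;> infer_instance

/-- The number of crossings and precrossings of the moving part. -/
def crossings (w : List (Slice Colour)) : ℕ := w.countP fun s => ¬ Planar s.gen

/-- Crossings and precrossings of the moving part are smoothed one at a time until none is left. The
resulting planar diagram is replaced by an annular closure, and any new crossings there are handled
by its state sum. -/
theorem exists_isExpansion (M : OMixedDiagram Colour) : ∃ c : ℕ →₀ R, IsExpansion p M c := by
  generalize hn : crossings M.word = n
  induction n generalizing M with
  | zero =>
    have h : ∀ s ∈ M.word, Planar s.gen := by simpa [crossings] using hn
    obtain ⟨D, hD⟩ := IsBracket.exists_annular M h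
    refine ⟨stateSum p (fun k => Finsupp.single k 1) D.forget.base.length []
      (states p D.forget.word), fun N _ _ v B hB => ?_⟩
    rw [hD hB, ← D.forget_toMixed]
    exact isExpansion_annular D.forget v B hB
  | succ n ih =>
    obtain ⟨⟨l, g, r⟩, hs, hg⟩ : ∃ s ∈ M.word, ¬ Planar s.gen := by
      have : 0 < crossings M.word := by omega
      simpa [crossings] using this
    obtain ⟨u, w, hM⟩ := List.append_of_mem hs
    have hV : g.Valid := by
      have := M.closed
      rw [hM] at this
      obtain ⟨b, -, -, h, -⟩ := (Tg.of_isTangle (P := fun _ => True) this fun _ _ => trivial).split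
      exact h.1
    have smooth : ∀ x y : R, g.dom = [.moving, .moving] → g.cod = [.moving, .moving] →
        (∀ ⦃N : Type⦄ [AddCommGroup N] [Module R N] (v : ℕ → N) (B : OMixedDiagram Colour → N),
          IsBracket p v B → ∀ (D D₀ D₁ : OMixedDiagram Colour) (u v : List (Slice Colour))
            (l r : List Colour), D.word = u ++ [⟨l, g, r⟩] ++ v → D₀.word = u ++ v →
            D₁.word = u ++ horizontal l r ++ v → B D = x • B D₀ + y • B D₁) →
        ∃ c : ℕ →₀ R, IsExpansion p M c := by
      intro x y hd hc h
      obtain ⟨M₀, M₁, h₀, h₁⟩ := M.exists_smoothings hd hc hM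
      have e : crossings u + crossings w = n := by
        have h1 : crossings M.word = crossings u + (crossings w + 1) := by
          rw [hM]; simp [crossings, hg]
        omega
      obtain ⟨c₀, hc₀⟩ := ih M₀ (by rw [h₀, ← e]; simp [crossings])
      obtain ⟨c₁, hc₁⟩ := ih M₁ (by rw [h₁, ← e]; simp [crossings, horizontal, Planar])
      exact ⟨_, hc₀.smooth hc₁ fun N _ _ v B hB => h v B hB M M₀ M₁ u w l r (by simp [hM]) h₀ h₁⟩
    cases g with
    | cup x => exact absurd trivial hg
    | cap x => exact absurd trivial hg
    | cross x y o =>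
      cases x <;> cases y
      · cases o
        · exact smooth _ _ rfl rfl fun N _ _ v B hB => hB.crossing_false
        · exact smooth _ _ rfl rfl fun N _ _ v B hB => hB.crossing_true
      all_goals exact absurd trivial hg
    | pre x y m =>
      obtain rfl : x = .moving := hV.1
      obtain rfl : y = .moving := hV.2.1
      cases m
      · exact smooth _ _ rfl rfl fun N _ _ v B hB => hB.precrossing_false
      · exact smooth _ _ rfl rfl fun N _ _ v B hB => hB.precrossing_true

end Expansion

/-! ### Linear independence of the basic diagrams -/

section Independence

variable {R : Type} [CommRing R] [IsDomain R] (p : BracketData R)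

/-- The evaluations in the fraction field, one for each colour `n` of `O`. -/
noncomputable def BracketData.evalData (n : ℕ) : EvalData (FractionRing R) where
  A := algebraMap R _ p.A
  V := algebraMap R _ p.V
  H := algebraMap R _ p.H
  n := n
  A_ne := by simp

/-- The values of the basic diagrams under the evaluations in the fraction field. -/
noncomputable def BracketData.basicValue (n k : ℕ) : FractionRing R :=
  (p.evalData n).wordOp (if k = 0 then unknotWord else hopfWord k) (fun _ => 1) []

theorem BracketData.isBracket_eval (n : ℕ) :
    IsBracket p (p.basicValue n) (p.evalData n).eval :=
  EvalData.isBracket_eval p rfl rfl rfl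

variable {p}

/-- If `x + 1/x = y + 1/y` then `x = y` or `x * y = 1`; for powers of `A` with distinct positive
exponents both would make `A` a root of unity. -/
theorem circleValue_injective (hA : ∀ m : ℕ, 0 < m → (p.A : R) ^ m ≠ 1) :
    Function.Injective fun n => (p.evalData n).circleValue := by
  set a := algebraMap R (FractionRing R) p.A with ha
  have h0 : a ≠ 0 := by simp [ha]
  have h1 : ∀ m : ℕ, 0 < m → a ^ m ≠ 1 := fun m hm h => hA m hm (by
    apply IsFractionRing.injective R (FractionRing R)
    rw [map_pow, map_one, h])
  intro m n h
  change -(a ^ (2 * m + 2) + (a ^ (2 * m + 2))⁻¹) = -(a ^ (2 * n + 2) + (a ^ (2 * n + 2))⁻¹) at h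
  have hx : a ^ (2 * m + 2) ≠ 0 := pow_ne_zero _ h0
  have hy : a ^ (2 * n + 2) ≠ 0 := pow_ne_zero _ h0
  have h2 : (a ^ (2 * m + 2) - a ^ (2 * n + 2)) * (a ^ (2 * m + 2) * a ^ (2 * n + 2) - 1) = 0 := by
    field_simp at h
    linear_combination -h
  have key : ∀ i j : ℕ, i < j → a ^ (2 * i + 2) ≠ a ^ (2 * j + 2) := by
    intro i j hij h
    have h' : a ^ (2 * j - 2 * i) * a ^ (2 * i + 2) = a ^ (2 * i + 2) := by
      rw [← pow_add, show 2 * j - 2 * i + (2 * i + 2) = 2 * j + 2 by omega, h]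
    exact h1 (2 * j - 2 * i) (by omega) (mul_right_cancel₀ (pow_ne_zero _ h0) (by rw [one_mul, h']))
  rcases mul_eq_zero.1 h2 with h3 | h3
  · by_contra hne
    rcases lt_or_gt_of_ne hne with h4 | h4
    · exact key _ _ h4 (sub_eq_zero.1 h3)
    · exact key _ _ h4 (sub_eq_zero.1 h3).symm
  · rw [← pow_add, sub_eq_zero] at h3
    exact absurd h3 (h1 _ (by omega))

/-- Divided by the value of `O`, the evaluation of the combination is a polynomial in the value of a
circle around `O`. It has a root for each `n`, infinitely many in all, so its coefficients vanish.
-/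
theorem eq_zero_of_basicValue (hA : ∀ m : ℕ, 0 < m → (p.A : R) ^ m ≠ 1) {c : ℕ →₀ R}
    (h : ∀ n, linearCombination R (p.basicValue n) c = 0) : c = 0 := by
  classical
  set K := FractionRing R
  set a := algebraMap R K p.A with ha
  have h0 : a ≠ 0 := by simp [ha, K]
  have h1 : ∀ m : ℕ, 0 < m → a ^ m ≠ 1 := fun m hm h => hA m hm (by
    apply IsFractionRing.injective R K
    rw [map_pow, map_one, h])
  -- If `d` vanished, then `a ^ 4 = -1` and hence `a ^ 8 = 1`.
  have hδ : -a ^ 2 - (a ^ 2)⁻¹ ≠ 0 := by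
    intro h2
    have h3 : (a ^ 2)⁻¹ * a ^ 2 = 1 := inv_mul_cancel₀ (pow_ne_zero _ h0)
    refine h1 8 (by norm_num) ?_
    linear_combination (-(a ^ 4 - 1) * a ^ 2) * h2 - (a ^ 4 - 1) * h3
  -- The constant term carries the additional factor `d`, because the evaluation of the unlinked
  -- unknot is `d` times the value of `O`.
  let P : Polynomial K := ∑ k ∈ c.support,
    Polynomial.monomial k (algebraMap R K (c k) * if k = 0 then -a ^ 2 - (a ^ 2)⁻¹ else 1)
  have hP : P = 0 := by
    refine Polynomial.eq_zero_of_infinite_isRoot P ?_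
    refine Set.Infinite.mono ?_ (Set.infinite_range_of_injective (circleValue_injective hA))
    rintro _ ⟨n, rfl⟩
    have h2 := h n
    have h3 : (p.evalData n).ringValue ≠ 0 := EvalData.ringValue_ne (h1 _ (by omega))
    refine (mul_eq_zero.1 (?_ : (p.evalData n).ringValue * P.eval _ = 0)).resolve_left h3
    rw [← h2, Finsupp.linearCombination_apply, Finsupp.sum, Polynomial.eval_finsetSum,
      Finset.mul_sum]
    refine Finset.sum_congr rfl fun k _ => ?_
    rw [Polynomial.eval_monomial, BracketData.basicValue, Algebra.smul_def]
    split_ifs with hk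
    · rw [EvalData.wordOp_unknotWord, hk, pow_zero]
      change _ = _ * (_ * (-a ^ 2 - (a ^ 2)⁻¹))
      ring
    · rw [EvalData.wordOp_hopfWord]
      ring
  ext k
  by_contra hk
  have h2 : P.coeff k = algebraMap R K (c k) * if k = 0 then -a ^ 2 - (a ^ 2)⁻¹ else 1 := by
    simp only [P, Polynomial.finsetSum_coeff, Polynomial.coeff_monomial]
    rw [Finset.sum_ite_eq', if_pos (Finsupp.mem_support_iff.2 hk)]
  rw [hP, Polynomial.coeff_zero] at h2
  rcases mul_eq_zero.1 h2.symm with h3 | h3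
  · exact hk ((IsFractionRing.injective R K) (by rw [h3, Finsupp.zero_apply, map_zero]))
  · split_ifs at h3
    · exact hδ h3
    · exact one_ne_zero h3

theorem eq_of_basicValue (hA : ∀ m : ℕ, 0 < m → (p.A : R) ^ m ≠ 1) {c c' : ℕ →₀ R}
    (h : ∀ n, linearCombination R (p.basicValue n) c = linearCombination R (p.basicValue n) c') :
    c = c' :=
  sub_eq_zero.1 (eq_zero_of_basicValue hA fun n => by rw [map_sub, h n, sub_self])

theorem IsExpansion.unique (hA : ∀ m : ℕ, 0 < m → (p.A : R) ^ m ≠ 1) {M : OMixedDiagram Colour}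
    {c c' : ℕ →₀ R} (h : IsExpansion p M c) (h' : IsExpansion p M c') : c = c' :=
  eq_of_basicValue hA fun n => by
    rw [← h _ _ (p.isBracket_eval n), ← h' _ _ (p.isBracket_eval n)]

/-- The evaluations are invariant under every isotopy, precrossings included, and they jointly
determine the expansion. -/
theorem IsExpansion.eq_of_isotopy (hA : ∀ m : ℕ, 0 < m → (p.A : R) ^ m ≠ 1)
    {M M' : OMixedDiagram OStrand} {c c' : ℕ →₀ R} (h : IsExpansion p M.forget c)
    (h' : IsExpansion p M'.forget c') (e : OMixedRegularIsotopy M M') : c = c' :=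
  eq_of_basicValue hA fun n => by
    rw [← h _ _ (p.isBracket_eval n), ← h' _ _ (p.isBracket_eval n), EvalData.eval_forget_eq e]

end Independence

/-! ### Construction and uniqueness of the mixed bracket -/

section Bracket

variable {R : Type} [CommRing R] (p : BracketData R)

/-- The values of parallel essential curves and of the unlinked unknot. -/
def BracketData.value (k : ℕ) : R := if k = 0 then 1 else p.s k

/-- The `O`-mixed pseudo bracket. -/
noncomputable def mixedBracket (M : OMixedDiagram Colour) : R :=
  linearCombination R p.value (exists_isExpansion (p := p) M).choose

variable {p}

theorem IsOMixedBracket.isBracket {B : OMixedDiagram Colour → R} (h : IsOMixedBracket p B) :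
    IsBracket p p.value B where
  crossing_true := h.crossing_true
  crossing_false := h.crossing_false
  precrossing_true := h.precrossing_true
  precrossing_false := h.precrossing_false
  loop := h.loop
  essential := fun D k hk hD => by
    rw [h.essential D k hk hD, BracketData.value, if_neg (by omega)]
  unknot := fun D hD => by rw [h.unknot D hD, BracketData.value, if_pos rfl]
  skein_module := h.skein_module

/-- Any bracket takes on `M` the value prescribed by the chosen expansion; independence of the basic
diagrams plays no role in this direction. -/
theorem IsOMixedBracket.eq_mixedBracket {B : OMixedDiagram Colour → R} (h : IsOMixedBracket p B) :
    B = mixedBracket p :=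
  funext fun M => (exists_isExpansion (p := p) M).choose_spec _ _ h.isBracket

variable [IsDomain R]

theorem IsExpansion.mixedBracket_eq (hA : ∀ m : ℕ, 0 < m → (p.A : R) ^ m ≠ 1)
    {M : OMixedDiagram Colour} {c : ℕ →₀ R} (h : IsExpansion p M c) :
    mixedBracket p M = linearCombination R p.value c := by
  rw [mixedBracket, (exists_isExpansion M).choose_spec.unique hA h]

theorem mixedBracket_eq_of_isotopy (hA : ∀ m : ℕ, 0 < m → (p.A : R) ^ m ≠ 1)
    {M M' : OMixedDiagram OStrand} (e : OMixedRegularIsotopy M M') :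
    mixedBracket p M.forget = mixedBracket p M'.forget := by
  rw [mixedBracket, mixedBracket, (exists_isExpansion M.forget).choose_spec.eq_of_isotopy hA
    (exists_isExpansion M'.forget).choose_spec e]

/-- Each of rules (1)–(5) is a linear relation valid for all module-valued brackets. It therefore
holds between expansions, by their uniqueness, and survives the substitution of the values. Rule (6)
is the isotopy invariance of expansions. -/
theorem isOMixedBracket_mixedBracket (hA : ∀ m : ℕ, 0 < m → (p.A : R) ^ m ≠ 1) :
    IsOMixedBracket p (mixedBracket p) := by
  have smooth : ∀ (M M₀ M₁ : OMixedDiagram Colour) (x y : R),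
      (∀ ⦃N : Type⦄ [AddCommGroup N] [Module R N] (v : ℕ → N) (B : OMixedDiagram Colour → N),
        IsBracket p v B → B M = x • B M₀ + y • B M₁) →
      mixedBracket p M = x * mixedBracket p M₀ + y * mixedBracket p M₁ := by
    intro M M₀ M₁ x y h
    rw [((exists_isExpansion M₀).choose_spec.smooth (exists_isExpansion M₁).choose_spec
      h).mixedBracket_eq hA, map_add, map_smul, map_smul]
    rfl
  have basic : ∀ (M : OMixedDiagram Colour) (k : ℕ),
      (∀ ⦃N : Type⦄ [AddCommGroup N] [Module R N] (v : ℕ → N) (B : OMixedDiagram Colour → N),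
        IsBracket p v B → B M = v k) → mixedBracket p M = p.value k := by
    intro M k h
    have : IsExpansion p M (Finsupp.single k 1) := fun N _ _ v B hB => by simp [h v B hB]
    rw [this.mixedBracket_eq hA]
    simp
  constructor
  · exact fun D D₀ D₁ u v l r h h₀ h₁ => smooth _ _ _ _ _ fun N _ _ w B hB =>
      hB.crossing_true D D₀ D₁ u v l r h h₀ h₁
  · exact fun D D₀ D₁ u v l r h h₀ h₁ => smooth _ _ _ _ _ fun N _ _ w B hB =>
      hB.crossing_false D D₀ D₁ u v l r h h₀ h₁
  · exact fun D D₀ D₁ u v l r h h₀ h₁ => smooth _ _ _ _ _ fun N _ _ w B hB =>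
      hB.precrossing_true D D₀ D₁ u v l r h h₀ h₁
  · exact fun D D₀ D₁ u v l r h h₀ h₁ => smooth _ _ _ _ _ fun N _ _ w B hB =>
      hB.precrossing_false D D₀ D₁ u v l r h h₀ h₁
  · intro D D₀ u v l r h h₀
    -- The loop rule is treated as a smoothing whose second coefficient is zero.
    have := smooth D D₀ D₀ p.d 0 fun N _ _ w B hB => by
      rw [zero_smul, add_zero, hB.loop D D₀ u v l r h h₀]
    rw [this]
    ring
  · intro D k hk hD
    rw [basic D k fun N _ _ w B hB => hB.essential D k hk hD, BracketData.value, if_neg (by omega)]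
  · intro D hD
    rw [basic D 0 fun N _ _ w B hB => hB.unknot D hD, BracketData.value, if_pos rfl]
  · exact fun M M' _ _ e => mixedBracket_eq_of_isotopy hA e

end Bracket


/-! # Invariance of the annular pseudo bracket -/

open Curves

namespace Curves

/-- The first part of an annular word may be moved to its end. -/
theorem colourSum_append_comm {ω : X → ℤ} (hω : ∀ x, ω x * ω x = 1) {x y : List Colour}
    {u w : List (Slice Colour)} (hu : Tg Flat x u y) (hw : Tg Flat y w x) :
    colourSum ω x.length (u ++ w) = colourSum ω y.length (w ++ u) := by
  induction u generalizing x w with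
  | nil => cases hu; simp
  | cons s u ih =>
    obtain ⟨rfl, hs, hu⟩ := hu
    have h1 := ih hu (hw.append (tg_singleton hs.1 hs.2))
    rw [List.cons_append, colourSum_rotate hω hs.2 (hu.append hw), List.append_assoc, h1]
    simp

end Curves

section States

variable {R : Type} [CommRing R] (p : BracketData R)

theorem states_append (u w : List (Slice Colour)) : states p (u ++ w) =
    (states p u).flatMap fun x => (states p w).map fun y => (x.1 * y.1, x.2 ++ y.2) := by
  induction u with
  | nil => simp [states]
  | cons s u ih =>
    simp only [List.cons_append, states, ih, List.flatMap_assoc, List.map_flatMap, List.flatMap_map,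
      List.map_map, Function.comp_def, mul_assoc, List.append_assoc]

theorem sum_states_append (u w : List (Slice Colour)) (f : List (Slice Colour) → R) :
    ((states p (u ++ w)).map fun y => y.1 * f y.2).sum = ((states p u).map fun x =>
      ((states p w).map fun y => x.1 * y.1 * f (x.2 ++ y.2)).sum).sum := by
  rw [states_append, List.map_flatMap, List.flatMap_def, List.sum_flatten]
  simp only [List.map_map, Function.comp_def]

theorem tg_smoothSlice {s : Slice Colour} (hv : s.gen.Valid) (hs : Mv s.dom ∧ Mv s.cod)
    {y : R × List (Slice Colour)} (hy : y ∈ smoothSlice p s) : Tg Flat s.dom y.2 s.cod := by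
  have hh : ∀ l r : List Colour, Tg Flat (l ++ .moving :: .moving :: r) (horizontal l r)
      (l ++ .moving :: .moving :: r) := fun l r =>
    ⟨by simp [Slice.dom, Gen.dom], ⟨trivial, .inr rfl⟩, by simp [Slice.dom, Slice.cod, Gen.dom,
      Gen.cod], ⟨trivial, .inl rfl⟩, by simp [Slice.cod, Gen.cod, Tg]⟩
  have both : ∀ {l r : List Colour} {a b : R} {y : R × List (Slice Colour)},
      y ∈ [(a, []), (b, horizontal l r)] →
      Tg Flat (l ++ [.moving, .moving] ++ r) y.2 (l ++ [.moving, .moving] ++ r) := by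
    intro l r a b y hy
    simp only [List.mem_cons, List.not_mem_nil, or_false] at hy
    rcases hy with rfl | rfl
    · rfl
    · simpa using hh l r
  obtain ⟨l, g, r⟩ := s
  cases g with
  | cup x =>
    obtain rfl : x = .moving := hs.2 x (by simp [Slice.cod, Gen.cod])
    obtain rfl : y = (1, [_]) := by simpa [smoothSlice] using hy
    exact tg_singleton trivial (.inl rfl)
  | cap x =>
    obtain rfl : x = .moving := hs.1 x (by simp [Slice.dom, Gen.dom])
    obtain rfl : y = (1, [_]) := by simpa [smoothSlice] using hy
    exact tg_singleton trivial (.inr rfl)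
  | cross x z o =>
    obtain rfl : x = .moving := hs.1 x (by simp [Slice.dom, Gen.dom])
    obtain rfl : z = .moving := hs.1 z (by simp [Slice.dom, Gen.dom])
    cases o <;> exact both hy
  | pre x z m =>
    obtain rfl : x = .moving := hv.1
    obtain rfl : z = .moving := hv.2.1
    cases m <;> exact both hy

theorem tg_states {a b : List Colour} {w : List (Slice Colour)} (hw : IsTangle a w b) (hM : MvW w)
    {y : R × List (Slice Colour)} (hy : y ∈ states p w) : Tg Flat a y.2 b := by
  induction w generalizing a y with
  | nil =>
    obtain rfl : y = (1, []) := by simpa [states] using hy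
    exact hw
  | cons s w ih =>
    obtain ⟨rfl, hv, hw⟩ := hw
    rw [MvW_cons] at hM
    simp only [states, List.mem_flatMap, List.mem_map] at hy
    obtain ⟨x, hx, z, hz, rfl⟩ := hy
    exact (tg_smoothSlice p hv hM.1 hx).append (ih hw hM.2 hz)

theorem stateValue_eq (n : ℕ) (w : List (Slice Colour)) :
    stateValue p n w = curveValue p p.value n w := by
  unfold stateValue curveValue essentials trivials
  split_ifs with h
  · simp [h, BracketData.value]
  · simp [BracketData.value, h]

theorem annularBracket_eq_stateSum (D : AnnularDiagram OStrand) : annularBracket p D =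
    stateSum p p.value D.forget.base.length [] (states p D.forget.word) := by
  simp [annularBracket, stateSum, stateValue_eq, AnnularDiagram.forget]

/-- The annular pseudo bracket is invariant under rotation of the annulus. -/
theorem annularBracket_rotate {D D' : AnnularDiagram OStrand} {u w : List (Slice OStrand)}
    (h : D.word = u ++ w) (h' : D'.word = w ++ u) (ht : IsTangle D.base u D'.base) :
    annularBracket p D = annularBracket p D' := by
  have hM := D.forget.mvW
  have e : D.forget.word = forgetWord u ++ forgetWord w := by
    change forgetWord D.word = _
    rw [h, forgetWord_append]
  have e' : D'.forget.word = forgetWord w ++ forgetWord u := by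
    change forgetWord D'.word = _
    rw [h', forgetWord_append]
  rw [e, MvW_append] at hM
  have tu : IsTangle D.forget.base (forgetWord u) D'.forget.base := ht.forget
  have tw : IsTangle D'.forget.base (forgetWord w) D.forget.base := by
    have h1 := Tg.of_isTangle (P := fun _ => True) D.forget.closed fun _ _ => trivial
    rw [e] at h1
    obtain ⟨b, h2, h3⟩ := h1.split
    obtain rfl := h2.cod_eq (Tg.of_isTangle tu fun _ _ => trivial)
    exact h3.isTangle
  rw [annularBracket_eq_stateSum, annularBracket_eq_stateSum, e, e']
  simp only [stateSum, List.nil_append, smul_eq_mul]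
  -- States of the rotated word are rotated states, so the two double sums are compared term by
  -- term.
  rw [sum_states_append, sum_states_append, sum_map_comm]
  congr 1
  refine List.map_congr_left fun y hy => ?_
  congr 1
  refine List.map_congr_left fun x hx => ?_
  have hx' := tg_states p tu hM.1 hx
  have hy' := tg_states p tw hM.2 hy
  obtain ⟨h1, h2⟩ := curves_eq (hx'.append hy') (hy'.append hx') fun ω hω =>
    colourSum_append_comm hω hx' hy'
  rw [curveValue, curveValue, h1, h2, mul_comm x.1]

theorem LocalMove.mixedWord {a : List OStrand} {w w' : List (Slice OStrand)} (h : LocalMove w w') :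
    LocalMove (mixedWord a w) (mixedWord a w') := by
  obtain ⟨u, v, x, y, rfl, rfl, hm⟩ := h
  refine ⟨_, _, wpad [] x (bar a), wpad [] y (bar a), mixedWord_append a u x v,
    mixedWord_append a u y v, ?_⟩
  have := hm.pad [] ((bar a).map OStrand.colour)
  have e : ∀ z : List (Slice OStrand), forgetWord (wpad [] z (bar a)) =
      wpad [] (forgetWord z) ((bar a).map OStrand.colour) := fun z =>
    colourWord_wpad [] (bar a) z
  rwa [e, e]

end States

/-! ### Comparison of the mixed and the annular bracket -/

section Correspondence

variable {R : Type} [CommRing R] [IsDomain R] {p : BracketData R}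

/-- The expansion into states valid for every bracket is, for the values `1` and `s_k`, the
definition of the annular bracket. -/
theorem mixedBracket_toMixed (hA : ∀ m : ℕ, 0 < m → (p.A : R) ^ m ≠ 1)
    (D : AnnularDiagram OStrand) : mixedBracket p D.toMixed.forget = annularBracket p D := by
  rw [annularBracket_eq_stateSum, ← D.forget_toMixed]
  exact (isOMixedBracket_mixedBracket hA).isBracket.eq_stateSum D.forget (u := []) (by simp) rfl

/-- A move away from the ray is also a move of the planar closure, so invariance follows from the
mixed bracket; a rotation of the annulus is handled directly on states. -/
theorem annularBracket_eq_of_isotopy (hA : ∀ m : ℕ, 0 < m → (p.A : R) ^ m ≠ 1)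
    {D D' : AnnularDiagram OStrand} (h : AnnularRegularIsotopy D D') :
    annularBracket p D = annularBracket p D' := by
  induction h with
  | rel D D' h =>
    cases h with
    | move hb h =>
      rw [← mixedBracket_toMixed hA, ← mixedBracket_toMixed hA]
      refine mixedBracket_eq_of_isotopy hA (.rel _ _ ?_)
      change LocalMove (mixedWord D.base D.word) (mixedWord D'.base D'.word)
      rw [← hb]
      exact h.mixedWord
    | rotate u w h h' ht => exact annularBracket_rotate p h h' ht
  | refl => rfl
  | symm _ _ _ ih => exact ih.symm
  | trans _ _ _ _ _ ih1 ih2 => exact ih1.trans ih2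

/-- Existence, uniqueness and invariance of the `O`-mixed pseudo bracket, and its equivalence with the
annular pseudo bracket, when `A` is not a root of unity. -/
theorem exists_mixedBracket (hA : ∀ m : ℕ, 0 < m → (p.A : R) ^ m ≠ 1) :
    ∃ B : OMixedDiagram Colour → R, IsOMixedBracket p B ∧
      (∀ B' : OMixedDiagram Colour → R, IsOMixedBracket p B' → B' = B) ∧
      (∀ M M' : OMixedDiagram OStrand, OMixedRegularIsotopy M M' → B M.forget = B M'.forget) ∧
      (∀ (M : OMixedDiagram OStrand) (D : AnnularDiagram OStrand), Corresponds M D →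
        B M.forget = annularBracket p D) := by
  refine ⟨mixedBracket p, isOMixedBracket_mixedBracket hA, fun B' h => h.eq_mixedBracket,
    fun M M' h => mixedBracket_eq_of_isotopy hA h, ?_⟩
  rintro M D ⟨D', h1, h2⟩
  rw [mixedBracket_eq_of_isotopy hA h2, mixedBracket_toMixed hA, annularBracket_eq_of_isotopy hA h1]

end Correspondence

/-- Compare degrees: `A ^ m` is the monomial of degree `m`. -/
theorem laurentA_pow_ne (m : ℕ) (hm : 0 < m) : (laurentA : LaurentPolynomial ℤ) ^ m ≠ 1 := by
  change (LaurentPolynomial.T 1 : LaurentPolynomial ℤ) ^ m ≠ 1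
  rw [LaurentPolynomial.T_pow, ← LaurentPolynomial.T_zero]
  intro h
  have := congrArg LaurentPolynomial.degree h
  rw [LaurentPolynomial.degree_T, LaurentPolynomial.degree_T] at this
  have : (m : ℤ) * 1 = 0 := by exact_mod_cast this
  omega

theorem C_laurentA_pow_ne (σ : Type) (m : ℕ) (hm : 0 < m) :
    (MvPolynomial.C (laurentA : LaurentPolynomial ℤ) : MvPolynomial σ (LaurentPolynomial ℤ)) ^ m ≠ 1 := by
  intro h
  rw [← map_pow, ← MvPolynomial.C_1] at h
  exact laurentA_pow_ne m hm (MvPolynomial.C_injective _ _ h)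

/-- Both rings are polynomial rings over `ℤ[A^{±1}]`, hence domains in which `A` is not a root of
unity. Nothing else about `V`, `H` and the `s_k` enters. -/
theorem theorem3p5 :
    (∃ B : OMixedDiagram Colour → UnivRing,
      IsOMixedBracket univData B ∧
      (∀ B' : OMixedDiagram Colour → UnivRing, IsOMixedBracket univData B' → B' = B) ∧
      (∀ M M' : OMixedDiagram OStrand, OMixedRegularIsotopy M M' → B M.forget = B M'.forget) ∧
      (∀ (M : OMixedDiagram OStrand) (D : AnnularDiagram OStrand), Corresponds M D →
        B M.forget = annularBracket univData D)) ∧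
    (∃ B : OMixedDiagram Colour → FourRing,
      IsOMixedBracket fourData B ∧
      (∀ B' : OMixedDiagram Colour → FourRing, IsOMixedBracket fourData B' → B' = B) ∧
      (∀ M M' : OMixedDiagram OStrand, OMixedRegularIsotopy M M' → B M.forget = B M'.forget) ∧
      (∀ (M : OMixedDiagram OStrand) (D : AnnularDiagram OStrand), Corresponds M D →
        B M.forget = annularBracket fourData D)) ∧
    (∀ M : OMixedDiagram OStrand, ∃ D : AnnularDiagram OStrand, Corresponds M D) := by
  exact ⟨exists_mixedBracket (C_laurentA_pow_ne UnivVar), exists_mixedBracket (C_laurentA_pow_ne FourVar),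
    exists_corresponds⟩
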